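/- Let $k,m\ge 0$, $n\ge 1$ and $L=k+m+n$. Let $\mathfrak N\subset\mathbb C^{k+m}$ and $M\subset\mathbb C^{L}$ be (embedded) $\mathcal C^\infty$ generic submanifolds, both of CR dimension $k$, let $h:\mathfrak N\to\mathbb C^n$ be a $\mathcal C^\infty$ CR map, and assume that the CR submanifold $N=\{(q,h(q)):q\in\mathfrak N\}$ is contained in $M$. Let $p_0'\in\mathfrak N$ and $p_0=(p_0',h(p_0'))$. *Wedges.* For submanifolds $A\subset B$ of a complex vector space $E$ and $p\in A$, a wedge in $B$ at $p$ with edge $A$ (near $p$) is a set $\mathcal W=\{q\in B\cap O:\rho(q)\in\Gamma\}$, where $O$ is an open neighbourhood of $p$ in $E$, $\rho:O\to\mathbb R^c$ is smooth with $A\cap O=\{q\in B\cap O:\rho(q)=0\}$ and $d\rho_q|_{T_qB}$ surjective for all $q\in B\cap O$, and $\Gamma\subset\mathbb R^c$ is an open convex cone. It is of direction $v\in T_pB$ if $d\rho_p(v)\in\Gamma$. *Decomposability.* Fix a smooth local parametrization $\gamma:\Omega\to\mathfrak N$, $\Omega\subset\mathbb R^{2k+m}$ open, with $\gamma(x_0)=p_0'$.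 Distributions on $\mathfrak N$, equivalently on $N$, near the base point are distributions on $\Omega$, and functions are paired with test functions through $dx$. A distribution $U$ extends holomorphically to a wedge at $p_0'$ if there are a wedge $\mathcal W$ in $\mathbb C^{k+m}$ at $p_0'$ with edge $\mathfrak N$, of some direction $w$, and a holomorphic function $F$ on $\mathcal W$ of slow growth, $|F(z)|\le C\,\mathrm{dist}(z,\mathfrak N)^{-\ell}$, such that $\langle U,\varphi\rangle=\lim_{\lambda\to0^+}\int F(\gamma(x)+\lambda w)\varphi(x)\,dx$ for all test functions $\varphi$ supported near $x_0$. A distribution is decomposable at $p_0$ if near $x_0$ it is a finite sum of distributions extending holomorphically to wedges (depending on the summand). A smooth function on $\mathfrak N$ is decomposable at $p_0'$ if near $p_0'$ it is a finite sum of smooth functions, each of which, as a distribution, extends holomorphically to a wedge. Assume that each component of $h$ is decomposable at $p_0'$ (as a smooth function). Let $v\in T_{p_0}M\setminus \mathrm{span}_{\mathbb C}T_{p_0}N$, and let $f$ be a CR distribution on $N$ (in the coordinates $x\in\Omega$) which is decomposable at $p_0$. Then there exists a wedge $\mathcal W$ in $M$ at $p_0$, of direction $v$, whose edge contains a neighbourhood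 of $p_0$ in $N$, such that the following hold. 1. There is a $\mathcal C^\infty$ CR function $F$ on $\mathcal W$ with boundary value $f$ near $p_0$: there is a neighbourhood $O'$ of $x_0$ such that for every open $U\subset O'$, every smooth family of curves $\lambda\mapsto\sigma(x,\lambda)\in M$ ($x\in U$, $0\le\lambda<\varepsilon$) with $\sigma(x,0)=(\gamma(x),h(\gamma(x)))$ and $d\rho(\partial_\lambda\sigma(x,0))\in\Gamma$, where $\rho,\Gamma$ define $\mathcal W$, and every test function $\varphi$ supported in $U$, one has $\lim_{\lambda\to0^+}\int F(\sigma(x,\lambda))\varphi(x)\,dx=\langle f,\varphi\rangle$. 2. There are $\mathcal C^\infty$ CR functions $g_1,\dots,g_n$ on $\mathcal W$ which vanish to order one on $N$, with $dg_1\wedge\dots\wedge dg_n\ne0$ on $\mathcal W$. Precisely, extended by $0$ to the part of $N$ in the neighbourhood defining $\mathcal W$, the $g_\ell$ are of class $\mathcal C^1$ up to that part of $N$, and their differentials on the tangent spaces of $M$ are linearly independent over $\mathbb C$ at all points of $\mathcal W$ and of that part of $N$. -/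

import Mathlib

open Set Filter Topology MeasureTheory TopologicalSpace
open scoped ContDiff Distributions

noncomputable section

/-- The space `ℂ^d`. -/
abbrev Cn (d : ℕ) : Type := EuclideanSpace ℂ (Fin d)

/-- The space `ℝ^d`. -/
abbrev Rn (d : ℕ) : Type := EuclideanSpace ℝ (Fin d)

section Submanifolds

variable {E : Type*} [NormedAddCommGroup E] [NormedSpace ℂ E]
variable {G : Type*} [NormedAddCommGroup G] [NormedSpace ℂ G]

/-- `γ`, restricted to the open set `Ω ⊆ ℝ^d`, is a smooth local parametrization of `S ⊆ E`:
an injective smooth immersion which is a homeomorphism onto a relatively open subset of `S`. -/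
structure IsLocalParam {d : ℕ} (S : Set E) (Ω : Opens (Rn d)) (γ : Rn d → E) : Prop where
  smooth : ContDiffOn ℝ ∞ γ Ω
  injOn : InjOn γ Ω
  immersion : ∀ x ∈ Ω, Function.Injective (fderiv ℝ γ x)
  isOpen_image : ∀ U : Set (Rn d), IsOpen U → U ⊆ Ω → ∃ V : Set E, IsOpen V ∧ γ '' U = S ∩ V

/-- `S` is an embedded (locally closed) smooth submanifold of `E` of real dimension `d`. -/
def IsSmoothSubmanifold (d : ℕ) (S : Set E) : Prop :=
  ∀ p ∈ S, ∃ (Ω : Opens (Rn d)) (γ : Rn d → E), IsLocalParam S Ω γ ∧ p ∈ γ '' (Ω : Set (Rn d))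

/-- The real tangent space `T_p S`: the velocities at `p` of the curves in `S`. (For a submanifold
these velocities already form a linear subspace.) -/
def tangentSpace (S : Set E) (p : E) : Submodule ℝ E :=
  Submodule.span ℝ {v | ∃ c : ℝ → E, c 0 = p ∧ (∀ᶠ t in 𝓝 0, c t ∈ S) ∧ HasDerivAt c v 0}

/-- The complex tangent space `T_p S ∩ i T_p S`, a complex subspace of `E`. -/
def complexTangent (S : Set E) (p : E) : Submodule ℂ E where
  carrier := {X | X ∈ tangentSpace S p ∧ Complex.I • X ∈ tangentSpace S p}
  zero_mem' := by simp
  add_mem' := by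
    rintro a b ⟨ha, ha'⟩ ⟨hb, hb'⟩
    exact ⟨add_mem ha hb, by rw [smul_add]; exact add_mem ha' hb'⟩
  smul_mem' := by
    rintro c X ⟨hX, hX'⟩
    have h1 : c • X = c.re • X + c.im • (Complex.I • X) := by
      conv_lhs => rw [← Complex.re_add_im c]
      rw [add_smul, mul_smul]
      rfl
    have h2 : Complex.I • (c • X) = c.re • (Complex.I • X) - c.im • X := by
      have h3 : Complex.I • (c.im • (Complex.I • X)) = -(c.im • X) := by
        rw [smul_comm, ← mul_smul, Complex.I_mul_I, neg_one_smul, smul_neg]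
      rw [h1, smul_add, h3, smul_comm, sub_eq_add_neg]
    refine ⟨?_, ?_⟩
    · rw [h1]
      exact add_mem (Submodule.smul_mem _ _ hX) (Submodule.smul_mem _ _ hX')
    · rw [h2]
      exact sub_mem (Submodule.smul_mem _ _ hX') (Submodule.smul_mem _ _ hX)

/-- `S` is a smooth generic submanifold of `E` of CR dimension `k`: at each point `p`, the tangent
space spans `E` over `ℂ`, and `T_p S ∩ i T_p S` has complex dimension `k`. -/
structure IsGenericSubmanifold (k : ℕ) (S : Set E) : Prop where
  isSmooth : ∃ d : ℕ, IsSmoothSubmanifold d S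
  span_eq_top : ∀ p ∈ S, Submodule.span ℂ (tangentSpace S p : Set E) = ⊤
  crDim : ∀ p ∈ S, Module.finrank ℂ (complexTangent S p) = k

/-- `F` is a smooth CR map on `W`, where `W` is a relatively open subset of the submanifold `M`:
at each point the differential (which is determined on `T_q M`) is `ℂ`-linear on
`T_q M ∩ i T_q M`. Equivalently, `F` is annihilated by all vectors of type `(0,1)` tangent
to `M`. -/
def IsSmoothCR (M W : Set E) (F : E → G) : Prop :=
  ContDiffOn ℝ ∞ F W ∧
    ∀ q ∈ W, ∃ A : E →L[ℝ] G, HasFDerivWithinAt F A W q ∧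
      ∀ X ∈ complexTangent M q, A (Complex.I • X) = Complex.I • A X

/-- The graph `{(q, h q) : q ∈ S}`. -/
def graphOver (S : Set E) (h : E → G) : Set (E × G) := (fun q => (q, h q)) '' S

/-! ### Wedges -/

/-- Data of a wedge in the submanifold `M`, near the point `p`, whose edge is (a neighbourhood of
`p` in) `N ⊆ M`: a neighbourhood `nhd` of `p` in `E`, a smooth map `ρ` to `ℝ^c` which defines
`N` in `M ∩ nhd` with independent differentials along `M`, and an open convex cone `Γ` in `ℝ^c`.
For `M = univ` this is a wedge in `E` with edge `N`. As usual, `Γ` may be all of `ℝ^c`, in which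
case the wedge is a full neighbourhood of `p` in `M`. -/
structure Wedge (M N : Set E) (p : E) where
  nhd : Set E
  isOpen_nhd : IsOpen nhd
  mem_nhd : p ∈ nhd
  c : ℕ
  ρ : E → Rn c
  smooth_ρ : ContDiffOn ℝ ∞ ρ nhd
  mem_edge_iff : ∀ q ∈ M ∩ nhd, q ∈ N ↔ ρ q = 0
  surj : ∀ q ∈ M ∩ nhd,
    Submodule.map (fderiv ℝ ρ q : E →ₗ[ℝ] Rn c) (tangentSpace M q) = ⊤
  Γ : ConvexCone ℝ (Rn c)
  isOpen_Γ : IsOpen (Γ : Set (Rn c))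

/-- The wedge itself, `{q ∈ M ∩ nhd : ρ q ∈ Γ}`. -/
def Wedge.toSet {M N : Set E} {p : E} (W : Wedge M N p) : Set E :=
  {q | q ∈ M ∩ W.nhd ∧ W.ρ q ∈ W.Γ}

/-- At the point `q` of the edge, `v` is a tangent vector to `M` pointing into the wedge. The wedge
is "of direction `v`" if this holds at the central point `q = p`. -/
def Wedge.DirectedAt {M N : Set E} {p : E} (W : Wedge M N p) (q v : E) : Prop :=
  q ∈ W.nhd ∧ v ∈ tangentSpace M q ∧ fderiv ℝ W.ρ q v ∈ W.Γ

/-! ### Distributions on a parametrized submanifold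

The submanifold is parametrized by `γ : Ω → E`; a distribution on it is a distribution on `Ω`, and
functions on it are paired with test functions by means of Lebesgue measure on `Ω`. -/

/-- The distribution `u` satisfies the tangential Cauchy-Riemann equations. Let `A`, `B` be smooth
vector fields with compact support in `Ω` such that `dγ(B) = i dγ(A)`, i.e. `L = A + iB` is of type
`(0,1)`; then `⟨u, div L⟩ = ⟨u, div A⟩ + i ⟨u, div B⟩ = 0`. (Applied to `φ L` for a test function
`φ`, this says that `L u = 0`.) -/
def IsCRDistribution {d : ℕ} {Ω : Opens (Rn d)} (γ : Rn d → E) (u : 𝓓'(Ω, ℂ)) : Prop :=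
  ∀ (A B : 𝓓(Ω, Rn d)) (a b : 𝓓(Ω, ℝ)),
    (∀ x ∈ Ω, fderiv ℝ γ x (B x) = Complex.I • fderiv ℝ γ x (A x)) →
    (∀ x, a x = LinearMap.trace ℝ (Rn d) (fderiv ℝ A x : Rn d →ₗ[ℝ] Rn d)) →
    (∀ x, b x = LinearMap.trace ℝ (Rn d) (fderiv ℝ B x : Rn d →ₗ[ℝ] Rn d)) →
    u a + Complex.I * u b = 0

/-- Near `x₀`, the functional `u` on test functions extends holomorphically to a wedge in `E` with
edge `S = γ(Ω)` near `γ x₀`: it is the boundary value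
`⟨u, φ⟩ = lim_{t → 0+} ∫ F(γ x + t v) φ(x) dx`, along a direction `v` of the wedge, of a holomorphic
function `F` of slow growth `|F(z)| ≤ C / dist(z, S)^l`. (Such a `u` is automatically CR
near `x₀`.) -/
def ExtendsHolomorphically {d : ℕ} (S : Set E) (Ω : Opens (Rn d)) (γ : Rn d → E) (x₀ : Rn d)
    (u : 𝓓(Ω, ℝ) → ℂ) : Prop :=
  ∃ (W : Wedge univ S (γ x₀)) (v : E) (F : E → ℂ),
    W.DirectedAt (γ x₀) v ∧
    DifferentiableOn ℂ F W.toSet ∧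
    (∃ (C : ℝ) (l : ℕ), ∀ z ∈ W.toSet, ‖F z‖ * Metric.infDist z S ^ l ≤ C) ∧
    ∃ U : Set (Rn d), IsOpen U ∧ x₀ ∈ U ∧
      ∀ φ : 𝓓(Ω, ℝ), tsupport φ ⊆ U →
        Tendsto (fun t : ℝ => ∫ x, F (γ x + t • v) * (φ x : ℂ)) (𝓝[>] 0) (𝓝 (u φ))

/-- The distribution `u` is decomposable at `γ x₀`: near that point it is a finite sum of
distributions, each of which extends holomorphically to a wedge with edge `S`. -/
def DistributionDecomposableAt {d : ℕ} (S : Set E) {Ω : Opens (Rn d)} (γ : Rn d → E) (x₀ : Rn d)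
    (u : 𝓓'(Ω, ℂ)) : Prop :=
  ∃ (K : ℕ) (U : Fin K → 𝓓'(Ω, ℂ)),
    (∀ j, ExtendsHolomorphically S Ω γ x₀ (fun φ => U j φ)) ∧
    ∃ O : Set (Rn d), IsOpen O ∧ x₀ ∈ O ∧
      ∀ φ : 𝓓(Ω, ℝ), tsupport φ ⊆ O → u φ = ∑ j, U j φ

/-- The smooth function `u` on `S` is decomposable (as a smooth function) at `γ x₀`: near that
point it is a finite sum of smooth functions on `S`, each of which extends holomorphically, in the
sense of distributional boundary values, to a wedge with edge `S`. -/
def FunctionDecomposableAt {d : ℕ} (S : Set E) (Ω : Opens (Rn d)) (γ : Rn d → E) (x₀ : Rn d)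
    (u : E → ℂ) : Prop :=
  ∃ (K : ℕ) (U : Fin K → E → ℂ) (V : Set E), IsOpen V ∧ γ x₀ ∈ V ∧
    (∀ j, ContDiffOn ℝ ∞ (U j) (S ∩ V)) ∧
    (∀ j, ExtendsHolomorphically S Ω γ x₀ (fun φ => ∫ x, U j (γ x) * (φ x : ℂ))) ∧
    ∀ q ∈ S ∩ V, u q = ∑ j, U j q

/-- `σ` is a smooth family of curves `t ↦ σ x t` in `M`, parametrized by `x ∈ U`, which start at the
point `b x` of the edge and enter the wedge `W` transversally to the edge. -/
def Wedge.IsApproach {d : ℕ} {M N : Set E} {p : E} (W : Wedge M N p) (b : Rn d → E)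
    (U : Set (Rn d)) (σ : Rn d → ℝ → E) : Prop :=
  (∀ x ∈ U, σ x 0 = b x) ∧
  (∃ ε : ℝ, 0 < ε ∧
    ContDiffOn ℝ ∞ (fun y : Rn d × ℝ => σ y.1 y.2) (U ×ˢ Ioo (-ε) ε) ∧
    ∀ x ∈ U, ∀ t ∈ Ico 0 ε, σ x t ∈ M) ∧
  ∀ x ∈ U, W.DirectedAt (b x) (deriv (σ x) 0)

/-- Near `x₀`, the distribution `f` on the edge, which is parametrized by `b`, is the boundary
value of the function `F` on the wedge `W` in `M`:
`⟨f, φ⟩ = lim_{t → 0+} ∫ F(σ(x, t)) φ(x) dx` for every smooth family `σ` of curves entering the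
wedge. -/
def Wedge.HasBoundaryValue {d : ℕ} {M N : Set E} {p : E} (W : Wedge M N p) {Ω : Opens (Rn d)}
    (b : Rn d → E) (x₀ : Rn d) (F : E → ℂ) (f : 𝓓'(Ω, ℂ)) : Prop :=
  ∃ O : Set (Rn d), IsOpen O ∧ x₀ ∈ O ∧
    ∀ U : Set (Rn d), IsOpen U → U ⊆ O → ∀ σ : Rn d → ℝ → E, W.IsApproach b U σ →
      ∀ φ : 𝓓(Ω, ℝ), tsupport φ ⊆ U →
        Tendsto (fun t : ℝ => ∫ x, F (σ x t) * (φ x : ℂ)) (𝓝[>] 0) (𝓝 (f φ))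

/-- The functions `g₁, …, gₙ` on the wedge `W` in `M` are (extended by `0` to the edge) of class
`C¹` up to the edge and vanish there, and `dg₁ ∧ … ∧ dgₙ ≠ 0` on the wedge and on the edge, i.e.
the differentials, restricted to the tangent spaces of `M`, are linearly independent over `ℂ`. In
particular the `g_l` vanish to order exactly one on the edge. -/
def Wedge.VanishToFirstOrder {M N : Set E} {p : E} (W : Wedge M N p) {n : ℕ}
    (g : Fin n → E → ℂ) : Prop :=
  (∀ l, ContDiffOn ℝ 1 (g l) (W.toSet ∪ (N ∩ W.nhd))) ∧
  (∀ l, ∀ q ∈ N ∩ W.nhd, g l q = 0) ∧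
  ∀ q ∈ W.toSet ∪ (N ∩ W.nhd), ∃ A : Fin n → E →L[ℝ] ℂ,
    (∀ l, HasFDerivWithinAt (g l) (A l) (W.toSet ∪ (N ∩ W.nhd)) q) ∧
    LinearIndependent ℂ
      (fun l => (A l : E →ₗ[ℝ] ℂ).domRestrict (tangentSpace M q))

end Submanifolds

end

/-!
The proof constructs `F` and the `g_l` as restrictions to `M` of functions which are holomorphic on
an open set containing the wedge. Let `b x = (γ x, h (γ x))` parametrize the graph `N` and write
`q = (z, w)` for the points of the ambient space.

**Idea.** Each component of `h` is a sum `h_l = ∑_j F_{lj}` of boundary values of holomorphic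
functions `F_{lj}` on wedges with edge `𝔑`, of directions `v_{lj}`. If all these wedges were one, the
functions `w_l - ∑_j F_{lj}(z)` would define `N` in a wedge over it. In general, the points `z` of the
projection of a wedge in `M` of direction `v` do not lie in any of the given wedges, and they have to
be pushed into them: `F_{lj}` is evaluated at `z + τ(q) (v_{lj} - v_z)`, where `v_z` is the projection
of `v` and `τ` is a holomorphic function which vanishes on `N` and is close to `t` at the points
`b x + t v`. There `z + τ (v_{lj} - v_z) ≈ γ x + t v_{lj}`, so that this point belongs to the wedge of
`F_{lj}`, and it is `γ x` if `t = 0`. Hence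
`g_l = w_l - ∑_j F_{lj}(z + τ (v_{lj} - v_z))` vanishes on `N`; and if `f` is the sum of the boundary
values of holomorphic functions `F_j` of directions `v_j`, then `F = ∑_j F_j(z + τ (v_j - v_z))` has
the boundary value `f`.

The function `τ` is itself a multiple of some `g_l`, namely of one whose linear part at the base point
does not vanish at `v`; it exists since `v` is not in the complex span of the tangent space of `N`
(`mem_span_of_graphDefect_eq_zero`). The definition of `g_l` in terms of `τ` thus becomes an implicit
equation for `τ`. The differentials of the `F_{lj}` at the base point are combined with `w_l` into the
linear functional `graphDefect`; the remainders have small Lipschitz constants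
(`HasSmoothBoundaryValue.exists_remainder`), and can be extended to the whole space with the same
property. So the equation `τ = a(q) + ∑ G_i(p(q) + τ w_i)` is solved by contraction
(`exists_solution_of_lipschitz`), and its solution is holomorphic where the arguments lie in the
wedges (`differentiableOn_of_implicit`, `exists_aperture`) and differentiable up to the edge
(`contDiffOn_of_implicit`). The differentials of the `g_l` are close to the functionals `graphDefect`,
which are independent over `ℂ` on the tangent space of the generic manifold `M`.

**Regularity at the edge.** The argument requires the holomorphic extensions of smooth functions to
be smooth up to the edge (`HasSmoothBoundaryValue.exists_contDiffOn`), although the boundary values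
are only assumed to be attained in the sense of distributions. A function of slow growth with bounded
boundary values is bounded on smaller wedges (`exists_bound_of_boundaryValue`): for the Taylor
polynomials `Z(s + it)` of `γ(x + (s + it) w)`, which fill the wedge and are almost holomorphic in
`s + it`, the means of `F ∘ Z` over `x` have a small Laplacian, and the maximum principle on a
rectangle with one side on the edge applies. Since constant vector fields are combinations, with
smooth complex coefficients, of tangent vector fields of `𝔑`, all derivatives of `F` have smooth
boundary values as well, so that they are bounded, and `F` and its derivatives are Lipschitz
continuous.

**Boundary values along curves.** If `F` is of slow growth `t^(-L)`, the integrals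
`∫ F(ψ(x, t)) φ(x) dx` along a family of curves are differentiated in `t`; as `F` is holomorphic,
`∂_t` can be expressed by the derivatives in `x`, and repeated integration by parts shows that the
integrals converge, to a limit which only depends on `ψ(·, 0)` (`norm_integral_sub_boundaryValue_le`).
Since `τ` is sufficiently smooth up to the edge along curves, this applies to the curves
`z + τ (v_j - v_z)` (`Wedge.IsApproach.tendsto_integral`).
-/

/-! ### Holomorphic functions of several variables -/

section SeveralComplexVariables

variable {E : Type*} [NormedAddCommGroup E] [NormedSpace ℂ E]

/-- Cauchy estimate for the differential of a holomorphic function. -/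
theorem norm_fderiv_le_of_norm_le_on_ball {W : Type*} [NormedAddCommGroup W] [NormedSpace ℂ W]
    {F : E → W} {z : E} {r M : ℝ} (hr : 0 < r)
    (hF : DifferentiableOn ℂ F (Metric.ball z r)) (hM : ∀ y ∈ Metric.ball z r, ‖F y‖ ≤ M) :
    ‖fderiv ℂ F z‖ ≤ 2 * M / r := by
  refine Complex.norm_fderiv_le_div_of_mapsTo_ball hF (fun y hy => ?_) hr
  rw [mem_closedBall_iff_norm]
  calc ‖F y - F z‖ ≤ ‖F y‖ + ‖F z‖ := norm_sub_le _ _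
    _ ≤ 2 * M := by linarith [hM y hy, hM z (Metric.mem_ball_self hr)]

theorem HasFDerivAt.comp_add_const_right {𝕜 V G : Type*} [NontriviallyNormedField 𝕜]
    [NormedAddCommGroup V] [NormedSpace 𝕜 V] [NormedAddCommGroup G] [NormedSpace 𝕜 G]
    {f : V → G} {f' : V →L[𝕜] G} {x a : V} (h : HasFDerivAt f f' (x + a)) :
    HasFDerivAt (fun x => f (x + a)) f' x := by
  have := HasFDerivAt.comp x h ((hasFDerivAt_id x).add_const a)
  simpa [Function.comp_def] using this

theorem continuousOn_fderiv_of_differentiableOn_complex {F : E → ℂ} {R : Set E} (hR : IsOpen R)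
    (hF : DifferentiableOn ℂ F R) : ContinuousOn (fderiv ℂ F) R := by
  intro z hz
  refine ContinuousAt.continuousWithinAt ?_
  -- `F' (z + h) - F' z` is the differential at `z` of `F (· + h) - F`, which is small near `z`.
  have hc : ContinuousAt F z := (hF.differentiableAt (hR.mem_nhds hz)).continuousAt
  rw [Metric.continuousAt_iff]
  intro ε hε
  obtain ⟨r₁, hr₁, h₁⟩ := Metric.isOpen_iff.1 hR z hz
  obtain ⟨L, hL⟩ : ∃ L, ∀ᶠ y in 𝓝 z, ‖fderiv ℂ F y‖ ≤ L := by
    obtain ⟨r₂, hr₂, h₂⟩ := Metric.continuousAt_iff.1 hc 1 one_pos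
    set r := min r₁ r₂ / 2
    have hrp : 0 < r := by positivity
    refine ⟨2 * (‖F z‖ + 1) / r, ?_⟩
    filter_upwards [Metric.ball_mem_nhds z hrp] with y hy
    have hsub : Metric.ball y r ⊆ Metric.ball z (min r₁ r₂) := by
      apply Metric.ball_subset_ball'
      have : dist y z < r := hy
      simp only [r] at *
      linarith
    refine norm_fderiv_le_of_norm_le_on_ball hrp (hF.mono ?_) (fun x hx => ?_)
    · exact fun x hx => h₁ (Metric.ball_subset_ball (min_le_left _ _) (hsub hx))
    · have := h₂ (show dist x z < r₂ from
        Metric.ball_subset_ball (min_le_right _ _) (hsub hx))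
      rw [dist_eq_norm] at this
      have h3 := norm_le_norm_add_norm_sub' (F x) (F z)
      linarith
  obtain ⟨r₂, hr₂, h₂⟩ := Metric.eventually_nhds_iff_ball.1 hL
  have hL0 : 0 ≤ L := (norm_nonneg _).trans (h₂ z (Metric.mem_ball_self hr₂))
  set r := min r₁ r₂ / 2 with hr
  have hrp : 0 < r := by positivity
  refine ⟨min r (ε * r / (2 * (L + 1)) / 2), by positivity, fun {y} hy => ?_⟩
  have hyr : dist y z < r := lt_of_lt_of_le hy (min_le_left _ _)
  have hyε : dist y z < ε * r / (2 * (L + 1)) / 2 := lt_of_lt_of_le hy (min_le_right _ _)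
  have hin : ∀ x ∈ Metric.ball z r, x ∈ Metric.ball z (min r₁ r₂) ∧
      x + (y - z) ∈ Metric.ball z (min r₁ r₂) := by
    intro x hx
    rw [mem_ball_iff_norm] at hx
    rw [dist_eq_norm] at hyr
    constructor
    · rw [mem_ball_iff_norm]; linarith
    · rw [mem_ball_iff_norm]
      calc ‖x + (y - z) - z‖ = ‖(x - z) + (y - z)‖ := by congr 1; abel
        _ ≤ ‖x - z‖ + ‖y - z‖ := norm_add_le _ _
        _ < min r₁ r₂ := by linarith
  have hd : ∀ x ∈ Metric.ball z (min r₁ r₂), DifferentiableAt ℂ F x := fun x hx =>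
    hF.differentiableAt (hR.mem_nhds (h₁ (Metric.ball_subset_ball (min_le_left _ _) hx)))
  have hlip : ∀ x ∈ Metric.ball z r, ‖F (x + (y - z)) - F x‖ ≤ L * ‖y - z‖ := by
    intro x hx
    have := (convex_ball z (min r₁ r₂)).norm_image_sub_le_of_norm_fderiv_le (𝕜 := ℂ) (f := F)
      (C := L) hd (fun x hx => h₂ x (Metric.ball_subset_ball (min_le_right _ _) hx))
      (hin x hx).1 (hin x hx).2
    simpa using this
  have hg : DifferentiableOn ℂ (fun x => F (x + (y - z)) - F x) (Metric.ball z r) := by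
    intro x hx
    refine (DifferentiableAt.sub ?_ (hd x (hin x hx).1)).differentiableWithinAt
    exact (hd _ (hin x hx).2).hasFDerivAt.comp_add_const_right.differentiableAt
  have hest := norm_fderiv_le_of_norm_le_on_ball hrp hg hlip
  have heq : fderiv ℂ (fun x => F (x + (y - z)) - F x) z = fderiv ℂ F y - fderiv ℂ F z := by
    have hz0 := hin z (Metric.mem_ball_self hrp)
    have h1 := (hd _ hz0.2).hasFDerivAt.comp_add_const_right
    rw [fderiv_fun_sub h1.differentiableAt (hd _ hz0.1), h1.fderiv]
    simp
  rw [heq] at hest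
  rw [dist_eq_norm]
  refine hest.trans_lt ?_
  rw [dist_eq_norm] at hyε
  rw [div_lt_iff₀ hrp]
  rw [lt_div_iff₀ two_pos, lt_div_iff₀ (by positivity)] at hyε
  nlinarith [norm_nonneg (y - z)]

/-- Each directional derivative of a holomorphic function is holomorphic: it is given by
Cauchy's formula, which can be differentiated under the integral. -/
theorem differentiableOn_fderiv_apply_complex {F : E → ℂ} {R : Set E} (hR : IsOpen R)
    (hF : DifferentiableOn ℂ F R) (e : E) :
    DifferentiableOn ℂ (fun z => fderiv ℂ F z e) R := by
  intro z hz
  refine DifferentiableAt.differentiableWithinAt ?_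
  have hcF' := continuousOn_fderiv_of_differentiableOn_complex hR hF
  obtain ⟨r₁, hr₁, h₁⟩ := Metric.isOpen_iff.1 hR z hz
  obtain ⟨r₂, hr₂, h₂⟩ := Metric.continuousAt_iff.1 (hcF'.continuousAt (hR.mem_nhds hz)) 1 one_pos
  set r := min r₁ r₂
  have hrp : 0 < r := by positivity
  obtain ⟨ρ, hρ, hρe⟩ : ∃ ρ : ℝ, 0 < ρ ∧ ρ * ‖e‖ < r / 2 := by
    refine ⟨r / 2 / (‖e‖ + 1), by positivity, ?_⟩
    rw [div_mul_eq_mul_div, div_lt_iff₀ (by positivity)]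
    nlinarith [norm_nonneg e]
  have hin : ∀ x ∈ Metric.ball z (r / 2), ∀ ζ ∈ Metric.closedBall (0 : ℂ) ρ,
      x + ζ • e ∈ Metric.ball z r := by
    intro x hx ζ hζ
    rw [mem_ball_iff_norm] at *
    rw [mem_closedBall_zero_iff] at hζ
    calc ‖x + ζ • e - z‖ = ‖(x - z) + ζ • e‖ := by congr 1; abel
      _ ≤ ‖x - z‖ + ‖ζ‖ * ‖e‖ := by rw [← norm_smul]; exact norm_add_le _ _
      _ < r := by nlinarith [norm_nonneg e]
  have hinR : ∀ x ∈ Metric.ball z r, x ∈ R := fun x hx =>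
    h₁ (Metric.ball_subset_ball (min_le_left _ _) hx)
  have hd : ∀ x ∈ Metric.ball z r, DifferentiableAt ℂ F x := fun x hx =>
    hF.differentiableAt (hR.mem_nhds (hinR x hx))
  have hline : ∀ x, ∀ ζ : ℂ, HasDerivAt (fun ζ : ℂ => x + ζ • e) e ζ := by
    intro x ζ
    simpa using ((hasDerivAt_id ζ).smul_const e).const_add x
  have hcauchy : ∀ x ∈ Metric.ball z (r / 2), fderiv ℂ F x e =
      (2 * Real.pi * Complex.I : ℂ)⁻¹ • ∮ ζ in C(0, ρ), (1 / (ζ - 0) ^ 2) • F (x + ζ • e) := by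
    intro x hx
    have hdf : ∀ ζ ∈ Metric.closedBall (0 : ℂ) ρ,
        HasDerivAt (fun ζ : ℂ => F (x + ζ • e)) (fderiv ℂ F (x + ζ • e) e) ζ := fun ζ hζ =>
      (hd _ (hin x hx ζ hζ)).hasFDerivAt.comp_hasDerivAt ζ (hline x ζ)
    have h := DiffContOnCl.deriv_eq_smul_circleIntegral (f := fun ζ : ℂ => F (x + ζ • e))
      (c := 0) (R := ρ) hρ (DifferentiableOn.diffContOnCl_ball (U := Metric.closedBall (0 : ℂ) ρ)
        (fun ζ hζ => (hdf ζ hζ).differentiableAt.differentiableWithinAt) subset_rfl)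
    have h0 := (hdf 0 (Metric.mem_closedBall_self hρ.le)).deriv
    simp only [zero_smul, add_zero] at h0
    rw [← h0, h, smul_smul, inv_mul_cancel₀ Complex.two_pi_I_ne_zero, one_smul]
  have hcirc : ∀ θ : ℝ, circleMap 0 ρ θ ∈ Metric.closedBall (0 : ℂ) ρ := fun θ =>
    circleMap_mem_closedBall _ hρ.le _
  have key : DifferentiableAt ℂ
      (fun x => ∮ ζ in C(0, ρ), (1 / (ζ - 0) ^ 2) • F (x + ζ • e)) z := by
    simp only [circleIntegral]
    set m : ℝ → ℂ := fun θ => deriv (circleMap 0 ρ) θ * (1 / (circleMap 0 ρ θ - 0) ^ 2) with hm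
    have hmc : Continuous m := by
      have h0 : ∀ θ, (circleMap 0 ρ θ - 0) ^ 2 ≠ 0 := fun θ => by
        simp [hρ.ne']
      simp only [hm, deriv_circleMap]
      exact ((continuous_circleMap 0 ρ).mul continuous_const).mul
        (continuous_const.div (((continuous_circleMap 0 ρ).sub continuous_const).pow 2) h0)
    have hcm : ∀ x, Continuous fun θ => x + circleMap 0 ρ θ • e := fun x =>
      continuous_const.add ((continuous_circleMap 0 ρ).smul continuous_const)
    have hmeas : ∀ x ∈ Metric.ball z (r / 2),
        Continuous fun θ => m θ • F (x + circleMap 0 ρ θ • e) := by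
      intro x hx
      refine hmc.smul (continuous_iff_continuousAt.2 fun θ => ?_)
      exact ContinuousAt.comp (f := fun θ => x + circleMap 0 ρ θ • e) (g := F)
        (hd _ (hin x hx _ (hcirc θ))).continuousAt (hcm x).continuousAt
    have hmeas' : Continuous fun θ => m θ • fderiv ℂ F (z + circleMap 0 ρ θ • e) := by
      refine hmc.smul (continuous_iff_continuousAt.2 fun θ => ?_)
      exact ContinuousAt.comp (f := fun θ => z + circleMap 0 ρ θ • e) (g := fderiv ℂ F)
        (hcF'.continuousAt (hR.mem_nhds (hinR _ (hin z (Metric.mem_ball_self (by positivity)) _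
          (hcirc θ))))) (hcm z).continuousAt
    have := (intervalIntegral.hasFDerivAt_integral_of_dominated_of_fderiv_le (𝕜 := ℂ)
      (F := fun x θ => m θ • F (x + circleMap 0 ρ θ • e))
      (F' := fun x θ => m θ • fderiv ℂ F (x + circleMap 0 ρ θ • e))
      (x₀ := z) (a := 0) (b := 2 * Real.pi) (μ := volume)
      (bound := fun θ => ‖m θ‖ * (‖fderiv ℂ F z‖ + 1))
      (Metric.ball_mem_nhds z (half_pos hrp)) ?_ ?_ ?_ ?_ ?_ ?_).differentiableAt
    · simpa only [hm, smul_eq_mul, mul_assoc] using this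
    · filter_upwards [Metric.ball_mem_nhds z (half_pos hrp)] with x hx
      exact (hmeas x hx).aestronglyMeasurable
    · exact (hmeas z (Metric.mem_ball_self (by positivity))).intervalIntegrable _ _
    · exact hmeas'.aestronglyMeasurable
    · refine Eventually.of_forall fun θ _ x hx => ?_
      rw [norm_smul]
      gcongr
      have := h₂ (Metric.ball_subset_ball (min_le_right _ _) (hin x hx _ (hcirc θ)))
      rw [dist_eq_norm] at this
      have h3 := norm_le_norm_add_norm_sub' (fderiv ℂ F (x + circleMap 0 ρ θ • e)) (fderiv ℂ F z)
      linarith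
    · exact (hmc.norm.mul continuous_const).intervalIntegrable _ _
    · refine Eventually.of_forall fun θ _ x hx => ?_
      exact ((hd _ (hin x hx _ (hcirc θ))).hasFDerivAt.comp_add_const_right).const_smul (m θ)
  refine (key.const_smul ((2 * Real.pi * Complex.I : ℂ)⁻¹)).congr_of_eventuallyEq ?_
  filter_upwards [Metric.ball_mem_nhds z (half_pos hrp)] with x hx
  exact hcauchy x hx

variable [FiniteDimensional ℂ E]

/-- A holomorphic function of several variables is smooth. -/
theorem contDiffOn_of_differentiableOn_complex {F : E → ℂ} {R : Set E} (hR : IsOpen R)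
    (hF : DifferentiableOn ℂ F R) : ContDiffOn ℂ ∞ F R := by
  rw [contDiffOn_infty]
  intro n
  induction n generalizing F with
  | zero => exact contDiffOn_zero.2 hF.continuousOn
  | succ n ih =>
    refine (contDiffOn_succ_iff_fderiv_of_isOpen (n := (n : WithTop ℕ∞)) hR).2 ⟨hF, by simp, ?_⟩
    exact contDiffOn_clm_apply.2 fun e => ih (differentiableOn_fderiv_apply_complex hR hF e)

theorem differentiableOn_fderiv_complex {F : E → ℂ} {R : Set E} (hR : IsOpen R)
    (hF : DifferentiableOn ℂ F R) : DifferentiableOn ℂ (fderiv ℂ F) R :=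
  ((contDiffOn_of_differentiableOn_complex hR hF).fderiv_of_isOpen (m := ∞) hR
    le_rfl).differentiableOn (by simp)

end SeveralComplexVariables

/-! ### Boundary values of holomorphic functions of slow growth -/

section BoundaryValues

variable {D : ℕ} {Y : Type*} [NormedAddCommGroup Y] [NormedSpace ℝ Y]
variable {E : Type*} [NormedAddCommGroup E] [NormedSpace ℂ E]

/-- A family of maps `x ↦ Ψ (x, t, y)` into the open set `R`, for `t > 0` and a parameter `y`, along
which the holomorphic function `F` on `R` grows at most like `t ^ (-L)` as `t → 0`. The velocity
`∂Ψ/∂t` is a combination, with smooth complex coefficients `c j`, of the derivatives of `Ψ` in the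
directions `e j` of the `x`-space; so is then the `t`-derivative of `F ∘ Ψ`. Only points `x` of the
compact set `K` and parameters `y` of the compact set `Y₁` matter. -/
structure SlowFamily (D : ℕ) (Y : Type*) [NormedAddCommGroup Y] [NormedSpace ℝ Y]
    (E : Type*) [NormedAddCommGroup E] [NormedSpace ℂ E] (L : ℕ) where
  U : Set (Rn D)
  isOpen_U : IsOpen U
  K : Set (Rn D)
  isCompact_K : IsCompact K
  K_subset : K ⊆ U
  δ : ℝ
  Y₀ : Set Y
  isOpen_Y₀ : IsOpen Y₀
  Y₁ : Set Y
  isCompact_Y₁ : IsCompact Y₁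
  Y₁_subset : Y₁ ⊆ Y₀
  R : Set E
  isOpen_R : IsOpen R
  F : E → ℂ
  holo : DifferentiableOn ℂ F R
  Ψ : Rn D × ℝ × Y → E
  smooth_Ψ : ContDiffOn ℝ 1 Ψ (U ×ˢ (Ico 0 δ ×ˢ Y₀))
  ι : Type
  fintype_ι : Fintype ι
  e : ι → Rn D
  c : ι → Rn D × ℝ × Y → ℂ
  smooth_c : ∀ j, ContDiffOn ℝ (L + 1 : ℕ) (c j) (U ×ˢ (Ico 0 δ ×ˢ Y₀))
  velocity : ∀ x ∈ K, ∀ t ∈ Ioo 0 δ, ∀ y ∈ Y₁,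
    fderivWithin ℝ Ψ (U ×ˢ (Ico 0 δ ×ˢ Y₀)) (x, t, y) (0, 1, 0) =
      ∑ j, c j (x, t, y) •
        fderivWithin ℝ Ψ (U ×ˢ (Ico 0 δ ×ˢ Y₀)) (x, t, y) (e j, 0, 0)
  mem_R : ∀ x ∈ K, ∀ t ∈ Ioo 0 δ, ∀ y ∈ Y₁, Ψ (x, t, y) ∈ R
  C : ℝ
  growth : ∀ x ∈ K, ∀ t ∈ Ioo 0 δ, ∀ y ∈ Y₁, ‖F (Ψ (x, t, y))‖ ≤ C / t ^ L

namespace SlowFamily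

variable {L : ℕ} (S : SlowFamily D Y E L)

attribute [instance] SlowFamily.fintype_ι

/-- The domain of the family, which includes the edge `t = 0`. -/
def Q : Set (Rn D × ℝ × Y) := S.U ×ˢ (Ico 0 S.δ ×ˢ S.Y₀)

theorem uniqueDiffOn_Q : UniqueDiffOn ℝ S.Q :=
  S.isOpen_U.uniqueDiffOn.prod ((uniqueDiffOn_Ico _ _).prod S.isOpen_Y₀.uniqueDiffOn)

theorem mem_Q {x : Rn D} {t : ℝ} {y : Y} (hx : x ∈ S.K) (ht : t ∈ Ico 0 S.δ) (hy : y ∈ S.Y₁) :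
    (x, t, y) ∈ S.Q := ⟨S.K_subset hx, ht, S.Y₁_subset hy⟩

theorem Q_mem_nhds {x : Rn D} {t : ℝ} {y : Y} (hx : x ∈ S.U) (ht : t ∈ Ioo 0 S.δ)
    (hy : y ∈ S.Y₀) : S.Q ∈ 𝓝 (x, t, y) :=
  prod_mem_nhds (S.isOpen_U.mem_nhds hx)
    (prod_mem_nhds (Ico_mem_nhds ht.1 ht.2) (S.isOpen_Y₀.mem_nhds hy))

/-- Test functions of class `C^a`, depending on `t` and on the parameter `y`. -/
def IsTest (a : ℕ) (χ : Rn D × ℝ × Y → ℂ) : Prop :=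
  ContDiffOn ℝ a χ S.Q ∧ ∀ x ∉ S.K, ∀ t ∈ Ico 0 S.δ, ∀ y ∈ S.Y₀, χ (x, t, y) = 0

/-- The pairing of `F ∘ Ψ` with a test function. -/
noncomputable def J (χ : Rn D × ℝ × Y → ℂ) (t : ℝ) (y : Y) : ℂ :=
  ∫ x, S.F (S.Ψ (x, t, y)) * χ (x, t, y)

open Classical in
/-- The operator `∂χ/∂t - ∑ ∂(c j χ)/∂(e j)`, cut off outside `K` in order to discard the
meaningless derivatives outside the domain. The `t`-derivative of the pairing of `F ∘ Ψ` with `χ` is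
the pairing with this function. -/
noncomputable def transpose (χ : Rn D × ℝ × Y → ℂ) (p : Rn D × ℝ × Y) : ℂ :=
  if p.1 ∈ S.K then
    fderivWithin ℝ χ S.Q p (0, 1, 0) -
      ∑ j, fderivWithin ℝ (fun p => S.c j p * χ p) S.Q p (S.e j, 0, 0)
  else 0

variable {S}

theorem IsTest.mul_left {a : ℕ} {χ : Rn D × ℝ × Y → ℂ} (hχ : S.IsTest a χ)
    {g : Rn D × ℝ × Y → ℂ} (hg : ContDiffOn ℝ a g S.Q) : S.IsTest a (fun p => g p * χ p) :=
  ⟨hg.mul hχ.1, fun x hx t ht y hy => by simp [hχ.2 x hx t ht y hy]⟩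

theorem IsTest.fderivWithin_eq_zero {a : ℕ} {χ : Rn D × ℝ × Y → ℂ} (hχ : S.IsTest a χ)
    {p : Rn D × ℝ × Y} (hp : p ∈ S.Q) (hpK : p.1 ∉ S.K) : fderivWithin ℝ χ S.Q p = 0 := by
  have : χ =ᶠ[𝓝[S.Q] p] fun _ => 0 := by
    have h1 : {q : Rn D × ℝ × Y | q.1 ∉ S.K} ∈ 𝓝[S.Q] p :=
      mem_nhdsWithin_of_mem_nhds
        ((S.isCompact_K.isClosed.isOpen_compl.preimage continuous_fst).mem_nhds hpK)
    filter_upwards [h1, self_mem_nhdsWithin] with q hq hqQ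
    exact hχ.2 q.1 hq q.2.1 hqQ.2.1 q.2.2 hqQ.2.2
  rw [this.fderivWithin_eq (hχ.2 p.1 hpK p.2.1 hp.2.1 p.2.2 hp.2.2)]
  simp

theorem IsTest.transpose {a : ℕ} (haL : a ≤ L) {χ : Rn D × ℝ × Y → ℂ} (hχ : S.IsTest (a + 1) χ) :
    S.IsTest a (S.transpose χ) := by
  have hc : ∀ j, S.IsTest (a + 1) (fun p => S.c j p * χ p) := fun j =>
    hχ.mul_left ((S.smooth_c j).of_le (by exact_mod_cast Nat.succ_le_succ haL))
  refine ⟨?_, fun x hx t _ y _ => by simp [SlowFamily.transpose, hx]⟩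
  have hd : ∀ {g : Rn D × ℝ × Y → ℂ}, S.IsTest (a + 1) g → ∀ v,
      ContDiffOn ℝ a (fun p => fderivWithin ℝ g S.Q p v) S.Q := fun hg v =>
    (hg.1.fderivWithin S.uniqueDiffOn_Q (by norm_cast)).clm_apply contDiffOn_const
  refine ContDiffOn.congr (f := fun p => fderivWithin ℝ χ S.Q p (0, 1, 0) -
      ∑ j, fderivWithin ℝ (fun p => S.c j p * χ p) S.Q p (S.e j, 0, 0)) ?_ fun p hp => ?_
  · exact (hd hχ _).sub (ContDiffOn.sum fun j _ => hd (hc j) _)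
  · unfold SlowFamily.transpose
    split_ifs with hpK
    · rfl
    · rw [hχ.fderivWithin_eq_zero hp hpK]
      simp [fun j => (hc j).fderivWithin_eq_zero hp hpK]

theorem hasFDerivAt_of_mem {G : Type*} [NormedAddCommGroup G] [NormedSpace ℝ G]
    {g : Rn D × ℝ × Y → G} (hg : ContDiffOn ℝ 1 g S.Q) {x : Rn D} {t : ℝ} {y : Y}
    (hx : x ∈ S.U) (ht : t ∈ Ioo 0 S.δ) (hy : y ∈ S.Y₀) :
    HasFDerivAt g (fderivWithin ℝ g S.Q (x, t, y)) (x, t, y) :=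
  ((hg.differentiableOn one_ne_zero (x, t, y)
    ⟨hx, Ioo_subset_Ico_self ht, hy⟩).hasFDerivWithinAt).hasFDerivAt (S.Q_mem_nhds hx ht hy)

theorem hasDerivAt_time {G : Type*} [NormedAddCommGroup G] [NormedSpace ℝ G]
    {g : Rn D × ℝ × Y → G} (hg : ContDiffOn ℝ 1 g S.Q) {x : Rn D} {t : ℝ} {y : Y}
    (hx : x ∈ S.U) (ht : t ∈ Ioo 0 S.δ) (hy : y ∈ S.Y₀) :
    HasDerivAt (fun t => g (x, t, y)) (fderivWithin ℝ g S.Q (x, t, y) (0, 1, 0)) t := by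
  refine (hasFDerivAt_of_mem hg hx ht hy).comp_hasDerivAt (f := fun t => (x, t, y)) t ?_
  exact (hasDerivAt_const t x).prodMk ((hasDerivAt_id t).prodMk (hasDerivAt_const t y))

theorem hasLineDerivAt_space {G : Type*} [NormedAddCommGroup G] [NormedSpace ℝ G]
    {g : Rn D × ℝ × Y → G} (hg : ContDiffOn ℝ 1 g S.Q) {x : Rn D} {t : ℝ} {y : Y}
    (hx : x ∈ S.U) (ht : t ∈ Ioo 0 S.δ) (hy : y ∈ S.Y₀) (v : Rn D) :
    HasLineDerivAt ℝ (fun x => g (x, t, y)) (fderivWithin ℝ g S.Q (x, t, y) (v, 0, 0)) x v := by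
  have h1 := hasFDerivAt_of_mem hg hx ht hy
  have h2 : HasFDerivAt (fun x : Rn D => (x, t, y))
      ((ContinuousLinearMap.id ℝ (Rn D)).prod 0) x := (hasFDerivAt_id x).prodMk
        (hasFDerivAt_const (t, y) x)
  have := (HasFDerivAt.comp (f := fun x : Rn D => (x, t, y)) x h1 h2).hasLineDerivAt v
  exact this

/-- A function which is continuous on `K` and vanishes elsewhere is integrable. -/
theorem integrable_of_continuousOn_K {g : Rn D → ℂ} (hg : ContinuousOn g S.K)
    (h0 : ∀ x ∉ S.K, g x = 0) : Integrable g :=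
  (hg.integrableOn_compact S.isCompact_K).integrable_of_forall_notMem_eq_zero h0

theorem continuousOn_slice {G : Type*} [TopologicalSpace G] {g : Rn D × ℝ × Y → G}
    (hg : ContinuousOn g S.Q) {y : Y} (hy : y ∈ S.Y₁) :
    ContinuousOn (fun q : Rn D × ℝ => g (q.1, q.2, y)) (S.K ×ˢ Ioo 0 S.δ) :=
  hg.comp (by fun_prop) fun q hq => S.mem_Q hq.1 (Ioo_subset_Ico_self hq.2) hy

theorem continuousOn_F_slice {y : Y} (hy : y ∈ S.Y₁) :
    ContinuousOn (fun q : Rn D × ℝ => S.F (S.Ψ (q.1, q.2, y))) (S.K ×ˢ Ioo 0 S.δ) :=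
  S.holo.continuousOn.comp (S.continuousOn_slice S.smooth_Ψ.continuousOn hy)
    fun q hq => S.mem_R q.1 hq.1 q.2 hq.2 y hy

theorem continuousOn_fderiv_F_slice {y : Y} (hy : y ∈ S.Y₁) (v : Rn D × ℝ × Y) :
    ContinuousOn (fun q : Rn D × ℝ => fderiv ℂ S.F (S.Ψ (q.1, q.2, y))
      (fderivWithin ℝ S.Ψ S.Q (q.1, q.2, y) v)) (S.K ×ˢ Ioo 0 S.δ) := by
  refine ContinuousOn.clm_apply ?_ ?_
  · exact (continuousOn_fderiv_of_differentiableOn_complex S.isOpen_R S.holo).comp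
      (S.continuousOn_slice S.smooth_Ψ.continuousOn hy)
      fun q hq => S.mem_R q.1 hq.1 q.2 hq.2 y hy
  · exact S.continuousOn_slice (g := fun p => fderivWithin ℝ S.Ψ S.Q p v)
      ((S.smooth_Ψ.continuousOn_fderivWithin S.uniqueDiffOn_Q le_rfl).clm_apply
        continuousOn_const) hy

theorem continuousOn_fderivWithin_slice {g : Rn D × ℝ × Y → ℂ} (hg : ContDiffOn ℝ 1 g S.Q) {y : Y}
    (hy : y ∈ S.Y₁) (v : Rn D × ℝ × Y) :
    ContinuousOn (fun q : Rn D × ℝ => fderivWithin ℝ g S.Q (q.1, q.2, y) v)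
      (S.K ×ˢ Ioo 0 S.δ) :=
  S.continuousOn_slice (g := fun p => fderivWithin ℝ g S.Q p v)
    ((hg.continuousOn_fderivWithin S.uniqueDiffOn_Q le_rfl).clm_apply continuousOn_const) hy

theorem continuousOn_space {G : Type*} [TopologicalSpace G] {g : Rn D × ℝ → G}
    (hg : ContinuousOn g (S.K ×ˢ Ioo 0 S.δ)) {t : ℝ} (ht : t ∈ Ioo 0 S.δ) :
    ContinuousOn (fun x => g (x, t)) S.K :=
  hg.comp (by fun_prop) fun _ hx => ⟨hx, ht⟩

open Classical in
/-- Integration by parts in the space variables. -/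
theorem integral_fderiv_mul {g : Rn D × ℝ × Y → ℂ} (hg : S.IsTest 1 g) {t : ℝ}
    (ht : t ∈ Ioo 0 S.δ) {y : Y} (hy : y ∈ S.Y₁) (v : Rn D) :
    ∫ x, fderiv ℂ S.F (S.Ψ (x, t, y)) (fderivWithin ℝ S.Ψ S.Q (x, t, y) (v, 0, 0)) * g (x, t, y) =
      -∫ x, S.F (S.Ψ (x, t, y)) *
        (if x ∈ S.K then fderivWithin ℝ g S.Q (x, t, y) (v, 0, 0) else 0) := by
  have hy0 := S.Y₁_subset hy
  have ht' := Ioo_subset_Ico_self ht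
  have hg1 : ContDiffOn ℝ 1 g S.Q := hg.1
  have hgK : ContinuousOn (fun x => g (x, t, y)) S.K :=
    S.continuousOn_space (g := fun q => g (q.1, q.2, y))
      (S.continuousOn_slice hg.1.continuousOn hy) ht
  have hFK : ContinuousOn (fun x => S.F (S.Ψ (x, t, y))) S.K :=
    S.continuousOn_space (g := fun q => S.F (S.Ψ (q.1, q.2, y))) (S.continuousOn_F_slice hy) ht
  have hsupp : tsupport (fun x => g (x, t, y)) ⊆ S.K :=
    closure_minimal (fun x hx => by
      by_contra h
      exact hx (hg.2 x h t ht' y hy0)) S.isCompact_K.isClosed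
  have key := integral_bilinear_hasLineDerivAt_right_eq_neg_left_of_integrable
    (μ := (volume : Measure (Rn D)))
    (f := fun x => S.F (S.Ψ (x, t, y)))
    (f' := fun x => fderiv ℂ S.F (S.Ψ (x, t, y)) (fderivWithin ℝ S.Ψ S.Q (x, t, y) (v, 0, 0)))
    (g := fun x => g (x, t, y))
    (g' := fun x => if x ∈ S.K then fderivWithin ℝ g S.Q (x, t, y) (v, 0, 0) else 0)
    (v := v) (B := ContinuousLinearMap.mul ℝ ℂ) ?_ ?_ ?_ ?_ ?_
  · simp only [ContinuousLinearMap.mul_apply'] at key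
    rw [key, neg_neg]
  · refine S.integrable_of_continuousOn_K ?_ fun x hx => ?_
    · exact (S.continuousOn_space (g := fun q => fderiv ℂ S.F (S.Ψ (q.1, q.2, y))
        (fderivWithin ℝ S.Ψ S.Q (q.1, q.2, y) (v, 0, 0))) (S.continuousOn_fderiv_F_slice hy _)
        ht).mul hgK
    · simp [hg.2 x hx t ht' y hy0]
  · refine S.integrable_of_continuousOn_K ?_ fun x hx => by simp [hx]
    refine (hFK.mul (S.continuousOn_space (g := fun q =>
      fderivWithin ℝ g S.Q (q.1, q.2, y) (v, 0, 0))
        (S.continuousOn_fderivWithin_slice hg1 hy _) ht)).congr fun x hx => by simp [hx]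
  · refine S.integrable_of_continuousOn_K (hFK.mul hgK) fun x hx => ?_
    simp [hg.2 x hx t ht' y hy0]
  · intro x hx
    have hxK := hsupp hx
    have h1 := S.hasLineDerivAt_space S.smooth_Ψ (S.K_subset hxK) ht hy0 v
    have h2 : DifferentiableAt ℂ S.F (S.Ψ (x, t, y)) :=
      S.holo.differentiableAt (S.isOpen_R.mem_nhds (S.mem_R x hxK t ht y hy))
    rw [HasLineDerivAt] at h1 ⊢
    have h3 : HasFDerivAt S.F ((fderiv ℂ S.F (S.Ψ (x, t, y))).restrictScalars ℝ)
        (S.Ψ (x + (0 : ℝ) • v, t, y)) := by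
      rw [zero_smul, add_zero]
      exact h2.hasFDerivAt.restrictScalars ℝ
    exact h3.comp_hasDerivAt (f := fun s : ℝ => S.Ψ (x + s • v, t, y)) 0 h1
  · intro x _
    split_ifs with hxK
    · exact S.hasLineDerivAt_space hg1 (S.K_subset hxK) ht hy0 v
    · have : (fun x => g (x, t, y)) =ᶠ[𝓝 x] fun _ => 0 := by
        filter_upwards [S.isCompact_K.isClosed.isOpen_compl.mem_nhds hxK] with z hz
        exact hg.2 z hz t ht' y hy0
      exact ((hasFDerivAt_const (0 : ℂ) x).congr_of_eventuallyEq this).hasLineDerivAt v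

theorem hasDerivAt_J {χ : Rn D × ℝ × Y → ℂ} (hχ : S.IsTest 1 χ) {t : ℝ} (ht : t ∈ Ioo 0 S.δ)
    {y : Y} (hy : y ∈ S.Y₁) :
    HasDerivAt (fun t => S.J χ t y) (S.J (S.transpose χ) t y) t := by
  classical
  have hy0 := S.Y₁_subset hy
  have hχ1 : ContDiffOn ℝ 1 χ S.Q := hχ.1
  set f' : ℝ → Rn D → ℂ := fun t x => if x ∈ S.K then
      fderiv ℂ S.F (S.Ψ (x, t, y)) (fderivWithin ℝ S.Ψ S.Q (x, t, y) (0, 1, 0)) * χ (x, t, y)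
      + S.F (S.Ψ (x, t, y)) * fderivWithin ℝ χ S.Q (x, t, y) (0, 1, 0) else 0 with hf'
  have hcont : ContinuousOn (fun q : Rn D × ℝ => f' q.2 q.1) (S.K ×ˢ Ioo 0 S.δ) := by
    refine ((S.continuousOn_fderiv_F_slice hy (0, 1, 0)).mul
      (S.continuousOn_slice hχ.1.continuousOn hy)).add
      ((S.continuousOn_F_slice hy).mul (S.continuousOn_fderivWithin_slice hχ1 hy (0, 1, 0))) |>.congr
      fun q hq => by simp [hf', hq.1]
  have hcont0 : ContinuousOn (fun q : Rn D × ℝ => S.F (S.Ψ (q.1, q.2, y)) * χ (q.1, q.2, y))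
      (S.K ×ˢ Ioo 0 S.δ) :=
    (S.continuousOn_F_slice hy).mul (S.continuousOn_slice hχ.1.continuousOn hy)
  obtain ⟨η, hη, hηsub⟩ := Metric.nhds_basis_closedBall.mem_iff.1 (Ioo_mem_nhds ht.1 ht.2)
  obtain ⟨M, hM⟩ := (S.isCompact_K.prod (isCompact_closedBall t η)).exists_bound_of_continuousOn
    (hcont.mono (prod_mono subset_rfl hηsub))
  have hint0 : ∀ t ∈ Ioo 0 S.δ, Integrable (fun x => S.F (S.Ψ (x, t, y)) * χ (x, t, y)) := by
    intro t ht
    refine S.integrable_of_continuousOn_K (S.continuousOn_space hcont0 ht) fun x hx => ?_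
    simp [hχ.2 x hx t (Ioo_subset_Ico_self ht) y hy0]
  have hderiv := (hasDerivAt_integral_of_dominated_loc_of_deriv_le
    (μ := (volume : Measure (Rn D)))
    (F := fun t x => S.F (S.Ψ (x, t, y)) * χ (x, t, y)) (F' := f') (x₀ := t)
    (bound := S.K.indicator fun _ => M) (Metric.ball_mem_nhds t hη) ?_ (hint0 t ht) ?_ ?_ ?_ ?_).2
  · have heq : ∫ x, f' t x = S.J (S.transpose χ) t y := by
      have hc : ∀ j, S.IsTest 1 (fun p => S.c j p * χ p) := fun j =>
        hχ.mul_left ((S.smooth_c j).of_le (by norm_cast; omega))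
      have hA : ∀ j, Integrable fun x => fderiv ℂ S.F (S.Ψ (x, t, y))
          (fderivWithin ℝ S.Ψ S.Q (x, t, y) (S.e j, 0, 0)) * (S.c j (x, t, y) * χ (x, t, y)) := by
        intro j
        refine S.integrable_of_continuousOn_K (S.continuousOn_space (g := fun q =>
          fderiv ℂ S.F (S.Ψ (q.1, q.2, y)) (fderivWithin ℝ S.Ψ S.Q (q.1, q.2, y) (S.e j, 0, 0)) *
            (S.c j (q.1, q.2, y) * χ (q.1, q.2, y))) ((S.continuousOn_fderiv_F_slice hy _).mul
          (S.continuousOn_slice (hc j).1.continuousOn hy)) ht) fun x hx => ?_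
        simp [hχ.2 x hx t (Ioo_subset_Ico_self ht) y hy0]
      have hB : ∀ {g : Rn D × ℝ × Y → ℂ}, S.IsTest 1 g → ∀ v, Integrable fun x =>
          S.F (S.Ψ (x, t, y)) * (if x ∈ S.K then fderivWithin ℝ g S.Q (x, t, y) v else 0) := by
        intro g hg v
        refine S.integrable_of_continuousOn_K ?_ fun x hx => by simp [hx]
        exact (S.continuousOn_space (g := fun q => S.F (S.Ψ (q.1, q.2, y)) *
          fderivWithin ℝ g S.Q (q.1, q.2, y) v) ((S.continuousOn_F_slice hy).mul
            (S.continuousOn_fderivWithin_slice hg.1 hy _)) ht).congr fun x hx => by simp [hx]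
      calc ∫ x, f' t x = ∫ x, ((∑ j, fderiv ℂ S.F (S.Ψ (x, t, y))
              (fderivWithin ℝ S.Ψ S.Q (x, t, y) (S.e j, 0, 0)) * (S.c j (x, t, y) * χ (x, t, y)))
            + S.F (S.Ψ (x, t, y)) *
              (if x ∈ S.K then fderivWithin ℝ χ S.Q (x, t, y) (0, 1, 0) else 0)) := by
            congr 1 with x
            by_cases hx : x ∈ S.K
            · have hv := S.velocity x hx t ht y hy
              change fderivWithin ℝ S.Ψ S.Q (x, t, y) (0, 1, 0) = _ at hv
              simp only [hf', hx, if_true, hv, map_sum, map_smul, Finset.sum_mul, smul_eq_mul]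
              congr 1
              refine Finset.sum_congr rfl fun j _ => ?_
              change _ * fderiv ℂ S.F _ (fderivWithin ℝ S.Ψ S.Q (x, t, y) (S.e j, 0, 0)) * _ = _
              ring
            · simp [hf', hx, hχ.2 x hx t (Ioo_subset_Ico_self ht) y hy0]
        _ = (∑ j, -∫ x, S.F (S.Ψ (x, t, y)) * (if x ∈ S.K then
              fderivWithin ℝ (fun p => S.c j p * χ p) S.Q (x, t, y) (S.e j, 0, 0) else 0))
            + ∫ x, S.F (S.Ψ (x, t, y)) *
              (if x ∈ S.K then fderivWithin ℝ χ S.Q (x, t, y) (0, 1, 0) else 0) := by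
            rw [integral_add (integrable_finsetSum _ fun j _ => hA j) (hB hχ _),
              integral_finsetSum _ fun j _ => hA j]
            congr 1
            exact Finset.sum_congr rfl fun j _ => S.integral_fderiv_mul (hc j) ht hy (S.e j)
        _ = S.J (S.transpose χ) t y := by
            rw [Finset.sum_neg_distrib, ← integral_finsetSum _ fun j _ => hB (hc j) _, neg_add_eq_sub,
              ← integral_sub (hB hχ _) (integrable_finsetSum _ fun j _ => hB (hc j) _)]
            unfold J transpose
            congr 1 with x
            by_cases hx : x ∈ S.K
            · simp only [hx, if_true]
              rw [mul_sub, Finset.mul_sum]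
            · simp [hx]
    rw [← heq]
    exact hderiv
  · filter_upwards [Ioo_mem_nhds ht.1 ht.2] with s hs
    exact (hint0 s hs).aestronglyMeasurable
  · refine (S.integrable_of_continuousOn_K (S.continuousOn_space hcont ht)
      fun x hx => by simp [hf', hx]).aestronglyMeasurable
  · refine Eventually.of_forall fun x s hs => ?_
    by_cases hx : x ∈ S.K
    · simpa [hx] using hM (x, s) ⟨hx, Metric.ball_subset_closedBall hs⟩
    · simp [hx, hf']
  · exact (integrable_indicator_iff S.isCompact_K.measurableSet).2
      (integrableOn_const S.isCompact_K.measure_lt_top.ne)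
  · refine Eventually.of_forall fun x s hs => ?_
    have hs' := hηsub (Metric.ball_subset_closedBall hs)
    by_cases hx : x ∈ S.K
    · have h1 := S.hasDerivAt_time S.smooth_Ψ (S.K_subset hx) hs' hy0
      have h2 : HasFDerivAt S.F ((fderiv ℂ S.F (S.Ψ (x, s, y))).restrictScalars ℝ)
          (S.Ψ (x, s, y)) := (S.holo.differentiableAt (S.isOpen_R.mem_nhds
            (S.mem_R x hx s hs' y hy))).hasFDerivAt.restrictScalars ℝ
      have h3 := h2.comp_hasDerivAt (f := fun s : ℝ => S.Ψ (x, s, y)) s h1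
      have h4 := S.hasDerivAt_time hχ1 (S.K_subset hx) hs' hy0
      rw [show f' s x = _ from if_pos hx]
      exact h3.mul h4
    · have : (fun s => S.F (S.Ψ (x, s, y)) * χ (x, s, y)) =ᶠ[𝓝 s] fun _ => 0 := by
        filter_upwards [Ioo_mem_nhds hs'.1 hs'.2] with r hr
        simp [hχ.2 x hx r (Ioo_subset_Ico_self hr) y hy0]
      simpa [hf', hx] using (hasDerivAt_const s (0 : ℂ)).congr_of_eventuallyEq this

theorem IsTest.exists_bound {a : ℕ} {χ : Rn D × ℝ × Y → ℂ} (hχ : S.IsTest a χ) {δ₁ : ℝ}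
    (hδ₁ : δ₁ < S.δ) :
    ∃ B, 0 ≤ B ∧ ∀ x, ∀ t ∈ Ioc 0 δ₁, ∀ y ∈ S.Y₁, ‖χ (x, t, y)‖ ≤ B := by
  obtain ⟨B, hB⟩ := (S.isCompact_K.prod (isCompact_Icc.prod
    S.isCompact_Y₁)).exists_bound_of_continuousOn (f := χ) (hχ.1.continuousOn.mono
      (prod_mono S.K_subset (prod_mono (Icc_subset_Ico_right hδ₁) S.Y₁_subset)))
  refine ⟨max B 0, le_max_right _ _, fun x t ht y hy => ?_⟩
  by_cases hx : x ∈ S.K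
  · exact (hB (x, t, y) ⟨hx, Ioc_subset_Icc_self ht, hy⟩).trans (le_max_left _ _)
  · rw [hχ.2 x hx t ⟨ht.1.le, ht.2.trans_lt hδ₁⟩ y (S.Y₁_subset hy)]
    simp

theorem exists_norm_J_le_pow {a : ℕ} {χ : Rn D × ℝ × Y → ℂ} (hχ : S.IsTest a χ) {δ₁ : ℝ}
    (hδ₁ : δ₁ < S.δ) :
    ∃ B, 0 ≤ B ∧ ∀ t ∈ Ioc 0 δ₁, ∀ y ∈ S.Y₁, ‖S.J χ t y‖ ≤ B / t ^ L := by
  obtain ⟨B, hB0, hB⟩ := hχ.exists_bound hδ₁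
  refine ⟨|S.C| * B * volume.real S.K, by positivity, fun t ht y hy => ?_⟩
  have h1 : S.J χ t y = ∫ x in S.K, S.F (S.Ψ (x, t, y)) * χ (x, t, y) := by
    refine (setIntegral_eq_integral_of_forall_compl_eq_zero fun x hx => ?_).symm
    simp [hχ.2 x hx t ⟨ht.1.le, ht.2.trans_lt hδ₁⟩ y (S.Y₁_subset hy)]
  rw [h1]
  have htL : 0 < t ^ L := pow_pos ht.1 _
  calc _ ≤ (|S.C| / t ^ L * B) * volume.real S.K := by
        refine norm_setIntegral_le_of_norm_le_const S.isCompact_K.measure_lt_top fun x hx => ?_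
        rw [norm_mul]
        refine mul_le_mul ((S.growth x hx t ⟨ht.1, ht.2.trans_lt hδ₁⟩ y hy).trans ?_) (hB x t ht y hy)
          (norm_nonneg _) (by positivity)
        gcongr
        exact le_abs_self _
    _ = _ := by ring

/-- Integration of a bound for the derivative. -/
theorem norm_sub_le_of_hasDerivAt {J J' : ℝ → ℂ} {β β' : ℝ → ℝ} {t₀ t₁ : ℝ} (h : t₀ ≤ t₁)
    (hJ : ∀ t ∈ Icc t₀ t₁, HasDerivAt J (J' t) t) (hβ : ∀ t ∈ Icc t₀ t₁, HasDerivAt β (β' t) t)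
    (hle : ∀ t ∈ Icc t₀ t₁, ‖J' t‖ ≤ β' t) : ‖J t₁ - J t₀‖ ≤ β t₁ - β t₀ := by
  refine image_norm_le_of_norm_deriv_right_le_deriv_boundary' (f := fun t => J t - J t₀)
    (f' := J') (B := fun t => β t - β t₀) (B' := β') (a := t₀) (b := t₁) ?_ ?_ ?_ ?_ ?_ ?_
    (right_mem_Icc.2 h)
  · exact fun t ht => ((hJ t ht).sub_const _).continuousAt.continuousWithinAt
  · exact fun t ht => ((hJ t (Ico_subset_Icc_self ht)).sub_const _).hasDerivWithinAt
  · simp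
  · exact fun t ht => ((hβ t ht).sub_const _).continuousAt.continuousWithinAt
  · exact fun t ht => ((hβ t (Ico_subset_Icc_self ht)).sub_const _).hasDerivWithinAt
  · exact fun t ht => hle t (Ico_subset_Icc_self ht)

/-- Each derivative of a test function which is spent improves the growth of the pairing by one
power of `t`. The exponents are half-integers, so that no logarithm occurs. -/
theorem exists_norm_J_le_rpow {δ₁ : ℝ} (hδ₀ : 0 < δ₁) (hδ₁ : δ₁ < S.δ) (h1 : δ₁ ≤ 1) {a : ℕ}
    (haL : a ≤ L) {χ : Rn D × ℝ × Y → ℂ} (hχ : S.IsTest a χ) :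
    ∃ B, 0 ≤ B ∧ ∀ t ∈ Ioc 0 δ₁, ∀ y ∈ S.Y₁, ‖S.J χ t y‖ ≤ B * t ^ (-((L : ℝ) - a + 1 / 2)) := by
  induction a generalizing χ with
  | zero =>
    obtain ⟨B, hB0, hB⟩ := exists_norm_J_le_pow hχ hδ₁
    refine ⟨B, hB0, fun t ht y hy => (hB t ht y hy).trans ?_⟩
    rw [div_eq_mul_inv]
    refine mul_le_mul_of_nonneg_left ?_ hB0
    rw [← Real.rpow_natCast, ← Real.rpow_neg ht.1.le]
    exact Real.rpow_le_rpow_of_exponent_ge ht.1 (ht.2.trans h1) (by simp)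
  | succ a ih =>
    obtain ⟨B, hB0, hB⟩ := ih (by omega) (hχ.transpose (by omega))
    obtain ⟨B₁, hB₁0, hB₁⟩ := exists_norm_J_le_pow hχ hδ₁
    set b : ℝ := (L : ℝ) - (a + 1 : ℕ) + 1 / 2 with hb
    have hbpos : 0 < b := by
      have : ((a + 1 : ℕ) : ℝ) ≤ L := by exact_mod_cast haL
      rw [hb]; linarith
    refine ⟨B₁ / δ₁ ^ L + B / b, by positivity, fun t ht y hy => ?_⟩
    have key : ‖S.J χ δ₁ y - S.J χ t y‖ ≤ -(B / b) * δ₁ ^ (-b) - -(B / b) * t ^ (-b) := by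
      refine norm_sub_le_of_hasDerivAt (β := fun t => -(B / b) * t ^ (-b)) ht.2 (fun s hs =>
        hasDerivAt_J (hχ := ⟨hχ.1.of_le (by norm_cast; omega), hχ.2⟩)
          ⟨ht.1.trans_le hs.1, hs.2.trans_lt hδ₁⟩ hy)
        (fun s hs => (Real.hasDerivAt_rpow_const (Or.inl (ht.1.trans_le hs.1).ne')).const_mul _)
        fun s hs => (hB s ⟨ht.1.trans_le hs.1, hs.2⟩ y hy).trans (le_of_eq ?_)
      have : -b - 1 = -((L : ℝ) - a + 1 / 2) := by rw [hb]; push_cast; ring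
      rw [this]
      field_simp
    have h2 : 1 ≤ t ^ (-b) := Real.one_le_rpow_of_pos_of_le_one_of_nonpos ht.1 (ht.2.trans h1)
      (by linarith)
    have h3 : ‖S.J χ t y‖ ≤ ‖S.J χ δ₁ y‖ + ‖S.J χ δ₁ y - S.J χ t y‖ := norm_le_insert _ _
    have h4 := hB₁ δ₁ ⟨hδ₀, le_rfl⟩ y hy
    have h5 : 0 ≤ B / b * δ₁ ^ (-b) := by positivity
    have h6 : B₁ / δ₁ ^ L ≤ B₁ / δ₁ ^ L * t ^ (-b) := le_mul_of_one_le_right (by positivity) h2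
    linarith

/-- The pairing with a test function of class `C^(L+1)` is Hölder continuous up to `t = 0`, uniformly
in the parameter. -/
theorem exists_norm_J_sub_le {δ₁ : ℝ} (hδ₀ : 0 < δ₁) (hδ₁ : δ₁ < S.δ) (h1 : δ₁ ≤ 1)
    {χ : Rn D × ℝ × Y → ℂ} (hχ : S.IsTest (L + 1) χ) :
    ∃ B, ∀ t₀ t₁, 0 < t₀ → t₀ ≤ t₁ → t₁ ≤ δ₁ → ∀ y ∈ S.Y₁,
      ‖S.J χ t₁ y - S.J χ t₀ y‖ ≤ B * √t₁ := by
  obtain ⟨B, hB0, hB⟩ := exists_norm_J_le_rpow hδ₀ hδ₁ h1 le_rfl (hχ.transpose le_rfl)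
  refine ⟨2 * B, fun t₀ t₁ h0 h01 h11 y hy => ?_⟩
  have key : ‖S.J χ t₁ y - S.J χ t₀ y‖ ≤ 2 * B * t₁ ^ (1 / 2 : ℝ) - 2 * B * t₀ ^ (1 / 2 : ℝ) := by
    refine norm_sub_le_of_hasDerivAt (β := fun t => 2 * B * t ^ (1 / 2 : ℝ)) h01 (fun s hs =>
      hasDerivAt_J (hχ := ⟨hχ.1.of_le (by norm_cast; omega), hχ.2⟩)
        ⟨h0.trans_le hs.1, (hs.2.trans h11).trans_lt hδ₁⟩ hy)
      (fun s hs => (Real.hasDerivAt_rpow_const (Or.inl (h0.trans_le hs.1).ne')).const_mul _)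
      fun s hs => (hB s ⟨h0.trans_le hs.1, hs.2.trans h11⟩ y hy).trans (le_of_eq ?_)
    have : (1 / 2 : ℝ) - 1 = -((L : ℝ) - L + 1 / 2) := by ring
    rw [this]
    ring
  rw [Real.sqrt_eq_rpow]
  have : 0 ≤ 2 * B * t₀ ^ (1 / 2 : ℝ) := by positivity
  linarith

end SlowFamily

end BoundaryValues

section BoundaryValues

variable {E : Type*} [NormedAddCommGroup E] [NormedSpace ℂ E]

/-- The endomorphism `a ↦ ∑ (C₀ a) j • T j`. When it is close to the identity, the vectors `T j` span
the space over `ℂ`. -/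
noncomputable def frameMap {ι : Type*} [Fintype ι] (C₀ : E →L[ℂ] (ι → ℂ)) (T : ι → E) :
    E →L[ℂ] E :=
  ∑ j, ((ContinuousLinearMap.proj j).comp C₀).smulRight (T j)

theorem frameMap_apply {ι : Type*} [Fintype ι] (C₀ : E →L[ℂ] (ι → ℂ)) (T : ι → E) (a : E) :
    frameMap C₀ T a = ∑ j, C₀ a j • T j := by
  simp [frameMap]

theorem contDiffOn_frameMap {ι : Type*} [Fintype ι] (C₀ : E →L[ℂ] (ι → ℂ))
    {P : Type*} [NormedAddCommGroup P] [NormedSpace ℝ P] {n : WithTop ℕ∞} {s : Set P}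
    {T : ι → P → E} (hT : ∀ j, ContDiffOn ℝ n (T j) s) :
    ContDiffOn ℝ n (fun p => frameMap C₀ fun j => T j p) s := by
  refine ContDiffOn.sum fun j _ => ?_
  have h : ContDiff ℝ n
      (ContinuousLinearMap.smulRightL ℂ E E ((ContinuousLinearMap.proj j).comp C₀)) :=
    ContDiff.restrict_scalars ℝ (𝕜' := ℂ) (ContinuousLinearMap.contDiff _)
  exact h.comp_contDiffOn (hT j)

theorem frameMap_near_one {ι : Type*} [Fintype ι] [CompleteSpace E] {C₀ : E →L[ℂ] (ι → ℂ)}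
    {T : ι → E} (h : ‖frameMap C₀ T - 1‖ < 1) : IsUnit (frameMap C₀ T) := by
  have := isUnit_one_sub_of_norm_lt_one (x := 1 - frameMap C₀ T) (by rwa [norm_sub_rev])
  simpa using this

/-- Solving for complex coefficients with respect to a smooth frame. -/
theorem exists_coefficients {ι : Type*} [Fintype ι] [CompleteSpace E] (C₀ : E →L[ℂ] (ι → ℂ))
    {P : Type*} [NormedAddCommGroup P] [NormedSpace ℝ P] {n : WithTop ℕ∞} {s : Set P}
    {T : ι → P → E} (hT : ∀ j, ContDiffOn ℝ n (T j) s)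
    (h : ∀ p ∈ s, ‖frameMap C₀ (fun j => T j p) - 1‖ < 1) {a : P → E} (ha : ContDiffOn ℝ n a s) :
    ∃ c : ι → P → ℂ, (∀ j, ContDiffOn ℝ n (c j) s) ∧ ∀ p ∈ s, a p = ∑ j, c j p • T j p := by
  refine ⟨fun j p => C₀ (Ring.inverse (frameMap C₀ fun j => T j p) (a p)) j, fun j => ?_,
    fun p hp => ?_⟩
  · have h1 : ContDiffOn ℝ n (fun p => Ring.inverse (frameMap C₀ fun j => T j p)) s := by
      intro p hp
      obtain ⟨u, hu⟩ := frameMap_near_one (h p hp)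
      have h2 : ContDiffAt ℝ n Ring.inverse (frameMap C₀ fun j => T j p) := by
        rw [← hu]
        exact (contDiffAt_ringInverse ℂ u).restrict_scalars ℝ
      exact h2.comp_contDiffWithinAt p (contDiffOn_frameMap C₀ hT p hp)
    have h3 : ContDiffOn ℝ n
        (fun p => Ring.inverse (frameMap C₀ fun j => T j p) (a p)) s := by
      have hb : ContDiff ℝ n (fun q : (E →L[ℂ] E) × E => q.1 q.2) :=
        ContDiff.restrict_scalars ℝ (𝕜' := ℂ) isBoundedBilinearMap_apply.contDiff
      exact hb.comp_contDiffOn (h1.prodMk ha)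
    have h4 : ContDiff ℝ n (fun a : E => C₀ a j) :=
      ContDiff.restrict_scalars ℝ (𝕜' := ℂ)
        ((ContinuousLinearMap.proj (R := ℂ) (φ := fun _ : ι => ℂ) j).comp C₀).contDiff
    exact h4.comp_contDiffOn h3
  · have h5 := Ring.mul_inverse_cancel _ (frameMap_near_one (h p hp))
    have h6 := congrArg (fun B : E →L[ℂ] E => B (a p)) h5
    simp only [mul_apply_eq_comp, one_apply_eq_self] at h6
    rw [frameMap_apply] at h6
    exact h6.symm

/-- Integrals over a compact set depend continuously on parameters. -/
theorem continuousOn_integral_of_compact {X P : Type*} [TopologicalSpace X] [T2Space X]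
    [MeasurableSpace X] [OpensMeasurableSpace X] {μ : Measure X} [IsFiniteMeasureOnCompacts μ]
    [TopologicalSpace P] [FirstCountableTopology P] {K : Set X} (hK : IsCompact K) {s : Set P}
    (hs : IsCompact s) {g : P → X → ℂ}
    (hg : ContinuousOn (fun q : P × X => g q.1 q.2) (s ×ˢ K)) (h0 : ∀ p, ∀ x ∉ K, g p x = 0) :
    ContinuousOn (fun p => ∫ x, g p x ∂μ) s := by
  obtain ⟨B, hB⟩ := (hs.prod hK).exists_bound_of_continuousOn hg
  have h1 : ∀ p, ∫ x, g p x ∂μ = ∫ x in K, g p x ∂μ := fun p =>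
    (setIntegral_eq_integral_of_forall_compl_eq_zero fun x hx => h0 p x hx).symm
  simp only [h1]
  refine continuousOn_of_dominated (bound := fun _ => B) (fun p hp => ?_) (fun p hp => ?_) ?_ ?_
  · exact (hg.comp (f := fun x => (p, x)) (by fun_prop)
      fun x hx => ⟨hp, hx⟩).aestronglyMeasurable_of_isCompact hK hK.measurableSet
  · filter_upwards [ae_restrict_mem hK.measurableSet] with x hx using hB (p, x) ⟨hp, hx⟩
  · exact integrableOn_const hK.measure_lt_top.ne
  · filter_upwards [ae_restrict_mem hK.measurableSet] with x hx
    exact hg.comp (f := fun p => (p, x)) (by fun_prop) fun p hp => ⟨hp, hx⟩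

variable {D : ℕ}

theorem uniqueDiffOn_prod_Ico {U : Set (Rn D)} (hU : IsOpen U) (δ : ℝ) :
    UniqueDiffOn ℝ (U ×ˢ Ico (0 : ℝ) δ) := hU.uniqueDiffOn.prod (uniqueDiffOn_Ico _ _)

/-- A smooth family of maps `x ↦ ψ (x, t)` along which `F` grows slowly has the same boundary values
as the family `x ↦ ψ (x, 0) + ε • v` of translates, provided that `F` grows slowly along the
combined family `ψ (x, t) + ε • v`. The convergence is uniform for compact sets of translates of
a test function. -/
theorem norm_integral_sub_boundaryValue_le_of_coefficients {L : ℕ} {U K : Set (Rn D)}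
    (hU : IsOpen U) (hK : IsCompact K)
    (hKU : K ⊆ U) {δ : ℝ} (hδ : 0 < δ) {ψ : Rn D × ℝ → E}
    (hψ : ContDiffOn ℝ 1 ψ (U ×ˢ Ico 0 δ)) {v : E} {R : Set E} (hR : IsOpen R)
    {F : E → ℂ} (hF : DifferentiableOn ℂ F R)
    (hmem : ∀ x ∈ K, ∀ t ∈ Ico 0 δ, ∀ ε ∈ Ico 0 δ, 0 < t + ε → ψ (x, t) + ε • v ∈ R) {C : ℝ}
    (hgrowth : ∀ x ∈ K, ∀ t ∈ Ioo 0 δ, ∀ ε ∈ Ico 0 δ, ‖F (ψ (x, t) + ε • v)‖ ≤ C / t ^ L)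
    {ι : Type} [Fintype ι] {e : ι → Rn D} {c : ι → Rn D × ℝ → ℂ}
    (hc : ∀ j, ContDiffOn ℝ (L + 1 : ℕ) (c j) (U ×ˢ Ico 0 δ))
    (hvel : ∀ x ∈ K, ∀ t ∈ Ioo 0 δ, fderivWithin ℝ ψ (U ×ˢ Ico 0 δ) (x, t) (0, 1) =
      ∑ j, c j (x, t) • fderivWithin ℝ ψ (U ×ˢ Ico 0 δ) (x, t) (e j, 0))
    {φ : Rn D → ℂ} (hφ : ContDiff ℝ (L + 1 : ℕ) φ) {Y₀ Y₁ : Set (Rn D)} (hY₀ : IsOpen Y₀)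
    (hY₁ : IsCompact Y₁) (hY : Y₁ ⊆ Y₀) (hsupp : ∀ y ∈ Y₀, ∀ x ∉ K, φ (y - x) = 0)
    {l : Rn D → ℂ}
    (hbv : ∀ y ∈ Y₁, Tendsto (fun ε : ℝ => ∫ x, F (ψ (x, 0) + ε • v) * φ (y - x)) (𝓝[>] 0)
      (𝓝 (l y))) :
    ∃ B, ∃ δ₁ ∈ Ioo 0 δ, ∀ t ∈ Ioc 0 δ₁, ∀ y ∈ Y₁,
      ‖(∫ x, F (ψ (x, t)) * φ (y - x)) - l y‖ ≤ B * √t := by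
  set Q := U ×ˢ Ico 0 δ with hQ
  set pr : Rn D × ℝ × (ℝ × Rn D) → Rn D × ℝ := fun p => (p.1, p.2.1) with hpr
  have hprs : ∀ n, ContDiff ℝ n pr := fun n => by fun_prop
  have hmaps : MapsTo pr (U ×ˢ (Ico 0 δ ×ˢ (univ ×ˢ Y₀))) Q := fun p hp => ⟨hp.1, hp.2.1⟩
  have hΨ1 : ContDiffOn ℝ 1 (fun p : Rn D × ℝ × (ℝ × Rn D) => ψ (pr p) + p.2.2.1 • v)
      (U ×ˢ (Ico 0 δ ×ˢ (univ ×ˢ Y₀))) :=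
    (hψ.comp (hprs 1).contDiffOn hmaps).add (by fun_prop)
  have huniq : UniqueDiffOn ℝ (U ×ˢ (Ico 0 δ ×ˢ ((univ : Set ℝ) ×ˢ Y₀))) :=
    hU.uniqueDiffOn.prod ((uniqueDiffOn_Ico _ _).prod (uniqueDiffOn_univ.prod hY₀.uniqueDiffOn))
  have hder : ∀ x ∈ K, ∀ t ∈ Ioo 0 δ, ∀ y ∈ (Icc 0 (δ / 2) ×ˢ Y₁ : Set (ℝ × Rn D)), ∀ w : Rn D × ℝ,
      fderivWithin ℝ (fun p : Rn D × ℝ × (ℝ × Rn D) => ψ (pr p) + p.2.2.1 • v)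
        (U ×ˢ (Ico 0 δ ×ˢ (univ ×ˢ Y₀))) (x, t, y) (w.1, w.2, 0) = fderivWithin ℝ ψ Q (x, t) w := by
    intro x hx t ht y hy w
    have hmem' : (x, t, y) ∈ U ×ˢ (Ico 0 δ ×ˢ ((univ : Set ℝ) ×ˢ Y₀)) :=
      ⟨hKU hx, Ioo_subset_Ico_self ht, mem_univ _, hY hy.2⟩
    have h1 : HasFDerivWithinAt ψ (fderivWithin ℝ ψ Q (x, t)) Q (pr (x, t, y)) :=
      (hψ.differentiableOn one_ne_zero (x, t) (hmaps hmem')).hasFDerivWithinAt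
    have h2 : HasFDerivWithinAt pr ((ContinuousLinearMap.fst ℝ _ _).prod
        ((ContinuousLinearMap.fst ℝ _ _).comp (ContinuousLinearMap.snd ℝ _ _)))
        (U ×ˢ (Ico 0 δ ×ˢ ((univ : Set ℝ) ×ˢ Y₀))) (x, t, y) :=
      (hasFDerivAt_fst.prodMk hasFDerivAt_snd.fst).hasFDerivWithinAt
    have h3 : HasFDerivWithinAt (fun p : Rn D × ℝ × (ℝ × Rn D) => p.2.2.1 • v)
        (((ContinuousLinearMap.fst ℝ ℝ (Rn D)).comp ((ContinuousLinearMap.snd ℝ ℝ _).comp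
          (ContinuousLinearMap.snd ℝ (Rn D) _))).smulRight v)
        (U ×ˢ (Ico 0 δ ×ˢ ((univ : Set ℝ) ×ˢ Y₀))) (x, t, y) :=
      (ContinuousLinearMap.hasFDerivAt (((ContinuousLinearMap.fst ℝ ℝ (Rn D)).comp
        ((ContinuousLinearMap.snd ℝ ℝ _).comp
          (ContinuousLinearMap.snd ℝ (Rn D) _))).smulRight v)).hasFDerivWithinAt
    have h4 := ((h1.comp (x, t, y) h2 hmaps).add h3).fderivWithin (huniq _ hmem')
    have h5 := congrArg (fun A => A (w.1, w.2, 0)) h4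
    refine h5.trans ?_
    simp
  let S : SlowFamily D (ℝ × Rn D) E L :=
    { U := U, isOpen_U := hU, K := K, isCompact_K := hK, K_subset := hKU, δ := δ
      Y₀ := univ ×ˢ Y₀, isOpen_Y₀ := isOpen_univ.prod hY₀
      Y₁ := Icc 0 (δ / 2) ×ˢ Y₁, isCompact_Y₁ := isCompact_Icc.prod hY₁
      Y₁_subset := prod_mono (subset_univ _) hY
      R := R, isOpen_R := hR, F := F, holo := hF
      Ψ := fun p => ψ (pr p) + p.2.2.1 • v
      smooth_Ψ := hΨ1
      ι := ι, fintype_ι := inferInstance, e := e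
      c := fun j p => c j (pr p)
      smooth_c := fun j => (hc j).comp (hprs _).contDiffOn hmaps
      velocity := fun x hx t ht y hy => by
        have h1 := hder x hx t ht y hy (0, 1)
        have h2 := fun j => hder x hx t ht y hy (e j, 0)
        simp only at h1 h2
        rw [h1, hvel x hx t ht]
        exact Finset.sum_congr rfl fun j _ => by rw [h2 j]
      mem_R := fun x hx t ht y hy => hmem x hx t (Ioo_subset_Ico_self ht) y.1
        ⟨hy.1.1, by linarith [hy.1.2]⟩ (by linarith [ht.1, hy.1.1])
      C := C
      growth := fun x hx t ht y hy => hgrowth x hx t ht y.1 ⟨hy.1.1, by linarith [hy.1.2]⟩ }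
  set χ : Rn D × ℝ × (ℝ × Rn D) → ℂ := fun p => φ (p.2.2.2 - p.1) with hχ
  have hχt : S.IsTest (L + 1) χ := by
    refine ⟨(hφ.comp (by fun_prop)).contDiffOn, fun x hx t _ y hy => hsupp _ hy.2 x hx⟩
  have hδ₁ : min 1 (δ / 2) < δ := (min_le_right _ _).trans_lt (by linarith)
  obtain ⟨B, hB⟩ := S.exists_norm_J_sub_le (lt_min one_pos (half_pos hδ)) hδ₁ (min_le_left _ _) hχt
  refine ⟨B, min 1 (δ / 2), ⟨lt_min one_pos (half_pos hδ), hδ₁⟩, fun t ht y hy => ?_⟩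
  have htδ : t < δ := ht.2.trans_lt hδ₁
  have hJ : ∀ s ε, S.J χ s (ε, y) = ∫ x, F (ψ (x, s) + ε • v) * φ (y - x) := fun s ε => rfl
  have hφ0 : ∀ x ∉ K, φ (y - x) = 0 := hsupp y (hY hy)
  have hcontφ : ∀ {P : Type} [TopologicalSpace P], Continuous fun q : P × Rn D => φ (y - q.2) :=
    hφ.continuous.comp (by fun_prop)
  have hψc := hψ.continuousOn
  -- For fixed `ε > 0`, the lower limit of integration may be moved to `0`.
  have hε_bound : ∀ ε ∈ Ioc 0 (δ / 2), ‖(∫ x, F (ψ (x, t) + ε • v) * φ (y - x)) -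
      ∫ x, F (ψ (x, 0) + ε • v) * φ (y - x)‖ ≤ B * √t := by
    intro ε hε
    have hcont : ContinuousOn (fun s => ∫ x, F (ψ (x, s) + ε • v) * φ (y - x)) (Icc 0 t) := by
      refine continuousOn_integral_of_compact hK isCompact_Icc ?_ fun s x hx => by simp [hφ0 x hx]
      refine ContinuousOn.mul (hF.continuousOn.comp (ContinuousOn.add (hψc.comp
        (f := fun q : ℝ × Rn D => (q.2, q.1)) (by fun_prop) fun q hq => ⟨hKU hq.2, hq.1.1,
          hq.1.2.trans_lt htδ⟩) continuousOn_const) fun q hq => ?_) hcontφ.continuousOn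
      exact hmem q.2 hq.2 q.1 ⟨hq.1.1, hq.1.2.trans_lt htδ⟩ ε ⟨hε.1.le, by linarith [hε.2]⟩
        (by linarith [hq.1.1, hε.1])
    have hlim : Tendsto (fun s => ∫ x, F (ψ (x, s) + ε • v) * φ (y - x)) (𝓝[>] 0)
        (𝓝 (∫ x, F (ψ (x, 0) + ε • v) * φ (y - x))) := by
      have := (hcont 0 ⟨le_rfl, ht.1.le⟩).mono (Ioc_subset_Icc_self (a := (0 : ℝ)) (b := t))
      rwa [ContinuousWithinAt, nhdsWithin_Ioc_eq_nhdsGT ht.1] at this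
    refine le_of_tendsto ((tendsto_const_nhds.sub hlim).norm) ?_
    filter_upwards [Ioc_mem_nhdsGT ht.1] with s hs
    exact hB s t hs.1 hs.2 ht.2 (ε, y) ⟨⟨hε.1.le, hε.2⟩, hy⟩
  have hcont : ContinuousOn (fun ε : ℝ => ∫ x, F (ψ (x, t) + ε • v) * φ (y - x))
      (Icc 0 (δ / 2)) := by
    refine continuousOn_integral_of_compact hK isCompact_Icc ?_ fun s x hx => by simp [hφ0 x hx]
    refine ContinuousOn.mul (hF.continuousOn.comp (ContinuousOn.add (hψc.comp
      (f := fun q : ℝ × Rn D => (q.2, t)) (by fun_prop) fun q hq => ⟨hKU hq.2, ht.1.le, htδ⟩)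
        (by fun_prop)) fun q hq => ?_) hcontφ.continuousOn
    exact hmem q.2 hq.2 t ⟨ht.1.le, htδ⟩ q.1 ⟨hq.1.1, by linarith [hq.1.2]⟩
      (by linarith [hq.1.1, ht.1])
  have hlim : Tendsto (fun ε : ℝ => ∫ x, F (ψ (x, t) + ε • v) * φ (y - x)) (𝓝[>] 0)
      (𝓝 (∫ x, F (ψ (x, t)) * φ (y - x))) := by
    have := (hcont 0 ⟨le_rfl, (half_pos hδ).le⟩).mono
      (Ioc_subset_Icc_self (a := (0 : ℝ)) (b := δ / 2))
    rw [ContinuousWithinAt, nhdsWithin_Ioc_eq_nhdsGT (half_pos hδ)] at this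
    simpa using this
  refine le_of_tendsto ((hlim.sub (hbv y hy)).norm) ?_
  filter_upwards [Ioc_mem_nhdsGT (half_pos hδ)] with ε hε using hε_bound ε hε

/-- If the derivatives of `x ↦ ψ (x, 0)` span `E` over `ℂ`, then so do those of `x ↦ ψ (x, t)` for
small `t`, and the velocity of a family is a combination of them. -/
theorem norm_integral_sub_boundaryValue_le [CompleteSpace E] {L : ℕ} {U K : Set (Rn D)}
    (hU : IsOpen U) (hK : IsCompact K) (hKU : K ⊆ U) {δ : ℝ} (hδ : 0 < δ) {ψ : Rn D × ℝ → E}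
    (hψ : ContDiffOn ℝ (L + 2 : ℕ) ψ (U ×ˢ Ico 0 δ)) {γ : Rn D → E}
    (hγ : ∀ x ∈ U, ψ (x, 0) = γ x)
    {ι : Type} [Fintype ι] {e : ι → Rn D} {C₀ : E →L[ℂ] (ι → ℂ)}
    (hC₀ : ∀ x ∈ U, ‖frameMap C₀ (fun j => fderiv ℝ γ x (e j)) - 1‖ < 1)
    {v : E} {R : Set E} (hR : IsOpen R) {F : E → ℂ} (hF : DifferentiableOn ℂ F R)
    (hmem : ∀ x ∈ K, ∀ t ∈ Ico 0 δ, ∀ ε ∈ Ico 0 δ, 0 < t + ε → ψ (x, t) + ε • v ∈ R) {C : ℝ}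
    (hgrowth : ∀ x ∈ K, ∀ t ∈ Ioo 0 δ, ∀ ε ∈ Ico 0 δ, ‖F (ψ (x, t) + ε • v)‖ ≤ C / t ^ L)
    {φ : Rn D → ℂ} (hφ : ContDiff ℝ (L + 1 : ℕ) φ) {Y₀ Y₁ : Set (Rn D)} (hY₀ : IsOpen Y₀)
    (hY₁ : IsCompact Y₁) (hY : Y₁ ⊆ Y₀) (hsupp : ∀ y ∈ Y₀, ∀ x ∉ K, φ (y - x) = 0)
    {l : Rn D → ℂ}
    (hbv : ∀ y ∈ Y₁, Tendsto (fun ε : ℝ => ∫ x, F (γ x + ε • v) * φ (y - x)) (𝓝[>] 0)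
      (𝓝 (l y))) :
    ∃ B, ∃ δ₁ ∈ Ioo 0 δ, ∀ t ∈ Ioc 0 δ₁, ∀ y ∈ Y₁,
      ‖(∫ x, F (ψ (x, t)) * φ (y - x)) - l y‖ ≤ B * √t := by
  set Q := U ×ˢ Ico 0 δ with hQ
  have hu := uniqueDiffOn_prod_Ico hU δ
  have hd : ∀ w, ContDiffOn ℝ (L + 1 : ℕ) (fun p => fderivWithin ℝ ψ Q p w) Q := fun w =>
    (hψ.fderivWithin hu (by norm_cast)).clm_apply contDiffOn_const
  have hψ1 : ContDiffOn ℝ 1 ψ Q := hψ.of_le (by norm_cast; omega)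
  -- The frame condition persists on a neighbourhood of `K × {0}`.
  have hcont : ContinuousOn (fun p => frameMap C₀ (fun j => fderivWithin ℝ ψ Q p (e j, 0)) - 1) Q :=
    (contDiffOn_frameMap C₀ fun j => hd (e j, 0)).continuousOn.sub continuousOn_const
  obtain ⟨V, hV, hVeq⟩ := continuousOn_iff'.1 hcont.norm (Iio 1) isOpen_Iio
  have hKV : K ×ˢ {(0 : ℝ)} ⊆ V := by
    rintro ⟨x, t⟩ ⟨hx, rfl : t = 0⟩
    have hxQ : (x, (0 : ℝ)) ∈ Q := ⟨hKU hx, le_rfl, hδ⟩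
    have : (x, (0 : ℝ)) ∈ V ∩ Q := by
      rw [← hVeq]
      refine ⟨?_, hxQ⟩
      have heq : ∀ w, fderivWithin ℝ ψ Q (x, 0) (w, 0) = fderiv ℝ γ x w := by
        intro w
        have h1 : HasFDerivWithinAt ψ (fderivWithin ℝ ψ Q (x, 0)) Q (x, 0) :=
          (hψ1.differentiableOn one_ne_zero _ hxQ).hasFDerivWithinAt
        have h2 : HasFDerivWithinAt (fun x : Rn D => (x, (0 : ℝ)))
          ((ContinuousLinearMap.id ℝ _).prod 0) U x :=
          ((hasFDerivAt_id x).prodMk (hasFDerivAt_const _ _)).hasFDerivWithinAt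
        have h3 := h1.comp (f := fun x : Rn D => (x, (0 : ℝ))) x h2 fun x hx => ⟨hx, le_rfl, hδ⟩
        have h4 := (h3.hasFDerivAt (hU.mem_nhds (hKU hx))).congr_of_eventuallyEq (f₁ := γ) (by
          filter_upwards [hU.mem_nhds (hKU hx)] with z hz using (hγ z hz).symm)
        rw [h4.fderiv]
        simp
      simp only [mem_preimage, mem_Iio, heq]
      exact hC₀ x (hKU hx)
    exact this.1
  obtain ⟨u, s, hu_open, hs_open, hKu, hs0, hus⟩ := generalized_tube_lemma hK isCompact_singleton
    hV hKV
  obtain ⟨δ', hδ', hδs⟩ := Metric.isOpen_iff.1 hs_open 0 (hs0 rfl)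
  set δ₀ := min δ δ' with hδ₀
  have hδ₀p : 0 < δ₀ := lt_min hδ hδ'
  have hQ' : (U ∩ u) ×ˢ Ico 0 δ₀ ⊆ Q := prod_mono inter_subset_left
    (Ico_subset_Ico_right (min_le_left _ _))
  have hu' := uniqueDiffOn_prod_Ico (hU.inter hu_open) δ₀
  have hfd : ∀ p ∈ (U ∩ u) ×ˢ Ico 0 δ₀,
      fderivWithin ℝ ψ ((U ∩ u) ×ˢ Ico 0 δ₀) p = fderivWithin ℝ ψ Q p := fun p hp =>
    fderivWithin_subset hQ' (hu' p hp) (hψ1.differentiableOn one_ne_zero p (hQ' hp))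
  obtain ⟨c, hc, hceq⟩ := exists_coefficients C₀ (s := (U ∩ u) ×ˢ Ico 0 δ₀)
    (T := fun j p => fderivWithin ℝ ψ Q p (e j, 0)) (fun j => (hd _).mono hQ') (fun p hp => by
      have : p ∈ V ∩ Q := ⟨hus ⟨hp.1.2, hδs (by
        rw [mem_ball_zero_iff, Real.norm_of_nonneg hp.2.1]
        exact hp.2.2.trans_le (min_le_right _ _))⟩, hQ' hp⟩
      rw [← hVeq] at this
      exact this.1) ((hd (0, 1)).mono hQ')
  have hI : Ico 0 δ₀ ⊆ Ico 0 δ := Ico_subset_Ico_right (min_le_left _ _)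
  have hI' : Ioo 0 δ₀ ⊆ Ioo 0 δ := Ioo_subset_Ioo_right (min_le_left _ _)
  have hKU' : K ⊆ U ∩ u := subset_inter hKU hKu
  obtain ⟨B, δ₁, hδ₁, hB⟩ := norm_integral_sub_boundaryValue_le_of_coefficients (hU.inter hu_open) hK
    hKU' hδ₀p (hψ1.mono hQ') hR hF (fun x hx t ht ε hε => hmem x hx t (hI ht) ε (hI hε))
    (fun x hx t ht ε hε => hgrowth x hx t (hI' ht) ε (hI hε)) hc (fun x hx t ht => by
      have hp : (x, t) ∈ (U ∩ u) ×ˢ Ico 0 δ₀ := ⟨hKU' hx, Ioo_subset_Ico_self ht⟩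
      rw [hfd _ hp]
      exact hceq _ hp) hφ hY₀ hY₁ hY hsupp (l := l) (fun y hy => by
        refine (hbv y hy).congr fun ε => integral_congr_ae (Eventually.of_forall fun x => ?_)
        by_cases hx : x ∈ K
        · simp only [hγ x (hKU hx)]
        · simp [hsupp y (hY hy) x hx])
  exact ⟨B, δ₁, ⟨hδ₁.1, hδ₁.2.trans_le (min_le_left _ _)⟩, hB⟩

end BoundaryValues

/-! ### A maximum principle -/

section MaximumPrinciple

theorem IsLocalMax.deriv_deriv_nonpos {f f' : ℝ → ℝ} {f'' x : ℝ} (h : IsLocalMax f x)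
    (hf : ∀ᶠ y in 𝓝 x, HasDerivAt f (f' y) y) (hf' : HasDerivAt f' f'' x) : f'' ≤ 0 := by
  by_contra! hpos
  have h1 : deriv f =ᶠ[𝓝 x] f' := hf.mono fun y hy => hy.deriv
  have h2 : deriv (deriv f) x = f'' := h1.deriv_eq.trans hf'.deriv
  have hmin : IsLocalMin f x := isLocalMin_of_deriv_deriv_pos (h2 ▸ hpos) h.deriv_eq_zero
    hf.self_of_nhds.continuousAt
  have hconst : f =ᶠ[𝓝 x] fun _ => f x := by
    filter_upwards [h, hmin] with y h1 h2 using le_antisymm h1 h2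
  have h3 : deriv f =ᶠ[𝓝 x] fun _ => 0 := hconst.deriv.trans (by simp)
  have h4 := h3.deriv_eq
  rw [h2] at h4
  simp at h4
  exact hpos.ne' h4

theorem hasDerivAt_normSq_deriv {v v' : ℝ → ℂ} {v'' : ℂ} {s : ℝ} (h : HasDerivAt v (v' s) s)
    (h' : HasDerivAt v' v'' s) :
    HasDerivAt (fun s => 2 * inner ℝ (v s) (v' s)) (2 * (‖v' s‖ ^ 2 + inner ℝ (v s) v'')) s := by
  have := (h.inner ℝ h').const_mul 2
  rw [real_inner_self_eq_norm_sq] at this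
  exact this.congr_deriv (by ring)

/-- Maximum principle on a rectangle for functions whose Laplacian is controlled: if
`|v| |Δv| ≤ A`, then `|v|² + (A + 1) s²` is subharmonic. -/
theorem norm_sq_le_of_laplacian_le {v vs vss vt vtt : ℝ → ℝ → ℂ} {a b τ A M : ℝ}
    (hA : 0 ≤ A)
    (hcont : ContinuousOn (fun p : ℝ × ℝ => v p.1 p.2) (Icc (-a) a ×ˢ Icc τ b))
    (hs : ∀ s ∈ Ioo (-a) a, ∀ t ∈ Ioo τ b, HasDerivAt (fun s => v s t) (vs s t) s)
    (hss : ∀ s ∈ Ioo (-a) a, ∀ t ∈ Ioo τ b, HasDerivAt (fun s => vs s t) (vss s t) s)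
    (ht : ∀ s ∈ Ioo (-a) a, ∀ t ∈ Ioo τ b, HasDerivAt (fun t => v s t) (vt s t) t)
    (htt : ∀ s ∈ Ioo (-a) a, ∀ t ∈ Ioo τ b, HasDerivAt (fun t => vt s t) (vtt s t) t)
    (hlap : ∀ s ∈ Ioo (-a) a, ∀ t ∈ Ioo τ b, ‖v s t‖ * ‖vss s t + vtt s t‖ ≤ A)
    (hside : ∀ s ∈ Icc (-a) a, ∀ t ∈ Icc τ b, s = -a ∨ s = a ∨ t = τ ∨ t = b → ‖v s t‖ ≤ M)
    {s t : ℝ} (hs0 : s ∈ Icc (-a) a) (ht0 : t ∈ Icc τ b) :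
    ‖v s t‖ ^ 2 ≤ M ^ 2 + (A + 1) * a ^ 2 := by
  set q : ℝ × ℝ → ℝ := fun p => ‖v p.1 p.2‖ ^ 2 + (A + 1) * p.1 ^ 2 with hq
  have hqc : ContinuousOn q (Icc (-a) a ×ˢ Icc τ b) := (hcont.norm.pow 2).add (by fun_prop)
  obtain ⟨⟨s₁, t₁⟩, hp, hmax⟩ := (isCompact_Icc.prod isCompact_Icc).exists_isMaxOn
    ⟨(s, t), hs0, ht0⟩ hqc
  have hle : q (s, t) ≤ q (s₁, t₁) := hmax ⟨hs0, ht0⟩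
  have hsq : 0 ≤ (A + 1) * s ^ 2 := by positivity
  have hgoal : q (s₁, t₁) ≤ M ^ 2 + (A + 1) * a ^ 2 → ‖v s t‖ ^ 2 ≤ M ^ 2 + (A + 1) * a ^ 2 := by
    intro h
    have : q (s, t) = ‖v s t‖ ^ 2 + (A + 1) * s ^ 2 := rfl
    linarith
  apply hgoal
  by_cases hbd : s₁ = -a ∨ s₁ = a ∨ t₁ = τ ∨ t₁ = b
  · have h1 := hside s₁ hp.1 t₁ hp.2 hbd
    have h2 : s₁ ^ 2 ≤ a ^ 2 := sq_le_sq' hp.1.1 hp.1.2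
    have h3 : ‖v s₁ t₁‖ ^ 2 ≤ M ^ 2 := pow_le_pow_left₀ (norm_nonneg _) h1 2
    have h4 : (A + 1) * s₁ ^ 2 ≤ (A + 1) * a ^ 2 := mul_le_mul_of_nonneg_left h2 (by linarith)
    simp only [hq]
    linarith
  · exfalso
    push Not at hbd
    have hs1 : s₁ ∈ Ioo (-a) a := ⟨lt_of_le_of_ne hp.1.1 (Ne.symm hbd.1),
      lt_of_le_of_ne hp.1.2 hbd.2.1⟩
    have ht1 : t₁ ∈ Ioo τ b := ⟨lt_of_le_of_ne hp.2.1 (Ne.symm hbd.2.2.1),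
      lt_of_le_of_ne hp.2.2 hbd.2.2.2⟩
    have hloc : IsLocalMax q (s₁, t₁) := hmax.isLocalMax (prod_mem_nhds
      (Icc_mem_nhds hs1.1 hs1.2) (Icc_mem_nhds ht1.1 ht1.2))
    have hms : IsLocalMax (fun s => q (s, t₁)) s₁ :=
      hloc.comp_continuous (g := fun s => (s, t₁)) (by fun_prop)
    have hmt : IsLocalMax (fun t => q (s₁, t)) t₁ :=
      hloc.comp_continuous (g := fun t => (s₁, t)) (by fun_prop)
    have h1 := hms.deriv_deriv_nonpos
      (f' := fun s => 2 * inner ℝ (v s t₁) (vs s t₁) + (A + 1) * (2 * s)) (by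
        filter_upwards [Ioo_mem_nhds hs1.1 hs1.2] with s hs'
        have := ((hs s hs' t₁ ht1).norm_sq).add ((hasDerivAt_pow 2 s).const_mul (A + 1))
        refine this.congr_deriv ?_
        simp)
      ((hasDerivAt_normSq_deriv (hs s₁ hs1 t₁ ht1) (hss s₁ hs1 t₁ ht1)).add
        (((hasDerivAt_id s₁).const_mul 2).const_mul (A + 1)))
    have h2 := hmt.deriv_deriv_nonpos
      (f' := fun t => 2 * inner ℝ (v s₁ t) (vt s₁ t)) (by
        filter_upwards [Ioo_mem_nhds ht1.1 ht1.2] with t ht'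
        exact ((ht s₁ hs1 t ht').norm_sq).add_const ((A + 1) * s₁ ^ 2))
      (hasDerivAt_normSq_deriv (ht s₁ hs1 t₁ ht1) (htt s₁ hs1 t₁ ht1))
    have h3 : -A ≤ inner ℝ (v s₁ t₁) (vss s₁ t₁) + inner ℝ (v s₁ t₁) (vtt s₁ t₁) := by
      rw [← inner_add_right]
      have := abs_real_inner_le_norm (v s₁ t₁) (vss s₁ t₁ + vtt s₁ t₁)
      have h4 := hlap s₁ hs1 t₁ ht1
      linarith [neg_abs_le (inner ℝ (v s₁ t₁) (vss s₁ t₁ + vtt s₁ t₁))]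
    have h5 := sq_nonneg ‖vs s₁ t₁‖
    have h6 := sq_nonneg ‖vt s₁ t₁‖
    linarith

end MaximumPrinciple

/-! ### Estimates on almost holomorphic discs -/

section Discs

/-- Differentiation of an integral over a compact set. -/
theorem hasDerivAt_integral_of_compact {X : Type*} [TopologicalSpace X] [T2Space X]
    [MeasurableSpace X] [OpensMeasurableSpace X] {μ : Measure X} [IsFiniteMeasureOnCompacts μ]
    {K : Set X} (hK : IsCompact K) {I : Set ℝ} (hI : IsOpen I) {f f' : ℝ → X → ℂ}
    (hf : ContinuousOn (fun q : ℝ × X => f q.1 q.2) (I ×ˢ K))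
    (hf' : ContinuousOn (fun q : ℝ × X => f' q.1 q.2) (I ×ˢ K))
    (h0 : ∀ s, ∀ x ∉ K, f s x = 0) (h0' : ∀ s, ∀ x ∉ K, f' s x = 0)
    (hd : ∀ s ∈ I, ∀ x ∈ K, HasDerivAt (fun s => f s x) (f' s x) s) {s : ℝ} (hs : s ∈ I) :
    HasDerivAt (fun s => ∫ x, f s x ∂μ) (∫ x, f' s x ∂μ) s := by
  obtain ⟨η, hη, hηsub⟩ := Metric.nhds_basis_closedBall.mem_iff.1 (hI.mem_nhds hs)
  obtain ⟨M, hM⟩ := ((isCompact_closedBall s η).prod hK).exists_bound_of_continuousOn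
    (hf'.mono (prod_mono hηsub subset_rfl))
  have hint : ∀ {g : ℝ → X → ℂ}, ContinuousOn (fun q : ℝ × X => g q.1 q.2) (I ×ˢ K) →
      (∀ s, ∀ x ∉ K, g s x = 0) → ∀ s ∈ I, Integrable (g s) μ := by
    intro g hg hg0 s hs
    exact ((hg.comp (f := fun x => (s, x)) (by fun_prop)
      fun x hx => ⟨hs, hx⟩).integrableOn_compact hK).integrable_of_forall_notMem_eq_zero (hg0 s)
  refine (hasDerivAt_integral_of_dominated_loc_of_deriv_le (μ := μ) (F := f) (F' := f') (x₀ := s)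
    (bound := K.indicator fun _ => M) (Metric.ball_mem_nhds s hη) ?_ (hint hf h0 s hs)
    (hint hf' h0' s hs).aestronglyMeasurable ?_ ?_ ?_).2
  · filter_upwards [hI.mem_nhds hs] with r hr using (hint hf h0 r hr).aestronglyMeasurable
  · refine Eventually.of_forall fun x r hr => ?_
    by_cases hx : x ∈ K
    · simpa [hx] using hM (r, x) ⟨Metric.ball_subset_closedBall hr, hx⟩
    · simp [hx, h0']
  · exact (integrable_indicator_iff hK.measurableSet).2 (integrableOn_const hK.measure_lt_top.ne)
  · refine Eventually.of_forall fun x r hr => ?_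
    by_cases hx : x ∈ K
    · exact hd r (hηsub (Metric.ball_subset_closedBall hr)) x hx
    · rw [h0' r x hx]
      exact (hasDerivAt_const r (0 : ℂ)).congr_of_eventuallyEq
        (Eventually.of_forall fun r => h0 r x hx)

theorem hasDerivAt_comp_complexLine (q : Polynomial ℂ) (s t : ℝ) :
    HasDerivAt (fun s : ℝ => q.eval ((s : ℂ) + t * Complex.I))
      (q.derivative.eval ((s : ℂ) + t * Complex.I)) s ∧
    HasDerivAt (fun t : ℝ => q.eval ((s : ℂ) + t * Complex.I))
      (Complex.I * q.derivative.eval ((s : ℂ) + t * Complex.I)) t := by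
  constructor
  · have h1 : HasDerivAt (fun s : ℝ => (s : ℂ) + t * Complex.I) 1 s :=
      ((hasDerivAt_id (s : ℂ)).comp_ofReal).add_const _
    have := (q.hasDerivAt ((s : ℂ) + t * Complex.I)).comp (𝕜' := ℂ) s h1
    simpa [Function.comp_def] using this
  · have h1 : HasDerivAt (fun t : ℝ => (s : ℂ) + t * Complex.I) Complex.I t := by
      simpa using (((hasDerivAt_id (t : ℂ)).comp_ofReal).mul_const Complex.I).const_add (s : ℂ)
    have := (q.hasDerivAt ((s : ℂ) + t * Complex.I)).comp (𝕜' := ℂ) t h1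
    simpa [Function.comp_def, mul_comm] using this

variable {D : ℕ} {E : Type*} [NormedAddCommGroup E] [NormedSpace ℂ E]

/-- A map `Z` of a rectangle `-a ≤ s ≤ a`, `0 < t ≤ b` into the domain of the holomorphic function
`F`, depending on a further parameter `x`. The map is almost holomorphic in `s + it`,
and `F` grows slowly as `t → 0`. The means of `F ∘ Z` against the density `φ` in the variable `x` are
almost bounded by `M` at the bottom of the rectangle. -/
structure DiscFamily (D : ℕ) (E : Type*) [NormedAddCommGroup E] [NormedSpace ℂ E]
    (l : ℕ) (a b C G M : ℝ) where
  R : Set E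
  isOpen_R : IsOpen R
  F : E → ℂ
  holo : DifferentiableOn ℂ F R
  K : Set (Rn D)
  isCompact_K : IsCompact K
  φ : Rn D → ℝ
  continuous_φ : Continuous φ
  φ_nonneg : ∀ x, 0 ≤ φ x
  φ_eq_zero : ∀ x ∉ K, φ x = 0
  integral_φ : ∫ x, φ x = 1
  Z : ℝ → ℝ → Rn D → E
  Zs : ℝ → ℝ → Rn D → E
  Zss : ℝ → ℝ → Rn D → E
  Zt : ℝ → ℝ → Rn D → E
  Ztt : ℝ → ℝ → Rn D → E
  cont_Z : ContinuousOn (fun q : (ℝ × ℝ) × Rn D => Z q.1.1 q.1.2 q.2) ((Icc (-a) a ×ˢ Ioc 0 b) ×ˢ K)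
  cont_Zs : ContinuousOn (fun q : (ℝ × ℝ) × Rn D => Zs q.1.1 q.1.2 q.2)
    ((Icc (-a) a ×ˢ Ioc 0 b) ×ˢ K)
  cont_Zss : ContinuousOn (fun q : (ℝ × ℝ) × Rn D => Zss q.1.1 q.1.2 q.2)
    ((Icc (-a) a ×ˢ Ioc 0 b) ×ˢ K)
  cont_Zt : ContinuousOn (fun q : (ℝ × ℝ) × Rn D => Zt q.1.1 q.1.2 q.2)
    ((Icc (-a) a ×ˢ Ioc 0 b) ×ˢ K)
  cont_Ztt : ContinuousOn (fun q : (ℝ × ℝ) × Rn D => Ztt q.1.1 q.1.2 q.2)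
    ((Icc (-a) a ×ˢ Ioc 0 b) ×ˢ K)
  deriv_s : ∀ s ∈ Ioo (-a) a, ∀ t ∈ Ioo 0 b, ∀ x ∈ K, HasDerivAt (fun s => Z s t x) (Zs s t x) s
  deriv_ss : ∀ s ∈ Ioo (-a) a, ∀ t ∈ Ioo 0 b, ∀ x ∈ K,
    HasDerivAt (fun s => Zs s t x) (Zss s t x) s
  deriv_t : ∀ s ∈ Ioo (-a) a, ∀ t ∈ Ioo 0 b, ∀ x ∈ K, HasDerivAt (fun t => Z s t x) (Zt s t x) t
  deriv_tt : ∀ s ∈ Ioo (-a) a, ∀ t ∈ Ioo 0 b, ∀ x ∈ K,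
    HasDerivAt (fun t => Zt s t x) (Ztt s t x) t
  mem_R : ∀ s ∈ Icc (-a) a, ∀ t ∈ Ioc 0 b, ∀ x ∈ K, Z s t x ∈ R
  growth : ∀ s ∈ Icc (-a) a, ∀ t ∈ Ioc 0 b, ∀ x ∈ K, ‖F (Z s t x)‖ ≤ C / t ^ l
  growth' : ∀ s ∈ Icc (-a) a, ∀ t ∈ Ioc 0 b, ∀ x ∈ K,
    ‖fderiv ℂ F (Z s t x)‖ ≤ C / t ^ (l + 1)
  growth'' : ∀ s ∈ Icc (-a) a, ∀ t ∈ Ioc 0 b, ∀ x ∈ K,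
    ‖fderiv ℂ (fderiv ℂ F) (Z s t x)‖ ≤ C / t ^ (l + 2)
  norm_Zs : ∀ s ∈ Icc (-a) a, ∀ t ∈ Ioc 0 b, ∀ x ∈ K, ‖Zs s t x‖ ≤ G
  norm_dbar : ∀ s ∈ Icc (-a) a, ∀ t ∈ Ioc 0 b, ∀ x ∈ K,
    ‖Zt s t x - Complex.I • Zs s t x‖ ≤ G * t ^ (2 * l + 2)
  norm_laplacian : ∀ s ∈ Icc (-a) a, ∀ t ∈ Ioc 0 b, ∀ x ∈ K,
    ‖Zss s t x + Ztt s t x‖ ≤ G * t ^ (2 * l + 1)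
  bottom : ∀ ε > 0, ∃ τ₀ > 0, ∀ τ ∈ Ioo 0 τ₀, ∀ s ∈ Icc (-a) a,
    ‖∫ x, F (Z s τ x) * φ x‖ ≤ M + ε

namespace DiscFamily

variable {l : ℕ} {a b C G M : ℝ} (S : DiscFamily D E l a b C G M)

/-- The mean of a function against the density `φ`. -/
noncomputable def mean (f : Rn D → ℂ) : ℂ := ∫ x, f x * S.φ x

variable {S}

theorem norm_mean_le {f : Rn D → ℂ} {B : ℝ} (hB : ∀ x ∈ S.K, ‖f x‖ ≤ B) : ‖S.mean f‖ ≤ B := by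
  have hint : Integrable S.φ := by
    by_contra h
    have := S.integral_φ
    rw [integral_undef h] at this
    exact one_ne_zero this.symm
  calc ‖S.mean f‖ ≤ ∫ x, B * S.φ x := by
        refine norm_integral_le_of_norm_le (hint.const_mul B) (Eventually.of_forall fun x => ?_)
        rw [norm_mul, Complex.norm_real, Real.norm_of_nonneg (S.φ_nonneg x)]
        by_cases hx : x ∈ S.K
        · exact mul_le_mul_of_nonneg_right (hB x hx) (S.φ_nonneg x)
        · simp [S.φ_eq_zero x hx]
    _ = B := by rw [integral_const_mul, S.integral_φ, mul_one]

theorem integrable_mul_φ {f : Rn D → ℂ} (hf : ContinuousOn f S.K) :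
    Integrable fun x => f x * (S.φ x : ℂ) := by
  refine ((hf.mul (Complex.continuous_ofReal.comp S.continuous_φ).continuousOn).integrableOn_compact
    S.isCompact_K).integrable_of_forall_notMem_eq_zero fun x hx => ?_
  simp [S.φ_eq_zero x hx]

theorem hasDerivAt_mean {I : Set ℝ} (hI : IsOpen I) {f f' : ℝ → Rn D → ℂ}
    (hf : ContinuousOn (fun q : ℝ × Rn D => f q.1 q.2) (I ×ˢ S.K))
    (hf' : ContinuousOn (fun q : ℝ × Rn D => f' q.1 q.2) (I ×ˢ S.K))
    (hd : ∀ s ∈ I, ∀ x ∈ S.K, HasDerivAt (fun s => f s x) (f' s x) s) {s : ℝ} (hs : s ∈ I) :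
    HasDerivAt (fun s => S.mean (f s)) (S.mean (f' s)) s := by
  have hφ : Continuous fun q : ℝ × Rn D => (S.φ q.2 : ℂ) :=
    Complex.continuous_ofReal.comp (S.continuous_φ.comp continuous_snd)
  exact hasDerivAt_integral_of_compact S.isCompact_K hI
    (f := fun s x => f s x * (S.φ x : ℂ)) (f' := fun s x => f' s x * (S.φ x : ℂ))
    (hf.mul hφ.continuousOn) (hf'.mul hφ.continuousOn)
    (fun s x hx => by simp [S.φ_eq_zero x hx]) (fun s x hx => by simp [S.φ_eq_zero x hx])
    (fun s hs x hx => (hd s hs x hx).mul_const _) hs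

variable (S)

/-- The derivative of `F` along `Z` in the direction of the vector field `A`; it is a partial
derivative of `F ∘ Z` if `A` is one of `Z`. -/
noncomputable def f₁ (A : ℝ → ℝ → Rn D → E) (s t : ℝ) (x : Rn D) : ℂ :=
  fderiv ℂ S.F (S.Z s t x) (A s t x)

/-- The second derivative of `F ∘ Z` in one variable, where `A` and `B` are the first and the second
derivative of `Z`. -/
noncomputable def f₂ (A B : ℝ → ℝ → Rn D → E) (s t : ℝ) (x : Rn D) : ℂ :=
  fderiv ℂ (fderiv ℂ S.F) (S.Z s t x) (A s t x) (A s t x) + fderiv ℂ S.F (S.Z s t x) (B s t x)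

variable {S}

theorem cont_f₀ : ContinuousOn (fun q : (ℝ × ℝ) × Rn D => S.F (S.Z q.1.1 q.1.2 q.2))
    ((Icc (-a) a ×ˢ Ioc 0 b) ×ˢ S.K) :=
  S.holo.continuousOn.comp S.cont_Z fun _ hq => S.mem_R _ hq.1.1 _ hq.1.2 _ hq.2

theorem hasDerivAt_f₀ {Z : ℝ → E} {Z' : E} {s : ℝ} (h : HasDerivAt Z Z' s) (hR : Z s ∈ S.R) :
    HasDerivAt (fun s => S.F (Z s)) (fderiv ℂ S.F (Z s) Z') s :=
  ((S.holo.differentiableAt (S.isOpen_R.mem_nhds hR)).hasFDerivAt.restrictScalars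
    ℝ).comp_hasDerivAt s h

theorem cont_f₁ {A : ℝ → ℝ → Rn D → E}
    (hA : ContinuousOn (fun q : (ℝ × ℝ) × Rn D => A q.1.1 q.1.2 q.2)
      ((Icc (-a) a ×ˢ Ioc 0 b) ×ˢ S.K)) :
    ContinuousOn (fun q : (ℝ × ℝ) × Rn D => S.f₁ A q.1.1 q.1.2 q.2)
      ((Icc (-a) a ×ˢ Ioc 0 b) ×ˢ S.K) :=
  ((continuousOn_fderiv_of_differentiableOn_complex S.isOpen_R S.holo).comp S.cont_Z
    fun _ hq => S.mem_R _ hq.1.1 _ hq.1.2 _ hq.2).clm_apply hA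

variable [FiniteDimensional ℂ E]

theorem cont_f₂ {A B : ℝ → ℝ → Rn D → E}
    (hA : ContinuousOn (fun q : (ℝ × ℝ) × Rn D => A q.1.1 q.1.2 q.2)
      ((Icc (-a) a ×ˢ Ioc 0 b) ×ˢ S.K))
    (hB : ContinuousOn (fun q : (ℝ × ℝ) × Rn D => B q.1.1 q.1.2 q.2)
      ((Icc (-a) a ×ˢ Ioc 0 b) ×ˢ S.K)) :
    ContinuousOn (fun q : (ℝ × ℝ) × Rn D => S.f₂ A B q.1.1 q.1.2 q.2)
      ((Icc (-a) a ×ˢ Ioc 0 b) ×ˢ S.K) := by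
  have h2 : ContinuousOn (fderiv ℂ (fderiv ℂ S.F)) S.R :=
    ((contDiffOn_of_differentiableOn_complex S.isOpen_R S.holo).fderiv_of_isOpen
      (m := ∞) S.isOpen_R le_rfl).continuousOn_fderiv_of_isOpen S.isOpen_R (by simp)
  exact (((h2.comp S.cont_Z fun _ hq => S.mem_R _ hq.1.1 _ hq.1.2 _ hq.2).clm_apply hA).clm_apply
    hA).add (S.cont_f₁ hB)

theorem hasDerivAt_f₁ {Z A : ℝ → E} {A' : E} {s : ℝ} (h : HasDerivAt Z (A s) s)
    (hA : HasDerivAt A A' s) (hR : Z s ∈ S.R) :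
    HasDerivAt (fun s => fderiv ℂ S.F (Z s) (A s))
      (fderiv ℂ (fderiv ℂ S.F) (Z s) (A s) (A s) + fderiv ℂ S.F (Z s) A') s := by
  have h1 : HasDerivAt (fun s => fderiv ℂ S.F (Z s)) (fderiv ℂ (fderiv ℂ S.F) (Z s) (A s)) s :=
    (((differentiableOn_fderiv_complex S.isOpen_R S.holo).differentiableAt
      (S.isOpen_R.mem_nhds hR)).hasFDerivAt.restrictScalars ℝ).comp_hasDerivAt s h
  have h2 : HasFDerivAt (fun q : (E →L[ℂ] ℂ) × E => q.1 q.2)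
      ((isBoundedBilinearMap_apply (𝕜 := ℂ) (E := E) (F := ℂ)).deriv
        (fderiv ℂ S.F (Z s), A s)) (fderiv ℂ S.F (Z s), A s) :=
    isBoundedBilinearMap_apply.hasFDerivAt _
  have h3 := (h2.restrictScalars ℝ).comp_hasDerivAt (f := fun s => (fderiv ℂ S.F (Z s), A s)) s
    (h1.prodMk hA)
  refine h3.congr_deriv ?_
  simp [add_comm]

omit [FiniteDimensional ℂ E] in
theorem slice_s {f : ℝ → ℝ → Rn D → ℂ}
    (hf : ContinuousOn (fun q : (ℝ × ℝ) × Rn D => f q.1.1 q.1.2 q.2)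
      ((Icc (-a) a ×ˢ Ioc 0 b) ×ˢ S.K)) {t : ℝ} (ht : t ∈ Ioc 0 b) :
    ContinuousOn (fun q : ℝ × Rn D => f q.1 t q.2) (Ioo (-a) a ×ˢ S.K) :=
  hf.comp (f := fun q : ℝ × Rn D => ((q.1, t), q.2)) (by fun_prop)
    fun _ hq => ⟨⟨Ioo_subset_Icc_self hq.1, ht⟩, hq.2⟩

omit [FiniteDimensional ℂ E] in
theorem slice_t {f : ℝ → ℝ → Rn D → ℂ}
    (hf : ContinuousOn (fun q : (ℝ × ℝ) × Rn D => f q.1.1 q.1.2 q.2)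
      ((Icc (-a) a ×ˢ Ioc 0 b) ×ˢ S.K)) {s : ℝ} (hs : s ∈ Icc (-a) a) :
    ContinuousOn (fun q : ℝ × Rn D => f s q.1 q.2) (Ioo 0 b ×ˢ S.K) :=
  hf.comp (f := fun q : ℝ × Rn D => ((s, q.1), q.2)) (by fun_prop)
    fun _ hq => ⟨⟨hs, Ioo_subset_Ioc_self hq.1⟩, hq.2⟩

omit [FiniteDimensional ℂ E] in
theorem slice_st {f : ℝ → ℝ → Rn D → ℂ}
    (hf : ContinuousOn (fun q : (ℝ × ℝ) × Rn D => f q.1.1 q.1.2 q.2)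
      ((Icc (-a) a ×ˢ Ioc 0 b) ×ˢ S.K)) {s t : ℝ} (hs : s ∈ Icc (-a) a) (ht : t ∈ Ioc 0 b) :
    ContinuousOn (f s t) S.K :=
  hf.comp (f := fun x : Rn D => ((s, t), x)) (by fun_prop) fun _ hx => ⟨⟨hs, ht⟩, hx⟩

omit [FiniteDimensional ℂ E] in
theorem mean_add {f g : Rn D → ℂ} (hf : ContinuousOn f S.K) (hg : ContinuousOn g S.K) :
    S.mean f + S.mean g = S.mean fun x => f x + g x := by
  unfold mean
  rw [← integral_add (integrable_mul_φ hf) (integrable_mul_φ hg)]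
  simp only [add_mul]

omit [FiniteDimensional ℂ E] in
theorem mean_const_mul (c : ℂ) (f : Rn D → ℂ) : c * S.mean f = S.mean fun x => c * f x := by
  unfold mean
  rw [← integral_const_mul]
  simp only [mul_assoc]

omit [FiniteDimensional ℂ E] in
/-- The Laplacian of `F ∘ Z` is small, since `Z` is almost holomorphic. -/
theorem norm_laplacian_le (hC : 0 ≤ C) (hG : 0 ≤ G) (hb : b ≤ 1) {s t : ℝ} (hs : s ∈ Icc (-a) a)
    (ht : t ∈ Ioc 0 b) {x : Rn D} (hx : x ∈ S.K) :
    ‖S.f₂ S.Zs S.Zss s t x + S.f₂ S.Zt S.Ztt s t x‖ ≤ C * (3 * G ^ 2 + G) * t ^ l := by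
  set X := S.Zt s t x - Complex.I • S.Zs s t x with hX
  have hZt : S.Zt s t x = Complex.I • S.Zs s t x + X := by rw [hX]; abel
  set F' := fderiv ℂ S.F (S.Z s t x) with hF'
  set F'' := fderiv ℂ (fderiv ℂ S.F) (S.Z s t x) with hF''
  have h1 : S.f₂ S.Zs S.Zss s t x + S.f₂ S.Zt S.Ztt s t x =
      (Complex.I * F'' (S.Zs s t x) X + Complex.I * F'' X (S.Zs s t x) + F'' X X)
        + F' (S.Zss s t x + S.Ztt s t x) := by
    unfold f₂
    rw [← hF', ← hF'', hZt]
    simp only [map_add, map_smul, add_apply, smul_apply,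
      smul_eq_mul]
    linear_combination (F'' (S.Zs s t x) (S.Zs s t x)) * Complex.I_mul_I
  have ht0 := ht.1
  have ht1 : t ≤ 1 := ht.2.trans hb
  have hXn := S.norm_dbar s hs t ht x hx
  have hLn := S.norm_laplacian s hs t ht x hx
  have hZn := S.norm_Zs s hs t ht x hx
  have hF'n := S.growth' s hs t ht x hx
  have hF''n := S.growth'' s hs t ht x hx
  rw [← hX] at hXn
  rw [← hF'] at hF'n
  rw [← hF''] at hF''n
  have hop : ∀ u w : E, ‖F'' u w‖ ≤ C / t ^ (l + 2) * ‖u‖ * ‖w‖ := fun u w =>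
    (F''.le_opNorm₂ u w).trans (by gcongr)
  have e1 : C / t ^ (l + 2) * G * (G * t ^ (2 * l + 2)) = C * G ^ 2 * t ^ l := by
    field_simp
    ring
  have e2 : C / t ^ (l + 1) * (G * t ^ (2 * l + 1)) = C * G * t ^ l := by
    field_simp
    ring
  have hXG : ‖X‖ ≤ G := hXn.trans (mul_le_of_le_one_right hG (pow_le_one₀ ht0.le ht1))
  have b1 : ‖Complex.I * F'' (S.Zs s t x) X‖ ≤ C * G ^ 2 * t ^ l := by
    rw [norm_mul, Complex.norm_I, one_mul, ← e1]
    exact (hop _ _).trans (by gcongr)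
  have b2 : ‖Complex.I * F'' X (S.Zs s t x)‖ ≤ C * G ^ 2 * t ^ l := by
    rw [norm_mul, Complex.norm_I, one_mul, ← e1]
    calc _ ≤ _ := hop _ _
      _ ≤ C / t ^ (l + 2) * (G * t ^ (2 * l + 2)) * G := by gcongr
      _ = _ := by ring
  have b3 : ‖F'' X X‖ ≤ C * G ^ 2 * t ^ l := by
    rw [← e1]
    exact (hop _ _).trans (by gcongr)
  have b4 : ‖F' (S.Zss s t x + S.Ztt s t x)‖ ≤ C * G * t ^ l := by
    rw [← e2]
    exact (F'.le_opNorm _).trans (by gcongr)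
  rw [h1]
  calc _ ≤ ‖Complex.I * F'' (S.Zs s t x) X‖ + ‖Complex.I * F'' X (S.Zs s t x)‖ + ‖F'' X X‖ +
        ‖F' (S.Zss s t x + S.Ztt s t x)‖ := (norm_add_le _ _).trans (add_le_add_left (norm_add₃_le) _)
    _ ≤ _ := by linarith

omit [FiniteDimensional ℂ E] in
/-- The first derivatives of `F ∘ Z` almost satisfy the Cauchy-Riemann equation. -/
theorem norm_dbar_le (hC : 0 ≤ C) (hb : b ≤ 1) (hG : 0 ≤ G) {s t : ℝ} (hs : s ∈ Icc (-a) a)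
    (ht : t ∈ Ioc 0 b) {x : Rn D} (hx : x ∈ S.K) :
    ‖S.f₁ S.Zs s t x + Complex.I * S.f₁ S.Zt s t x‖ ≤ C * G * t ^ l := by
  have h1 : S.f₁ S.Zs s t x + Complex.I * S.f₁ S.Zt s t x =
      Complex.I * fderiv ℂ S.F (S.Z s t x) (S.Zt s t x - Complex.I • S.Zs s t x) := by
    unfold f₁
    simp only [map_sub, map_smul, smul_eq_mul]
    linear_combination (fderiv ℂ S.F (S.Z s t x) (S.Zs s t x)) * Complex.I_mul_I
  have ht0 := ht.1
  have ht1 : t ≤ 1 := ht.2.trans hb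
  rw [h1, norm_mul, Complex.norm_I, one_mul]
  calc _ ≤ C / t ^ (l + 1) * (G * t ^ (2 * l + 2)) :=
        (ContinuousLinearMap.le_opNorm _ _).trans (mul_le_mul (S.growth' s hs t ht x hx)
          (S.norm_dbar s hs t ht x hx) (norm_nonneg _) (by positivity))
    _ = C * G * t ^ l * t := by field_simp; ring
    _ ≤ _ := mul_le_of_le_one_right (by positivity) ht1

end DiscFamily

/-- A bound for the means of `F ∘ Z` on the axis `s = 0` which only depends on the constants: the
maximum principle is applied to the mean times `((s + it)² - a²)^l`, a factor which vanishes at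
the corners and compensates the growth of `F` there. -/
theorem exists_discFamily_bound [FiniteDimensional ℂ E] {l : ℕ} {a b C G M : ℝ} (ha : 0 < a)
    (ha1 : a ≤ 1) (hb : 0 < b) (hb1 : b ≤ 1) (hC : 0 ≤ C) (hG : 0 ≤ G) (hM : 0 ≤ M) :
    ∃ B, ∀ S : DiscFamily D E l a b C G M, ∀ t ∈ Ioc 0 b,
      ‖∫ x, S.F (S.Z 0 t x) * S.φ x‖ ≤ B := by
  set q : Polynomial ℂ := (Polynomial.X ^ 2 - Polynomial.C ((a : ℂ) ^ 2)) ^ l with hq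
  have hqe : ∀ ζ : ℂ, q.eval ζ = (ζ ^ 2 - (a : ℂ) ^ 2) ^ l := fun ζ => by simp [hq]
  set z : ℝ → ℝ → ℂ := fun s t => (s : ℂ) + t * Complex.I with hz
  have hzc : Continuous fun p : ℝ × ℝ => z p.1 p.2 := by fun_prop
  obtain ⟨P, hP⟩ := (isCompact_Icc.prod isCompact_Icc :
    IsCompact (Icc (-a) a ×ˢ Icc (0 : ℝ) b)).exists_bound_of_continuousOn
      (f := fun p : ℝ × ℝ => ‖q.eval (z p.1 p.2)‖ + ‖q.derivative.eval (z p.1 p.2)‖)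
      (((q.continuous.comp hzc).norm.add (q.derivative.continuous.comp hzc).norm).continuousOn)
  have hP0 : 0 ≤ P := (norm_nonneg _).trans (hP (0, 0) ⟨⟨by linarith, ha.le⟩, le_rfl, hb.le⟩)
  have hPb : ∀ s ∈ Icc (-a) a, ∀ t ∈ Icc (0 : ℝ) b,
      ‖q.eval (z s t)‖ ≤ P ∧ ‖q.derivative.eval (z s t)‖ ≤ P := by
    intro s hs t ht
    have := hP (s, t) ⟨hs, ht⟩
    rw [Real.norm_of_nonneg (by positivity)] at this
    constructor <;> linarith [norm_nonneg (q.eval (z s t)), norm_nonneg (q.derivative.eval (z s t))]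
  set A := C * P * (C * (3 * G ^ 2 + G) * P + 2 * P * (C * G)) with hA
  set M' := C * 3 ^ l + C / b ^ l * P + (M + 1) * P with hM'
  have hA0 : 0 ≤ A := by positivity
  refine ⟨√(M' ^ 2 + (A + 1) * a ^ 2) / a ^ (2 * l), fun S t ht => ?_⟩
  obtain ⟨τ₀, hτ₀, hbot⟩ := S.bottom 1 one_pos
  set τ := min (τ₀ / 2) (t / 2) with hτ
  have hτp : 0 < τ := lt_min (half_pos hτ₀) (half_pos ht.1)
  have hττ₀ : τ < τ₀ := (min_le_left _ _).trans_lt (half_lt_self hτ₀)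
  have hτt : τ < t := (min_le_right _ _).trans_lt (half_lt_self ht.1)
  have hsub : ∀ {r}, r ∈ Ioo τ b → r ∈ Ioc 0 b := fun hr => ⟨hτp.trans hr.1, hr.2.le⟩
  have hsub' : ∀ {r}, r ∈ Ioo τ b → r ∈ Ioo 0 b := fun hr => ⟨hτp.trans hr.1, hr.2⟩
  set f₀ : ℝ → ℝ → Rn D → ℂ := fun s t x => S.F (S.Z s t x) with hf₀
  have hf₀b : ∀ s ∈ Icc (-a) a, ∀ t ∈ Ioc 0 b, ‖S.mean (f₀ s t)‖ ≤ C / t ^ l := fun s hs t ht =>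
    S.norm_mean_le fun x hx => S.growth s hs t ht x hx
  have hIs : ∀ {s}, s ∈ Ioo (-a) a → s ∈ Icc (-a) a := fun h => Ioo_subset_Icc_self h
  have main := norm_sq_le_of_laplacian_le (a := a) (b := b) (τ := τ) (A := A) (M := M')
    (v := fun s t => S.mean (f₀ s t) * q.eval (z s t))
    (vs := fun s t => S.mean (S.f₁ S.Zs s t) * q.eval (z s t) +
      S.mean (f₀ s t) * q.derivative.eval (z s t))
    (vss := fun s t => (S.mean (S.f₂ S.Zs S.Zss s t) * q.eval (z s t) +
      S.mean (S.f₁ S.Zs s t) * q.derivative.eval (z s t)) +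
      (S.mean (S.f₁ S.Zs s t) * q.derivative.eval (z s t) +
        S.mean (f₀ s t) * q.derivative.derivative.eval (z s t)))
    (vt := fun s t => S.mean (S.f₁ S.Zt s t) * q.eval (z s t) +
      S.mean (f₀ s t) * (Complex.I * q.derivative.eval (z s t)))
    (vtt := fun s t => (S.mean (S.f₂ S.Zt S.Ztt s t) * q.eval (z s t) +
      S.mean (S.f₁ S.Zt s t) * (Complex.I * q.derivative.eval (z s t))) +
      (S.mean (S.f₁ S.Zt s t) * (Complex.I * q.derivative.eval (z s t)) +
        S.mean (f₀ s t) * (Complex.I * (Complex.I * q.derivative.derivative.eval (z s t)))))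
    hA0 ?_ ?_ ?_ ?_ ?_ ?_ ?_ (s := 0) (t := t) ⟨by linarith, ha.le⟩ ⟨hτt.le, ht.2⟩
  · have hlow : a ^ (2 * l) ≤ ‖q.eval (z 0 t)‖ := by
      rw [hqe, norm_pow, pow_mul]
      refine pow_le_pow_left₀ (by positivity) ?_ l
      have : z 0 t ^ 2 - (a : ℂ) ^ 2 = ((-(t ^ 2 + a ^ 2) : ℝ) : ℂ) := by
        simp only [hz]
        push_cast
        linear_combination ((t : ℂ) ^ 2) * Complex.I_sq
      rw [this, Complex.norm_real, norm_neg, Real.norm_of_nonneg (by positivity)]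
      nlinarith [ht.1]
    rw [le_div_iff₀ (by positivity)]
    refine le_trans ?_ (Real.le_sqrt_of_sq_le main)
    rw [norm_mul]
    exact mul_le_mul_of_nonneg_left hlow (norm_nonneg _)
  · refine ContinuousOn.mul ?_ (q.continuous.comp hzc).continuousOn
    have hφ : Continuous fun p : (ℝ × ℝ) × Rn D => (S.φ p.2 : ℂ) :=
      Complex.continuous_ofReal.comp (S.continuous_φ.comp continuous_snd)
    refine continuousOn_integral_of_compact (P := ℝ × ℝ)
      (g := fun p x => S.F (S.Z p.1 p.2 x) * (S.φ x : ℂ)) S.isCompact_K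
      (isCompact_Icc.prod isCompact_Icc) ((S.cont_f₀.mono ?_).mul hφ.continuousOn)
      fun p x hx => by simp [S.φ_eq_zero x hx]
    exact prod_mono (prod_mono subset_rfl fun r hr => ⟨hτp.trans_le hr.1, hr.2⟩) subset_rfl
  · intro s hs t ht
    refine HasDerivAt.mul ?_ (hasDerivAt_comp_complexLine q s t).1
    exact S.hasDerivAt_mean isOpen_Ioo (f := fun s => f₀ s t) (S.slice_s (f := f₀) S.cont_f₀ (hsub ht))
      (S.slice_s (S.cont_f₁ S.cont_Zs) (hsub ht)) (fun s hs x hx => S.hasDerivAt_f₀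
        (S.deriv_s s hs t (hsub' ht) x hx) (S.mem_R s (hIs hs) t (hsub ht) x hx)) hs
  · intro s hs t ht
    refine HasDerivAt.add (HasDerivAt.mul ?_ (hasDerivAt_comp_complexLine q s t).1)
      (HasDerivAt.mul ?_ (hasDerivAt_comp_complexLine q.derivative s t).1)
    · exact S.hasDerivAt_mean isOpen_Ioo (S.slice_s (S.cont_f₁ S.cont_Zs) (hsub ht))
        (S.slice_s (S.cont_f₂ S.cont_Zs S.cont_Zss) (hsub ht)) (fun s hs x hx => S.hasDerivAt_f₁
          (A := fun s => S.Zs s t x) (S.deriv_s s hs t (hsub' ht) x hx)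
          (S.deriv_ss s hs t (hsub' ht) x hx) (S.mem_R s (hIs hs) t (hsub ht) x hx)) hs
    · exact S.hasDerivAt_mean isOpen_Ioo (f := fun s => f₀ s t) (S.slice_s (f := f₀) S.cont_f₀ (hsub ht))
        (S.slice_s (S.cont_f₁ S.cont_Zs) (hsub ht)) (fun s hs x hx => S.hasDerivAt_f₀
          (S.deriv_s s hs t (hsub' ht) x hx) (S.mem_R s (hIs hs) t (hsub ht) x hx)) hs
  · intro s hs t ht
    refine HasDerivAt.mul ?_ (hasDerivAt_comp_complexLine q s t).2
    exact S.hasDerivAt_mean isOpen_Ioo (f := fun t => f₀ s t) (S.slice_t (f := f₀) S.cont_f₀ (hIs hs))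
      (S.slice_t (S.cont_f₁ S.cont_Zt) (hIs hs)) (fun t ht x hx => S.hasDerivAt_f₀
        (S.deriv_t s hs t ht x hx) (S.mem_R s (hIs hs) t (Ioo_subset_Ioc_self ht) x hx)) (hsub' ht)
  · intro s hs t ht
    refine HasDerivAt.add (HasDerivAt.mul ?_ (hasDerivAt_comp_complexLine q s t).2)
      (HasDerivAt.mul ?_ ((hasDerivAt_comp_complexLine q.derivative s t).2.const_mul Complex.I))
    · exact S.hasDerivAt_mean isOpen_Ioo (S.slice_t (S.cont_f₁ S.cont_Zt) (hIs hs))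
        (S.slice_t (S.cont_f₂ S.cont_Zt S.cont_Ztt) (hIs hs)) (fun t ht x hx => S.hasDerivAt_f₁
          (A := fun t => S.Zt s t x) (S.deriv_t s hs t ht x hx)
          (S.deriv_tt s hs t ht x hx) (S.mem_R s (hIs hs) t (Ioo_subset_Ioc_self ht) x hx))
          (hsub' ht)
    · exact S.hasDerivAt_mean isOpen_Ioo (f := fun t => f₀ s t) (S.slice_t (f := f₀) S.cont_f₀ (hIs hs))
        (S.slice_t (S.cont_f₁ S.cont_Zt) (hIs hs)) (fun t ht x hx => S.hasDerivAt_f₀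
          (S.deriv_t s hs t ht x hx) (S.mem_R s (hIs hs) t (Ioo_subset_Ioc_self ht) x hx))
          (hsub' ht)
  · intro s hs t ht
    have hs' := hIs hs
    have ht' := hsub ht
    have htl : 0 < t ^ l := pow_pos ht'.1 l
    obtain ⟨hp, hp'⟩ := hPb s hs' t (Ioc_subset_Icc_self ht')
    have e1 : (S.mean (S.f₂ S.Zs S.Zss s t) * q.eval (z s t) +
        S.mean (S.f₁ S.Zs s t) * q.derivative.eval (z s t)) +
        (S.mean (S.f₁ S.Zs s t) * q.derivative.eval (z s t) +
          S.mean (f₀ s t) * q.derivative.derivative.eval (z s t)) +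
        ((S.mean (S.f₂ S.Zt S.Ztt s t) * q.eval (z s t) +
        S.mean (S.f₁ S.Zt s t) * (Complex.I * q.derivative.eval (z s t))) +
        (S.mean (S.f₁ S.Zt s t) * (Complex.I * q.derivative.eval (z s t)) +
          S.mean (f₀ s t) * (Complex.I * (Complex.I * q.derivative.derivative.eval (z s t))))) =
        S.mean (fun x => S.f₂ S.Zs S.Zss s t x + S.f₂ S.Zt S.Ztt s t x) * q.eval (z s t) +
        2 * q.derivative.eval (z s t) *
          S.mean (fun x => S.f₁ S.Zs s t x + Complex.I * S.f₁ S.Zt s t x) := by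
      have h1 : S.mean (fun x => S.f₁ S.Zs s t x + Complex.I * S.f₁ S.Zt s t x) =
          S.mean (S.f₁ S.Zs s t) + Complex.I * S.mean (S.f₁ S.Zt s t) := by
        rw [S.mean_const_mul, S.mean_add (g := fun x => Complex.I * S.f₁ S.Zt s t x)
          (S.slice_st (S.cont_f₁ S.cont_Zs) hs' ht') (continuousOn_const.mul (S.slice_st (S.cont_f₁ S.cont_Zt) hs' ht'))]
      rw [h1, ← S.mean_add (S.slice_st (S.cont_f₂ S.cont_Zs S.cont_Zss) hs' ht')
        (S.slice_st (S.cont_f₂ S.cont_Zt S.cont_Ztt) hs' ht')]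
      linear_combination (S.mean (f₀ s t) * q.derivative.derivative.eval (z s t)) * Complex.I_mul_I
    rw [e1]
    have h1 := S.norm_mean_le fun x hx => S.norm_laplacian_le hC hG hb1 hs' ht' hx
    have h2 := S.norm_mean_le fun x hx => S.norm_dbar_le hC hb1 hG hs' ht' hx
    calc _ ≤ (C / t ^ l * P) * ((C * (3 * G ^ 2 + G) * t ^ l) * P + 2 * P * (C * G * t ^ l)) := by
          refine mul_le_mul ?_ ?_ (norm_nonneg _) (by positivity)
          · rw [norm_mul]
            exact mul_le_mul (hf₀b s hs' t ht') hp (norm_nonneg _) (by positivity)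
          · refine (norm_add_le _ _).trans (add_le_add ?_ ?_)
            · rw [norm_mul]
              exact mul_le_mul h1 hp (norm_nonneg _) (by positivity)
            · rw [norm_mul, norm_mul, Complex.norm_ofNat]
              exact mul_le_mul (mul_le_mul_of_nonneg_left hp' zero_le_two) h2 (norm_nonneg _)
                (by positivity)
      _ = A := by
          rw [hA]
          field_simp
  · intro s hs t ht hside
    have ht' : t ∈ Ioc 0 b := ⟨hτp.trans_le ht.1, ht.2⟩
    have htl : 0 < t ^ l := pow_pos ht'.1 l
    have hp := (hPb s hs t (Ioc_subset_Icc_self ht')).1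
    have h0 := hf₀b s hs t ht'
    rw [norm_mul]
    have hcorner : s = -a ∨ s = a → ‖S.mean (f₀ s t)‖ * ‖q.eval (z s t)‖ ≤ C * 3 ^ l := by
      intro h
      have hsq : (s : ℂ) ^ 2 = (a : ℂ) ^ 2 := by rcases h with rfl | rfl <;> simp
      have hq3 : ‖q.eval (z s t)‖ ≤ (3 * t) ^ l := by
        rw [hqe, norm_pow]
        refine pow_le_pow_left₀ (norm_nonneg _) ?_ l
        have : z s t ^ 2 - (a : ℂ) ^ 2 = t * (2 * s * Complex.I - t) := by
          simp only [hz]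
          linear_combination hsq + ((t : ℂ) ^ 2) * Complex.I_sq
        rw [this, norm_mul, Complex.norm_real, Real.norm_of_nonneg ht'.1.le, mul_comm]
        refine mul_le_mul_of_nonneg_right ?_ ht'.1.le
        refine (norm_sub_le _ _).trans ?_
        rw [norm_mul, norm_mul, Complex.norm_I, Complex.norm_real, Complex.norm_real,
          Complex.norm_ofNat, mul_one, Real.norm_of_nonneg ht'.1.le, Real.norm_eq_abs]
        have h1 : |s| ≤ 1 := (abs_le.2 ⟨hs.1, hs.2⟩).trans ha1
        linarith [ht.2]
      calc _ ≤ C / t ^ l * (3 * t) ^ l := mul_le_mul h0 hq3 (norm_nonneg _) (by positivity)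
        _ = C * 3 ^ l := by rw [mul_pow]; field_simp
    have n1 : 0 ≤ C * 3 ^ l := by positivity
    have n2 : 0 ≤ C / b ^ l * P := by positivity
    have n3 : 0 ≤ (M + 1) * P := by positivity
    rcases hside with h | h | h | h
    · linarith [hcorner (Or.inl h)]
    · linarith [hcorner (Or.inr h)]
    · have h1 : ‖S.mean (f₀ s t)‖ ≤ M + 1 := hbot t (h ▸ ⟨hτp, hττ₀⟩) s hs
      have := mul_le_mul h1 hp (norm_nonneg _) (by positivity)
      linarith
    · have h1 : ‖S.mean (f₀ s t)‖ ≤ C / b ^ l := h ▸ h0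
      have := mul_le_mul h1 hp (norm_nonneg _) (by positivity)
      linarith

end Discs

/-! ### Local wedges in `E` -/

section ConeRegions

variable {D : ℕ} {E : Type*} [NormedAddCommGroup E] [NormedSpace ℂ E]

theorem HasStrictFDerivAt.exists_norm_sub_sub_le {V G : Type*} [NormedAddCommGroup V]
    [NormedSpace ℝ V] [NormedAddCommGroup G] [NormedSpace ℝ G] {f : V → G} {f' : V →L[ℝ] G} {a : V}
    (h : HasStrictFDerivAt f f' a) {c : ℝ} (hc : 0 < c) :
    ∃ ρ > 0, ∀ x ∈ Metric.ball a ρ, ∀ y ∈ Metric.ball a ρ,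
      ‖f x - f y - f' (x - y)‖ ≤ c * ‖x - y‖ := by
  have h1 := h.isLittleO.def hc
  rw [nhds_prod_eq] at h1
  obtain ⟨ρ, hρ, hb⟩ := (Metric.nhds_basis_ball.prod_self.eventually_iff).1 h1
  exact ⟨ρ, hρ, fun x hx y hy => @hb (x, y) ⟨hx, hy⟩⟩

/-- The region swept out by small balls of radius `t r` around the points `γ x + t v`, where
`0 < t < r`, and `x` is `r`-close to `x₀`. These regions are cofinal among the wedges at
`γ x₀` of direction `v` whose edge is the image of `γ`. -/
def coneRegion (γ : Rn D → E) (x₀ : Rn D) (v : E) (r : ℝ) : Set E :=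
  {z | ∃ x ∈ Metric.ball x₀ r, ∃ t ∈ Ioo 0 r, ∃ v' ∈ Metric.ball v r, z = γ x + t • v'}

/-- The union of `coneRegion` with its edge. -/
def closedConeRegion (γ : Rn D → E) (x₀ : Rn D) (v : E) (r : ℝ) : Set E :=
  {z | ∃ x ∈ Metric.ball x₀ r, ∃ t ∈ Ico 0 r, ∃ v' ∈ Metric.ball v r, z = γ x + t • v'}

variable {γ : Rn D → E} {x₀ : Rn D} {v : E} {r r' : ℝ}

theorem coneRegion_mono (h : r' ≤ r) : coneRegion γ x₀ v r' ⊆ coneRegion γ x₀ v r := by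
  rintro z ⟨x, hx, t, ht, v', hv', rfl⟩
  exact ⟨x, Metric.ball_subset_ball h hx, t, Ioo_subset_Ioo_right h ht, v',
    Metric.ball_subset_ball h hv', rfl⟩

theorem closedConeRegion_mono (h : r' ≤ r) :
    closedConeRegion γ x₀ v r' ⊆ closedConeRegion γ x₀ v r := by
  rintro z ⟨x, hx, t, ht, v', hv', rfl⟩
  exact ⟨x, Metric.ball_subset_ball h hx, t, Ico_subset_Ico_right h ht, v',
    Metric.ball_subset_ball h hv', rfl⟩

theorem coneRegion_subset_closedConeRegion :
    coneRegion γ x₀ v r ⊆ closedConeRegion γ x₀ v r := by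
  rintro z ⟨x, hx, t, ht, v', hv', rfl⟩
  exact ⟨x, hx, t, Ioo_subset_Ico_self ht, v', hv', rfl⟩

theorem exists_add_smul_of_mem_ball {t κ : ℝ} (ht : 0 < t) {a v' y : E}
    (hy : y ∈ Metric.ball (a + t • v') (t * κ)) : ∃ w ∈ Metric.ball v' κ, y = a + t • w := by
  refine ⟨t⁻¹ • (y - a), ?_, ?_⟩
  · have h1 : t⁻¹ • (y - a) - v' = t⁻¹ • (y - (a + t • v')) := by
      rw [← sub_sub, smul_sub t⁻¹ (y - a), inv_smul_smul₀ ht.ne']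
    rw [mem_ball_iff_norm, h1, norm_smul, norm_inv, Real.norm_of_nonneg ht.le]
    rw [mem_ball_iff_norm] at hy
    calc _ < t⁻¹ * (t * κ) := by gcongr
      _ = κ := by field_simp
  · rw [smul_inv_smul₀ ht.ne']
    abel

theorem isOpen_coneRegion : IsOpen (coneRegion γ x₀ v r) := by
  rw [Metric.isOpen_iff]
  rintro z ⟨x, hx, t, ht, v', hv', rfl⟩
  refine ⟨t * (r - dist v' v), mul_pos ht.1 (sub_pos.2 hv'), fun y hy => ?_⟩
  obtain ⟨w, hw, rfl⟩ := exists_add_smul_of_mem_ball ht.1 hy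
  refine ⟨x, hx, t, ht, w, ?_, rfl⟩
  rw [Metric.mem_ball] at hw ⊢
  linarith [dist_triangle w v' v]

/-- Points over nearby points of the edge: moving the base point in the direction `y` has the
same effect as changing the direction by `dγ y`. -/
theorem exists_shift {A : Rn D →L[ℝ] E} (hA : HasStrictFDerivAt γ A x₀) (hr : 0 < r) {b : ℝ}
    (hb : 0 ≤ b) :
    ∃ r' > 0, r' ≤ r ∧ ∀ x ∈ Metric.ball x₀ r', ∀ t ∈ Ioo 0 r', ∀ y : Rn D, ‖y‖ ≤ b →
      ∀ v' ∈ Metric.ball (v + A y) r', ∃ x' ∈ Metric.ball x₀ r, ∃ v'' ∈ Metric.ball v r,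
        γ x + t • v' = γ x' + t • v'' := by
  obtain ⟨ρ, hρ, h⟩ := hA.exists_norm_sub_sub_le (c := r / (2 * (b + 1))) (by positivity)
  set m := min ρ r with hm
  have hmp : 0 < m := lt_min hρ hr
  have hmr : m ≤ r := min_le_right _ _
  refine ⟨m / (2 * (b + 1)), by positivity, ?_, ?_⟩
  · refine (div_le_self hmp.le (by linarith)).trans hmr
  · intro x hx t ht y hy v' hv'
    have hm2 : m / (2 * (b + 1)) ≤ m / 2 :=
      div_le_div_of_nonneg_left hmp.le (by norm_num) (by linarith)
    have hty : ‖t • y‖ < m / 2 := by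
      rw [norm_smul, Real.norm_of_nonneg ht.1.le]
      calc t * ‖y‖ ≤ t * b := mul_le_mul_of_nonneg_left hy ht.1.le
        _ < t * (b + 1) := by nlinarith [ht.1]
        _ ≤ m / (2 * (b + 1)) * (b + 1) := by
            refine mul_le_mul_of_nonneg_right ht.2.le (by linarith)
        _ = m / 2 := by field_simp
    have hx' : x + t • y ∈ Metric.ball x₀ m := by
      rw [mem_ball_iff_norm] at hx ⊢
      calc ‖x + t • y - x₀‖ = ‖(x - x₀) + t • y‖ := by congr 1; abel
        _ ≤ _ := norm_add_le _ _
        _ < m := by linarith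
    have hxm : x ∈ Metric.ball x₀ m := Metric.ball_subset_ball (by linarith) hx
    have hest := h _ (Metric.ball_subset_ball (min_le_left _ _) hx') _
      (Metric.ball_subset_ball (min_le_left _ _) hxm)
    rw [add_sub_cancel_left] at hest
    refine ⟨x + t • y, Metric.ball_subset_ball hmr hx', v' - t⁻¹ • (γ (x + t • y) - γ x), ?_, ?_⟩
    · rw [mem_ball_iff_norm] at hv' ⊢
      have e1 : v' - t⁻¹ • (γ (x + t • y) - γ x) - v =
          (v' - (v + A y)) - t⁻¹ • (γ (x + t • y) - γ x - A (t • y)) := by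
        rw [smul_sub _ _ (A (t • y)), map_smul, inv_smul_smul₀ ht.1.ne']
        abel
      have e2 : ‖t⁻¹ • (γ (x + t • y) - γ x - A (t • y))‖ ≤ r / 2 := by
        rw [norm_smul, norm_inv, Real.norm_of_nonneg ht.1.le]
        rw [norm_smul, Real.norm_of_nonneg ht.1.le] at hest
        have ht0 := ht.1
        calc _ ≤ t⁻¹ * (r / (2 * (b + 1)) * (t * b)) := by gcongr; exact hest.trans (by gcongr)
          _ = r / 2 * (b / (b + 1)) := by field_simp
          _ ≤ r / 2 := mul_le_of_le_one_right (by positivity)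
              ((div_le_one (by linarith)).2 (by linarith))
      rw [e1]
      calc _ ≤ _ := norm_sub_le _ _
        _ < r := by linarith
    · rw [smul_sub, smul_inv_smul₀ ht.1.ne']
      abel

/-- `F` grows at most like `t^{-l}` at the edge of the cone region. -/
def SlowGrowth {W : Type*} [NormedAddCommGroup W] (γ : Rn D → E) (x₀ : Rn D) (v : E) (r : ℝ)
    (l : ℕ) (C : ℝ) (F : E → W) : Prop :=
  ∀ x ∈ Metric.ball x₀ r, ∀ t ∈ Ioo 0 r, ∀ v' ∈ Metric.ball v r, ‖F (γ x + t • v')‖ ≤ C / t ^ l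

theorem SlowGrowth.mono {W : Type*} [NormedAddCommGroup W] {F : E → W} {l : ℕ} {C : ℝ}
    (h : SlowGrowth γ x₀ v r l C F) (hr : r' ≤ r) : SlowGrowth γ x₀ v r' l C F :=
  fun x hx t ht v' hv' => h x (Metric.ball_subset_ball hr hx) t (Ioo_subset_Ioo_right hr ht) v'
    (Metric.ball_subset_ball hr hv')

theorem SlowGrowth.nonneg {W : Type*} [NormedAddCommGroup W] {F : E → W} {l : ℕ} {C : ℝ}
    (hr : 0 < r) (h : SlowGrowth γ x₀ v r l C F) : 0 ≤ C := by
  have h1 := (norm_nonneg _).trans (h x₀ (Metric.mem_ball_self hr) (r / 2)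
    ⟨half_pos hr, half_lt_self hr⟩ v (Metric.mem_ball_self hr))
  by_contra hC
  exact absurd h1 (not_le.2 (div_neg_of_neg_of_pos (not_le.1 hC) (by positivity)))

theorem SlowGrowth.fderiv {W : Type*} [NormedAddCommGroup W] [NormedSpace ℂ W] {F : E → W} {l : ℕ}
    {C : ℝ} (h : SlowGrowth γ x₀ v r l C F) (hr : 0 < r)
    (hF : DifferentiableOn ℂ F (coneRegion γ x₀ v r)) :
    SlowGrowth γ x₀ v (r / 2) (l + 1) (4 * C / r) (fderiv ℂ F) := by
  intro x hx t ht v' hv'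
  have hx' := Metric.ball_subset_ball (half_le_self hr.le) hx
  have ht' : t ∈ Ioo 0 r := ⟨ht.1, ht.2.trans (half_lt_self hr)⟩
  have ht0 := ht.1
  have hv'' : ∀ w ∈ Metric.ball v' (r / 2), w ∈ Metric.ball v r := fun w hw => by
    rw [Metric.mem_ball] at *
    linarith [dist_triangle w v' v]
  have := norm_fderiv_le_of_norm_le_on_ball (F := F) (z := γ x + t • v') (r := t * (r / 2))
    (M := C / t ^ l) (by positivity) (hF.mono fun y hy => by
      obtain ⟨w, hw, rfl⟩ := exists_add_smul_of_mem_ball ht.1 hy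
      exact ⟨x, hx', t, ht', w, hv'' w hw, rfl⟩) (fun y hy => by
      obtain ⟨w, hw, rfl⟩ := exists_add_smul_of_mem_ball ht.1 hy
      exact h x hx' t ht' w (hv'' w hw))
  refine this.trans_eq ?_
  field_simp
  ring

end ConeRegions

/-! ### Taylor discs attached to the edge -/

section TaylorDiscs

variable {D : ℕ} {E : Type*} [NormedAddCommGroup E] [NormedSpace ℂ E]

/-- The iterated directional derivative `D^j γ (x) (w, …, w)`, as a function of the pair `(x, w)`. -/
noncomputable def taylorTerm (γ : Rn D → E) : ℕ → Rn D × Rn D → E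
  | 0 => fun p => γ p.1
  | j + 1 => fun p => fderiv ℝ (taylorTerm γ j) p (p.2, 0)

/-- The Taylor polynomial in `t` of `γ (x + i t w)`, with the derivatives of `γ` shifted by `k`. -/
noncomputable def taylorDisc (γ : Rn D → E) (n k : ℕ) (x : Rn D) (t : ℝ) (w : Rn D) : E :=
  ∑ j ∈ Finset.range n, ((Complex.I * t) ^ j / (j.factorial : ℂ)) • taylorTerm γ (j + k) (x, w)

variable {γ : Rn D → E} {U : Set (Rn D)}

theorem contDiffOn_taylorTerm (hU : IsOpen U) (hγ : ContDiffOn ℝ ∞ γ U) (j : ℕ) :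
    ContDiffOn ℝ ∞ (taylorTerm γ j) (U ×ˢ univ) := by
  induction j with
  | zero => exact hγ.comp contDiffOn_fst fun p hp => hp.1
  | succ j ih =>
    exact (ih.fderiv_of_isOpen (m := ∞) (hU.prod isOpen_univ) le_rfl).clm_apply
      (contDiff_snd.prodMk contDiff_const).contDiffOn

theorem hasDerivAt_taylorTerm (hU : IsOpen U) (hγ : ContDiffOn ℝ ∞ γ U) (j : ℕ) {x w : Rn D}
    {s : ℝ} (hx : x + s • w ∈ U) :
    HasDerivAt (fun s : ℝ => taylorTerm γ j (x + s • w, w)) (taylorTerm γ (j + 1) (x + s • w, w))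
      s := by
  have h1 : HasFDerivAt (taylorTerm γ j) (fderiv ℝ (taylorTerm γ j) (x + s • w, w))
      (x + s • w, w) :=
    (((contDiffOn_taylorTerm hU hγ j).contDiffAt
      ((hU.prod isOpen_univ).mem_nhds ⟨hx, mem_univ _⟩)).differentiableAt (by simp)).hasFDerivAt
  have h2 : HasDerivAt (fun s : ℝ => (x + s • w, w)) (w, 0) s := by
    have : HasDerivAt (fun s : ℝ => x + s • w) w s := by
      simpa using ((hasDerivAt_id s).smul_const w).const_add x
    exact this.prodMk (hasDerivAt_const s w)
  exact h1.comp_hasDerivAt s h2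

theorem taylorTerm_smul (hU : IsOpen U) (hγ : ContDiffOn ℝ ∞ γ U) (j : ℕ) {x : Rn D} (hx : x ∈ U)
    (t : ℝ) (w : Rn D) : taylorTerm γ j (x, t • w) = t ^ j • taylorTerm γ j (x, w) := by
  induction j generalizing x with
  | zero => simp [taylorTerm]
  | succ j ih =>
    have h1 := hasDerivAt_taylorTerm (x := x) (w := t • w) (s := 0) hU hγ j (by simpa using hx)
    have h2 : HasDerivAt (fun s : ℝ => taylorTerm γ j (x + (s * t) • w, w))
        (t • taylorTerm γ (j + 1) (x, w)) 0 := by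
      have h3 := hasDerivAt_taylorTerm (x := x) (w := w) (s := 0 * t) hU hγ j (by simpa using hx)
      have h4 : HasDerivAt (fun s : ℝ => s * t) t 0 := by simpa using (hasDerivAt_id (0 : ℝ)).mul_const t
      simpa [Function.comp_def] using h3.scomp (0 : ℝ) h4
    have hc : ∀ᶠ s : ℝ in 𝓝 0, x + s • t • w ∈ U := by
      have : Continuous fun s : ℝ => x + s • t • w := by fun_prop
      exact this.continuousAt.eventually_mem (by simpa using hU.mem_nhds hx)
    have h5 : HasDerivAt (fun s : ℝ => taylorTerm γ j (x + s • t • w, t • w))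
        (t ^ j • t • taylorTerm γ (j + 1) (x, w)) 0 := by
      refine (h2.const_smul (t ^ j)).congr_of_eventuallyEq ?_
      filter_upwards [hc] with s hs
      rw [ih hs, Pi.smul_apply, mul_smul]
    have h6 := h1.unique h5
    simpa [pow_succ, mul_smul] using h6

theorem taylorDisc_eq_one (hU : IsOpen U) (hγ : ContDiffOn ℝ ∞ γ U) (n : ℕ) {x : Rn D}
    (hx : x ∈ U) (t : ℝ) (w : Rn D) : taylorDisc γ n 0 x t w = taylorDisc γ n 0 x 1 (t • w) := by
  refine Finset.sum_congr rfl fun j _ => ?_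
  rw [add_zero, taylorTerm_smul hU hγ j hx, ← Complex.coe_smul (t ^ j), smul_smul]
  congr 1
  push_cast
  ring

theorem taylorDisc_succ (n k : ℕ) (x : Rn D) (t : ℝ) (w : Rn D) :
    taylorDisc γ (n + 1) k x t w = taylorDisc γ n k x t w +
      ((Complex.I * t) ^ n / (n.factorial : ℂ)) • taylorTerm γ (n + k) (x, w) :=
  Finset.sum_range_succ _ _

theorem taylorDisc_zero_right (n : ℕ) (x : Rn D) (t : ℝ) : taylorDisc γ (n + 1) 0 x t 0 = γ x := by
  rw [taylorDisc, Finset.sum_range_succ', Finset.sum_eq_zero fun j _ => ?_]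
  · simp [taylorTerm]
  · have : taylorTerm γ (j + 1 + 0) (x, 0) = 0 := (fderiv ℝ (taylorTerm γ j) (x, 0)).map_zero
    rw [this, smul_zero]

theorem taylorDisc_zero_middle (n k : ℕ) (x w : Rn D) :
    taylorDisc γ (n + 1) k x 0 w = taylorTerm γ k (x, w) := by
  rw [taylorDisc, Finset.sum_range_succ', Finset.sum_eq_zero fun j _ => ?_]
  · simp
  · simp

theorem contDiffOn_taylorDisc (hU : IsOpen U) (hγ : ContDiffOn ℝ ∞ γ U) (n k : ℕ) {P : Type*}
    [NormedAddCommGroup P] [NormedSpace ℝ P] {s : Set P} {a w : P → Rn D} {t : P → ℝ}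
    (ha : ContDiffOn ℝ ∞ a s) (ht : ContDiffOn ℝ ∞ t s) (hw : ContDiffOn ℝ ∞ w s)
    (hs : MapsTo a s U) :
    ContDiffOn ℝ ∞ (fun p => taylorDisc γ n k (a p) (t p) (w p)) s := by
  refine ContDiffOn.sum fun j _ => ContDiffOn.smul ?_ ?_
  · have h : ContDiffOn ℝ ∞ (fun p => (t p : ℂ)) s := Complex.ofRealCLM.contDiff.comp_contDiffOn ht
    exact ((contDiffOn_const.mul h).pow j).div_const _
  · exact ContDiffOn.comp (g := taylorTerm γ (j + k)) (f := fun p => (a p, w p))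
      (contDiffOn_taylorTerm hU hγ (j + k)) (ha.prodMk hw) fun p hp => ⟨hs hp, mem_univ _⟩

theorem hasDerivAt_taylorDisc_left (hU : IsOpen U) (hγ : ContDiffOn ℝ ∞ γ U) (n k : ℕ) {x w : Rn D}
    {s : ℝ} (t : ℝ) (hx : x + s • w ∈ U) :
    HasDerivAt (fun s : ℝ => taylorDisc γ n k (x + s • w) t w)
      (taylorDisc γ n (k + 1) (x + s • w) t w) s := by
  unfold taylorDisc
  exact HasDerivAt.fun_sum fun j _ => (hasDerivAt_taylorTerm hU hγ (j + k) hx).const_smul _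

theorem hasDerivAt_taylorDisc_middle (n k : ℕ) (x w : Rn D) (t : ℝ) :
    HasDerivAt (fun t : ℝ => taylorDisc γ (n + 1) k x t w)
      (Complex.I • taylorDisc γ n (k + 1) x t w) t := by
  have hpow : ∀ j : ℕ, HasDerivAt
      (fun t : ℝ => (Complex.I * t) ^ (j + 1) / ((j + 1).factorial : ℂ))
      (Complex.I * ((Complex.I * t) ^ j / (j.factorial : ℂ))) t := by
    intro j
    have h1 : HasDerivAt (fun t : ℝ => Complex.I * (t : ℂ)) Complex.I t := by
      simpa using ((hasDerivAt_id (t : ℂ)).comp_ofReal).const_mul Complex.I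
    refine ((h1.pow (j + 1)).div_const _).congr_deriv ?_
    rw [Nat.factorial_succ]
    have : (j.factorial : ℂ) ≠ 0 := by exact_mod_cast j.factorial_ne_zero
    have : ((j : ℂ) + 1) ≠ 0 := by exact_mod_cast j.succ_ne_zero
    push_cast
    field_simp
  have h2 : HasDerivAt (fun t : ℝ => (∑ j ∈ Finset.range n,
      ((Complex.I * t) ^ (j + 1) / ((j + 1).factorial : ℂ)) • taylorTerm γ (j + 1 + k) (x, w)) +
      ((Complex.I * t) ^ 0 / ((Nat.factorial 0 : ℕ) : ℂ)) • taylorTerm γ (0 + k) (x, w))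
      (∑ j ∈ Finset.range n, (Complex.I * ((Complex.I * t) ^ j / (j.factorial : ℂ))) •
        taylorTerm γ (j + 1 + k) (x, w)) t := by
    refine HasDerivAt.add_const _ ?_ |>.congr_of_eventuallyEq
      (f := fun t : ℝ => (∑ j ∈ Finset.range n,
      ((Complex.I * t) ^ (j + 1) / ((j + 1).factorial : ℂ)) • taylorTerm γ (j + 1 + k) (x, w)) +
      taylorTerm γ (0 + k) (x, w)) (Eventually.of_forall fun t => by simp)
    exact HasDerivAt.fun_sum fun j _ => (hpow j).smul_const _
  unfold taylorDisc
  simp only [Finset.sum_range_succ' _ n]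
  refine h2.congr_deriv ?_
  rw [Finset.smul_sum]
  refine Finset.sum_congr rfl fun j _ => ?_
  rw [mul_smul, show j + 1 + k = j + (k + 1) by ring]

/-- At the points of the edge, `(x, w) ↦ γ (x + i w)` has the `ℝ`-linear differential
`(X, Y) ↦ dγ X + i dγ Y`. -/
theorem hasStrictFDerivAt_taylorDisc (hU : IsOpen U) (hγ : ContDiffOn ℝ ∞ γ U) (n : ℕ) {x₀ : Rn D}
    (hx₀ : x₀ ∈ U) :
    HasStrictFDerivAt (fun p : Rn D × Rn D => taylorDisc γ (n + 2) 0 p.1 1 p.2)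
      ((fderiv ℝ γ x₀).comp (ContinuousLinearMap.fst ℝ _ _) +
        Complex.I • (fderiv ℝ γ x₀).comp (ContinuousLinearMap.snd ℝ _ _)) (x₀, 0) := by
  set f := fun p : Rn D × Rn D => taylorDisc γ (n + 2) 0 p.1 1 p.2 with hf
  have hcd : ContDiffAt ℝ ∞ f (x₀, 0) := by
    have h1 : ContDiffOn ℝ ∞ f (U ×ˢ univ) := contDiffOn_taylorDisc hU hγ (n + 2) 0
      contDiffOn_fst contDiffOn_const contDiffOn_snd fun p hp => hp.1
    exact h1.contDiffAt ((hU.prod isOpen_univ).mem_nhds ⟨hx₀, mem_univ _⟩)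
  have hd : HasFDerivAt f (fderiv ℝ f (x₀, 0)) (x₀, 0) :=
    (hcd.differentiableAt (by simp)).hasFDerivAt
  have hγd : HasFDerivAt γ (fderiv ℝ γ x₀) x₀ :=
    ((hγ.contDiffAt (hU.mem_nhds hx₀)).differentiableAt (by simp)).hasFDerivAt
  refine (hcd.hasStrictFDerivAt (by simp)).congr_fderiv ?_
  have h1 : ∀ X, fderiv ℝ f (x₀, 0) (X, 0) = fderiv ℝ γ x₀ X := by
    intro X
    have hl : HasFDerivAt (fun x : Rn D => (x, (0 : Rn D)))
        ((ContinuousLinearMap.id ℝ _).prod 0) x₀ :=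
      (hasFDerivAt_id x₀).prodMk (hasFDerivAt_const _ _)
    have h2 := hd.comp x₀ hl
    have h3 : f ∘ (fun x : Rn D => (x, (0 : Rn D))) = γ := by
      ext1 x
      exact taylorDisc_zero_right (n + 1) x 1
    rw [h3] at h2
    rw [hγd.unique h2]
    simp
  have h2 : ∀ Y, fderiv ℝ f (x₀, 0) (0, Y) = Complex.I • fderiv ℝ γ x₀ Y := by
    intro Y
    have hl : HasDerivAt (fun t : ℝ => (x₀, t • Y)) (0, Y) 0 :=
      (hasDerivAt_const _ _).prodMk (by simpa using (hasDerivAt_id (0 : ℝ)).smul_const Y)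
    have h3 := HasFDerivAt.comp_hasDerivAt (f := fun t : ℝ => (x₀, t • Y)) (l := f) (0 : ℝ)
      (by simpa using hd) hl
    have h4 := hasDerivAt_taylorDisc_middle (γ := γ) (n + 1) 0 x₀ Y 0
    have h5 : f ∘ (fun t : ℝ => (x₀, t • Y)) = fun t : ℝ => taylorDisc γ (n + 2) 0 x₀ t Y := by
      ext1 t
      exact (taylorDisc_eq_one hU hγ (n + 2) hx₀ t Y).symm
    rw [h5] at h3
    rw [h3.unique h4, taylorDisc_zero_middle]
    congr 1
    have h6 : HasFDerivAt (taylorTerm γ 0) ((fderiv ℝ γ x₀).comp (ContinuousLinearMap.fst ℝ _ _))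
        (x₀, Y) := HasFDerivAt.comp (g := γ) (x₀, Y) hγd hasFDerivAt_fst
    change fderiv ℝ (taylorTerm γ 0) (x₀, Y) (Y, 0) = _
    rw [h6.fderiv]
    simp
  refine ContinuousLinearMap.ext fun p => ?_
  have hp : p = (p.1, 0) + (0, p.2) := by simp
  rw [hp, map_add, h1, h2]
  simp

end TaylorDiscs

/-! ### Boundedness of holomorphic functions with continuous boundary values -/

section Coverage

variable {D : ℕ} {E : Type*} [NormedAddCommGroup E] [NormedSpace ℂ E]
  {γ : Rn D → E} {U : Set (Rn D)} {x₀ : Rn D}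

theorem exists_re_im_of_frameMap {C₀ : E →L[ℂ] (Fin D → ℂ)} {A : Rn D →L[ℝ] E} {e : Fin D → Rn D}
    (hC₀ : frameMap C₀ (fun j => A (e j)) = 1) (a : E) : ∃ X Y, a = A X + Complex.I • A Y := by
  refine ⟨∑ j, (C₀ a j).re • e j, ∑ j, (C₀ a j).im • e j, ?_⟩
  have h := congrArg (fun B : E →L[ℂ] E => B a) hC₀
  simp only [frameMap_apply, one_apply_eq_self] at h
  rw [map_sum, map_sum, Finset.smul_sum, ← Finset.sum_add_distrib, ← h]
  refine Finset.sum_congr rfl fun j _ => ?_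
  rw [h, map_smul, map_smul]
  conv_lhs => rw [← Complex.re_add_im (C₀ a j)]
  rw [add_smul, mul_comm, mul_smul]
  rfl

/-- The Taylor discs in directions close to `w₀`, and their translates by small multiples of `v`, lie
in the cone region of direction `v`, where `v` and `i dγ w₀` agree up to the range of `dγ`. -/
theorem exists_taylorDisc_add_mem (hU : IsOpen U) (hγ : ContDiffOn ℝ ∞ γ U) (hx₀ : x₀ ∈ U) (n : ℕ)
    (y₀ w₀ : Rn D) {r : ℝ} (hr : 0 < r) {v : E}
    (hv : v = fderiv ℝ γ x₀ y₀ + Complex.I • fderiv ℝ γ x₀ w₀) :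
    ∃ r' > 0, r' ≤ r ∧ ∀ x ∈ Metric.ball x₀ r', ∀ w ∈ Metric.ball w₀ r', ∀ t ∈ Ico 0 r',
      ∀ ε ∈ Ico 0 r', 0 < t + ε → t + ε < r ∧ ∃ x' ∈ Metric.ball x₀ r, ∃ v' ∈ Metric.ball v r,
        taylorDisc γ (n + 2) 0 x t w + ε • v = γ x' + (t + ε) • v' := by
  set A := fderiv ℝ γ x₀ with hA
  have hsA : HasStrictFDerivAt γ A x₀ := (hγ.contDiffAt (hU.mem_nhds hx₀)).hasStrictFDerivAt (by simp)
  obtain ⟨r₁, hr₁, hr₁r, hshift⟩ := exists_shift (v := v) hsA hr (norm_nonneg y₀)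
  obtain ⟨ρ, hρ, hΘ⟩ := (hasStrictFDerivAt_taylorDisc hU hγ n hx₀).exists_norm_sub_sub_le
    (c := r₁ / (4 * (‖w₀‖ + 1))) (by positivity)
  obtain ⟨ρ', hρ', hUρ⟩ := Metric.isOpen_iff.1 hU x₀ hx₀
  obtain ⟨r', hr', h1, h2, h3, h4, h5, h6⟩ : ∃ r' > 0, r' ≤ r₁ / (4 * (‖A‖ + 1)) ∧ r' ≤ 1 ∧
      r' ≤ r₁ / 2 ∧ r' ≤ ρ ∧ r' ≤ ρ / (‖w₀‖ + 1) ∧ r' ≤ ρ' :=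
    ⟨min (r₁ / (4 * (‖A‖ + 1))) (min 1 (min (r₁ / 2) (min ρ (min (ρ / (‖w₀‖ + 1)) ρ')))),
      by positivity, by simp⟩
  refine ⟨r', hr', by linarith, fun x hx w hw t ht ε hε htε => ⟨by linarith [ht.2, hε.2], ?_⟩⟩
  have hxU : x ∈ U := hUρ (Metric.ball_subset_ball h6 hx)
  have hwn : ‖w - w₀‖ < r' := mem_ball_iff_norm.1 hw
  have hw1 : ‖w‖ ≤ ‖w₀‖ + 1 := by
    calc ‖w‖ = ‖w₀ + (w - w₀)‖ := by congr 1; abel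
      _ ≤ _ := norm_add_le _ _
      _ ≤ _ := by linarith
  have htw : ‖t • w‖ < ρ := by
    rw [norm_smul, Real.norm_of_nonneg ht.1]
    calc t * ‖w‖ ≤ t * (‖w₀‖ + 1) := mul_le_mul_of_nonneg_left hw1 ht.1
      _ < r' * (‖w₀‖ + 1) := mul_lt_mul_of_pos_right ht.2 (by positivity)
      _ ≤ ρ := (le_div_iff₀ (by positivity)).1 h5
  have hxρ : ‖x - x₀‖ < ρ := (mem_ball_iff_norm.1 hx).trans_le h4
  have hmem : ∀ y, ‖y‖ < ρ → (x, y) ∈ Metric.ball (x₀, (0 : Rn D)) ρ := fun y hy => by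
    rw [mem_ball_iff_norm, Prod.norm_def]
    exact max_lt hxρ (by simpa using hy)
  have hest := hΘ (x, t • w) (hmem _ htw) (x, 0) (hmem _ (by simpa using hρ))
  rw [← hA] at hest
  have hA'a : ∀ p : Rn D × Rn D, (A.comp (ContinuousLinearMap.fst ℝ (Rn D) (Rn D)) +
      Complex.I • A.comp (ContinuousLinearMap.snd ℝ (Rn D) (Rn D))) p = A p.1 + Complex.I • A p.2 :=
    fun p => by simp
  have hest' : ‖taylorDisc γ (n + 2) 0 x t w - γ x - t • (Complex.I • A w)‖ ≤
      t * (r₁ / 4) := by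
    rw [taylorDisc_eq_one hU hγ (n + 2) hxU]
    have e1 := taylorDisc_zero_right (γ := γ) (n + 1) x 1
    rw [hA'a] at hest
    simp only [e1, Prod.mk_sub_mk, sub_self, sub_zero, map_zero, zero_add, map_smul] at hest
    rw [smul_comm] at hest
    refine hest.trans ?_
    rw [Prod.norm_def, norm_zero, max_eq_right (norm_nonneg _), norm_smul,
      Real.norm_of_nonneg ht.1]
    calc r₁ / (4 * (‖w₀‖ + 1)) * (t * ‖w‖) ≤ r₁ / (4 * (‖w₀‖ + 1)) * (t * (‖w₀‖ + 1)) := by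
          have := ht.1
          gcongr
      _ = t * (r₁ / 4) := by field_simp
  set T := t + ε with hT
  -- The base point is moved by `- t y₀`.
  have hball : T⁻¹ • (taylorDisc γ (n + 2) 0 x t w + ε • v - γ x) ∈
      Metric.ball (v + A (-(t / T) • y₀)) r₁ := by
    have e1 : T⁻¹ • (taylorDisc γ (n + 2) 0 x t w + ε • v - γ x) - (v + A (-(t / T) • y₀)) =
        T⁻¹ • ((taylorDisc γ (n + 2) 0 x t w - γ x - t • (Complex.I • A w)) +
          t • (Complex.I • A (w - w₀))) := by
      have e2 : v + A (-(t / T) • y₀) = T⁻¹ • (t • (Complex.I • A w₀) + ε • v) := by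
        rw [eq_inv_smul_iff₀ htε.ne', smul_add, map_smul, smul_smul, hv]
        have : T * -(t / T) = - t := by field_simp
        rw [this, hT]
        module
      rw [e2, ← smul_sub, map_sub]
      congr 1
      module
    have n1 : ‖t • (Complex.I • A (w - w₀))‖ ≤ t * (r₁ / 4) := by
      rw [norm_smul, norm_smul, Complex.norm_I, one_mul, Real.norm_of_nonneg ht.1]
      refine mul_le_mul_of_nonneg_left ?_ ht.1
      calc _ ≤ ‖A‖ * ‖w - w₀‖ := A.le_opNorm _
        _ ≤ (‖A‖ + 1) * (r₁ / (4 * (‖A‖ + 1))) := by gcongr <;> linarith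
        _ = r₁ / 4 := by field_simp
    rw [mem_ball_iff_norm, e1, norm_smul, norm_inv, Real.norm_of_nonneg htε.le]
    calc _ ≤ T⁻¹ * (t * (r₁ / 4) + t * (r₁ / 4)) := by
          gcongr
          exact (norm_add_le _ _).trans (add_le_add hest' n1)
      _ = t / T * (r₁ / 2) := by ring
      _ ≤ 1 * (r₁ / 2) := by
          gcongr
          exact (div_le_one htε).2 (by linarith [hε.1])
      _ < r₁ := by linarith
  obtain ⟨x', hx', v', hv', h⟩ := hshift x (Metric.ball_subset_ball (by linarith) hx) T
    ⟨htε, by linarith [ht.2, hε.2]⟩ (-(t / T) • y₀) (by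
      rw [norm_smul, norm_neg, norm_div, Real.norm_of_nonneg ht.1, Real.norm_of_nonneg htε.le]
      exact mul_le_of_le_one_left (norm_nonneg _) ((div_le_one htε).2 (by linarith [hε.1])))
    _ hball
  refine ⟨x', hx', v', hv', ?_⟩
  rw [← h, smul_inv_smul₀ htε.ne']
  abel

/-- The Taylor discs in directions close to `w₀` fill the cone region of direction `v`. -/
theorem exists_eq_taylorDisc [FiniteDimensional ℂ E] (hU : IsOpen U) (hγ : ContDiffOn ℝ ∞ γ U)
    (hx₀ : x₀ ∈ U) (n : ℕ)
    (hspan : ∀ a, ∃ X Y, a = fderiv ℝ γ x₀ X + Complex.I • fderiv ℝ γ x₀ Y)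
    (y₀ w₀ : Rn D) {r : ℝ} (hr : 0 < r) {v : E}
    (hv : v = fderiv ℝ γ x₀ y₀ + Complex.I • fderiv ℝ γ x₀ w₀) :
    ∃ r' > 0, r' ≤ r ∧ ∀ x ∈ Metric.ball x₀ r', ∀ t ∈ Ioo 0 r', ∀ v' ∈ Metric.ball v r',
      ∃ x' ∈ Metric.ball x₀ r, ∃ w ∈ Metric.ball w₀ r,
        taylorDisc γ (n + 2) 0 x' t w = γ x + t • v' := by
  set A := fderiv ℝ γ x₀ with hA
  set A' : Rn D × Rn D →L[ℝ] E := A.comp (ContinuousLinearMap.fst ℝ _ _) +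
        Complex.I • A.comp (ContinuousLinearMap.snd ℝ _ _) with hA'
  have hA'a : ∀ p, A' p = A p.1 + Complex.I • A p.2 := fun p => by simp [hA']
  have : FiniteDimensional ℝ E := FiniteDimensional.complexToReal E
  have : CompleteSpace E := FiniteDimensional.complete ℝ E
  have hsurj : A'.range = ⊤ := by
    rw [LinearMap.range_eq_top]
    intro a
    obtain ⟨X, Y, h⟩ := hspan a
    exact ⟨(X, Y), (hA'a _).trans h.symm⟩
  set inv := A'.nonlinearRightInverseOfSurjective hsurj
  have hinv : 0 < (inv.nnnorm : ℝ) := A'.nonlinearRightInverseOfSurjective_nnnorm_pos hsurj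
  set q := (inv.nnnorm : ℝ)⁻¹ with hq
  have hqp : 0 < q := inv_pos.2 hinv
  -- `c` is so small that the image under the disc map of a ball of radius `t r / 2` contains a
  -- ball of radius `c (‖y₀‖ + ‖w₀‖ + 1) t` around the image of the centre.
  obtain ⟨c, hc, hcq, hcr⟩ : ∃ c > 0, c ≤ q / 2 ∧ 2 * c * (‖y₀‖ + ‖w₀‖ + 1) ≤ q / 2 * (r / 2) :=
    ⟨min (q / 2) (q / 2 * (r / 2) / (2 * (‖y₀‖ + ‖w₀‖ + 1))), by positivity, min_le_left _ _, by
      have := min_le_right (q / 2) (q / 2 * (r / 2) / (2 * (‖y₀‖ + ‖w₀‖ + 1)))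
      rw [le_div_iff₀ (by positivity)] at this
      linarith⟩
  obtain ⟨ρ, hρ, hΘ⟩ :=
    (hasStrictFDerivAt_taylorDisc hU hγ n hx₀).exists_norm_sub_sub_le hc
  obtain ⟨ρ', hρ', hUρ⟩ := Metric.isOpen_iff.1 hU x₀ hx₀
  set m := min ρ (min r ρ') with hm
  have hmp : 0 < m := by positivity
  have hmρ : m ≤ ρ := min_le_left _ _
  have hmr : m ≤ r := (min_le_right _ _).trans (min_le_left _ _)
  have hmρ' : m ≤ ρ' := (min_le_right _ _).trans (min_le_right _ _)
  set Q := ‖y₀‖ + ‖w₀‖ + r + 1 with hQ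
  have hQp : 0 < Q := by positivity
  obtain ⟨r', hr', h1, h2, h3⟩ : ∃ r' > 0, r' ≤ c ∧ r' ≤ m / (2 * Q) ∧ r' ≤ r :=
    ⟨min c (min (m / (2 * Q)) r), by positivity, by simp⟩
  have h2' : r' * Q ≤ m / 2 := by
    rw [le_div_iff₀ (by positivity)] at h2
    linarith
  refine ⟨r', hr', h3, fun x hx t ht v' hv' => ?_⟩
  have ht0 := ht.1
  have hxn : ‖x - x₀‖ < r' := mem_ball_iff_norm.1 hx
  have hxm : ‖x - x₀‖ < m / 2 := hxn.trans_le ((le_mul_of_one_le_right hr'.le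
    (by rw [hQ]; linarith [norm_nonneg y₀, norm_nonneg w₀])).trans h2')
  have hbig : ∀ p ∈ Metric.closedBall (x + t • y₀, t • w₀) (t * (r / 2)),
      ‖p.1 - x₀‖ < m ∧ ‖p.2‖ < m ∧ ‖p.2 - t • w₀‖ ≤ t * (r / 2) := by
    intro p hp
    rw [mem_closedBall_iff_norm, Prod.norm_def, max_le_iff] at hp
    have hp1 : ‖p.1 - (x + t • y₀)‖ ≤ t * (r / 2) := hp.1
    have hp2 : ‖p.2 - t • w₀‖ ≤ t * (r / 2) := hp.2
    have ey : ‖t • y₀‖ = t * ‖y₀‖ := by rw [norm_smul, Real.norm_of_nonneg ht0.le]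
    have ew : ‖t • w₀‖ = t * ‖w₀‖ := by rw [norm_smul, Real.norm_of_nonneg ht0.le]
    have hty : t * ‖y₀‖ + t * ‖w₀‖ + t * r < m / 2 := by
      calc _ ≤ t * Q := by rw [hQ]; nlinarith
        _ < r' * Q := mul_lt_mul_of_pos_right ht.2 hQp
        _ ≤ m / 2 := h2'
    have htr : 0 < t * r := mul_pos ht0 hr
    have hty0 : 0 ≤ t * ‖y₀‖ := by positivity
    have htw0 : 0 ≤ t * ‖w₀‖ := by positivity
    refine ⟨?_, ?_, hp2⟩
    · calc ‖p.1 - x₀‖ = ‖(p.1 - (x + t • y₀)) + (x - x₀) + t • y₀‖ := by congr 1; abel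
        _ ≤ ‖p.1 - (x + t • y₀)‖ + ‖x - x₀‖ + ‖t • y₀‖ := norm_add₃_le
        _ < m := by rw [ey]; linarith
    · calc ‖p.2‖ = ‖(p.2 - t • w₀) + t • w₀‖ := by congr 1; abel
        _ ≤ _ := norm_add_le _ _
        _ < m := by rw [ew]; linarith
  have happ : ApproximatesLinearOn (fun p : Rn D × Rn D => taylorDisc γ (n + 2) 0 p.1 1 p.2) A'
      (Metric.ball (x₀, 0) ρ) ⟨c, hc.le⟩ := fun p hp p' hp' => hΘ p hp p' hp'
  have hmem : ∀ {p : Rn D × Rn D}, ‖p.1 - x₀‖ < m → ‖p.2‖ < m → p ∈ Metric.ball (x₀, 0) ρ := by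
    intro p h1 h2
    rw [mem_ball_iff_norm, Prod.norm_def]
    exact max_lt (h1.trans_le hmρ) (by simpa using h2.trans_le hmρ)
  have hcenter := hbig _ (Metric.mem_closedBall_self (by positivity))
  have hsurjOn := happ.surjOn_closedBall_of_nonlinearRightInverse inv
    (ε := t * (r / 2)) (b := (x + t • y₀, t • w₀)) (by positivity)
    fun p hp => hmem (hbig p hp).1 (hbig p hp).2.1
  have htarget : γ x + t • v' ∈ Metric.closedBall (taylorDisc γ (n + 2) 0 (x + t • y₀) 1 (t • w₀))
      ((q - c) * (t * (r / 2))) := by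
    have hest := hΘ (x + t • y₀, t • w₀) (hmem hcenter.1 hcenter.2.1) (x, 0)
      (hmem (by linarith) (by simpa using hmp))
    have e1 := taylorDisc_zero_right (γ := γ) (n + 1) x 1
    have e2 : A' ((x + t • y₀, t • w₀) - (x, 0)) = t • v := by
      rw [hA'a, hv]
      simp only [Prod.mk_sub_mk, add_sub_cancel_left, sub_zero, map_smul, smul_add]
      rw [smul_comm]
    rw [← hA', e2] at hest
    simp only [e1, Prod.mk_sub_mk, add_sub_cancel_left, sub_zero] at hest
    have e3 : ‖(t • y₀, t • w₀)‖ ≤ t * (‖y₀‖ + ‖w₀‖) := by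
      rw [Prod.norm_def, norm_smul, norm_smul, Real.norm_of_nonneg ht0.le]
      refine max_le ?_ ?_ <;> nlinarith [norm_nonneg y₀, norm_nonneg w₀]
    rw [mem_closedBall_iff_norm]
    have hv'n : ‖v' - v‖ ≤ c := (mem_ball_iff_norm.1 hv').le.trans h1
    calc ‖γ x + t • v' - taylorDisc γ (n + 2) 0 (x + t • y₀) 1 (t • w₀)‖
        = ‖t • (v' - v) - (taylorDisc γ (n + 2) 0 (x + t • y₀) 1 (t • w₀) - γ x - t • v)‖ := by
          congr 1
          rw [smul_sub]
          abel
      _ ≤ ‖t • (v' - v)‖ + c * ‖(t • y₀, t • w₀)‖ := (norm_sub_le _ _).trans (by gcongr)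
      _ ≤ t * c + c * (t * (‖y₀‖ + ‖w₀‖)) := by
          rw [norm_smul, Real.norm_of_nonneg ht0.le]
          gcongr
      _ = t * (c * (‖y₀‖ + ‖w₀‖ + 1)) := by ring
      _ ≤ t * (q / 2 * (r / 2)) := by
          have : 0 ≤ c * (‖y₀‖ + ‖w₀‖ + 1) := by positivity
          exact mul_le_mul_of_nonneg_left (by linarith) ht0.le
      _ ≤ (q - c) * (t * (r / 2)) := by
          have : q / 2 ≤ q - c := by linarith
          rw [show t * (q / 2 * (r / 2)) = q / 2 * (t * (r / 2)) by ring]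
          exact mul_le_mul_of_nonneg_right this (by positivity)
  obtain ⟨p, hp, hpe⟩ := hsurjOn htarget
  obtain ⟨hp1, hp2, hp3⟩ := hbig p hp
  refine ⟨p.1, mem_ball_iff_norm.2 (hp1.trans_le hmr), t⁻¹ • p.2, ?_, ?_⟩
  · rw [mem_ball_iff_norm]
    have e : t⁻¹ • p.2 - w₀ = t⁻¹ • (p.2 - t • w₀) := by
      rw [smul_sub, inv_smul_smul₀ ht0.ne']
    rw [e, norm_smul, norm_inv, Real.norm_of_nonneg ht0.le]
    calc _ ≤ t⁻¹ * (t * (r / 2)) := by gcongr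
      _ = r / 2 := by field_simp
      _ < r := half_lt_self hr
  · rw [taylorDisc_eq_one hU hγ _ (hUρ (mem_ball_iff_norm.2 (hp1.trans_le hmρ'))),
      smul_inv_smul₀ ht0.ne']
    exact hpe

end Coverage

section Boundedness

variable {D : ℕ} {E : Type*} [NormedAddCommGroup E] [NormedSpace ℂ E]
  {γ : Rn D → E} {U : Set (Rn D)} {x₀ : Rn D}

/-- The functional `T` on test functions supported near `x₀` is the boundary value of `F` along the
direction `v`. -/
def HasLinearBoundaryValue (γ : Rn D → E) (x₀ : Rn D) (v : E) (r : ℝ) (F : E → ℂ)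
    (T : (Rn D → ℂ) → ℂ) : Prop :=
  ∀ φ : Rn D → ℂ, ContDiff ℝ ∞ φ → tsupport φ ⊆ Metric.ball x₀ r →
    Tendsto (fun ε : ℝ => ∫ x, F (γ x + ε • v) * φ x) (𝓝[>] 0) (𝓝 (T φ))

theorem norm_integral_mul_density_le {φ : Rn D → ℝ} (hφ0 : ∀ x, 0 ≤ φ x) (hφ1 : ∫ x, φ x = 1)
    {f : Rn D → ℂ} {B : ℝ} (hf : ∀ x, φ x ≠ 0 → ‖f x‖ ≤ B) : ‖∫ x, f x * (φ x : ℂ)‖ ≤ B := by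
  have hint : Integrable φ := by
    by_contra h
    rw [integral_undef h] at hφ1
    exact zero_ne_one hφ1
  calc _ ≤ ∫ x, B * φ x := by
        refine norm_integral_le_of_norm_le (hint.const_mul B) (Eventually.of_forall fun x => ?_)
        rw [norm_mul, Complex.norm_real, Real.norm_of_nonneg (hφ0 x)]
        by_cases hx : φ x = 0
        · simp [hx]
        · exact mul_le_mul_of_nonneg_right (hf x hx) (hφ0 x)
    _ = B := by rw [integral_const_mul, hφ1, mul_one]

/-- If the boundary value of `F` is bounded by `M`, then the means of `F` over the Taylor discs are
almost bounded by `M` near the edge, uniformly along the edge. -/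
theorem exists_norm_integral_taylorDisc_le [CompleteSpace E] (hU : IsOpen U)
    (hγ : ContDiffOn ℝ ∞ γ U) {r : ℝ} (hr : 0 < r) (hrU : Metric.ball x₀ r ⊆ U)
    {e : Fin D → Rn D} {C₀ : E →L[ℂ] (Fin D → ℂ)}
    (hC₀ : ∀ x ∈ Metric.ball x₀ r, ‖frameMap C₀ (fun j => fderiv ℝ γ x (e j)) - 1‖ < 1)
    {v : E} {R : Set E} (hR : IsOpen R) {F : E → ℂ} (hF : DifferentiableOn ℂ F R) {N : ℕ}
    {w : Rn D} (hmem : ∀ x ∈ Metric.ball x₀ r, ∀ t ∈ Ico 0 r, ∀ ε ∈ Ico 0 r, 0 < t + ε →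
      taylorDisc γ (N + 1) 0 x t w + ε • v ∈ R) {C : ℝ} {l : ℕ}
    (hgrowth : ∀ x ∈ Metric.ball x₀ r, ∀ t ∈ Ioo 0 r, ∀ ε ∈ Ico 0 r,
      ‖F (taylorDisc γ (N + 1) 0 x t w + ε • v)‖ ≤ C / t ^ l)
    {u : Rn D → ℂ} {M : ℝ} (hM : ∀ x ∈ Metric.ball x₀ r, ‖u x‖ ≤ M)
    (hbv : HasLinearBoundaryValue γ x₀ v r F fun φ => ∫ x, u x * φ x)
    {φ : Rn D → ℝ} (hφ : ContDiff ℝ ∞ φ) (hφ0 : ∀ x, 0 ≤ φ x) (hφ1 : ∫ x, φ x = 1)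
    (hφs : ∀ x ∉ Metric.closedBall x₀ (r / 2), φ x = 0) {a : ℝ} (haw : a * ‖w‖ ≤ r / 4)
    {η : ℝ} (hη : 0 < η) :
    ∃ τ₀ > 0, ∀ τ ∈ Ioo 0 τ₀, ∀ s ∈ Icc (-a) a,
      ‖∫ x, F (taylorDisc γ (N + 1) 0 (x + s • w) τ w) * (φ x : ℂ)‖ ≤ M + η := by
  have hK : ∀ y ∈ Metric.ball (0 : Rn D) (3 * r / 8), ∀ x ∉ Metric.closedBall x₀ (7 * r / 8),
      φ (x - y) = 0 := by
    intro y hy x hx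
    refine hφs _ fun h => hx ?_
    rw [mem_closedBall_iff_norm] at h ⊢
    rw [mem_ball_zero_iff] at hy
    calc ‖x - x₀‖ = ‖(x - y - x₀) + y‖ := by congr 1; abel
      _ ≤ _ := norm_add_le _ _
      _ ≤ _ := by linarith
  have hKsub : Metric.closedBall x₀ (7 * r / 8) ⊆ Metric.ball x₀ r :=
    Metric.closedBall_subset_ball (by linarith)
  have hYsub : (fun s : ℝ => s • w) '' Icc (-a) a ⊆ Metric.ball 0 (3 * r / 8) := by
    rintro _ ⟨s, hs, rfl⟩
    rw [mem_ball_zero_iff, norm_smul, Real.norm_eq_abs]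
    calc _ ≤ a * ‖w‖ := mul_le_mul_of_nonneg_right (abs_le.2 hs) (norm_nonneg _)
      _ < _ := by linarith
  have hφ' : ContDiff ℝ ∞ fun z : Rn D => (φ z : ℂ) := Complex.ofRealCLM.contDiff.comp hφ
  obtain ⟨B, δ₁, hδ₁, hB⟩ := norm_integral_sub_boundaryValue_le (L := l)
    (U := Metric.ball x₀ r) (K := Metric.closedBall x₀ (7 * r / 8)) Metric.isOpen_ball
    (isCompact_closedBall _ _) hKsub hr
    (ψ := fun p : Rn D × ℝ => taylorDisc γ (N + 1) 0 p.1 p.2 w)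
    (contDiffOn_infty.1 (contDiffOn_taylorDisc hU hγ (N + 1) 0 contDiffOn_fst contDiffOn_snd
      contDiffOn_const fun p hp => hrU hp.1) (l + 2)) (γ := γ)
    (fun x _ => by rw [taylorDisc_zero_middle]; rfl) hC₀ hR hF (v := v)
    (fun x hx => hmem x (hKsub hx)) (fun x hx => hgrowth x (hKsub hx))
    (φ := fun z => (φ (-z) : ℂ)) (contDiff_infty.1 (hφ'.comp contDiff_neg) (l + 1))
    (Y₀ := Metric.ball 0 (3 * r / 8)) (Y₁ := (fun s : ℝ => s • w) '' Icc (-a) a)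
    Metric.isOpen_ball (isCompact_Icc.image (by fun_prop)) hYsub
    (fun y hy x hx => by rw [neg_sub, hK y hy x hx, Complex.ofReal_zero])
    (l := fun y => ∫ x, u x * (φ (x - y) : ℂ)) (fun y hy => by
      simp only [neg_sub]
      refine hbv (fun x => (φ (x - y) : ℂ)) (hφ'.comp (contDiff_id.sub contDiff_const)) ?_
      refine (closure_minimal ?_ Metric.isClosed_closedBall).trans hKsub
      intro x hx
      by_contra hx'
      exact hx (by simp only [hK y (hYsub hy) x hx', Complex.ofReal_zero]))
  refine ⟨min δ₁ ((η / (|B| + 1)) ^ 2), lt_min hδ₁.1 (by positivity), fun τ hτ s hs => ?_⟩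
  have h1 := hB τ ⟨hτ.1, (hτ.2.trans_le (min_le_left _ _)).le⟩ (s • w) ⟨s, hs, rfl⟩
  have h2 : ‖∫ x, u x * (φ (x - s • w) : ℂ)‖ ≤ M := by
    refine norm_integral_mul_density_le (φ := fun x => φ (x - s • w)) (fun x => hφ0 _) ?_ ?_
    · rw [integral_sub_right_eq_self (fun x => φ x) (s • w), hφ1]
    · intro x hx
      refine hM x (hKsub ?_)
      by_contra hx'
      exact hx (hK _ (hYsub ⟨s, hs, rfl⟩) x hx')
  have h3 : ∫ x, F (taylorDisc γ (N + 1) 0 (x + s • w) τ w) * (φ x : ℂ) =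
      ∫ x, F (taylorDisc γ (N + 1) 0 x τ w) * (φ (x - s • w) : ℂ) := by
    rw [← integral_add_right_eq_self (fun x => F (taylorDisc γ (N + 1) 0 x τ w) *
      (φ (x - s • w) : ℂ)) (s • w)]
    simp only [add_sub_cancel_right]
  have h4 : B * √τ ≤ η := by
    have hs : √τ ≤ η / (|B| + 1) :=
      Real.sqrt_le_iff.2 ⟨by positivity, (hτ.2.trans_le (min_le_right _ _)).le⟩
    calc B * √τ ≤ |B| * (η / (|B| + 1)) :=
          mul_le_mul (le_abs_self B) hs (Real.sqrt_nonneg _) (abs_nonneg _)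
      _ = η * (|B| / (|B| + 1)) := by ring
      _ ≤ η * 1 := by
          gcongr
          exact (div_le_one (by positivity)).2 (by linarith)
      _ = η := mul_one _
  simp only [neg_sub] at h1
  rw [h3]
  calc _ = ‖(∫ x, u x * (φ (x - s • w) : ℂ)) +
        ((∫ x, F (taylorDisc γ (N + 1) 0 x τ w) * (φ (x - s • w) : ℂ)) -
          ∫ x, u x * (φ (x - s • w) : ℂ))‖ := by congr 1; ring
    _ ≤ _ := (norm_add_le _ _).trans (add_le_add h2 (h1.trans h4))

theorem exists_ball_norm_frameMap_sub_one_lt (hU : IsOpen U) (hγ : ContDiffOn ℝ ∞ γ U)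
    (hx₀ : x₀ ∈ U) {e : Fin D → Rn D} {C₀ : E →L[ℂ] (Fin D → ℂ)}
    (hC₀ : frameMap C₀ (fun j => fderiv ℝ γ x₀ (e j)) = 1) :
    ∃ r > 0, Metric.ball x₀ r ⊆ U ∧
      ∀ x ∈ Metric.ball x₀ r, ‖frameMap C₀ (fun j => fderiv ℝ γ x (e j)) - 1‖ < 1 := by
  have hd : ∀ j, ContDiffOn ℝ ∞ (fun x => fderiv ℝ γ x (e j)) U := fun j =>
    (hγ.fderiv_of_isOpen (m := ∞) hU le_rfl).clm_apply contDiffOn_const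
  have hc : ContinuousAt (fun x => ‖frameMap C₀ (fun j => fderiv ℝ γ x (e j)) - 1‖) x₀ :=
    (((contDiffOn_frameMap C₀ hd).continuousOn.continuousAt (hU.mem_nhds hx₀)).sub
      continuousAt_const).norm
  have h1 : ∀ᶠ x in 𝓝 x₀, x ∈ U ∧ ‖frameMap C₀ (fun j => fderiv ℝ γ x (e j)) - 1‖ < 1 :=
    (show ∀ᶠ x in 𝓝 x₀, x ∈ U from hU.mem_nhds hx₀).and (hc.eventually_lt continuousAt_const (by simp [hC₀]))
  obtain ⟨r, hr, h⟩ := Metric.eventually_nhds_iff_ball.1 h1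
  exact ⟨r, hr, fun x hx => (h x hx).1, fun x hx => (h x hx).2⟩

theorem taylorDisc_dbar (n : ℕ) (x : Rn D) (t : ℝ) (w : Rn D) :
    Complex.I • taylorDisc γ (n + 1) 1 x t w - Complex.I • taylorDisc γ (n + 2) 1 x t w =
      -(Complex.I • ((Complex.I * t) ^ (n + 1) / ((n + 1).factorial : ℂ)) •
        taylorTerm γ (n + 2) (x, w)) := by
  rw [taylorDisc_succ (n + 1), smul_add]
  abel

theorem taylorDisc_laplacian (n : ℕ) (x : Rn D) (t : ℝ) (w : Rn D) :
    taylorDisc γ (n + 2) 2 x t w + Complex.I • Complex.I • taylorDisc γ n 2 x t w =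
      ((Complex.I * t) ^ n / (n.factorial : ℂ)) • taylorTerm γ (n + 2) (x, w) +
      ((Complex.I * t) ^ (n + 1) / ((n + 1).factorial : ℂ)) • taylorTerm γ (n + 3) (x, w) := by
  rw [taylorDisc_succ (n + 1), taylorDisc_succ n, smul_smul, Complex.I_mul_I, neg_one_smul,
    show n + 1 + 2 = n + 3 by ring]
  abel

theorem norm_taylorCoefficient_smul_le (n : ℕ) {t : ℝ} (ht : 0 ≤ t) {z : E} {G : ℝ}
    (hz : ‖z‖ ≤ G) : ‖((Complex.I * t) ^ n / (n.factorial : ℂ)) • z‖ ≤ G * t ^ n := by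
  have hn : (1 : ℝ) ≤ n.factorial := by exact_mod_cast Nat.one_le_iff_ne_zero.2 n.factorial_ne_zero
  rw [norm_smul, norm_div, norm_pow, norm_mul, Complex.norm_I, one_mul, Complex.norm_real,
    Real.norm_of_nonneg ht, Complex.norm_natCast, mul_comm]
  exact mul_le_mul hz (div_le_self (by positivity) hn) (by positivity) ((norm_nonneg _).trans hz)

/-- A function which is almost bounded in the mean is bounded. -/
theorem norm_le_of_norm_mean_le {f : Rn D → ℂ} {x₁ : Rn D} (hf : ContinuousAt f x₁) {B ρ : ℝ}
    (hρ : 0 < ρ) (hB : ∀ φ : Rn D → ℝ, ContDiff ℝ ∞ φ → (∀ x, 0 ≤ φ x) → ∫ x, φ x = 1 →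
      (∀ x ∉ Metric.closedBall x₁ ρ, φ x = 0) → ‖∫ x, f x * (φ x : ℂ)‖ ≤ B)
    (hint : ContinuousOn f (Metric.closedBall x₁ ρ)) : ‖f x₁‖ ≤ B := by
  refine le_of_forall_pos_le_add fun η hη => ?_
  obtain ⟨ρ', hρ', hball⟩ := Metric.continuousAt_iff.1 hf η hη
  set m := min ρ (ρ' / 2) with hm
  have hmp : 0 < m := by positivity
  let b : ContDiffBump x₁ := ⟨m / 2, m, half_pos hmp, half_lt_self hmp⟩
  set φ := b.normed volume with hφ
  have hφ0 : ∀ x, 0 ≤ φ x := fun x => b.nonneg_normed x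
  have hφ1 : ∫ x, φ x = 1 := b.integral_normed
  have hsupp : ∀ x, φ x ≠ 0 → x ∈ Metric.ball x₁ m := by
    intro x hx
    have : x ∈ Function.support φ := hx
    rwa [hφ, b.support_normed_eq] at this
  have hs : ∀ x ∉ Metric.closedBall x₁ ρ, φ x = 0 := by
    intro x hx
    by_contra h
    exact hx (Metric.ball_subset_closedBall (Metric.ball_subset_ball (min_le_left _ _) (hsupp x h)))
  have h1 := hB φ b.contDiff_normed hφ0 hφ1 hs
  have hφc : Continuous fun x => (φ x : ℂ) := Complex.continuous_ofReal.comp b.continuous_normed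
  have hi : ∀ {g : Rn D → ℂ}, ContinuousOn g (Metric.closedBall x₁ ρ) →
      Integrable fun x => g x * (φ x : ℂ) := fun hg =>
    ((hg.mul hφc.continuousOn).integrableOn_compact
      (isCompact_closedBall _ _)).integrable_of_forall_notMem_eq_zero fun x hx => by simp [hs x hx]
  have h2 : ‖∫ x, (f x₁ - f x) * (φ x : ℂ)‖ ≤ η := by
    refine norm_integral_mul_density_le hφ0 hφ1 fun x hx => ?_
    rw [norm_sub_rev, ← dist_eq_norm]
    refine (hball ?_).le
    have := hsupp x hx
    rw [Metric.mem_ball] at this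
    linarith [min_le_right ρ (ρ' / 2)]
  have h3 : f x₁ = (∫ x, (f x₁ - f x) * (φ x : ℂ)) + ∫ x, f x * (φ x : ℂ) := by
    rw [← integral_add (hi (g := fun x => f x₁ - f x) (continuousOn_const.sub hint)) (hi hint)]
    simp only [sub_mul, sub_add_cancel]
    rw [integral_const_mul, integral_complex_ofReal, hφ1]
    simp
  rw [h3]
  exact (norm_add_le _ _).trans (by linarith)

end Boundedness

section Boundedness

variable {D : ℕ} {E : Type*} [NormedAddCommGroup E] [NormedSpace ℂ E]
  {γ : Rn D → E} {U : Set (Rn D)} {x₀ : Rn D}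

theorem HasLinearBoundaryValue.mono {v : E} {r r' : ℝ} {F : E → ℂ} {T : (Rn D → ℂ) → ℂ}
    (h : HasLinearBoundaryValue γ x₀ v r F T) (hr : r' ≤ r) :
    HasLinearBoundaryValue γ x₀ v r' F T :=
  fun φ hφ hs => h φ hφ (hs.trans (Metric.ball_subset_ball hr))

/-- A holomorphic function of slow growth on a wedge whose boundary value is a bounded function is
bounded on smaller wedges. -/
theorem exists_bound_of_boundaryValue [FiniteDimensional ℂ E] (hU : IsOpen U)
    (hγ : ContDiffOn ℝ ∞ γ U) (hx₀ : x₀ ∈ U) {e : Fin D → Rn D} {C₀ : E →L[ℂ] (Fin D → ℂ)}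
    (hC₀ : frameMap C₀ (fun j => fderiv ℝ γ x₀ (e j)) = 1) {v : E} {r : ℝ} (hr : 0 < r)
    {F : E → ℂ} (hF : DifferentiableOn ℂ F (coneRegion γ x₀ v r)) {l : ℕ} {C : ℝ}
    (hG : SlowGrowth γ x₀ v r l C F) {u : Rn D → ℂ} {M : ℝ}
    (hM : ∀ x ∈ Metric.ball x₀ r, ‖u x‖ ≤ M)
    (hbv : HasLinearBoundaryValue γ x₀ v r F fun φ => ∫ x, u x * φ x) :
    ∃ r' > 0, r' ≤ r ∧ ∃ B, ∀ z ∈ coneRegion γ x₀ v r', ‖F z‖ ≤ B := by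
  have : CompleteSpace E := FiniteDimensional.complete ℂ E
  have hspan := exists_re_im_of_frameMap hC₀
  obtain ⟨y₀, w₀, hv⟩ := hspan v
  set n := 2 * l + 1 with hn
  obtain ⟨rf, hrf, hrfU, hframe⟩ := exists_ball_norm_frameMap_sub_one_lt hU hγ hx₀ hC₀
  obtain ⟨r₂, hr₂, hr₂r, hdisc⟩ := exists_taylorDisc_add_mem hU hγ hx₀ n y₀ w₀
    (r := r / 4) (by positivity) hv
  set r₃ := min r₂ rf with hr₃
  have hr₃p : 0 < r₃ := lt_min hr₂ hrf
  have h32 : r₃ ≤ r₂ := min_le_left _ _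
  have h3U : Metric.ball x₀ r₃ ⊆ U := (Metric.ball_subset_ball (min_le_right _ _)).trans hrfU
  have h3r : r₃ ≤ r := by linarith
  -- Growth of `F` and its first two derivatives.
  set C' := max C (max (4 * C / r) (4 * (4 * C / r) / (r / 2))) with hC'
  have hFf : DifferentiableOn ℂ (fderiv ℂ F) (coneRegion γ x₀ v (r / 2)) :=
    (differentiableOn_fderiv_complex isOpen_coneRegion hF).mono
      (coneRegion_mono (half_le_self hr.le))
  have hC0 : 0 ≤ C := hG.nonneg hr
  have hC'0 : 0 ≤ C' := hC0.trans (le_max_left _ _)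
  have hG₀ : SlowGrowth γ x₀ v (r / 4) l C F := hG.mono (by linarith)
  have hG₁ : SlowGrowth γ x₀ v (r / 4) (l + 1) (4 * C / r) (fderiv ℂ F) :=
    (hG.fderiv hr hF).mono (by linarith)
  have hG₂ : SlowGrowth γ x₀ v (r / 4) (l + 2) (4 * (4 * C / r) / (r / 2))
      (fderiv ℂ (fderiv ℂ F)) :=
    ((hG.fderiv hr hF).fderiv (half_pos hr) hFf).mono (by linarith)
  have hmem4 : ∀ {z}, z ∈ coneRegion γ x₀ v (r / 4) → z ∈ coneRegion γ x₀ v r := fun h =>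
    coneRegion_mono (by linarith) h
  -- Bounds for the derivatives of the discs.
  set Q : Set (Rn D × ℝ × Rn D) :=
    Metric.closedBall x₀ (3 * r₃ / 4) ×ˢ Icc 0 1 ×ˢ Metric.closedBall w₀ r₃ with hQ
  have hQc : IsCompact Q := (isCompact_closedBall _ _).prod
    (isCompact_Icc.prod (isCompact_closedBall _ _))
  have hQ0 : (x₀, (0 : ℝ), w₀) ∈ Q := ⟨Metric.mem_closedBall_self (by positivity),
    ⟨le_rfl, zero_le_one⟩, Metric.mem_closedBall_self hr₃p.le⟩
  have hQU : MapsTo (fun q : Rn D × ℝ × Rn D => q.1) Q U := fun q hq =>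
    h3U (Metric.closedBall_subset_ball (by linarith) hq.1)
  have hterm : ∀ j, ContinuousOn (fun q : Rn D × ℝ × Rn D => taylorTerm γ j (q.1, q.2.2)) Q :=
    fun j => (contDiffOn_taylorTerm hU hγ j).continuousOn.comp (by fun_prop)
      fun q hq => ⟨hQU hq, mem_univ _⟩
  obtain ⟨G₁, hG1⟩ := hQc.exists_bound_of_continuousOn (contDiffOn_taylorDisc hU hγ (n + 2) 1
    contDiffOn_fst contDiff_snd.fst.contDiffOn contDiff_snd.snd.contDiffOn hQU).continuousOn
  obtain ⟨G₂, hG2⟩ := hQc.exists_bound_of_continuousOn (hterm (n + 2))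
  obtain ⟨G₃, hG3⟩ := hQc.exists_bound_of_continuousOn (hterm (n + 3))
  have hG10 : 0 ≤ G₁ := (norm_nonneg _).trans (hG1 _ hQ0)
  have hG20 : 0 ≤ G₂ := (norm_nonneg _).trans (hG2 _ hQ0)
  have hG30 : 0 ≤ G₃ := (norm_nonneg _).trans (hG3 _ hQ0)
  set G := G₁ + G₂ + G₃ with hGdef
  set b := min (r₃ / 2) 1 with hb
  have hbp : 0 < b := by positivity
  have hb1 : b ≤ 1 := min_le_right _ _
  have hbr : b < r₃ := (min_le_left _ _).trans_lt (half_lt_self hr₃p)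
  set a := min 1 (r₃ / (4 * (‖w₀‖ + r₃))) with ha
  have hap : 0 < a := by positivity
  have hM0 : 0 ≤ M := (norm_nonneg _).trans (hM x₀ (Metric.mem_ball_self hr))
  obtain ⟨B, hB⟩ := exists_discFamily_bound (D := D) (E := E) (l := l) hap (min_le_left _ _) hbp hb1
    hC'0 (show 0 ≤ G by positivity) hM0
  obtain ⟨r₄, hr₄, hr₄r, hcover⟩ := exists_eq_taylorDisc hU hγ hx₀ n hspan y₀ w₀
    (r := r₃ / 4) (by positivity) hv
  refine ⟨min r₄ b, lt_min hr₄ hbp, (min_le_left _ _).trans (by linarith), B, ?_⟩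
  rintro z ⟨x, hx, t, ht, v', hv', rfl⟩
  obtain ⟨x₁, hx₁, w, hw, hz⟩ := hcover x (Metric.ball_subset_ball (min_le_left _ _) hx) t
    (Ioo_subset_Ioo_right (min_le_left _ _) ht) v' (Metric.ball_subset_ball (min_le_left _ _) hv')
  have htb : t ∈ Ioc 0 b := ⟨ht.1, (ht.2.trans_le (min_le_right _ _)).le⟩
  have hw3 : w ∈ Metric.ball w₀ r₃ := Metric.ball_subset_ball (by linarith) hw
  have hw2 : w ∈ Metric.ball w₀ r₂ := Metric.ball_subset_ball h32 hw3
  have haw : a * ‖w‖ ≤ r₃ / 4 := by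
    have h1 : ‖w‖ ≤ ‖w₀‖ + r₃ := by
      rw [mem_ball_iff_norm] at hw3
      calc ‖w‖ = ‖w₀ + (w - w₀)‖ := by congr 1; abel
        _ ≤ _ := norm_add_le _ _
        _ ≤ _ := by linarith
    calc _ ≤ r₃ / (4 * (‖w₀‖ + r₃)) * (‖w₀‖ + r₃) :=
          mul_le_mul (min_le_right _ _) h1 (norm_nonneg _) (by positivity)
      _ = r₃ / 4 := by field_simp
  have hdisc' : ∀ x ∈ Metric.ball x₀ r₃, ∀ t ∈ Ico 0 r₃, ∀ ε ∈ Ico 0 r₃, 0 < t + ε →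
      ∃ x' ∈ Metric.ball x₀ (r / 4), ∃ v' ∈ Metric.ball v (r / 4), t + ε ∈ Ioo 0 (r / 4) ∧
        taylorDisc γ (n + 2) 0 x t w + ε • v = γ x' + (t + ε) • v' := by
    intro x hx t ht ε hε htε
    obtain ⟨h1, x', hx', v', hv', h⟩ := hdisc x (Metric.ball_subset_ball h32 hx) w hw2 t
      (Ico_subset_Ico_right h32 ht) ε (Ico_subset_Ico_right h32 hε) htε
    exact ⟨x', hx', v', hv', ⟨htε, h1⟩, h⟩
  have hdisc₀ : ∀ x ∈ Metric.ball x₀ r₃, ∀ t ∈ Ioc 0 b,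
      ∃ x' ∈ Metric.ball x₀ (r / 4), ∃ v' ∈ Metric.ball v (r / 4), t ∈ Ioo 0 (r / 4) ∧
        taylorDisc γ (n + 2) 0 x t w = γ x' + t • v' := by
    intro x hx t ht
    have := hdisc' x hx t ⟨ht.1.le, ht.2.trans_lt hbr⟩ 0 ⟨le_rfl, hr₃p⟩ (by linarith [ht.1])
    simpa using this
  have hx₁' : ‖x₁ - x₀‖ < r₃ / 4 := mem_ball_iff_norm.1 hx₁
  have hK : ∀ x ∈ Metric.closedBall x₁ (r₃ / 4), ‖x - x₀‖ < r₃ / 2 := by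
    intro x hx
    rw [mem_closedBall_iff_norm] at hx
    calc ‖x - x₀‖ = ‖(x - x₁) + (x₁ - x₀)‖ := by congr 1; abel
      _ ≤ _ := norm_add_le _ _
      _ < _ := by linarith
  have hKs : ∀ s ∈ Icc (-a) a, ∀ x ∈ Metric.closedBall x₁ (r₃ / 4),
      ‖x + s • w - x₀‖ < 3 * r₃ / 4 := by
    intro s hs x hx
    have h1 : ‖s • w‖ ≤ r₃ / 4 := by
      rw [norm_smul, Real.norm_eq_abs]
      exact (mul_le_mul_of_nonneg_right (abs_le.2 hs) (norm_nonneg _)).trans haw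
    calc ‖x + s • w - x₀‖ = ‖(x - x₀) + s • w‖ := by congr 1; abel
      _ ≤ _ := norm_add_le _ _
      _ < _ := by linarith [hK x hx]
  have hKs' : ∀ s ∈ Icc (-a) a, ∀ x ∈ Metric.closedBall x₁ (r₃ / 4),
      x + s • w ∈ Metric.ball x₀ r₃ := fun s hs x hx =>
    mem_ball_iff_norm.2 ((hKs s hs x hx).trans (by linarith))
  have hKQ : ∀ s ∈ Icc (-a) a, ∀ t ∈ Ioc 0 b, ∀ x ∈ Metric.closedBall x₁ (r₃ / 4),
      (x + s • w, t, w) ∈ Q := fun s hs t ht x hx =>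
    ⟨mem_closedBall_iff_norm.2 (hKs s hs x hx).le, ⟨ht.1.le, ht.2.trans hb1⟩,
      Metric.ball_subset_closedBall hw3⟩
  have hcont : ∀ m k, ContinuousOn (fun q : (ℝ × ℝ) × Rn D =>
      taylorDisc γ m k (q.2 + q.1.1 • w) q.1.2 w)
      ((Icc (-a) a ×ˢ Ioc 0 b) ×ˢ Metric.closedBall x₁ (r₃ / 4)) := fun m k =>
    (contDiffOn_taylorDisc hU hγ m k (P := (ℝ × ℝ) × Rn D)
      (contDiff_snd.add (contDiff_fst.fst.smul contDiff_const)).contDiffOn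
      contDiff_fst.snd.contDiffOn contDiffOn_const
      fun q hq => h3U (hKs' _ hq.1.1 _ hq.2)).continuousOn
  rw [← hz]
  refine norm_le_of_norm_mean_le (f := fun x => F (taylorDisc γ (n + 2) 0 x t w)) (x₁ := x₁)
    ?_ (ρ := r₃ / 4) (by positivity) ?_ ?_
  rotate_left
  · intro φ hφ hφ0 hφ1 hφs
    let S : DiscFamily D E l a b C' G M :=
      { R := coneRegion γ x₀ v r
        isOpen_R := isOpen_coneRegion
        F := F
        holo := hF
        K := Metric.closedBall x₁ (r₃ / 4)
        isCompact_K := isCompact_closedBall _ _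
        φ := φ
        continuous_φ := hφ.continuous
        φ_nonneg := hφ0
        φ_eq_zero := hφs
        integral_φ := hφ1
        Z := fun s t x => taylorDisc γ (n + 2) 0 (x + s • w) t w
        Zs := fun s t x => taylorDisc γ (n + 2) 1 (x + s • w) t w
        Zss := fun s t x => taylorDisc γ (n + 2) 2 (x + s • w) t w
        Zt := fun s t x => Complex.I • taylorDisc γ (n + 1) 1 (x + s • w) t w
        Ztt := fun s t x => Complex.I • Complex.I • taylorDisc γ n 2 (x + s • w) t w
        cont_Z := hcont _ _
        cont_Zs := hcont _ _
        cont_Zss := hcont _ _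
        cont_Zt := (hcont _ _).const_smul _
        cont_Ztt := ((hcont _ _).const_smul _).const_smul _
        deriv_s := fun s hs t _ x hx => hasDerivAt_taylorDisc_left hU hγ _ _ t
          (h3U (hKs' s (Ioo_subset_Icc_self hs) x hx))
        deriv_ss := fun s hs t _ x hx => hasDerivAt_taylorDisc_left hU hγ _ _ t
          (h3U (hKs' s (Ioo_subset_Icc_self hs) x hx))
        deriv_t := fun s _ t _ x _ => hasDerivAt_taylorDisc_middle _ _ _ _ t
        deriv_tt := fun s _ t _ x _ => (hasDerivAt_taylorDisc_middle _ _ _ _ t).const_smul _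
        mem_R := fun s hs t ht x hx => by
          obtain ⟨x', hx', v', hv', ht', h⟩ := hdisc₀ _ (hKs' s hs x hx) t ht
          exact hmem4 ⟨x', hx', t, ht', v', hv', h⟩
        growth := fun s hs t ht x hx => by
          obtain ⟨x', hx', v', hv', ht', h⟩ := hdisc₀ _ (hKs' s hs x hx) t ht
          rw [h]
          have := ht'.1
          exact (hG₀ x' hx' t ht' v' hv').trans (by gcongr; exact le_max_left _ _)
        growth' := fun s hs t ht x hx => by
          obtain ⟨x', hx', v', hv', ht', h⟩ := hdisc₀ _ (hKs' s hs x hx) t ht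
          rw [h]
          have := ht'.1
          exact (hG₁ x' hx' t ht' v' hv').trans
            (by gcongr; exact (le_max_left _ _).trans (le_max_right _ _))
        growth'' := fun s hs t ht x hx => by
          obtain ⟨x', hx', v', hv', ht', h⟩ := hdisc₀ _ (hKs' s hs x hx) t ht
          rw [h]
          have := ht'.1
          exact (hG₂ x' hx' t ht' v' hv').trans
            (by gcongr; exact (le_max_right _ _).trans (le_max_right _ _))
        norm_Zs := fun s hs t ht x hx => (hG1 _ (hKQ s hs t ht x hx)).trans (by linarith)
        norm_dbar := fun s hs t ht x hx => by
          rw [taylorDisc_dbar, norm_neg, norm_smul, Complex.norm_I, one_mul]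
          refine norm_taylorCoefficient_smul_le _ ht.1.le ?_
          exact (hG2 _ (hKQ s hs t ht x hx)).trans (by linarith)
        norm_laplacian := fun s hs t ht x hx => by
          rw [taylorDisc_laplacian]
          have h2 := norm_taylorCoefficient_smul_le n ht.1.le (hG2 _ (hKQ s hs t ht x hx))
          have h3 := norm_taylorCoefficient_smul_le (n + 1) ht.1.le (hG3 _ (hKQ s hs t ht x hx))
          have h4 : t ^ (n + 1) ≤ t ^ n :=
            pow_le_pow_of_le_one ht.1.le (ht.2.trans hb1) n.le_succ
          have h5 : 0 ≤ G₁ * t ^ n := mul_nonneg hG10 (pow_nonneg ht.1.le n)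
          calc _ ≤ G₂ * t ^ n + G₃ * t ^ (n + 1) := (norm_add_le _ _).trans (add_le_add h2 h3)
            _ ≤ G₂ * t ^ n + G₃ * t ^ n := by gcongr
            _ ≤ G * t ^ n := by rw [hGdef]; linarith
        bottom := fun η hη => exists_norm_integral_taylorDisc_le (N := n + 1) hU hγ hr₃p h3U
          (fun x hx => hframe x (Metric.ball_subset_ball (min_le_right _ _) hx)) isOpen_coneRegion hF
          (fun x hx t ht ε hε htε => by
            obtain ⟨x', hx', v', hv', ht', h⟩ := hdisc' x hx t ht ε hε htε
            exact hmem4 ⟨x', hx', t + ε, ht', v', hv', h⟩)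
          (fun x hx t ht ε hε => by
            obtain ⟨x', hx', v', hv', ht', h⟩ := hdisc' x hx t (Ioo_subset_Ico_self ht) ε hε
              (by linarith [ht.1, hε.1])
            rw [h]
            refine (hG₀ x' hx' _ ht' v' hv').trans ?_
            exact div_le_div_of_nonneg_left hC0 (pow_pos ht.1 l)
              (pow_le_pow_left₀ ht.1.le (by linarith [hε.1]) l))
          (fun x hx => hM x (Metric.ball_subset_ball h3r hx)) (hbv.mono h3r) hφ hφ0 hφ1
          (fun x hx => hφs x fun h => hx (mem_closedBall_iff_norm.2 (hK x h).le)) haw hη }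
    have := hB S t htb
    simpa [S] using this
  · have h1 : ContinuousOn (fun x => F (taylorDisc γ (n + 2) 0 x t w)) (Metric.ball x₀ r₃) :=
      hF.continuousOn.comp (contDiffOn_taylorDisc hU hγ (n + 2) 0 contDiffOn_id contDiffOn_const
        contDiffOn_const h3U).continuousOn fun x hx => by
          obtain ⟨x', hx', v', hv', ht', h⟩ := hdisc₀ x hx t htb
          exact hmem4 ⟨x', hx', t, ht', v', hv', h⟩
    exact h1.mono fun x hx => mem_ball_iff_norm.2 ((hK x hx).trans (half_lt_self hr₃p))
  · have h1 : ContinuousOn (fun x => F (taylorDisc γ (n + 2) 0 x t w)) (Metric.ball x₀ r₃) :=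
      hF.continuousOn.comp (contDiffOn_taylorDisc hU hγ (n + 2) 0 contDiffOn_id contDiffOn_const
        contDiffOn_const h3U).continuousOn fun x hx => by
          obtain ⟨x', hx', v', hv', ht', h⟩ := hdisc₀ x hx t htb
          exact hmem4 ⟨x', hx', t, ht', v', hv', h⟩
    exact h1.continuousAt (Metric.isOpen_ball.mem_nhds (mem_ball_iff_norm.2 (by linarith)))

end Boundedness

/-! ### Smoothness up to the edge -/

section SmoothBoundaryValues

variable {D : ℕ} {E : Type*} [NormedAddCommGroup E] [NormedSpace ℂ E]
  {γ : Rn D → E} {U : Set (Rn D)} {x₀ : Rn D}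

/-- `F` is a holomorphic function of slow growth on the cone region whose boundary value on the edge
is the smooth function `u`. -/
structure HasSmoothBoundaryValue (γ : Rn D → E) (x₀ : Rn D) (v : E) (r : ℝ) (F : E → ℂ)
    (u : Rn D → ℂ) : Prop where
  holo : DifferentiableOn ℂ F (coneRegion γ x₀ v r)
  growth : ∃ l C, SlowGrowth γ x₀ v r l C F
  smooth : ContDiffOn ℝ ∞ u (Metric.ball x₀ r)
  boundaryValue : HasLinearBoundaryValue γ x₀ v r F fun φ => ∫ x, u x * φ x

theorem HasSmoothBoundaryValue.mono {v : E} {r r' : ℝ} {F : E → ℂ} {u : Rn D → ℂ}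
    (h : HasSmoothBoundaryValue γ x₀ v r F u) (hr : r' ≤ r) :
    HasSmoothBoundaryValue γ x₀ v r' F u := by
  obtain ⟨l, C, hG⟩ := h.growth
  exact ⟨h.holo.mono (coneRegion_mono hr), ⟨l, C, hG.mono hr⟩,
    h.smooth.mono (Metric.ball_subset_ball hr), h.boundaryValue.mono hr⟩

theorem integral_mul_fderiv_eq_neg_of_tsupport_subset {V : Set (Rn D)} (hV : IsOpen V)
    {f g : Rn D → ℂ} (hf : ContDiffOn ℝ 1 f V) (hg : ContDiff ℝ 1 g) (hgc : HasCompactSupport g)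
    (hgV : tsupport g ⊆ V) (w : Rn D) :
    ∫ x, f x * fderiv ℝ g x w = -∫ x, fderiv ℝ f x w * g x := by
  have hint : ∀ {a b : Rn D → ℂ}, ContinuousOn a V → Continuous b →
      (∀ x ∉ tsupport g, b x = 0) → Integrable fun x => a x * b x := by
    intro a b ha hb h0
    exact (((ha.mono hgV).mul hb.continuousOn).integrableOn_compact
      hgc).integrable_of_forall_notMem_eq_zero fun x hx => by rw [Pi.mul_apply, h0 x hx, mul_zero]
  have hg' : Continuous fun x => fderiv ℝ g x w :=
    (hg.continuous_fderiv one_ne_zero).clm_apply continuous_const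
  have hf' : ContinuousOn (fun x => fderiv ℝ f x w) V :=
    (hf.continuousOn_fderiv_of_isOpen hV le_rfl).clm_apply continuousOn_const
  have hg0 : ∀ x ∉ tsupport g, g x = 0 := fun x hx => image_eq_zero_of_notMem_tsupport hx
  exact integral_mul_fderiv_eq_neg_fderiv_mul_of_integrable (hint hf' hg.continuous hg0)
    (hint hf.continuousOn hg' fun x hx => by
      rw [image_eq_zero_of_notMem_tsupport fun h => hx (tsupport_fderiv_subset ℝ h), zero_apply])
    (hint hf.continuousOn hg.continuous hg0)
    (fun x hx => (hf.differentiableOn one_ne_zero).differentiableAt (hV.mem_nhds (hgV hx)))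
    fun x _ => hg.differentiable one_ne_zero x

theorem ContDiffOn.contDiff_mul_of_tsupport_subset {V : Set (Rn D)} (hV : IsOpen V)
    {c φ : Rn D → ℂ} (hc : ContDiffOn ℝ ∞ c V) (hφ : ContDiff ℝ ∞ φ) (hs : tsupport φ ⊆ V) :
    ContDiff ℝ ∞ fun x => c x * φ x := by
  rw [contDiff_iff_contDiffAt]
  intro x
  by_cases hx : x ∈ tsupport φ
  · exact (hc.contDiffAt (hV.mem_nhds (hs hx))).mul hφ.contDiffAt
  · refine (contDiffAt_const (c := (0 : ℂ))).congr_of_eventuallyEq ?_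
    filter_upwards [(isClosed_tsupport φ).isOpen_compl.mem_nhds hx] with y hy
    rw [image_eq_zero_of_notMem_tsupport hy, mul_zero]

theorem tsupport_mul_subset_right' {c φ : Rn D → ℂ} :
    tsupport (fun x => c x * φ x) ⊆ tsupport φ :=
  closure_mono fun x hx h => hx (by simp only [h, mul_zero])

theorem hasCompactSupport_of_tsupport_subset_ball {φ : Rn D → ℂ} {r : ℝ}
    (h : tsupport φ ⊆ Metric.ball x₀ r) : HasCompactSupport φ :=
  (isCompact_closedBall x₀ r).of_isClosed_subset (isClosed_tsupport φ)
    (h.trans Metric.ball_subset_closedBall)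

/-- The derivatives of `F` belong to the same class: a constant vector is a combination of the
tangent vectors of the edge with smooth complex coefficients, and one integrates by parts. -/
theorem HasSmoothBoundaryValue.exists_fderiv [FiniteDimensional ℂ E] (hU : IsOpen U)
    (hγ : ContDiffOn ℝ ∞ γ U) (hx₀ : x₀ ∈ U) {e : Fin D → Rn D} {C₀ : E →L[ℂ] (Fin D → ℂ)}
    (hC₀ : frameMap C₀ (fun j => fderiv ℝ γ x₀ (e j)) = 1) {v : E} {r : ℝ} (hr : 0 < r)
    {F : E → ℂ} {u : Rn D → ℂ} (h : HasSmoothBoundaryValue γ x₀ v r F u) (T : E) :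
    ∃ r' > 0, r' ≤ r ∧ ∃ u', HasSmoothBoundaryValue γ x₀ v r' (fun z => fderiv ℂ F z T) u' := by
  have : CompleteSpace E := FiniteDimensional.complete ℂ E
  obtain ⟨rf, hrf, hrfU, hframe⟩ := exists_ball_norm_frameMap_sub_one_lt hU hγ hx₀ hC₀
  set r' := min (r / 2) rf with hr'
  have hr'p : 0 < r' := by positivity
  have hr'r : r' ≤ r := (min_le_left _ _).trans (half_le_self hr.le)
  have hBU : Metric.ball x₀ r' ⊆ U := (Metric.ball_subset_ball (min_le_right _ _)).trans hrfU
  have hγ' : ContDiffOn ℝ ∞ γ (Metric.ball x₀ r') := hγ.mono hBU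
  have hdγ : ∀ w, ContDiffOn ℝ ∞ (fun x => fderiv ℝ γ x w) (Metric.ball x₀ r') := fun w =>
    (hγ'.fderiv_of_isOpen (m := ∞) Metric.isOpen_ball le_rfl).clm_apply contDiffOn_const
  have hu' : ContDiffOn ℝ ∞ u (Metric.ball x₀ r') := h.smooth.mono (Metric.ball_subset_ball hr'r)
  obtain ⟨c, hc, hcT⟩ := exists_coefficients C₀ (T := fun j x => fderiv ℝ γ x (e j))
    (s := Metric.ball x₀ r') (fun j => hdγ (e j)) (fun x hx =>
      hframe x (Metric.ball_subset_ball (min_le_right _ _) hx)) (contDiffOn_const (c := T))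
  refine ⟨r', hr'p, hr'r, fun x => ∑ j, c j x * fderiv ℝ u x (e j), ?_, ?_, ?_, ?_⟩
  · exact (differentiableOn_fderiv_apply_complex isOpen_coneRegion h.holo T).mono
      (coneRegion_mono hr'r)
  · obtain ⟨l, C, hG⟩ := h.growth
    refine ⟨l + 1, 4 * C / r * ‖T‖, fun x hx t ht v' hv' => ?_⟩
    have := (hG.fderiv hr h.holo).mono (min_le_left (r / 2) rf) x hx t ht v' hv'
    calc _ ≤ ‖fderiv ℂ F (γ x + t • v')‖ * ‖T‖ := ContinuousLinearMap.le_opNorm _ _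
      _ ≤ 4 * C / r / t ^ (l + 1) * ‖T‖ := mul_le_mul_of_nonneg_right this (norm_nonneg _)
      _ = _ := by ring
  · exact ContDiffOn.sum fun j _ => (hc j).mul
      ((hu'.fderiv_of_isOpen (m := ∞) Metric.isOpen_ball le_rfl).clm_apply contDiffOn_const)
  · intro φ hφ hs
    have hψ : ∀ j, ContDiff ℝ ∞ fun x => c j x * φ x := fun j =>
      (hc j).contDiff_mul_of_tsupport_subset Metric.isOpen_ball hφ hs
    have hψs : ∀ j, tsupport (fun x => c j x * φ x) ⊆ Metric.ball x₀ r' := fun j =>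
      tsupport_mul_subset_right'.trans hs
    have hdψ : ∀ j, ContDiff ℝ ∞ fun x => fderiv ℝ (fun x => c j x * φ x) x (e j) := fun j =>
      ((hψ j).fderiv_right (m := ∞) le_rfl).clm_apply contDiff_const
    have hdψs : ∀ j, tsupport (fun x => fderiv ℝ (fun x => c j x * φ x) x (e j)) ⊆
        Metric.ball x₀ r' := fun j =>
      (tsupport_fderiv_apply_subset ℝ (f := fun x => c j x * φ x) (e j)).trans (hψs j)
    have hlim : Tendsto (fun ε : ℝ => -∑ j, ∫ x, F (γ x + ε • v) *
        fderiv ℝ (fun x => c j x * φ x) x (e j)) (𝓝[>] 0)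
        (𝓝 (-∑ j, ∫ x, u x * fderiv ℝ (fun x => c j x * φ x) x (e j))) :=
      (tendsto_finsetSum _ fun j _ => h.boundaryValue _ (hdψ j)
        ((hdψs j).trans (Metric.ball_subset_ball hr'r))).neg
    have hsupp0 : ∀ x ∉ Metric.ball x₀ r', φ x = 0 := fun x hx =>
      image_eq_zero_of_notMem_tsupport fun h => hx (hs h)
    have hintg : ∀ {g : Rn D → ℂ}, ContinuousOn g (Metric.ball x₀ r') →
        Integrable fun x => g x * φ x := fun hg =>
      (((hg.mono hs).mul hφ.continuous.continuousOn).integrableOn_compact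
        (hasCompactSupport_of_tsupport_subset_ball hs)).integrable_of_forall_notMem_eq_zero
        fun x hx => by rw [Pi.mul_apply, image_eq_zero_of_notMem_tsupport hx, mul_zero]
    have hparts : ∀ {f : Rn D → ℂ}, ContDiffOn ℝ 1 f (Metric.ball x₀ r') →
        ∫ x, (∑ j, c j x * fderiv ℝ f x (e j)) * φ x =
          -∑ j, ∫ x, f x * fderiv ℝ (fun x => c j x * φ x) x (e j) := by
      intro f hf
      have hf' : ∀ w, ContinuousOn (fun x => fderiv ℝ f x w) (Metric.ball x₀ r') := fun w =>
        (hf.continuousOn_fderiv_of_isOpen Metric.isOpen_ball le_rfl).clm_apply continuousOn_const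
      have hint : ∀ j, Integrable fun x => c j x * fderiv ℝ f x (e j) * φ x := fun j =>
        hintg (g := fun x => c j x * fderiv ℝ f x (e j)) ((hc j).continuousOn.mul (hf' (e j)))
      simp only [Finset.sum_mul]
      rw [integral_finsetSum _ fun j _ => hint j, ← Finset.sum_neg_distrib]
      refine Finset.sum_congr rfl fun j _ => ?_
      rw [integral_mul_fderiv_eq_neg_of_tsupport_subset Metric.isOpen_ball hf
        ((hψ j).of_le (by simp)) (hasCompactSupport_of_tsupport_subset_ball (hψs j)) (hψs j), neg_neg]
      exact integral_congr_ae (Eventually.of_forall fun x => by simp only; ring)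
    beta_reduce
    rw [hparts (hu'.of_le (by simp))]
    refine hlim.congr' ?_
    filter_upwards [Ioo_mem_nhdsGT hr'p] with ε hε
    have hmem : MapsTo (fun x => γ x + ε • v) (Metric.ball x₀ r') (coneRegion γ x₀ v r) :=
      fun x hx => ⟨x, Metric.ball_subset_ball hr'r hx, ε, ⟨hε.1, hε.2.trans_le hr'r⟩, v,
        Metric.mem_ball_self hr, rfl⟩
    have hFγ : ContDiffOn ℝ 1 (fun x => F (γ x + ε • v)) (Metric.ball x₀ r') :=
      ((((contDiffOn_of_differentiableOn_complex isOpen_coneRegion h.holo).restrict_scalars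
        ℝ).of_le (by simp)).comp ((hγ'.of_le (by simp)).add contDiffOn_const) hmem)
    rw [← hparts hFγ]
    refine integral_congr_ae (Eventually.of_forall fun x => ?_)
    by_cases hx : x ∈ Metric.ball x₀ r'
    · simp only
      congr 1
      have hd : HasFDerivAt (fun x => F (γ x + ε • v))
          (((fderiv ℂ F (γ x + ε • v)).restrictScalars ℝ).comp (fderiv ℝ γ x)) x := by
        have h1 := (h.holo.differentiableAt
          (isOpen_coneRegion.mem_nhds (hmem hx))).hasFDerivAt.restrictScalars ℝ
        have h2 : HasFDerivAt γ (fderiv ℝ γ x) x := ((hγ'.contDiffAt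
          (Metric.isOpen_ball.mem_nhds hx)).differentiableAt (by simp)).hasFDerivAt
        exact HasFDerivAt.comp (g := F) (f := fun x => γ x + ε • v) x h1 (h2.add_const _)
      rw [hd.fderiv]
      conv_rhs => rw [hcT x hx]
      simp [map_sum]
    · simp only [hsupp0 x hx, mul_zero]

end SmoothBoundaryValues

section Extension

variable {D : ℕ} {E : Type*} [NormedAddCommGroup E] [NormedSpace ℂ E]
  {γ : Rn D → E} {U : Set (Rn D)} {x₀ : Rn D} {v : E}

/-- The extension of a function on a cone region of direction `v` to the edge: the limit along the
direction `v`. At interior points of the region it is the function itself, by continuity. -/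
noncomputable def edgeExt (v : E) (F : E → ℂ) (z : E) : ℂ :=
  limUnder (𝓝[>] 0) fun s : ℝ => F (z + s • v)

theorem exists_pos_forall_of_antitone {ι : Type*} [Finite ι] {P : ι → ℝ → Prop}
    (hmono : ∀ j r r', r' ≤ r → P j r → P j r') (h : ∀ j, ∃ r > 0, P j r) :
    ∃ r > 0, ∀ j, P j r := by
  have h1 : ∀ j, ∀ᶠ r in 𝓝[>] (0 : ℝ), P j r := fun j => by
    obtain ⟨r, hr, hP⟩ := h j
    filter_upwards [Ioc_mem_nhdsGT hr] with r' hr' using hmono j r r' hr'.2 hP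
  obtain ⟨r, hr, hr0⟩ := ((eventually_all.2 h1).and self_mem_nhdsWithin).exists
  exact ⟨r, hr0, hr⟩

theorem add_smul_mem_coneRegion {r r' s : ℝ} (hs : 0 < s) {z : E}
    (hz : z ∈ closedConeRegion γ x₀ v r') (hsr : s + r' ≤ r) :
    ∃ x ∈ Metric.ball x₀ r', ∃ t ∈ Ioo 0 r, s ≤ t ∧ ∃ w ∈ Metric.ball v r',
      z + s • v = γ x + t • w := by
  obtain ⟨x, hx, t, ht, v', hv', rfl⟩ := hz
  have hts : 0 < t + s := by linarith [ht.1]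
  refine ⟨x, hx, t + s, ⟨hts, by linarith [ht.2]⟩, by linarith [ht.1],
    (t / (t + s)) • v' + (s / (t + s)) • v, ?_, ?_⟩
  · exact (convex_ball v r') hv' (Metric.mem_ball_self ((norm_nonneg _).trans_lt
      (mem_ball_iff_norm.1 hv'))) (div_nonneg ht.1 hts.le) (div_nonneg hs.le hts.le)
      (by field_simp)
  · rw [smul_add, smul_smul, smul_smul, mul_div_cancel₀ _ hts.ne', mul_div_cancel₀ _ hts.ne',
      add_assoc]

/-- Two points of the cone region are joined by a curve consisting of two segments in the direction
`v` and one segment far from the edge, whose length is comparable with the distance of the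
points. -/
theorem exists_path_estimate (hγ : ContinuousAt γ x₀) {r : ℝ} (hr : 0 < r) :
    ∃ r' > 0, r' ≤ r ∧ ∃ k ≥ 0, ∀ F : E → ℂ, DifferentiableOn ℂ F (coneRegion γ x₀ v r) →
      ∀ z ∈ closedConeRegion γ x₀ v r', ∀ z' ∈ closedConeRegion γ x₀ v r', ∀ s ∈ Ioo 0 r',
        ∀ (A : E →L[ℂ] ℂ) (η : ℝ),
          (∀ y ∈ coneRegion γ x₀ v r, ‖y - z‖ ≤ k * (‖z' - z‖ + s) → ‖fderiv ℂ F y - A‖ ≤ η) →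
          ‖F (z' + s • v) - F (z + s • v) - A (z' - z)‖ ≤ k * η * ‖z' - z‖ := by
  obtain ⟨ρ, hρ, hγρ⟩ := Metric.continuousAt_iff.1 hγ (r ^ 2 / 64) (by positivity)
  obtain ⟨r', hr', h1, h2, h3⟩ : ∃ r' > 0, r' ≤ ρ ∧ r' ≤ r / 4 ∧
      r' ≤ r ^ 2 / (64 * (‖v‖ + r + 1)) :=
    ⟨min ρ (min (r / 4) (r ^ 2 / (64 * (‖v‖ + r + 1)))), by positivity, by simp⟩
  have hnorm : ∀ z ∈ closedConeRegion γ x₀ v r', ‖z - γ x₀‖ ≤ r ^ 2 / 32 := by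
    rintro z ⟨x, hx, t, ht, v', hv', rfl⟩
    have e1 : ‖γ x - γ x₀‖ < r ^ 2 / 64 := by
      rw [← dist_eq_norm]
      exact hγρ (lt_of_lt_of_le hx h1)
    have e2 : ‖v'‖ ≤ ‖v‖ + r + 1 := by
      rw [mem_ball_iff_norm] at hv'
      calc ‖v'‖ = ‖v + (v' - v)‖ := by congr 1; abel
        _ ≤ _ := norm_add_le _ _
        _ ≤ _ := by linarith
    have e3 : ‖t • v'‖ ≤ r ^ 2 / 64 := by
      rw [norm_smul, Real.norm_of_nonneg ht.1]
      calc t * ‖v'‖ ≤ r ^ 2 / (64 * (‖v‖ + r + 1)) * (‖v‖ + r + 1) :=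
            mul_le_mul (ht.2.le.trans h3) e2 (norm_nonneg _) (by positivity)
        _ = r ^ 2 / 64 := by field_simp
    calc ‖γ x + t • v' - γ x₀‖ = ‖(γ x - γ x₀) + t • v'‖ := by congr 1; abel
      _ ≤ _ := norm_add_le _ _
      _ ≤ _ := by linarith
  set c := 4 / r with hc
  have hcp : 0 < c := by positivity
  refine ⟨r', hr', by linarith, 2 * c * ‖v‖ + ‖v‖ + 1, by positivity,
    fun F hF z hz z' hz' s hs A η hη => ?_⟩
  set k := 2 * c * ‖v‖ + ‖v‖ + 1 with hk
  set d := ‖z' - z‖ with hd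
  have hd0 : 0 ≤ d := norm_nonneg _
  rcases hd0.eq_or_lt with hd00 | hdp
  · have : z' = z := by rw [← sub_eq_zero, ← norm_eq_zero, ← hd, ← hd00]
    rw [this, ← hd00]
    simp
  have hdr : d ≤ r ^ 2 / 16 := by
    calc d = ‖(z' - γ x₀) - (z - γ x₀)‖ := by rw [hd]; congr 1; abel
      _ ≤ _ := norm_sub_le _ _
      _ ≤ _ := by linarith [hnorm z hz, hnorm z' hz']
  have hcd : c * d ≤ r / 4 := by
    calc c * d ≤ c * (r ^ 2 / 16) := by gcongr
      _ = r / 4 := by rw [hc]; field_simp; norm_num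
  have hsr := hs.2
  have hr'r : r' ≤ r := by linarith
  set T := s + c * d with hT
  have hTr : T + r' ≤ r := by rw [hT]; linarith
  have hTp : 0 < T := by have := hs.1; positivity
  have hinc : coneRegion γ x₀ v r' ⊆ coneRegion γ x₀ v r := coneRegion_mono hr'r
  -- The vertical segments.
  have hvert : ∀ y ∈ closedConeRegion γ x₀ v r', ∀ p ∈ segment ℝ (y + s • v) (y + T • v),
      p ∈ coneRegion γ x₀ v r ∧ ‖p - y‖ ≤ T * ‖v‖ := by
    intro y hy p hp
    rw [segment_eq_image'] at hp
    obtain ⟨θ, hθ, rfl⟩ := hp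
    have e : y + s • v + θ • (y + T • v - (y + s • v)) = y + (s + θ * (c * d)) • v := by
      rw [hT]
      module
    have hs0 : 0 < s + θ * (c * d) := by
      have := hs.1
      have := hθ.1
      positivity
    have hsT : s + θ * (c * d) ≤ T := by
      rw [hT]
      have : θ * (c * d) ≤ 1 * (c * d) := mul_le_mul_of_nonneg_right hθ.2 (by positivity)
      linarith
    beta_reduce
    rw [e]
    refine ⟨?_, ?_⟩
    · obtain ⟨x, hx, t, ht, -, w, hw, h⟩ := add_smul_mem_coneRegion (r := r) hs0 hy
        (by linarith)
      exact ⟨x, Metric.ball_subset_ball hr'r hx, t, ht, w, Metric.ball_subset_ball hr'r hw, h⟩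
    · rw [add_sub_cancel_left, norm_smul, Real.norm_of_nonneg hs0.le]
      gcongr
  -- The segment far from the edge.
  have hhor : ∀ p ∈ segment ℝ (z + T • v) (z' + T • v),
      p ∈ coneRegion γ x₀ v r ∧ ‖p - z‖ ≤ T * ‖v‖ + d := by
    intro p hp
    have hpd : ‖p - (z + T • v)‖ ≤ d := by
      rw [segment_eq_image'] at hp
      obtain ⟨θ, hθ, rfl⟩ := hp
      beta_reduce
      rw [add_sub_cancel_left, add_sub_add_right_eq_sub, norm_smul, Real.norm_of_nonneg hθ.1]
      exact mul_le_of_le_one_left hd0 hθ.2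
    refine ⟨?_, ?_⟩
    · obtain ⟨x, hx, t, ht, hTt, w, hw, h⟩ := add_smul_mem_coneRegion (r := r) hTp hz hTr
      have hp' : p ∈ Metric.ball (γ x + t • w) (t * (r / 2)) := by
        rw [mem_ball_iff_norm, ← h]
        refine hpd.trans_lt ?_
        calc d < 2 * d := by linarith
          _ = c * d * (r / 2) := by rw [hc]; field_simp; norm_num
          _ ≤ t * (r / 2) := by
              refine mul_le_mul_of_nonneg_right ?_ (by positivity)
              linarith [hs.1]
      obtain ⟨w', hw', rfl⟩ := exists_add_smul_of_mem_ball ht.1 hp'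
      refine ⟨x, Metric.ball_subset_ball hr'r hx, t, ht, w', ?_, rfl⟩
      rw [Metric.mem_ball] at hw hw' ⊢
      linarith [dist_triangle w' w v]
    · calc ‖p - z‖ = ‖(p - (z + T • v)) + T • v‖ := by congr 1; abel
        _ ≤ _ := norm_add_le _ _
        _ ≤ _ := by
          rw [norm_smul, Real.norm_of_nonneg hTp.le]
          linarith
  have hTk : T * ‖v‖ + d ≤ k * (d + s) := by
    rw [hT, hk]
    have := hs.1
    have : 0 ≤ c * d * ‖v‖ := by positivity
    have : 0 ≤ ‖v‖ * d := by positivity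
    have : 0 ≤ c * ‖v‖ * s := by positivity
    nlinarith
  have hseg : ∀ a b : E, (∀ p ∈ segment ℝ a b, p ∈ coneRegion γ x₀ v r ∧ ‖p - z‖ ≤ k * (d + s)) →
      ‖F b - F a - A (b - a)‖ ≤ η * ‖b - a‖ := fun a b h =>
    Convex.norm_image_sub_le_of_norm_hasFDerivWithin_le' (𝕜 := ℂ) (f' := fderiv ℂ F)
      (fun p hp => ((hF.differentiableAt (isOpen_coneRegion.mem_nhds
        (h p hp).1)).hasFDerivAt).hasFDerivWithinAt) (fun p hp => hη p (h p hp).1 (h p hp).2)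
      (convex_segment a b) (left_mem_segment ℝ a b) (right_mem_segment ℝ a b)
  have s1 := hseg (z + s • v) (z + T • v) fun p hp => ⟨(hvert z hz p hp).1,
    (hvert z hz p hp).2.trans (by linarith)⟩
  have s2 := hseg (z + T • v) (z' + T • v) fun p hp => ⟨(hhor p hp).1, (hhor p hp).2.trans hTk⟩
  have s3 := hseg (z' + s • v) (z' + T • v) fun p hp => ⟨(hvert z' hz' p hp).1, by
    calc ‖p - z‖ = ‖(p - z') + (z' - z)‖ := by congr 1; abel
      _ ≤ ‖p - z'‖ + ‖z' - z‖ := norm_add_le _ _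
      _ ≤ T * ‖v‖ + d := by linarith [(hvert z' hz' p hp).2]
      _ ≤ _ := hTk⟩
  have n1 : ∀ y : E, ‖y + T • v - (y + s • v)‖ = c * d * ‖v‖ := fun y => by
    rw [add_sub_add_left_eq_sub, ← sub_smul, hT, add_sub_cancel_left, norm_smul,
      Real.norm_of_nonneg (by positivity)]
  rw [n1] at s1 s3
  rw [add_sub_add_right_eq_sub] at s2
  have hη0 : 0 ≤ η := by
    by_contra hneg
    exact absurd ((norm_nonneg _).trans s2) (not_le.2 (mul_neg_of_neg_of_pos (not_le.1 hneg) hdp))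
  have e : F (z' + s • v) - F (z + s • v) - A (z' - z) =
      (F (z + T • v) - F (z + s • v) - A (z + T • v - (z + s • v))) +
      (F (z' + T • v) - F (z + T • v) - A (z' - z)) +
      -(F (z' + T • v) - F (z' + s • v) - A (z' + T • v - (z' + s • v))) := by
    simp only [map_sub, map_add]
    ring
  rw [e]
  calc _ ≤ η * (c * d * ‖v‖) + η * d + η * (c * d * ‖v‖) := by
        refine norm_add₃_le.trans ?_
        rw [norm_neg]
        exact add_le_add (add_le_add s1 s2) s3
    _ = (2 * c * ‖v‖ + 1) * (η * d) := by ring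
    _ ≤ k * (η * d) := by
        refine mul_le_mul_of_nonneg_right ?_ (by positivity)
        rw [hk]
        linarith [norm_nonneg v]
    _ = k * η * d := by ring

end Extension

section Extension

variable {D : ℕ} {E : Type*} [NormedAddCommGroup E] [NormedSpace ℂ E]
  {γ : Rn D → E} {U : Set (Rn D)} {x₀ : Rn D} {v : E}

/-- The `j`-th coordinate with respect to a frame. -/
noncomputable def frameCoord (C₀ : E →L[ℂ] (Fin D → ℂ)) (j : Fin D) : E →L[ℂ] ℂ :=
  (ContinuousLinearMap.proj j).comp C₀

theorem eq_sum_of_frameMap {C₀ : E →L[ℂ] (Fin D → ℂ)} {T : Fin D → E} (hC₀ : frameMap C₀ T = 1)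
    (B : E →L[ℂ] ℂ) :
    B = ∑ j, B (T j) • frameCoord C₀ j := by
  ext a
  have h := congrArg (fun A : E →L[ℂ] E => A a) hC₀
  simp only [frameMap_apply, one_apply_eq_self] at h
  conv_lhs => rw [← h]
  simp [map_sum, mul_comm, frameCoord]

/-- The derivatives of a holomorphic function with smooth boundary value are bounded. -/
theorem HasSmoothBoundaryValue.exists_bound_fderiv [FiniteDimensional ℂ E] (hU : IsOpen U)
    (hγ : ContDiffOn ℝ ∞ γ U) (hx₀ : x₀ ∈ U) {e : Fin D → Rn D} {C₀ : E →L[ℂ] (Fin D → ℂ)}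
    (hC₀ : frameMap C₀ (fun j => fderiv ℝ γ x₀ (e j)) = 1) {r : ℝ} (hr : 0 < r)
    {F : E → ℂ} {u : Rn D → ℂ} (h : HasSmoothBoundaryValue γ x₀ v r F u) :
    ∃ r' > 0, r' ≤ r ∧ ∃ L, ∀ z ∈ coneRegion γ x₀ v r', ‖fderiv ℂ F z‖ ≤ L := by
  set T : Fin D → E := fun j => fderiv ℝ γ x₀ (e j) with hT
  have h1 : ∀ j, ∃ r' > 0, ∃ B, ∀ z ∈ coneRegion γ x₀ v r', ‖fderiv ℂ F z (T j)‖ ≤ B := by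
    intro j
    obtain ⟨r₁, hr₁, -, u', h'⟩ := h.exists_fderiv hU hγ hx₀ hC₀ hr (T j)
    obtain ⟨l, C, hG⟩ := h'.growth
    obtain ⟨M, hM⟩ := (isCompact_closedBall x₀ (r₁ / 2)).exists_bound_of_continuousOn
      (h'.smooth.continuousOn.mono (Metric.closedBall_subset_ball (half_lt_self hr₁)))
    have h2 := h'.mono (half_le_self hr₁.le)
    obtain ⟨r₂, hr₂, -, B, hB⟩ := exists_bound_of_boundaryValue hU hγ hx₀ hC₀ (half_pos hr₁) h2.holo
      (hG.mono (half_le_self hr₁.le)) (fun x hx => hM x (Metric.ball_subset_closedBall hx))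
      h2.boundaryValue
    exact ⟨r₂, hr₂, B, hB⟩
  obtain ⟨r₁, hr₁, hB⟩ := exists_pos_forall_of_antitone (fun j r r' hr' ⟨B, hB⟩ =>
    ⟨B, fun z hz => hB z (coneRegion_mono hr' hz)⟩) h1
  choose B hB using hB
  refine ⟨min r₁ r, lt_min hr₁ hr, min_le_right _ _, ∑ j, B j *
    ‖frameCoord C₀ j‖, fun z hz => ?_⟩
  rw [eq_sum_of_frameMap hC₀ (fderiv ℂ F z)]
  refine norm_sum_le_of_le _ fun j _ => ?_
  rw [norm_smul]
  exact mul_le_mul_of_nonneg_right (hB j z (coneRegion_mono (min_le_left _ _) hz)) (norm_nonneg _)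

/-- A holomorphic function with smooth boundary value is Lipschitz continuous up to the edge. -/
theorem HasSmoothBoundaryValue.exists_lipschitz [FiniteDimensional ℂ E] (hU : IsOpen U)
    (hγ : ContDiffOn ℝ ∞ γ U) (hx₀ : x₀ ∈ U) {e : Fin D → Rn D} {C₀ : E →L[ℂ] (Fin D → ℂ)}
    (hC₀ : frameMap C₀ (fun j => fderiv ℝ γ x₀ (e j)) = 1) {r : ℝ} (hr : 0 < r)
    {F : E → ℂ} {u : Rn D → ℂ} (h : HasSmoothBoundaryValue γ x₀ v r F u) :
    ∃ r' > 0, r' ≤ r ∧ ∃ K : NNReal, LipschitzOnWith K (edgeExt v F) (closedConeRegion γ x₀ v r') ∧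
      (∀ z ∈ closedConeRegion γ x₀ v r',
        Tendsto (fun s : ℝ => F (z + s • v)) (𝓝[>] 0) (𝓝 (edgeExt v F z))) ∧
      (∀ z ∈ coneRegion γ x₀ v r', edgeExt v F z = F z) ∧
      ∀ x ∈ Metric.ball x₀ r', edgeExt v F (γ x) = u x := by
  have hγc : ContinuousOn γ U := hγ.continuousOn
  obtain ⟨r₁, hr₁, hr₁r, L, hL⟩ := h.exists_bound_fderiv hU hγ hx₀ hC₀ hr
  obtain ⟨r₂, hr₂, hr₂r, k, hk, hpath⟩ :=
    exists_path_estimate (v := v) (hγc.continuousAt (hU.mem_nhds hx₀)) hr₁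
  obtain ⟨rU, hrU, hrUU⟩ := Metric.isOpen_iff.1 hU x₀ hx₀
  have h1 := h.mono hr₁r
  have hlip : LipschitzOnWith (k * |L|).toNNReal F (coneRegion γ x₀ v r₂) := by
    refine LipschitzOnWith.of_dist_le_mul fun z' hz' z hz => ?_
    rw [dist_eq_norm, dist_eq_norm, Real.coe_toNNReal _ (by positivity)]
    have hc : ∀ y ∈ coneRegion γ x₀ v r₂, Tendsto (fun s : ℝ => F (y + s • v)) (𝓝[>] 0)
        (𝓝 (F y)) := by
      intro y hy
      have h2 : ContinuousAt F y := (h.holo.differentiableAt (isOpen_coneRegion.mem_nhds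
        (coneRegion_mono (hr₂r.trans hr₁r) hy))).continuousAt
      have h3 : Tendsto (fun s : ℝ => y + s • v) (𝓝[>] 0) (𝓝 y) := by
        have : Continuous fun s : ℝ => y + s • v := by fun_prop
        simpa using (this.tendsto 0).mono_left nhdsWithin_le_nhds
      exact h2.tendsto.comp h3
    refine le_of_tendsto ((hc z' hz').sub (hc z hz)).norm ?_
    filter_upwards [Ioo_mem_nhdsGT hr₂] with s hs
    have := hpath F h1.holo z (coneRegion_subset_closedConeRegion hz) z'
      (coneRegion_subset_closedConeRegion hz') s hs 0 |L| fun y hy _ => by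
        rw [sub_zero]
        exact (hL y hy).trans (le_abs_self L)
    simpa using this
  obtain ⟨H, hH, hHF⟩ := hlip.extend_finite_dimension
  set r₃ := min (r₂ / 2) rU with hr₃
  have hr₃p : 0 < r₃ := by positivity
  have hr₃r : r₃ ≤ r₂ := (min_le_left _ _).trans (half_le_self hr₂.le)
  have hmem : ∀ z ∈ closedConeRegion γ x₀ v r₃, ∀ s ∈ Ioo 0 (r₂ / 2),
      z + s • v ∈ coneRegion γ x₀ v r₂ := by
    intro z hz s hs
    obtain ⟨x, hx, t, ht, -, w, hw, he⟩ := add_smul_mem_coneRegion (r := r₂) hs.1 hz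
      (by linarith [hs.2, min_le_left (r₂ / 2) rU])
    exact ⟨x, Metric.ball_subset_ball hr₃r hx, t, ht, w, Metric.ball_subset_ball hr₃r hw, he⟩
  have htend : ∀ z ∈ closedConeRegion γ x₀ v r₃,
      Tendsto (fun s : ℝ => F (z + s • v)) (𝓝[>] 0) (𝓝 (H z)) := by
    intro z hz
    have h3 : Tendsto (fun s : ℝ => H (z + s • v)) (𝓝[>] 0) (𝓝 (H z)) := by
      have : Continuous fun s : ℝ => H (z + s • v) := hH.continuous.comp (by fun_prop)
      simpa using (this.tendsto 0).mono_left nhdsWithin_le_nhds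
    refine h3.congr' ?_
    filter_upwards [Ioo_mem_nhdsGT (half_pos hr₂)] with s hs
    exact (hHF (hmem z hz s hs)).symm
  have hext : ∀ z ∈ closedConeRegion γ x₀ v r₃, edgeExt v F z = H z := fun z hz =>
    (htend z hz).limUnder_eq
  have hedge : ∀ x ∈ Metric.ball x₀ r₃, γ x ∈ closedConeRegion γ x₀ v r₃ := fun x hx =>
    ⟨x, hx, 0, ⟨le_rfl, hr₃p⟩, v, Metric.mem_ball_self hr₃p, by simp⟩
  refine ⟨r₃, hr₃p, hr₃r.trans (hr₂r.trans hr₁r),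
    lipschitzExtensionConstant ℂ * (k * |L|).toNNReal, ?_, fun z hz => hext z hz ▸ htend z hz,
    fun z hz => ?_, fun x hx => ?_⟩
  · intro z hz z' hz'
    rw [hext z hz, hext z' hz']
    exact hH z z'
  · rw [hext z (coneRegion_subset_closedConeRegion hz), hHF (coneRegion_mono hr₃r hz)]
  -- Along the edge, both `H ∘ γ` and `u` are the boundary value of `F`.
  · rw [hext _ (hedge x hx), ← sub_eq_zero, ← norm_le_zero_iff]
    have hr₃U : Metric.ball x₀ r₃ ⊆ U := (Metric.ball_subset_ball (min_le_right _ _)).trans hrUU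
    have hHγ : ContinuousOn (fun x => H (γ x)) (Metric.ball x₀ r₃) :=
      hH.continuous.comp_continuousOn (hγc.mono hr₃U)
    have hr₃r' : r₃ ≤ r := hr₃r.trans (hr₂r.trans hr₁r)
    have huc : ContinuousOn u (Metric.ball x₀ r₃) :=
      h.smooth.continuousOn.mono (Metric.ball_subset_ball hr₃r')
    obtain ⟨ρ, hρ, hρb⟩ := Metric.nhds_basis_closedBall.mem_iff.1 (Metric.isOpen_ball.mem_nhds hx)
    refine norm_le_of_norm_mean_le (f := fun x => H (γ x) - u x)
      ((hHγ.sub huc).continuousAt (Metric.isOpen_ball.mem_nhds hx)) hρ ?_ ((hHγ.sub huc).mono hρb)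
    intro φ hφ hφ0 hφ1 hφs
    have hφ' : ContDiff ℝ ∞ fun z : Rn D => (φ z : ℂ) := Complex.ofRealCLM.contDiff.comp hφ
    have hi : ∀ {g : Rn D → ℂ}, ContinuousOn g (Metric.ball x₀ r₃) →
        Integrable fun x => g x * (φ x : ℂ) := fun hg =>
      (((hg.mono hρb).mul hφ'.continuous.continuousOn).integrableOn_compact
        (isCompact_closedBall _ _)).integrable_of_forall_notMem_eq_zero
        fun x hx => by simp [hφs x hx]
    have hsupp : tsupport (fun x => (φ x : ℂ)) ⊆ Metric.closedBall x ρ := by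
      refine closure_minimal (fun y hy => ?_) Metric.isClosed_closedBall
      by_contra hy'
      exact hy (by simp [hφs y hy'])
    have t1 := h.boundaryValue _ hφ' (hsupp.trans (hρb.trans (Metric.ball_subset_ball hr₃r')))
    have t2 : Tendsto (fun ε : ℝ => ∫ x, F (γ x + ε • v) * (φ x : ℂ)) (𝓝[>] 0)
        (𝓝 (∫ x, H (γ x) * (φ x : ℂ))) := by
      have hcont : ContinuousOn (fun ε : ℝ => ∫ x, H (γ x + ε • v) * (φ x : ℂ)) (Icc 0 1) := by
        refine continuousOn_integral_of_compact (P := ℝ)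
          (g := fun ε x => H (γ x + ε • v) * (φ x : ℂ)) (isCompact_closedBall x ρ) isCompact_Icc
          (ContinuousOn.mul ?_ (hφ'.continuous.comp continuous_snd).continuousOn)
          fun p x hx => by simp [hφs x hx]
        refine hH.continuous.comp_continuousOn (ContinuousOn.add ?_ ?_)
        · exact (hγc.mono (hρb.trans hr₃U)).comp continuousOn_snd fun p hp => hp.2
        · fun_prop
      have t3 := (hcont 0 ⟨le_rfl, zero_le_one⟩).tendsto
      simp only [zero_smul, add_zero] at t3
      refine ((t3.mono_left (nhdsWithin_mono 0 (s := Ioo 0 1) Ioo_subset_Icc_self)).mono_left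
        (nhdsWithin_Ioo_eq_nhdsGT zero_lt_one).ge).congr' ?_
      filter_upwards [Ioo_mem_nhdsGT (half_pos hr₂)] with ε hε
      refine integral_congr_ae (Eventually.of_forall fun y => ?_)
      by_cases hy : y ∈ Metric.closedBall x ρ
      · simp only
        rw [hHF (hmem _ (hedge y (hρb hy)) ε hε)]
      · simp [hφs y hy]
    have t4 := tendsto_nhds_unique t1 t2
    have t5 : ∫ y, (H (γ y) - u y) * (φ y : ℂ) = 0 := by
      simp only [sub_mul]
      rw [integral_sub (hi (g := fun y => H (γ y)) hHγ) (hi huc), ← t4, sub_self]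
    rw [t5, norm_zero]

/-- The differential of the extension to the edge. -/
noncomputable def edgeExtDeriv (v : E) (C₀ : E →L[ℂ] (Fin D → ℂ)) (T : Fin D → E) (F : E → ℂ)
    (z : E) : E →L[ℂ] ℂ :=
  ∑ j, edgeExt v (fun z => fderiv ℂ F z (T j)) z •
    frameCoord C₀ j

theorem HasSmoothBoundaryValue.exists_hasFDerivWithinAt [FiniteDimensional ℂ E] (hU : IsOpen U)
    (hγ : ContDiffOn ℝ ∞ γ U) (hx₀ : x₀ ∈ U) {e : Fin D → Rn D} {C₀ : E →L[ℂ] (Fin D → ℂ)}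
    (hC₀ : frameMap C₀ (fun j => fderiv ℝ γ x₀ (e j)) = 1) {r : ℝ} (hr : 0 < r)
    {F : E → ℂ} {u : Rn D → ℂ} (h : HasSmoothBoundaryValue γ x₀ v r F u) :
    ∃ r' > 0, r' ≤ r ∧ ∀ z ∈ closedConeRegion γ x₀ v r', HasFDerivWithinAt (edgeExt v F)
      ((edgeExtDeriv v C₀ (fun j => fderiv ℝ γ x₀ (e j)) F z).restrictScalars ℝ)
      (closedConeRegion γ x₀ v r') z := by
  set T : Fin D → E := fun j => fderiv ℝ γ x₀ (e j) with hT
  have h1 : ∀ j, ∃ r' > 0, ∃ K : NNReal,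
      LipschitzOnWith K (edgeExt v fun z => fderiv ℂ F z (T j)) (closedConeRegion γ x₀ v r') ∧
      ∀ z ∈ coneRegion γ x₀ v r', edgeExt v (fun z => fderiv ℂ F z (T j)) z = fderiv ℂ F z (T j) := by
    intro j
    obtain ⟨r₁, hr₁, -, u', h'⟩ := h.exists_fderiv hU hγ hx₀ hC₀ hr (T j)
    obtain ⟨r₂, hr₂, -, K, hK, -, hK', -⟩ := h'.exists_lipschitz hU hγ hx₀ hC₀ hr₁
    exact ⟨r₂, hr₂, K, hK, hK'⟩
  obtain ⟨r₁, hr₁, hL⟩ := exists_pos_forall_of_antitone (fun j r r' hr' ⟨K, hK, hK'⟩ =>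
    ⟨K, hK.mono (closedConeRegion_mono hr'), fun z hz => hK' z (coneRegion_mono hr' hz)⟩) h1
  choose K hK hKF using hL
  obtain ⟨r₂, hr₂, hr₂r, -, -, htend, -, -⟩ := h.exists_lipschitz hU hγ hx₀ hC₀ hr
  set m := min r₁ r₂ with hm
  have hmp : 0 < m := lt_min hr₁ hr₂
  obtain ⟨r₃, hr₃, hr₃m, k, hk, hpath⟩ :=
    exists_path_estimate (v := v) (hγ.continuousOn.continuousAt (hU.mem_nhds hx₀)) hmp
  set L : ℝ := ∑ j, K j * ‖frameCoord C₀ j‖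
    with hLdef
  have hL0 : 0 ≤ L := Finset.sum_nonneg fun j _ => by positivity
  -- The differential of `F` is close to that of the extension at a point of the edge.
  have hA : ∀ z ∈ closedConeRegion γ x₀ v r₃, ∀ y ∈ coneRegion γ x₀ v m,
      ‖fderiv ℂ F y - edgeExtDeriv v C₀ T F z‖ ≤ L * ‖y - z‖ := by
    intro z hz y hy
    have hy' := coneRegion_mono (min_le_left _ _) hy
    have hz' := closedConeRegion_mono (hr₃m.trans (min_le_left _ _)) hz
    rw [eq_sum_of_frameMap hC₀ (fderiv ℂ F y), edgeExtDeriv, ← Finset.sum_sub_distrib, hLdef,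
      Finset.sum_mul]
    refine norm_sum_le_of_le _ fun j _ => ?_
    have hsub : ∀ (a b : ℂ) (B : E →L[ℂ] ℂ), a • B - b • B = (a - b) • B := fun a b B => by
      ext
      simp [sub_mul]
    rw [hsub, norm_smul]
    have := (hK j).dist_le_mul y (coneRegion_subset_closedConeRegion hy') z hz'
    rw [hKF j y hy', dist_eq_norm, dist_eq_norm] at this
    calc _ ≤ (K j * ‖y - z‖) * _ := mul_le_mul_of_nonneg_right this (norm_nonneg _)
      _ = _ := by ring
  refine ⟨r₃, hr₃, hr₃m.trans ((min_le_right _ _).trans hr₂r), fun z hz => ?_⟩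
  have hsub : closedConeRegion γ x₀ v r₃ ⊆ closedConeRegion γ x₀ v r₂ :=
    closedConeRegion_mono (hr₃m.trans (min_le_right _ _))
  have hquad : ∀ z' ∈ closedConeRegion γ x₀ v r₃,
      ‖edgeExt v F z' - edgeExt v F z - edgeExtDeriv v C₀ T F z (z' - z)‖ ≤
        k * (L * (k * ‖z' - z‖)) * ‖z' - z‖ := by
    intro z' hz'
    have hlim : Tendsto (fun s : ℝ => k * (L * (k * (‖z' - z‖ + s))) * ‖z' - z‖) (𝓝[>] 0)
        (𝓝 (k * (L * (k * (‖z' - z‖ + 0))) * ‖z' - z‖)) := by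
      have : Continuous fun s : ℝ => k * (L * (k * (‖z' - z‖ + s))) * ‖z' - z‖ := by fun_prop
      exact (this.tendsto 0).mono_left nhdsWithin_le_nhds
    rw [add_zero] at hlim
    refine le_of_tendsto_of_tendsto
      (((htend z' (hsub hz')).sub (htend z (hsub hz))).sub_const _).norm hlim ?_
    filter_upwards [Ioo_mem_nhdsGT hr₃] with s hs
    refine hpath F (h.holo.mono (coneRegion_mono ((min_le_right _ _).trans hr₂r))) z hz z' hz' s hs
      _ _ fun y hy hyz => (hA z hz y hy).trans ?_
    gcongr
  rw [hasFDerivWithinAt_iff_isLittleO, Asymptotics.isLittleO_iff]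
  intro c hc
  have hnear : ∀ᶠ z' in 𝓝[closedConeRegion γ x₀ v r₃] z, k * (L * (k * ‖z' - z‖)) < c := by
    have : Continuous fun z' : E => k * (L * (k * ‖z' - z‖)) := by fun_prop
    exact ((this.tendsto z).eventually_lt_const (by simpa using hc)).filter_mono nhdsWithin_le_nhds
  filter_upwards [hnear, self_mem_nhdsWithin] with z' hz' hzm
  exact (hquad z' hzm).trans (mul_le_mul_of_nonneg_right hz'.le (norm_nonneg _))

/-- A holomorphic function with smooth boundary value is smooth up to the edge. -/
theorem HasSmoothBoundaryValue.exists_contDiffOn [FiniteDimensional ℂ E] (hU : IsOpen U)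
    (hγ : ContDiffOn ℝ ∞ γ U) (hx₀ : x₀ ∈ U) {e : Fin D → Rn D} {C₀ : E →L[ℂ] (Fin D → ℂ)}
    (hC₀ : frameMap C₀ (fun j => fderiv ℝ γ x₀ (e j)) = 1) (n : ℕ) {r : ℝ} (hr : 0 < r)
    {F : E → ℂ} {u : Rn D → ℂ} (h : HasSmoothBoundaryValue γ x₀ v r F u) :
    ∃ r' > 0, ContDiffOn ℝ n (edgeExt v F) (closedConeRegion γ x₀ v r') := by
  induction n generalizing F u r with
  | zero =>
    obtain ⟨r', hr', -, K, hK, -⟩ := h.exists_lipschitz hU hγ hx₀ hC₀ hr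
    exact ⟨r', hr', contDiffOn_zero.2 hK.continuousOn⟩
  | succ n ih =>
    obtain ⟨r₁, hr₁, -, hd⟩ := h.exists_hasFDerivWithinAt hU hγ hx₀ hC₀ hr
    have h1 : ∀ j, ∃ r' > 0, ContDiffOn ℝ n
        (edgeExt v fun z => fderiv ℂ F z (fderiv ℝ γ x₀ (e j))) (closedConeRegion γ x₀ v r') := by
      intro j
      obtain ⟨r₁, hr₁, -, u', h'⟩ := h.exists_fderiv hU hγ hx₀ hC₀ hr (fderiv ℝ γ x₀ (e j))
      exact ih hr₁ h'
    obtain ⟨r₂, hr₂, hr₂'⟩ := exists_pos_forall_of_antitone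
      (fun j r r' hr' hK => hK.mono (closedConeRegion_mono hr')) h1
    refine ⟨min r₁ r₂, lt_min hr₁ hr₂, ?_⟩
    have hsub := closedConeRegion_mono (γ := γ) (x₀ := x₀) (v := v) (min_le_left r₁ r₂)
    push_cast
    rw [contDiffOn_succ_iff_hasFDerivWithinAt (by simp)]
    intro z hz
    refine ⟨closedConeRegion γ x₀ v (min r₁ r₂), ?_, by simp, _,
      fun z hz => (hd z (hsub hz)).mono hsub, ?_⟩
    · rw [insert_eq_of_mem hz]
      exact self_mem_nhdsWithin
    · have h2 : ContDiffOn ℝ n (edgeExtDeriv v C₀ (fun j => fderiv ℝ γ x₀ (e j)) F)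
          (closedConeRegion γ x₀ v (min r₁ r₂)) :=
        ContDiffOn.sum fun j _ =>
          ((hr₂' j).mono (closedConeRegion_mono (min_le_right _ _))).smul contDiffOn_const
      exact (ContinuousLinearMap.restrictScalarsL ℂ E ℂ ℝ ℝ).contDiff.comp_contDiffOn h2

end Extension

/-! ### Holomorphic extension to wedges and to cone regions -/

section WedgeExtension

variable {D : ℕ} {E : Type*} [NormedAddCommGroup E] [NormedSpace ℂ E]
  {S : Set E} {Ω : Opens (Rn D)} {γ : Rn D → E} {x₀ : Rn D}

theorem IsLocalParam.mem {x : Rn D} (hγ : IsLocalParam S Ω γ) (hx : x ∈ Ω) : γ x ∈ S := by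
  obtain ⟨V, -, hV⟩ := hγ.isOpen_image Ω Ω.isOpen le_rfl
  exact (hV.subset (mem_image_of_mem γ hx)).1

theorem IsLocalParam.contDiffAt {x : Rn D} (hγ : IsLocalParam S Ω γ) (hx : x ∈ Ω) :
    ContDiffAt ℝ ∞ γ x :=
  hγ.smooth.contDiffAt (Ω.isOpen.mem_nhds hx)

theorem ConvexCone.eq_univ_of_zero_mem {V : Type*} [NormedAddCommGroup V] [NormedSpace ℝ V]
    {Γ : ConvexCone ℝ V} (hΓ : IsOpen (Γ : Set V)) (h0 : (0 : V) ∈ Γ) (y : V) : y ∈ Γ := by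
  have h1 : Tendsto (fun s : ℝ => s • y) (𝓝[>] 0) (𝓝 0) := by
    have : Tendsto (fun s : ℝ => s • y) (𝓝 0) (𝓝 ((0 : ℝ) • y)) :=
      (continuous_id.smul continuous_const).tendsto _
    rw [zero_smul] at this
    exact this.mono_left nhdsWithin_le_nhds
  obtain ⟨s, hs, hs0⟩ := ((h1.eventually (hΓ.mem_nhds h0)).and self_mem_nhdsWithin).exists
  have := Γ.smul_mem (inv_pos.2 hs0) hs
  rwa [inv_smul_smul₀ (ne_of_gt hs0)] at this

/-- In the definition of holomorphic extension to a wedge, the wedge may be replaced by a cone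
region, and the distance to the edge by the parameter `t`. -/
theorem ExtendsHolomorphically.exists_coneRegion {u : 𝓓(Ω, ℝ) → ℂ} (hγ : IsLocalParam S Ω γ)
    (hx₀ : x₀ ∈ Ω) (h : ExtendsHolomorphically S Ω γ x₀ u) :
    ∃ (v : E) (F : E → ℂ) (r : ℝ), 0 < r ∧ Metric.ball x₀ r ⊆ Ω ∧
      DifferentiableOn ℂ F (coneRegion γ x₀ v r) ∧ (∃ l C, SlowGrowth γ x₀ v r l C F) ∧
      ∀ φ : 𝓓(Ω, ℝ), tsupport φ ⊆ Metric.ball x₀ r →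
        Tendsto (fun t : ℝ => ∫ x, F (γ x + t • v) * (φ x : ℂ)) (𝓝[>] 0) (𝓝 (u φ)) := by
  obtain ⟨W, v, F, ⟨-, -, hdir⟩, hF, ⟨C, l, hC⟩, U, hU, hxU, hbv⟩ := h
  have hρ : HasStrictFDerivAt W.ρ (fderiv ℝ W.ρ (γ x₀)) (γ x₀) :=
    (W.smooth_ρ.contDiffAt (W.isOpen_nhd.mem_nhds W.mem_nhd)).hasStrictFDerivAt (by simp)
  set A := fderiv ℝ W.ρ (γ x₀) with hA
  obtain ⟨η, hη, hηΓ⟩ := Metric.isOpen_iff.1 W.isOpen_Γ _ hdir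
  obtain ⟨δ, hδ, hest⟩ := hρ.exists_norm_sub_sub_le (c := η / (4 * (‖v‖ + 1))) (by positivity)
  obtain ⟨δ₁, hδ₁, hnhd⟩ := Metric.isOpen_iff.1 W.isOpen_nhd _ W.mem_nhd
  -- near the base point, a bound for `F` if the wedge is a full neighbourhood
  obtain ⟨δ₂, hδ₂, B, hB⟩ : ∃ δ₂ > 0, ∃ B, (0 : Rn W.c) ∈ W.Γ →
      ∀ z ∈ Metric.ball (γ x₀) δ₂, ‖F z‖ ≤ B := by
    by_cases h0 : (0 : Rn W.c) ∈ W.Γ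
    · have hz : W.nhd ⊆ W.toSet := fun z hz =>
        ⟨⟨mem_univ _, hz⟩, ConvexCone.eq_univ_of_zero_mem W.isOpen_Γ h0 _⟩
      have hcont : ContinuousAt F (γ x₀) := ((hF.mono hz).differentiableAt
        (W.isOpen_nhd.mem_nhds W.mem_nhd)).continuousAt
      obtain ⟨δ₂, hδ₂, hb⟩ := Metric.continuousAt_iff.1 hcont 1 one_pos
      refine ⟨δ₂, hδ₂, ‖F (γ x₀)‖ + 1, fun _ z hz => ?_⟩
      have := hb hz
      rw [dist_eq_norm] at this
      have h2 := norm_add_le (F z - F (γ x₀)) (F (γ x₀))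
      rw [sub_add_cancel] at h2
      linarith
    · exact ⟨1, one_pos, 0, fun h => absurd h h0⟩
  set m := min δ δ₁ with hm
  have hmp : 0 < m := lt_min hδ hδ₁
  set d := min (m / 2) δ₂ with hd
  have hdp : 0 < d := lt_min (half_pos hmp) hδ₂
  have hdm : d ≤ m / 2 := min_le_left _ _
  have hdδ : d ≤ δ := hdm.trans ((half_le_self hmp.le).trans (min_le_left _ _))
  have hdδ₁ : d ≤ δ₁ := hdm.trans ((half_le_self hmp.le).trans (min_le_right _ _))
  -- the cone region is small
  obtain ⟨r₁, hr₁, hγr⟩ := Metric.continuousAt_iff.1 (hγ.contDiffAt hx₀).continuousAt (d / 2)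
    (half_pos hdp)
  obtain ⟨r₂, hr₂, hΩr⟩ := Metric.isOpen_iff.1 (Ω.isOpen.inter hU) _ ⟨hx₀, hxU⟩
  set r := min (min r₁ r₂) (min (min 1 (η / (4 * (‖A‖ + 1)))) (d / (2 * (‖v‖ + 1)))) with hr
  have hrp : 0 < r := by rw [hr]; positivity
  have hr_1 : r ≤ r₁ := (min_le_left _ _).trans (min_le_left _ _)
  have hr_2 : r ≤ r₂ := (min_le_left _ _).trans (min_le_right _ _)
  have hr_3 : r ≤ 1 := (min_le_right _ _).trans ((min_le_left _ _).trans (min_le_left _ _))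
  have hr_4 : r ≤ η / (4 * (‖A‖ + 1)) :=
    (min_le_right _ _).trans ((min_le_left _ _).trans (min_le_right _ _))
  have hr_5 : r ≤ d / (2 * (‖v‖ + 1)) := (min_le_right _ _).trans (min_le_right _ _)
  have hball : Metric.ball x₀ r ⊆ Ω := fun x hx => (hΩr (Metric.ball_subset_ball hr_2 hx)).1
  have key : ∀ x ∈ Metric.ball x₀ r, ∀ t ∈ Ioo 0 r, ∀ v' ∈ Metric.ball v r,
      γ x + t • v' ∈ Metric.ball (γ x₀) d ∧
      ∃ ξ ∈ Metric.ball (A v) (η / 2), W.ρ (γ x + t • v') = t • ξ := by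
    intro x hx t ht v' hv'
    have ht0 := ht.1
    have hγx : γ x ∈ Metric.ball (γ x₀) (d / 2) := hγr (Metric.ball_subset_ball hr_1 hx)
    rw [mem_ball_iff_norm] at hγx hv'
    have hnv : ‖v'‖ < ‖v‖ + 1 := by
      have := norm_add_le (v' - v) v
      rw [sub_add_cancel] at this
      linarith
    have hmem : γ x + t • v' ∈ Metric.ball (γ x₀) d := by
      rw [mem_ball_iff_norm]
      have h1 : ‖t • v'‖ ≤ d / 2 := by
        rw [norm_smul, Real.norm_of_nonneg ht0.le]
        calc _ ≤ d / (2 * (‖v‖ + 1)) * (‖v‖ + 1) := by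
              gcongr
              exact ht.2.le.trans hr_5
          _ = d / 2 := by field_simp
      calc _ = ‖(γ x - γ x₀) + t • v'‖ := by congr 1; abel
        _ ≤ _ := norm_add_le _ _
        _ < d := by linarith
    refine ⟨hmem, t⁻¹ • W.ρ (γ x + t • v'), ?_, (smul_inv_smul₀ ht0.ne' _).symm⟩
    have hx' : γ x ∈ Metric.ball (γ x₀) d := by
      rw [mem_ball_iff_norm]
      linarith
    have h2 := hest _ (Metric.ball_subset_ball hdδ hmem) _ (Metric.ball_subset_ball hdδ hx')
    have h3 : W.ρ (γ x) = 0 := (W.mem_edge_iff _ ⟨mem_univ _,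
      hnhd (Metric.ball_subset_ball hdδ₁ hx')⟩).1
      (hγ.mem (hball hx))
    rw [h3, sub_zero, add_sub_cancel_left, map_smul, norm_smul, Real.norm_of_nonneg ht0.le] at h2
    have e1 : t⁻¹ • W.ρ (γ x + t • v') - A v =
        t⁻¹ • (W.ρ (γ x + t • v') - t • A v') + A (v' - v) := by
      rw [smul_sub, inv_smul_smul₀ ht0.ne', map_sub]
      abel
    have e2 : ‖t⁻¹ • (W.ρ (γ x + t • v') - t • A v')‖ ≤ η / 4 := by
      rw [norm_smul, norm_inv, Real.norm_of_nonneg ht0.le]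
      calc _ ≤ t⁻¹ * (η / (4 * (‖v‖ + 1)) * (t * (‖v‖ + 1))) := by
            gcongr
            exact h2.trans (by gcongr)
        _ = η / 4 := by field_simp
    have e3 : ‖A (v' - v)‖ < η / 4 := by
      calc _ ≤ ‖A‖ * ‖v' - v‖ := A.le_opNorm _
        _ ≤ ‖A‖ * (η / (4 * (‖A‖ + 1))) := by gcongr; exact hv'.le.trans hr_4
        _ = η / 4 * (‖A‖ / (‖A‖ + 1)) := by field_simp
        _ < η / 4 * 1 := by
            gcongr
            rw [div_lt_one (by positivity)]
            linarith
        _ = η / 4 := mul_one _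
    rw [mem_ball_iff_norm, e1]
    calc _ ≤ _ := norm_add_le _ _
      _ < η / 2 := by linarith
  have hsub : coneRegion γ x₀ v r ⊆ W.toSet := by
    rintro z ⟨x, hx, t, ht, v', hv', rfl⟩
    obtain ⟨h1, ξ, hξ, h2⟩ := key x hx t ht v' hv'
    refine ⟨⟨mem_univ _, hnhd (Metric.ball_subset_ball hdδ₁ h1)⟩, ?_⟩
    rw [h2]
    exact W.Γ.smul_mem ht.1 (hηΓ (Metric.ball_subset_ball (half_le_self hη.le) hξ))
  refine ⟨v, F, r, hrp, hball, hF.mono hsub, ?_, fun φ hφ => hbv φ fun x hx =>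
    (hΩr (Metric.ball_subset_ball hr_2 (hφ hx))).2⟩
  by_cases h0 : (0 : Rn W.c) ∈ W.Γ
  · refine ⟨0, B, fun x hx t ht v' hv' => ?_⟩
    rw [pow_zero, div_one]
    exact hB h0 _ (Metric.ball_subset_ball (min_le_right _ _)
      (key x hx t ht v' hv').1)
  · -- otherwise the distance to the edge is comparable to `t`
    set K := η / (4 * (‖v‖ + 1)) + ‖A‖ with hK
    have hKp : 0 < K := by positivity
    set c := min (η / 2 / K) (m / 2) with hc
    have hcp : 0 < c := by positivity
    refine ⟨l, C / c ^ l, fun x hx t ht v' hv' => ?_⟩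
    have ht0 := ht.1
    obtain ⟨h1, ξ, hξ, h2⟩ := key x hx t ht v' hv'
    set z := γ x + t • v' with hz
    have hξn : η / 2 ≤ ‖ξ‖ := by
      by_contra hlt
      refine h0 (hηΓ ?_)
      rw [mem_ball_iff_norm] at hξ ⊢
      have := norm_sub_le (ξ - A v) ξ
      rw [sub_sub_cancel_left, norm_neg] at this
      rw [zero_sub, norm_neg]
      linarith [not_le.1 hlt]
    have hdist : c * t ≤ Metric.infDist z S := by
      refine (Metric.le_infDist ⟨_, hγ.mem hx₀⟩).2 fun y hy => ?_
      by_cases hyd : y ∈ Metric.ball (γ x₀) m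
      · have h3 : W.ρ y = 0 := (W.mem_edge_iff _ ⟨mem_univ _,
          hnhd (Metric.ball_subset_ball (min_le_right _ _) hyd)⟩).1 hy
        have h4 := hest z (Metric.ball_subset_ball hdδ h1) y
          (Metric.ball_subset_ball (min_le_left _ _) hyd)
        rw [h3, sub_zero, h2] at h4
        have h5 : t * (η / 2) ≤ K * ‖z - y‖ := by
          calc t * (η / 2) ≤ t * ‖ξ‖ := by gcongr
            _ = ‖t • ξ‖ := by rw [norm_smul, Real.norm_of_nonneg ht0.le]
            _ = ‖(t • ξ - A (z - y)) + A (z - y)‖ := by rw [sub_add_cancel]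
            _ ≤ _ := norm_add_le _ _
            _ ≤ _ := add_le_add h4 (A.le_opNorm _)
            _ = _ := by rw [hK]; ring
        rw [dist_eq_norm]
        calc c * t ≤ η / 2 / K * t := by gcongr; exact min_le_left _ _
          _ = t * (η / 2) / K := by ring
          _ ≤ ‖z - y‖ := by rw [div_le_iff₀ hKp]; linarith
      · rw [Metric.mem_ball, not_lt] at hyd
        rw [Metric.mem_ball] at h1
        have h8 := dist_triangle y z (γ x₀)
        rw [dist_comm y z] at h8
        calc c * t ≤ m / 2 * 1 := by
              gcongr
              · exact min_le_right _ _
              · exact ht.2.le.trans hr_3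
          _ ≤ dist z y := by linarith
    have h6 := hC z (hsub ⟨x, hx, t, ht, v', hv', rfl⟩)
    have h7 : ‖F z‖ * (c * t) ^ l ≤ C := (by gcongr : _ ≤ _).trans h6
    rw [div_div, le_div_iff₀ (by positivity), ← mul_pow]
    exact h7

theorem isBoundaryValue_complex {u : Rn D → ℂ} {v : E} {F : E → ℂ} {r : ℝ} (hr : 0 < r)
    (hγ : ContinuousOn γ (Metric.ball x₀ r)) (hrΩ : Metric.ball x₀ r ⊆ Ω)
    (hF : ContinuousOn F (coneRegion γ x₀ v r)) (hu : ContinuousOn u (Metric.ball x₀ r))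
    (h : ∀ φ : 𝓓(Ω, ℝ), tsupport φ ⊆ Metric.ball x₀ r →
      Tendsto (fun t : ℝ => ∫ x, F (γ x + t • v) * (φ x : ℂ)) (𝓝[>] 0)
        (𝓝 (∫ x, u x * (φ x : ℂ)))) :
    HasLinearBoundaryValue γ x₀ v r F fun φ => ∫ x, u x * φ x := by
  intro φ hφ hs
  have hcs := hasCompactSupport_of_tsupport_subset_ball hs
  have hint : ∀ {a : Rn D → ℂ} {ψ : Rn D → ℝ}, ContinuousOn a (Metric.ball x₀ r) →
      Continuous ψ → (∀ x ∉ tsupport φ, ψ x = 0) → Integrable fun x => a x * (ψ x : ℂ) := by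
    intro a ψ ha hψ h0
    refine (((ha.mono hs).mul (Complex.continuous_ofReal.comp hψ).continuousOn).integrableOn_compact
      hcs).integrable_of_forall_notMem_eq_zero fun x hx => ?_
    change a x * (ψ x : ℂ) = 0
    rw [h0 x hx, Complex.ofReal_zero, mul_zero]
  have hre : Continuous fun x => (φ x).re := Complex.continuous_re.comp hφ.continuous
  have him : Continuous fun x => (φ x).im := Complex.continuous_im.comp hφ.continuous
  have hre0 : ∀ x ∉ tsupport φ, (φ x).re = 0 := fun x hx => by
    rw [image_eq_zero_of_notMem_tsupport hx, Complex.zero_re]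
  have him0 : ∀ x ∉ tsupport φ, (φ x).im = 0 := fun x hx => by
    rw [image_eq_zero_of_notMem_tsupport hx, Complex.zero_im]
  have hsub : ∀ {ψ : Rn D → ℝ}, (∀ x ∉ tsupport φ, ψ x = 0) → tsupport ψ ⊆ tsupport φ :=
    fun h0 => closure_minimal (fun x hx => by
      by_contra hx'
      exact hx (h0 x hx')) (isClosed_tsupport φ)
  have hsplit : ∀ {a : Rn D → ℂ}, ContinuousOn a (Metric.ball x₀ r) →
      ∫ x, a x * φ x = (∫ x, a x * ((φ x).re : ℂ)) + Complex.I * ∫ x, a x * ((φ x).im : ℂ) := by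
    intro a ha
    rw [← integral_const_mul, ← integral_add (hint ha hre hre0) ((hint ha him him0).const_mul _)]
    refine integral_congr_ae (Eventually.of_forall fun x => ?_)
    change a x * φ x = a x * ((φ x).re : ℂ) + Complex.I * (a x * ((φ x).im : ℂ))
    conv_lhs => rw [← Complex.re_add_im (φ x)]
    ring
  let φ₁ : 𝓓(Ω, ℝ) := ⟨fun x => (φ x).re, Complex.reCLM.contDiff.comp hφ,
    hcs.mono' ((subset_tsupport _).trans (hsub hre0)), (hsub hre0).trans (hs.trans hrΩ)⟩
  let φ₂ : 𝓓(Ω, ℝ) := ⟨fun x => (φ x).im, Complex.imCLM.contDiff.comp hφ,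
    hcs.mono' ((subset_tsupport _).trans (hsub him0)), (hsub him0).trans (hs.trans hrΩ)⟩
  have h1 := h φ₁ ((hsub hre0).trans hs)
  have h2 := h φ₂ ((hsub him0).trans hs)
  have h3 := h1.add (h2.const_mul Complex.I)
  change Tendsto _ _ (𝓝 (∫ x, u x * φ x))
  rw [hsplit hu]
  refine h3.congr' ?_
  filter_upwards [Ioo_mem_nhdsGT hr] with t ht
  refine (hsplit (hF.comp (hγ.add continuousOn_const) fun x hx => ?_)).symm
  exact ⟨x, hx, t, ht, v, Metric.mem_ball_self hr, rfl⟩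

/-- The summands of a decomposable smooth function are smooth boundary values of holomorphic
functions on cone regions. -/
theorem FunctionDecomposableAt.exists_hasSmoothBoundaryValue {u : E → ℂ} (hγ : IsLocalParam S Ω γ)
    (hx₀ : x₀ ∈ Ω) (h : FunctionDecomposableAt S Ω γ x₀ u) :
    ∃ (K : ℕ) (v : Fin K → E) (F : Fin K → E → ℂ) (U : Fin K → Rn D → ℂ) (r : ℝ), 0 < r ∧
      Metric.ball x₀ r ⊆ Ω ∧ (∀ j, HasSmoothBoundaryValue γ x₀ (v j) r (F j) (U j)) ∧
      ∀ x ∈ Metric.ball x₀ r, u (γ x) = ∑ j, U j x := by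
  obtain ⟨K, U, V, hV, hxV, hU, hext, hsum⟩ := h
  choose v F r hr hrΩ hF hG hbv using fun j => (hext j).exists_coneRegion hγ hx₀
  obtain ⟨r₀, hr₀, hr₀V⟩ := Metric.mem_nhds_iff.1
    ((hγ.contDiffAt hx₀).continuousAt.preimage_mem_nhds (hV.mem_nhds hxV))
  obtain ⟨r₂, hr₂, hr₂Ω⟩ := Metric.isOpen_iff.1 Ω.isOpen _ hx₀
  obtain ⟨r₁, hr₁, hr₁r⟩ := exists_pos_forall_of_antitone (P := fun j s => s ≤ r j)
    (fun j a b hab hb => hab.trans hb) fun j => ⟨r j, hr j, le_rfl⟩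
  set s := min (min r₀ r₂) r₁ with hs
  have hsp : 0 < s := by positivity
  have hsΩ : Metric.ball x₀ s ⊆ Ω :=
    (Metric.ball_subset_ball ((min_le_left _ _).trans (min_le_right _ _))).trans hr₂Ω
  have hsr : ∀ j, s ≤ r j := fun j => (min_le_right _ _).trans (hr₁r j)
  have hSV : ∀ x ∈ Metric.ball x₀ s, γ x ∈ S ∩ V := fun x hx =>
    ⟨hγ.mem (hsΩ hx), hr₀V (Metric.ball_subset_ball ((min_le_left _ _).trans (min_le_left _ _)) hx)⟩
  have hγs : ContDiffOn ℝ ∞ γ (Metric.ball x₀ s) := hγ.smooth.mono hsΩ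
  refine ⟨K, v, F, fun j x => U j (γ x), s, hsp, hsΩ, fun j => ?_, fun x hx => hsum _ (hSV x hx)⟩
  have hu : ContDiffOn ℝ ∞ (fun x => U j (γ x)) (Metric.ball x₀ s) := (hU j).comp hγs hSV
  have hFs := (hF j).mono (coneRegion_mono (hsr j))
  obtain ⟨l, C, hlC⟩ := hG j
  exact ⟨hFs, ⟨l, C, hlC.mono (hsr j)⟩, hu, isBoundaryValue_complex hsp hγs.continuousOn hsΩ
    hFs.continuousOn hu.continuousOn fun φ hφ => hbv j φ
      (hφ.trans (Metric.ball_subset_ball (hsr j)))⟩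

end WedgeExtension

/-! ### Tangent spaces of parametrized submanifolds -/

section TangentSpaces

variable {d : ℕ} {V : Type*} [NormedAddCommGroup V] [NormedSpace ℂ V]
  {S : Set V} {Ω : Opens (Rn d)} {γ : Rn d → V} {x₀ : Rn d}

theorem LinearMap.exists_pos_mul_norm_le {V W : Type*} [NormedAddCommGroup V] [NormedSpace ℝ V]
    [FiniteDimensional ℝ V] [NormedAddCommGroup W] [NormedSpace ℝ W] (A : V →ₗ[ℝ] W)
    (hA : Function.Injective A) : ∃ c > 0, ∀ ξ, c * ‖ξ‖ ≤ ‖A ξ‖ := by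
  obtain ⟨K, hK, h⟩ := A.injective_iff_antilipschitz.1 hA
  have hK' : (0 : ℝ) < K := hK
  refine ⟨(K : ℝ)⁻¹, inv_pos.2 hK', fun ξ => ?_⟩
  have := h.le_mul_dist ξ 0
  rw [dist_zero_right, map_zero, dist_zero_right] at this
  rw [inv_mul_le_iff₀ hK']
  exact this

theorem IsLocalParam.hasStrictFDerivAt {x : Rn d} (hγ : IsLocalParam S Ω γ) (hx : x ∈ Ω) :
    HasStrictFDerivAt γ (fderiv ℝ γ x) x :=
  (hγ.contDiffAt hx).hasStrictFDerivAt (by simp)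

/-- Points of the submanifold near a given point have parameters near that of the point. -/
theorem IsLocalParam.eventually_exists (hγ : IsLocalParam S Ω γ) (hx₀ : x₀ ∈ Ω) {P : Rn d → Prop}
    (hP : ∀ᶠ x in 𝓝 x₀, P x) : ∀ᶠ q in 𝓝 (γ x₀), q ∈ S → ∃ x ∈ Ω, P x ∧ q = γ x := by
  obtain ⟨δ, hδ, hb⟩ := Metric.mem_nhds_iff.1 (Filter.inter_mem hP (Ω.isOpen.mem_nhds hx₀))
  obtain ⟨O, hO, hOS⟩ := hγ.isOpen_image (Metric.ball x₀ δ) Metric.isOpen_ball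
    fun x hx => (hb hx).2
  have hmem : γ x₀ ∈ O :=
    (hOS.subset (mem_image_of_mem γ (Metric.mem_ball_self hδ))).2
  filter_upwards [hO.mem_nhds hmem] with q hq hqS
  obtain ⟨x, hx, rfl⟩ := hOS.symm.subset ⟨hqS, hq⟩
  exact ⟨x, (hb hx).2, (hb hx).1, rfl⟩

/-- Secants of a submanifold near a point are almost tangent to it. -/
theorem IsLocalParam.exists_secant_approx (hγ : IsLocalParam S Ω γ) (hx₀ : x₀ ∈ Ω) {ε : ℝ}
    (hε : 0 < ε) : ∃ δ > 0, ∀ q ∈ S ∩ Metric.ball (γ x₀) δ, ∀ q' ∈ S ∩ Metric.ball (γ x₀) δ,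
      ∃ ξ, ‖q - q' - fderiv ℝ γ x₀ ξ‖ ≤ ε * ‖q - q'‖ := by
  obtain ⟨κ, hκ, hA⟩ := LinearMap.exists_pos_mul_norm_le (fderiv ℝ γ x₀ : Rn d →ₗ[ℝ] V)
    (hγ.immersion x₀ hx₀)
  obtain ⟨ρ, hρ, hest⟩ := (hγ.hasStrictFDerivAt hx₀).exists_norm_sub_sub_le
    (c := min (κ / 2) (ε * κ / 2)) (by positivity)
  obtain ⟨δ, hδ, hb⟩ := Metric.mem_nhds_iff.1
    (hγ.eventually_exists hx₀ (Metric.ball_mem_nhds x₀ hρ))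
  refine ⟨δ, hδ, fun q hq q' hq' => ?_⟩
  obtain ⟨y, -, hy, rfl⟩ := hb hq.2 hq.1
  obtain ⟨y', -, hy', rfl⟩ := hb hq'.2 hq'.1
  refine ⟨y - y', ?_⟩
  have h1 := hest y hy y' hy'
  have h2 : κ / 2 * ‖y - y'‖ ≤ ‖γ y - γ y'‖ := by
    have h3 := norm_sub_norm_le (fderiv ℝ γ x₀ (y - y')) (fderiv ℝ γ x₀ (y - y') - (γ y - γ y'))
    rw [sub_sub_cancel, norm_sub_rev _ (γ y - γ y')] at h3
    have h4 : min (κ / 2) (ε * κ / 2) * ‖y - y'‖ ≤ κ / 2 * ‖y - y'‖ := by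
      gcongr
      exact min_le_left _ _
    have h5 := hA (y - y')
    change κ * ‖y - y'‖ ≤ ‖fderiv ℝ γ x₀ (y - y')‖ at h5
    linarith
  calc _ ≤ _ := h1
    _ ≤ ε * κ / 2 * ‖y - y'‖ := by gcongr; exact min_le_right _ _
    _ = ε * (κ / 2 * ‖y - y'‖) := by ring
    _ ≤ ε * ‖γ y - γ y'‖ := by gcongr

theorem IsLocalParam.tangentSpace_eq (hγ : IsLocalParam S Ω γ) (hx₀ : x₀ ∈ Ω) :
    tangentSpace S (γ x₀) = (fderiv ℝ γ x₀ : Rn d →ₗ[ℝ] V).range := by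
  refine le_antisymm (Submodule.span_le.2 ?_) ?_
  · rintro v ⟨c, hc0, hcS, hcv⟩
    have hcl : IsClosed ((fderiv ℝ γ x₀ : Rn d →ₗ[ℝ] V).range : Set V) :=
      Submodule.closed_of_finiteDimensional _
    rw [← hcl.closure_eq, Metric.mem_closure_iff]
    intro ε hε
    obtain ⟨δ, hδ, hsec⟩ := hγ.exists_secant_approx hx₀ (ε := ε / (4 * (‖v‖ + ε))) (by positivity)
    have hslope : Tendsto (fun t : ℝ => t⁻¹ • (c t - c 0)) (𝓝[>] 0) (𝓝 v) := by
      have := (hasDerivAt_iff_tendsto_slope.1 hcv).mono_left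
        (nhdsWithin_mono (0 : ℝ) fun t (ht : 0 < t) => ne_of_gt ht)
      refine this.congr fun t => ?_
      rw [slope, sub_zero, vsub_eq_sub]
    have hcont : ∀ᶠ t in 𝓝[>] (0 : ℝ), c t ∈ Metric.ball (γ x₀) δ := by
      rw [← hc0]
      exact nhdsWithin_le_nhds (hcv.continuousAt (Metric.ball_mem_nhds _ hδ))
    obtain ⟨t, ht1, ht2, ht3, ht0⟩ := ((hslope.eventually (Metric.ball_mem_nhds v (half_pos hε))).and
      (hcont.and ((hcS.filter_mono nhdsWithin_le_nhds).and self_mem_nhdsWithin))).exists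
    have ht0' : (0 : ℝ) < t := ht0
    obtain ⟨ξ, hξ⟩ := hsec (c t) ⟨ht3, ht2⟩ (c 0) ⟨hc0 ▸ hγ.mem hx₀, hc0 ▸ Metric.mem_ball_self hδ⟩
    change t⁻¹ • (c t - c 0) ∈ Metric.ball v (ε / 2) at ht1
    rw [mem_ball_iff_norm] at ht1
    refine ⟨_, ⟨t⁻¹ • ξ, rfl⟩, ?_⟩
    change dist v (fderiv ℝ γ x₀ (t⁻¹ • ξ)) < ε
    set w := t⁻¹ • (c t - c 0) with hw
    have h1 : ‖w - fderiv ℝ γ x₀ (t⁻¹ • ξ)‖ ≤ ε / (4 * (‖v‖ + ε)) * ‖w‖ := by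
      rw [map_smul, hw, ← smul_sub, norm_smul, norm_smul, mul_left_comm]
      gcongr
    have h2 : ‖w‖ ≤ ‖v‖ + ε := by
      have := norm_add_le (w - v) v
      rw [sub_add_cancel] at this
      linarith
    have h3 : ε / (4 * (‖v‖ + ε)) * ‖w‖ ≤ ε / 4 := by
      calc _ ≤ ε / (4 * (‖v‖ + ε)) * (‖v‖ + ε) := by gcongr
        _ = ε / 4 := by field_simp
    rw [dist_eq_norm]
    calc _ = ‖(w - fderiv ℝ γ x₀ (t⁻¹ • ξ)) - (w - v)‖ := by congr 1; abel
      _ ≤ _ := norm_sub_le _ _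
      _ < ε := by linarith
  · rintro _ ⟨ξ, rfl⟩
    refine Submodule.subset_span ⟨fun t => γ (x₀ + t • ξ), by simp, ?_, ?_⟩
    · have : ContinuousAt (fun t : ℝ => x₀ + t • ξ) 0 := by fun_prop
      refine (this.eventually (Ω.isOpen.eventually_mem (by simpa using hx₀))).mono
        fun t ht => hγ.mem ht
    · have h1 : HasDerivAt (fun t : ℝ => x₀ + t • ξ) ξ 0 := by
        simpa using ((hasDerivAt_id (0 : ℝ)).smul_const ξ).const_add x₀
      have h2 : HasFDerivAt γ (fderiv ℝ γ x₀) (x₀ + (0 : ℝ) • ξ) := by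
        rw [zero_smul, add_zero]
        exact (hγ.hasStrictFDerivAt hx₀).hasFDerivAt
      exact h2.comp_hasDerivAt 0 h1

/-- The graph of a smooth map over a parametrized submanifold. -/
theorem IsLocalParam.graph {G : Type*} [NormedAddCommGroup G] [NormedSpace ℂ G] {h : V → G}
    (hγ : IsLocalParam S Ω γ) (hh : ContDiffOn ℝ ∞ h S) :
    IsLocalParam (graphOver S h) Ω fun x => (γ x, h (γ x)) := by
  have hs : ContDiffOn ℝ ∞ (fun x => (γ x, h (γ x))) Ω :=
    hγ.smooth.prodMk (hh.comp hγ.smooth fun x hx => hγ.mem hx)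
  refine ⟨hs, fun x hx y hy hxy => hγ.injOn hx hy (Prod.ext_iff.1 hxy).1, fun x hx => ?_,
    fun U hU hUΩ => ?_⟩
  · have hd : HasFDerivAt (fun x => (γ x, h (γ x))) (fderiv ℝ (fun x => (γ x, h (γ x))) x) x :=
      ((hs.contDiffAt (Ω.isOpen.mem_nhds hx)).differentiableAt (by simp)).hasFDerivAt
    have h1 := hd.fst.fderiv
    intro a b hab
    refine hγ.immersion x hx ?_
    change fderiv ℝ (fun x => γ x) x a = fderiv ℝ (fun x => γ x) x b
    rw [h1]
    exact congrArg Prod.fst hab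
  · obtain ⟨O, hO, hOS⟩ := hγ.isOpen_image U hU hUΩ
    refine ⟨Prod.fst ⁻¹' O, hO.preimage continuous_fst, ?_⟩
    ext ⟨a, b⟩
    constructor
    · rintro ⟨x, hx, hxab⟩
      obtain ⟨rfl, rfl⟩ := Prod.ext_iff.1 hxab
      exact ⟨⟨γ x, hγ.mem (hUΩ hx), rfl⟩, (hOS.subset (mem_image_of_mem γ hx)).2⟩
    · rintro ⟨⟨q, hq, hqab⟩, hO'⟩
      obtain ⟨rfl, rfl⟩ := Prod.ext_iff.1 hqab
      obtain ⟨x, hx, rfl⟩ := hOS.symm.subset ⟨hq, hO'⟩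
      exact ⟨x, hx, rfl⟩

/-- Surjectivity of a linear map onto a space of finite dimension is an open condition. -/
theorem ContinuousAt.eventually_surjective {X F G : Type*} [TopologicalSpace X]
    [NormedAddCommGroup F] [NormedSpace ℝ F] [NormedAddCommGroup G] [NormedSpace ℝ G]
    [FiniteDimensional ℝ G] {A : X → F →L[ℝ] G} {a : X} (hA : ContinuousAt A a)
    (hs : Function.Surjective (A a)) : ∀ᶠ x in 𝓝 a, Function.Surjective (A x) := by
  obtain ⟨B, hB⟩ := (A a : F →ₗ[ℝ] G).exists_rightInverse_of_surjective
    (LinearMap.range_eq_top.2 hs)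
  have : CompleteSpace G := FiniteDimensional.complete ℝ G
  have h1 : ContinuousAt (fun x => (A x).comp (LinearMap.toContinuousLinearMap B)) a :=
    hA.clm_comp continuousAt_const
  have h2 : (A a).comp (LinearMap.toContinuousLinearMap B) = 1 := by
    ext ξ
    exact LinearMap.congr_fun hB ξ
  have h3 : ∀ᶠ x in 𝓝 a, IsUnit ((A x).comp (LinearMap.toContinuousLinearMap B)) := by
    refine h1.eventually ?_
    change ∀ᶠ y in 𝓝 ((A a).comp (LinearMap.toContinuousLinearMap B)), IsUnit y
    rw [h2]
    exact Units.nhds (1 : (G →L[ℝ] G)ˣ)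
  filter_upwards [h3] with x hx ξ
  obtain ⟨u, hu⟩ := hx
  refine ⟨B ((u⁻¹ : (G →L[ℝ] G)ˣ).1 ξ), ?_⟩
  change (A x).comp (LinearMap.toContinuousLinearMap B) ((u⁻¹ : (G →L[ℝ] G)ˣ).1 ξ) = ξ
  rw [← hu]
  change (u.1 * (u⁻¹).1) ξ = ξ
  rw [u.mul_inv]
  rfl

/-- A smooth map with invertible derivative has a smooth local inverse. -/
theorem exists_smooth_localInverse {β : Rn d → Rn d} {U : Set (Rn d)} (hU : IsOpen U)
    (hβ : ContDiffOn ℝ ∞ β U) (hx₀ : x₀ ∈ U) (hd : fderiv ℝ β x₀ = ContinuousLinearMap.id ℝ _) :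
    ∃ (g : Rn d → Rn d) (Y : Set (Rn d)), IsOpen Y ∧ β x₀ ∈ Y ∧ ContDiffOn ℝ ∞ g Y ∧
      (∀ y ∈ Y, g y ∈ U ∧ β (g y) = y) ∧ ∀ᶠ x in 𝓝 x₀, g (β x) = x := by
  have hβx : ∀ x ∈ U, ContDiffAt ℝ ∞ β x := fun x hx => hβ.contDiffAt (hU.mem_nhds hx)
  have hd' : HasFDerivAt β
      ((ContinuousLinearEquiv.refl ℝ (Rn d) : Rn d ≃L[ℝ] Rn d) : Rn d →L[ℝ] Rn d) x₀ := by
    have := ((hβx x₀ hx₀).differentiableAt (by simp)).hasFDerivAt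
    rwa [hd] at this
  set Φ := (hβx x₀ hx₀).toOpenPartialHomeomorph β hd' (by simp) with hΦ
  have hΦβ : ∀ x, Φ x = β x := fun x => rfl
  have hsrc : x₀ ∈ Φ.source := (hβx x₀ hx₀).mem_toOpenPartialHomeomorph_source hd' (by simp)
  -- the set of points where the derivative is invertible
  have hinv : ∀ᶠ x in 𝓝 x₀, ∃ e : Rn d ≃L[ℝ] Rn d, fderiv ℝ β x = e := by
    have hc : ContinuousAt (fderiv ℝ β) x₀ := ((hβ.continuousOn_fderiv_of_isOpen hU
      (by simp)).continuousAt (hU.mem_nhds hx₀))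
    have hn := ContinuousLinearEquiv.nhds (ContinuousLinearEquiv.refl ℝ (Rn d))
    have := hc.eventually (p := fun A => A ∈ range ((↑) : (Rn d ≃L[ℝ] Rn d) → Rn d →L[ℝ] Rn d))
      (by rw [hd]; exact hn)
    exact this.mono fun x ⟨e, he⟩ => ⟨e, he.symm⟩
  obtain ⟨δ, hδ, hb⟩ := Metric.mem_nhds_iff.1 (Filter.inter_mem hinv (hU.mem_nhds hx₀))
  refine ⟨Φ.symm, Φ.target ∩ Φ.symm ⁻¹' Metric.ball x₀ δ,
    Φ.isOpen_inter_preimage_symm Metric.isOpen_ball, ⟨Φ.map_source hsrc, ?_⟩, ?_, ?_, ?_⟩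
  · change Φ.symm (Φ x₀) ∈ Metric.ball x₀ δ
    rw [Φ.left_inv hsrc]
    exact Metric.mem_ball_self hδ
  · rintro y ⟨hy, hyb⟩
    obtain ⟨⟨e, he⟩, hyU⟩ := hb hyb
    have h1 := (hβx _ hyU)
    have h2 : HasFDerivAt Φ (e : Rn d →L[ℝ] Rn d) (Φ.symm y) := by
      have := (h1.differentiableAt (by simp)).hasFDerivAt
      rwa [he] at this
    exact (Φ.contDiffAt_symm hy h2 h1).contDiffWithinAt
  · rintro y ⟨hy, hyb⟩
    exact ⟨(hb hyb).2, Φ.right_inv hy⟩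
  · filter_upwards [Φ.open_source.mem_nhds hsrc] with x hx
    exact Φ.left_inv hx

end TangentSpaces

/-! ### Wedges in a submanifold -/

section Wedges

/-- Given nested subspaces, there is a map to some `ℝ^c` whose restriction to the larger one is
surjective with the smaller one as its kernel. -/
theorem exists_clm_ker_eq {V : Type*} [NormedAddCommGroup V] [NormedSpace ℝ V]
    [FiniteDimensional ℝ V] (T T' : Submodule ℝ V) :
    ∃ (c : ℕ) (P : V →L[ℝ] Rn c), T.map (P : V →ₗ[ℝ] Rn c) = ⊤ ∧ (∀ x ∈ T', P x = 0) ∧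
      ∀ x ∈ T, P x = 0 → x ∈ T' := by
  set W := T.map T'.mkQ with hW
  obtain ⟨p, hp⟩ := W.subtype.exists_leftInverse_of_injective W.ker_subtype
  have hp' : ∀ w : W, p w = w := fun w => LinearMap.congr_fun hp w
  obtain ⟨e⟩ : Nonempty (W ≃ₗ[ℝ] Rn (Module.finrank ℝ W)) :=
    ⟨LinearEquiv.ofFinrankEq _ _ (by simp)⟩
  refine ⟨_, LinearMap.toContinuousLinearMap (e.toLinearMap ∘ₗ p ∘ₗ T'.mkQ), ?_, fun x hx => ?_,
    fun x hx h0 => ?_⟩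
  · rw [eq_top_iff]
    intro y _
    obtain ⟨x, hx, hxy⟩ := (e.symm y).2
    refine ⟨x, hx, ?_⟩
    change e (p (T'.mkQ x)) = y
    rw [hxy, hp', e.apply_symm_apply]
  · change e (p (T'.mkQ x)) = 0
    rw [(Submodule.Quotient.mk_eq_zero T').2 hx |> fun h => (h : T'.mkQ x = 0), map_zero, map_zero]
  · change e (p (T'.mkQ x)) = 0 at h0
    have h1 : p (T'.mkQ x) = 0 := by rwa [LinearEquiv.map_eq_zero_iff] at h0
    have h2 := hp' ⟨T'.mkQ x, Submodule.mem_map_of_mem hx⟩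
    change p (T'.mkQ x) = _ at h2
    rw [h1] at h2
    exact (Submodule.Quotient.mk_eq_zero T').1 (congrArg Subtype.val h2).symm

/-- The convex cone generated by the ball of radius `κ` around `e`. -/
def ballCone {c : ℕ} (e : Rn c) (κ : ℝ) : ConvexCone ℝ (Rn c) where
  carrier := {ξ | ∃ t > 0, ‖ξ - t • e‖ < κ * t}
  smul_mem' := by
    rintro s hs ξ ⟨t, ht, h⟩
    refine ⟨s * t, mul_pos hs ht, ?_⟩
    rw [mul_smul, ← smul_sub, norm_smul, Real.norm_of_nonneg hs.le, mul_left_comm]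
    exact mul_lt_mul_of_pos_left h hs
  add_mem' := by
    rintro ξ ⟨t, ht, h⟩ ξ' ⟨t', ht', h'⟩
    refine ⟨t + t', add_pos ht ht', ?_⟩
    calc _ = ‖(ξ - t • e) + (ξ' - t' • e)‖ := by
          congr 1
          module
      _ ≤ _ := norm_add_le _ _
      _ < _ := by linarith

theorem mem_ballCone {c : ℕ} {e ξ : Rn c} {κ : ℝ} :
    ξ ∈ ballCone e κ ↔ ∃ t > 0, ‖ξ - t • e‖ < κ * t := Iff.rfl

theorem isOpen_ballCone {c : ℕ} (e : Rn c) (κ : ℝ) : IsOpen (ballCone e κ : Set (Rn c)) := by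
  have : (ballCone e κ : Set (Rn c)) = ⋃ t > 0, {ξ | ‖ξ - t • e‖ < κ * t} := by
    ext ξ
    simp [mem_ballCone]
  rw [this]
  exact isOpen_biUnion fun t _ => isOpen_lt (by fun_prop) continuous_const

variable {d d' : ℕ} {V : Type*} [NormedAddCommGroup V] [NormedSpace ℂ V] [FiniteDimensional ℂ V]
  {M N : Set V} {Ω : Opens (Rn d)} {b : Rn d → V} {x₀ : Rn d}
  {Ω' : Opens (Rn d')} {μ : Rn d' → V} {y₀ : Rn d'}

set_option maxHeartbeats 1000000 in
/-- There are arbitrarily thin wedges in `M` with edge `N` in a given direction `v` transversal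
to `N`. -/
theorem exists_thin_wedge (hNM : N ⊆ M) (hb : IsLocalParam N Ω b) (hx₀ : x₀ ∈ Ω)
    (hμ : IsLocalParam M Ω' μ) (hy₀ : y₀ ∈ Ω') (hbμ : μ y₀ = b x₀) {v : V}
    (hv : v ∈ tangentSpace M (b x₀)) (hv' : v ∉ tangentSpace N (b x₀)) :
    ∃ v₁ : V, v - v₁ ∈ tangentSpace N (b x₀) ∧ ∀ κ > 0, ∀ O ∈ 𝓝 (b x₀),
      ∃ W : Wedge M N (b x₀), W.nhd ⊆ O ∧ W.DirectedAt (b x₀) v ∧ (0 : Rn W.c) ∉ W.Γ ∧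
        (∀ q ∈ N ∩ W.nhd, ∃ x ∈ Metric.ball x₀ κ, q = b x) ∧
        ∃ C, ∀ q ∈ W.toSet, ∃ x ∈ Metric.ball x₀ κ, ∃ t ∈ Ioo 0 κ, ‖W.ρ q‖ ≤ C * t ∧
          ∃ y ∈ Metric.ball v₁ κ, q = b x + t • y := by
  have : FiniteDimensional ℝ V := FiniteDimensional.complexToReal V
  have hTN := hb.tangentSpace_eq hx₀
  have hTM := hμ.tangentSpace_eq hy₀
  rw [hbμ] at hTM
  set B := fderiv ℝ b x₀ with hB
  set T := tangentSpace M (b x₀) with hT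
  have hTNM : tangentSpace N (b x₀) ≤ T :=
    Submodule.span_mono fun w ⟨c, h0, h1, h2⟩ => ⟨c, h0, h1.mono fun t ht => hNM ht, h2⟩
  obtain ⟨c, P, hPT, hPN, hPker⟩ := exists_clm_ker_eq T (tangentSpace N (b x₀))
  obtain ⟨lam₀, hlam₀⟩ := (B : Rn d →ₗ[ℝ] V).exists_leftInverse_of_injective
    (LinearMap.ker_eq_bot.2 (hb.immersion x₀ hx₀))
  set lam : V →L[ℝ] Rn d := LinearMap.toContinuousLinearMap lam₀ with hlam
  have hlamB : ∀ ξ, lam (B ξ) = ξ := fun ξ => LinearMap.congr_fun hlam₀ ξ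
  have hBN : ∀ ξ, B ξ ∈ tangentSpace N (b x₀) := fun ξ => hTN ▸ ⟨ξ, rfl⟩
  have hPB : ∀ ξ, P (B ξ) = 0 := fun ξ => hPN _ (hBN ξ)
  set e := P v with he
  have he0 : e ≠ 0 := fun h => hv' (hPker v hv h)
  have hep : 0 < ‖e‖ := norm_pos_iff.2 he0
  set v₁ := v - B (lam v) with hv₁
  have hv₁T : v₁ ∈ T := sub_mem hv (hTNM (hBN _))
  have hPv₁ : P v₁ = e := by rw [hv₁, map_sub, hPB, sub_zero]
  have hlv₁ : lam v₁ = 0 := by rw [hv₁, map_sub, hlamB, sub_self]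
  refine ⟨v₁, by rw [hv₁, sub_sub_cancel]; exact hBN _, fun κ hκ O hO => ?_⟩
  -- `P` and `lam` control tangent vectors
  obtain ⟨a, ha, hlow⟩ : ∃ a > 0, ∀ τ ∈ T, a * ‖τ‖ ≤ ‖P τ‖ + ‖lam τ‖ := by
    obtain ⟨a, ha, h⟩ := LinearMap.exists_pos_mul_norm_le
      ((P.prod lam : V →ₗ[ℝ] Rn c × Rn d) ∘ₗ T.subtype) (by
        rw [← LinearMap.ker_eq_bot, LinearMap.ker_eq_bot']
        rintro ⟨τ, hτ⟩ h0
        obtain ⟨h1, h2⟩ := Prod.ext_iff.1 h0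
        change P τ = 0 at h1
        change lam τ = 0 at h2
        have h3 := hPker τ hτ h1
        rw [hTN] at h3
        obtain ⟨ξ, rfl⟩ := h3
        change lam (B ξ) = 0 at h2
        rw [hlamB] at h2
        ext
        change B ξ = 0
        rw [h2, map_zero])
    refine ⟨a, ha, fun τ hτ => (h ⟨τ, hτ⟩).trans ?_⟩
    change ‖(P τ, lam τ)‖ ≤ _
    rw [Prod.norm_def]
    exact max_le (le_add_of_nonneg_right (norm_nonneg _)) (le_add_of_nonneg_left (norm_nonneg _))
  set m := ‖P‖ + ‖lam‖ with hm
  have hm0 : 0 ≤ m := by positivity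
  -- the aperture of the cone and the precision of the tangential approximation
  obtain ⟨κ₁, hκ₁, hκ₁e, hκ₁κ⟩ : ∃ κ₁ > 0, κ₁ ≤ ‖e‖ / 2 ∧ κ₁ / a ≤ κ / 4 :=
    ⟨min (‖e‖ / 2) (a * (κ / 4)), by positivity, min_le_left _ _, by
      rw [div_le_iff₀' ha]; exact min_le_right _ _⟩
  set Q := (2 * ‖e‖) * (2 / a) with hQ
  have hQp : 0 < Q := by positivity
  obtain ⟨ε, hε, hεm, hεQ⟩ : ∃ ε > 0, (m / a + 1) * ε ≤ 1 / 2 ∧ (m / a + 1) * ε * Q ≤ κ / 4 := by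
    have hma : 0 < m / a + 1 := by positivity
    refine ⟨min (1 / 2) (κ / 4 / Q) / (m / a + 1), by positivity, ?_, ?_⟩
    · rw [mul_div_cancel₀ _ hma.ne']
      exact min_le_left _ _
    · rw [mul_div_cancel₀ _ hma.ne', ← le_div_iff₀ hQp]
      exact min_le_right _ _
  obtain ⟨δ, hδ, hsec⟩ := hμ.exists_secant_approx hy₀ hε
  rw [hbμ] at hsec
  -- a smooth map `xh` with `lam (b (xh q)) = lam q`
  have hbs : ContDiffOn ℝ ∞ (fun x => lam (b x)) Ω := lam.contDiff.comp_contDiffOn hb.smooth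
  have hbd : HasFDerivAt b B x₀ := (hb.hasStrictFDerivAt hx₀).hasFDerivAt
  have hβd : fderiv ℝ (fun x => lam (b x)) x₀ = ContinuousLinearMap.id ℝ _ := by
    have h1 : HasFDerivAt (fun x => lam (b x)) (lam.comp B) x₀ := lam.hasFDerivAt.comp x₀ hbd
    rw [h1.fderiv]
    ext1 ξ
    exact hlamB ξ
  obtain ⟨g, Y, hY, hxY, hg, hgY, hgl⟩ := exists_smooth_localInverse Ω.isOpen hbs hx₀ hβd
  set xh : V → Rn d := fun q => g (lam q) with hxh
  set ρ : V → Rn c := fun q => P (q - b (xh q)) with hρ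
  set O₁ := lam ⁻¹' Y with hO₁
  have hO₁o : IsOpen O₁ := hY.preimage lam.continuous
  have hp₁ : b x₀ ∈ O₁ := hxY
  have hxhs : ContDiffOn ℝ ∞ xh O₁ := hg.comp lam.contDiff.contDiffOn fun q hq => hq
  have hbxh : ContDiffOn ℝ ∞ (fun q => b (xh q)) O₁ := hb.smooth.comp hxhs fun q hq => (hgY _ hq).1
  have hρs : ContDiffOn ℝ ∞ ρ O₁ := P.contDiff.comp_contDiffOn (contDiff_id.contDiffOn.sub hbxh)
  have hxh₀ : xh (b x₀) = x₀ := hgl.self_of_nhds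
  have hρ' : HasFDerivAt ρ P (b x₀) := by
    have h1 : HasFDerivAt xh (fderiv ℝ xh (b x₀)) (b x₀) :=
      ((hxhs.contDiffAt (hO₁o.mem_nhds hp₁)).differentiableAt (by simp)).hasFDerivAt
    have h2 : HasFDerivAt b B (xh (b x₀)) := by rwa [hxh₀]
    have h3 := P.hasFDerivAt.comp (b x₀) ((hasFDerivAt_id (b x₀)).sub (h2.comp (b x₀) h1))
    refine h3.congr_fderiv ?_
    ext1 w
    change P (w - B (fderiv ℝ xh (b x₀) w)) = P w
    rw [map_sub, hPB, sub_zero]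
  -- the neighbourhood
  have hxhc : ContinuousAt xh (b x₀) := (hxhs.continuousOn).continuousAt (hO₁o.mem_nhds hp₁)
  have hbxc : ContinuousAt (fun q => b (xh q)) (b x₀) :=
    (hbxh.continuousOn).continuousAt (hO₁o.mem_nhds hp₁)
  have hρc : ContinuousAt ρ (b x₀) := hρ'.continuousAt
  have hρ0 : ρ (b x₀) = 0 := by
    change P (b x₀ - b (xh (b x₀))) = 0
    rw [hxh₀, sub_self, map_zero]
  have e1 : ∀ᶠ q in 𝓝 (b x₀), xh q ∈ Metric.ball x₀ κ := by
    refine hxhc.eventually (Metric.isOpen_ball.eventually_mem ?_)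
    rw [hxh₀]
    exact Metric.mem_ball_self hκ
  have e2 : ∀ᶠ q in 𝓝 (b x₀), b (xh q) ∈ Metric.ball (b x₀) δ := by
    refine hbxc.eventually (Metric.isOpen_ball.eventually_mem ?_)
    change b (xh (b x₀)) ∈ _
    rw [hxh₀]
    exact Metric.mem_ball_self hδ
  have e3 : ∀ᶠ q in 𝓝 (b x₀), ρ q ∈ Metric.ball 0 (κ * (‖e‖ / 2)) := by
    refine hρc.eventually (Metric.isOpen_ball.eventually_mem ?_)
    rw [hρ0]
    exact Metric.mem_ball_self (by positivity)
  have e4 : ∀ᶠ q in 𝓝 (b x₀), q ∈ N → ∃ x ∈ Ω, (g (lam (b x)) = x ∧ x ∈ Metric.ball x₀ κ) ∧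
      q = b x :=
    hb.eventually_exists hx₀ (hgl.and (Metric.ball_mem_nhds x₀ hκ))
  have e5 : ∀ᶠ q in 𝓝 (b x₀), q ∈ M →
      Submodule.map (fderiv ℝ ρ q : V →ₗ[ℝ] Rn c) (tangentSpace M q) = ⊤ := by
    have h1 : ContinuousAt (fun y => (fderiv ℝ ρ (μ y)).comp (fderiv ℝ μ y)) y₀ := by
      have h2 : ContinuousAt (fderiv ℝ ρ) (μ y₀) := by
        rw [hbμ]
        exact (hρs.continuousOn_fderiv_of_isOpen hO₁o (by simp)).continuousAt (hO₁o.mem_nhds hp₁)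
      exact (ContinuousAt.comp (f := μ) h2 (hμ.contDiffAt hy₀).continuousAt).clm_comp
        ((hμ.smooth.continuousOn_fderiv_of_isOpen Ω'.isOpen (by simp)).continuousAt
          (Ω'.isOpen.mem_nhds hy₀))
    have h3 := h1.eventually_surjective (by
      rw [hbμ, hρ'.fderiv]
      intro ξ
      obtain ⟨w, hw, hwξ⟩ := hPT.symm ▸ (Submodule.mem_top : ξ ∈ ⊤)
      have hw' : w ∈ T := hw
      rw [hTM] at hw'
      obtain ⟨η, rfl⟩ := hw'
      exact ⟨η, hwξ⟩)
    rw [← hbμ]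
    filter_upwards [hμ.eventually_exists hy₀ h3] with q hq hqM
    obtain ⟨y, hy, hsurj, rfl⟩ := hq hqM
    rw [hμ.tangentSpace_eq hy, eq_top_iff]
    intro ξ _
    obtain ⟨η, hη⟩ := hsurj ξ
    exact ⟨_, ⟨η, rfl⟩, hη⟩
  obtain ⟨nhd, hnhd, hno, hpn⟩ := mem_nhds_iff.1 (Filter.inter_mem hO (Filter.inter_mem
    (hO₁o.mem_nhds hp₁) (Filter.inter_mem (Metric.ball_mem_nhds (b x₀) hδ)
    (e1.and (e2.and (e3.and (e4.and e5)))))))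
  -- the basic estimate
  have hest : ∀ q ∈ M ∩ nhd, xh q ∈ Metric.ball x₀ κ ∧ b (xh q) ∈ N ∧
      ∀ t : ℝ, ‖q - b (xh q) - t • v₁‖ ≤
        ‖ρ q - t • e‖ / a + (m / a + 1) * ε * ‖q - b (xh q)‖ := by
    rintro q ⟨hqM, hq⟩
    obtain ⟨-, h1, h2, h3, h4, -, -, -⟩ := hnhd hq
    have hN := hb.mem (hgY _ h1).1
    refine ⟨h3, hN, fun t => ?_⟩
    obtain ⟨ξ, hξ⟩ := hsec q ⟨hqM, h2⟩ _ ⟨hNM hN, h4⟩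
    set τ := fderiv ℝ μ y₀ ξ with hτ
    have hτT : τ ∈ T := hTM ▸ ⟨ξ, rfl⟩
    set w := q - b (xh q) with hw
    have hlw : lam w = 0 := by
      rw [hw, map_sub, sub_eq_zero]
      exact (hgY _ h1).2.symm
    have h5 := hlow (τ - t • v₁) (sub_mem hτT (T.smul_mem t hv₁T))
    have h6 : P (τ - t • v₁) = (ρ q - t • e) - P (w - τ) := by
      rw [map_sub, map_sub, map_smul, hPv₁]
      abel
    have h7 : lam (τ - t • v₁) = -lam (w - τ) := by
      rw [map_sub, map_sub, map_smul, hlv₁, hlw, smul_zero]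
      abel
    rw [h6, h7, norm_neg] at h5
    have h8 : ‖τ - t • v₁‖ ≤ (‖ρ q - t • e‖ + m * (ε * ‖w‖)) / a := by
      rw [le_div_iff₀' ha]
      calc _ ≤ _ := h5
        _ ≤ ‖ρ q - t • e‖ + ‖P (w - τ)‖ + ‖lam (w - τ)‖ := by gcongr; exact norm_sub_le _ _
        _ ≤ ‖ρ q - t • e‖ + ‖P‖ * (ε * ‖w‖) + ‖lam‖ * (ε * ‖w‖) := by
            gcongr
            · exact (P.le_opNorm _).trans (by gcongr)
            · exact (lam.le_opNorm _).trans (by gcongr)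
        _ = _ := by rw [hm]; ring
    calc _ = ‖(τ - t • v₁) + (w - τ)‖ := by congr 1; abel
      _ ≤ _ := norm_add_le _ _
      _ ≤ _ := add_le_add h8 hξ
      _ = _ := by ring
  have hlin : ∀ q ∈ M ∩ nhd, ‖q - b (xh q)‖ ≤ 2 / a * ‖ρ q‖ := by
    intro q hq
    have h1 := (hest q hq).2.2 0
    rw [zero_smul, zero_smul, sub_zero, sub_zero] at h1
    have h2 : (m / a + 1) * ε * ‖q - b (xh q)‖ ≤ 1 / 2 * ‖q - b (xh q)‖ := by gcongr
    have h3 : 2 / a * ‖ρ q‖ = 2 * (‖ρ q‖ / a) := by ring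
    rw [h3]
    linarith
  let W : Wedge M N (b x₀) :=
    { nhd := nhd
      isOpen_nhd := hno
      mem_nhd := hpn
      c := c
      ρ := ρ
      smooth_ρ := hρs.mono fun q hq => (hnhd hq).2.1
      mem_edge_iff := by
        intro q hq
        constructor
        · intro hqN
          obtain ⟨-, -, -, -, -, -, h4, -⟩ := hnhd hq.2
          obtain ⟨x, -, ⟨hgx, -⟩, rfl⟩ := h4 hqN
          change P (b x - b (g (lam (b x)))) = 0
          rw [hgx, sub_self, map_zero]
        · intro h0
          have := hlin q hq
          rw [h0, norm_zero, mul_zero] at this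
          rw [sub_eq_zero.1 (norm_le_zero_iff.1 this)]
          exact (hest q hq).2.1
      surj := fun q hq => (hnhd hq.2).2.2.2.2.2.2.2 hq.1
      Γ := ballCone e κ₁
      isOpen_Γ := isOpen_ballCone e κ₁ }
  refine ⟨W, fun q hq => (hnhd hq).1, ⟨hpn, hv, ?_⟩, ?_, ?_, 2 * ‖e‖, ?_⟩
  · change fderiv ℝ ρ (b x₀) v ∈ ballCone e κ₁
    rw [hρ'.fderiv]
    refine ⟨1, one_pos, ?_⟩
    rw [one_smul, ← he, sub_self, norm_zero, mul_one]
    exact hκ₁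
  · rintro ⟨t, ht, h⟩
    rw [zero_sub, norm_neg, norm_smul, Real.norm_of_nonneg ht.le, mul_comm] at h
    have := lt_of_mul_lt_mul_right h ht.le
    linarith
  · rintro q ⟨hqN, hq⟩
    obtain ⟨-, -, -, -, -, -, h4, -⟩ := hnhd hq
    obtain ⟨x, -, ⟨-, hx⟩, rfl⟩ := h4 hqN
    exact ⟨x, hx, rfl⟩
  · rintro q ⟨hq, t, ht, hqt⟩
    change ‖ρ q - t • e‖ < κ₁ * t at hqt
    obtain ⟨h1, -, h2⟩ := hest q hq
    have hte : ‖t • e‖ = t * ‖e‖ := by rw [norm_smul, Real.norm_of_nonneg ht.le]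
    have hup : ‖ρ q‖ ≤ 2 * ‖e‖ * t := by
      have := norm_add_le (ρ q - t • e) (t • e)
      rw [sub_add_cancel, hte] at this
      nlinarith
    have hlo : t * (‖e‖ / 2) ≤ ‖ρ q‖ := by
      have := norm_sub_le (ρ q) (ρ q - t • e)
      rw [sub_sub_cancel, hte] at this
      nlinarith
    have htκ : t < κ := by
      have h3 := (hnhd hq.2).2.2.2.2.2.1
      rw [mem_ball_zero_iff] at h3
      exact lt_of_mul_lt_mul_right (hlo.trans_lt h3) (by positivity)
    refine ⟨xh q, h1, t, ⟨ht, htκ⟩, hup, t⁻¹ • (q - b (xh q)), ?_, ?_⟩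
    · have h4 : t⁻¹ • (q - b (xh q)) - v₁ = t⁻¹ • (q - b (xh q) - t • v₁) := by
        rw [smul_sub _ _ (t • v₁), inv_smul_smul₀ ht.ne']
      rw [mem_ball_iff_norm, h4, norm_smul, norm_inv, Real.norm_of_nonneg ht.le,
        inv_mul_lt_iff₀ ht]
      have h5 : ‖q - b (xh q)‖ ≤ Q * t := by
        calc _ ≤ 2 / a * ‖ρ q‖ := hlin q hq
          _ ≤ 2 / a * (2 * ‖e‖ * t) := by gcongr
          _ = Q * t := by rw [hQ]; ring
      have h6 : ‖ρ q - t • e‖ / a ≤ κ / 4 * t := by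
        calc _ ≤ κ₁ * t / a := by gcongr
          _ = κ₁ / a * t := by ring
          _ ≤ _ := by gcongr
      have h7 : (m / a + 1) * ε * ‖q - b (xh q)‖ ≤ κ / 4 * t := by
        calc _ ≤ (m / a + 1) * ε * (Q * t) := by gcongr
          _ = (m / a + 1) * ε * Q * t := by ring
          _ ≤ _ := by gcongr
      have h8 := h2 t
      have h9 : 0 < κ * t := by positivity
      linarith
    · rw [smul_inv_smul₀ ht.ne']
      abel

end Wedges

/-! ### An implicit equation on sets with edges -/

section ImplicitEquation

variable {ι : Type*} [Fintype ι] {V E : Type*} [NormedAddCommGroup E] [NormedSpace ℂ E]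

/-- The equation `τ = a(q) + ∑ G_i(p(q) + τ w_i)`, with right-hand side contracting in `τ`, has a
unique solution, which depends on `q` in a Lipschitz manner. -/
theorem exists_solution_of_lipschitz {G : ι → E → ℂ} {w : ι → E} {K : ℝ} (hK : 0 ≤ K)
    (hG : ∀ i z z', ‖G i z - G i z'‖ ≤ K * ‖z - z'‖) (hKw : K * ∑ i, ‖w i‖ ≤ 1 / 2)
    (a : V → ℂ) (p : V → E) :
    ∃ τ : V → ℂ, (∀ q, τ q = a q + ∑ i, G i (p q + τ q • w i)) ∧
      ∀ q q' s, s = a q' + ∑ i, G i (p q' + s • w i) →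
        ‖τ q - s‖ ≤ 2 * (‖a q - a q'‖ + Fintype.card ι * K * ‖p q - p q'‖) := by
  have hcomp : ∀ (q q' : V) (s s' : ℂ), ‖(a q + ∑ i, G i (p q + s • w i)) -
      (a q' + ∑ i, G i (p q' + s' • w i))‖ ≤
      ‖a q - a q'‖ + Fintype.card ι * K * ‖p q - p q'‖ + 1 / 2 * ‖s - s'‖ := by
    intro q q' s s'
    have h1 : ∀ i, ‖G i (p q + s • w i) - G i (p q' + s' • w i)‖ ≤
        K * ‖p q - p q'‖ + K * ‖w i‖ * ‖s - s'‖ := by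
      intro i
      refine (hG i _ _).trans ?_
      have : p q + s • w i - (p q' + s' • w i) = (p q - p q') + (s - s') • w i := by
        rw [sub_smul]
        abel
      rw [this]
      calc _ ≤ K * (‖p q - p q'‖ + ‖(s - s') • w i‖) := by gcongr; exact norm_add_le _ _
        _ = _ := by rw [norm_smul]; ring
    calc _ = ‖(a q - a q') + ∑ i, (G i (p q + s • w i) - G i (p q' + s' • w i))‖ := by
          rw [Finset.sum_sub_distrib]
          congr 1
          abel
      _ ≤ ‖a q - a q'‖ + ∑ i, ‖G i (p q + s • w i) - G i (p q' + s' • w i)‖ :=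
          (norm_add_le _ _).trans (by gcongr; exact norm_sum_le _ _)
      _ ≤ ‖a q - a q'‖ + ∑ i, (K * ‖p q - p q'‖ + K * ‖w i‖ * ‖s - s'‖) := by
          gcongr with i
          exact h1 i
      _ = ‖a q - a q'‖ + Fintype.card ι * K * ‖p q - p q'‖ + (K * ∑ i, ‖w i‖) * ‖s - s'‖ := by
          rw [Finset.sum_add_distrib, Finset.sum_const, ← Finset.sum_mul, ← Finset.mul_sum,
            Finset.card_univ, nsmul_eq_mul]
          ring
      _ ≤ _ := by gcongr
  have hex : ∀ q, ∃ s, s = a q + ∑ i, G i (p q + s • w i) := by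
    intro q
    have hc : ContractingWith (1 / 2) fun s => a q + ∑ i, G i (p q + s • w i) := by
      refine ⟨by
        rw [← NNReal.coe_lt_coe]
        norm_num, LipschitzWith.of_dist_le_mul fun s s' => ?_⟩
      have := hcomp q q s s'
      rw [sub_self, sub_self, norm_zero, norm_zero, mul_zero, add_zero, zero_add] at this
      rw [dist_eq_norm, dist_eq_norm]
      simpa using this
    exact ⟨_, hc.fixedPoint_isFixedPt.symm⟩
  choose τ hτ using hex
  refine ⟨τ, hτ, fun q q' s hs => ?_⟩
  have := hcomp q q' (τ q) s
  rw [← hτ, ← hs] at this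
  linarith

variable {Y : Type*} [NormedAddCommGroup Y] [NormedSpace ℝ Y]

/-- The coefficient of `dτ` in the differentiated equation does not vanish. -/
theorem one_sub_sum_ne_zero {B : ι → E →L[ℂ] ℂ} {w : ι → E} {K : ℝ} (hB : ∀ i, ‖B i‖ ≤ K)
    (hKw : K * ∑ i, ‖w i‖ ≤ 1 / 2) : 1 - ∑ i, B i (w i) ≠ 0 := by
  intro h
  have h1 : ‖∑ i, B i (w i)‖ ≤ 1 / 2 := by
    calc _ ≤ ∑ i, ‖B i (w i)‖ := norm_sum_le _ _
      _ ≤ ∑ i, K * ‖w i‖ := by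
          gcongr with i
          exact ((B i).le_opNorm _).trans (by gcongr; exact hB i)
      _ = K * ∑ i, ‖w i‖ := by rw [Finset.mul_sum]
      _ ≤ _ := hKw
  rw [← sub_eq_zero.1 h, norm_one] at h1
  norm_num at h1

/-- Differentiation of a Lipschitz solution of the equation, within a set. -/
theorem hasFDerivWithinAt_of_implicit {X : Set Y} {y : Y} (hy : y ∈ X) {a T : Y → ℂ} {p : Y → E}
    {a' T' : Y →L[ℝ] ℂ} {p' : Y →L[ℝ] E} (ha : HasFDerivWithinAt a a' X y)
    (hp : HasFDerivWithinAt p p' X y) {R : ι → Set E} {G : ι → E → ℂ} {B : ι → E →L[ℂ] ℂ}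
    {w : ι → E} (hmem : ∀ i, ∀ x ∈ X, p x + T x • w i ∈ R i)
    (hG : ∀ i, HasFDerivWithinAt (G i) ((B i).restrictScalars ℝ) (R i) (p y + T y • w i))
    (hT : (fun x => T x - T y) =O[𝓝[X] y] fun x => x - y)
    (heq : ∀ x ∈ X, T x = a x + ∑ i, G i (p x + T x • w i)) (h0 : 1 - ∑ i, B i (w i) ≠ 0)
    (hT' : ∀ ξ, T' ξ = a' ξ + ∑ i, B i (p' ξ + T' ξ • w i)) : HasFDerivWithinAt T T' X y := by
  have hTc : Tendsto T (𝓝[X] y) (𝓝 (T y)) := by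
    have h1 : Tendsto (fun x => x - y) (𝓝[X] y) (𝓝 0) := by
      have : Tendsto (fun x => x - y) (𝓝 y) (𝓝 (y - y)) :=
        (continuous_id.sub continuous_const).tendsto y
      rw [sub_self] at this
      exact this.mono_left nhdsWithin_le_nhds
    have h2 := (hT.trans_tendsto h1).add_const (T y)
    simpa using h2
  have hP : ∀ i, Tendsto (fun x => p x + T x • w i) (𝓝[X] y) (𝓝[R i] (p y + T y • w i)) := fun i =>
    tendsto_nhdsWithin_iff.2 ⟨hp.continuousWithinAt.add (hTc.smul_const _),
      eventually_nhdsWithin_of_forall (hmem i)⟩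
  have hPO : ∀ i, (fun x => p x + T x • w i - (p y + T y • w i)) =O[𝓝[X] y] fun x => x - y := by
    intro i
    have h1 : (fun x => (T x - T y) • w i) =O[𝓝[X] y] fun x => x - y := by
      have h2 : (fun _ : Y => w i) =O[𝓝[X] y] fun _ => (1 : ℝ) :=
        Asymptotics.isBigO_const_const _ one_ne_zero _
      have h3 := hT.norm_right.smul h2
      simp only [smul_eq_mul, mul_one] at h3
      exact h3.of_norm_right
    refine (hp.isBigO_sub.add h1).congr_left fun x => ?_
    rw [sub_smul]
    abel
  have hGo : ∀ i, (fun x => G i (p x + T x • w i) - G i (p y + T y • w i) -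
      B i (p x + T x • w i - (p y + T y • w i))) =o[𝓝[X] y] fun x => x - y := fun i =>
    ((hG i).isLittleO.comp_tendsto (hP i)).trans_isBigO (hPO i)
  have hsum := (ha.isLittleO.add (Asymptotics.IsLittleO.fun_sum (s := Finset.univ)
    fun i _ => hGo i)).add (Asymptotics.IsLittleO.fun_sum (s := Finset.univ) fun i _ =>
      ((B i).restrictScalars ℝ).isBigO_comp _ _ |>.trans_isLittleO hp.isLittleO)
  refine HasFDerivWithinAt.of_isLittleO ((hsum.const_mul_left (1 - ∑ i, B i (w i))⁻¹).congr' ?_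
    EventuallyEq.rfl)
  filter_upwards [self_mem_nhdsWithin] with x hx
  rw [inv_mul_eq_iff_eq_mul₀ h0]
  have e1 : ∀ i, B i (p x + T x • w i - (p y + T y • w i)) =
      B i (p x - p y) + (T x - T y) * B i (w i) := by
    intro i
    rw [← smul_eq_mul, ← map_smul, ← map_add]
    congr 1
    rw [sub_smul]
    abel
  have e2 := hT' (x - y)
  simp only [map_add, map_smul, smul_eq_mul, Finset.sum_add_distrib, ← Finset.mul_sum] at e2
  have e3 : ∀ i, (B i).restrictScalars ℝ (p x - p y - p' (x - y)) =
      B i (p x - p y) - B i (p' (x - y)) := fun i => map_sub _ _ _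
  simp only [e1, e3, Finset.sum_sub_distrib, Finset.sum_add_distrib, ← Finset.mul_sum]
  linear_combination e2 - heq x hx + heq y hy

/-- The solution of the differentiated equation. -/
noncomputable def implicitDeriv (a' : Y →L[ℝ] ℂ) (p' : Y →L[ℝ] E) (B : ι → E →L[ℂ] ℂ)
    (w : ι → E) : Y →L[ℝ] ℂ :=
  (1 - ∑ i, B i (w i))⁻¹ • (a' + ∑ i, ((B i).restrictScalars ℝ).comp p')

theorem implicitDeriv_apply (a' : Y →L[ℝ] ℂ) (p' : Y →L[ℝ] E) {B : ι → E →L[ℂ] ℂ} {w : ι → E}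
    (h0 : 1 - ∑ i, B i (w i) ≠ 0) (ξ : Y) :
    implicitDeriv a' p' B w ξ =
      a' ξ + ∑ i, B i (p' ξ + implicitDeriv a' p' B w ξ • w i) := by
  have h1 : (1 - ∑ i, B i (w i)) * implicitDeriv a' p' B w ξ = a' ξ + ∑ i, B i (p' ξ) := by
    have h2 : implicitDeriv a' p' B w ξ =
        (1 - ∑ i, B i (w i))⁻¹ * (a' ξ + ∑ i, B i (p' ξ)) := by
      simp only [implicitDeriv, smul_apply, add_apply, sum_apply, ContinuousLinearMap.comp_apply,
        ContinuousLinearMap.coe_restrictScalars', smul_eq_mul]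
    rw [h2, mul_inv_cancel_left₀ h0]
  simp only [map_add, map_smul, smul_eq_mul, Finset.sum_add_distrib, ← Finset.mul_sum]
  linear_combination h1

/-- Solutions of the equation are smooth up to the edge if the data are. -/
theorem contDiffOn_of_implicit (N : ℕ) {O X : Set Y} (hO : IsOpen O) (hXO : X ⊆ O) {a T : Y → ℂ}
    {p : Y → E} (ha : ContDiffOn ℝ (N + 1 : ℕ) a O) (hp : ContDiffOn ℝ (N + 1 : ℕ) p O)
    {R : ι → Set E} {G : ι → E → ℂ} {G' : ι → E → E →L[ℂ] ℂ} {w : ι → E}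
    (hmem : ∀ i, ∀ x ∈ X, p x + T x • w i ∈ R i)
    (hG : ∀ i, ∀ z ∈ R i, HasFDerivWithinAt (G i) ((G' i z).restrictScalars ℝ) (R i) z)
    (hG' : ∀ i, ContDiffOn ℝ N (G' i) (R i)) {K : ℝ} (hGK : ∀ i, ∀ z ∈ R i, ‖G' i z‖ ≤ K)
    (hKw : K * ∑ i, ‖w i‖ ≤ 1 / 2)
    (hT : ∀ y ∈ X, (fun x => T x - T y) =O[𝓝[X] y] fun x => x - y)
    (heq : ∀ x ∈ X, T x = a x + ∑ i, G i (p x + T x • w i)) : ContDiffOn ℝ (N + 1 : ℕ) T X := by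
  set T' : Y → Y →L[ℝ] ℂ := fun y =>
    implicitDeriv (fderiv ℝ a y) (fderiv ℝ p y) (fun i => G' i (p y + T y • w i)) w with hT'
  have h0 : ∀ y ∈ X, 1 - ∑ i, G' i (p y + T y • w i) (w i) ≠ 0 := fun y hy =>
    one_sub_sum_ne_zero (fun i => hGK i _ (hmem i y hy)) hKw
  have hder : ∀ y ∈ X, HasFDerivWithinAt T (T' y) X y := by
    intro y hy
    have hn : ((N + 1 : ℕ) : WithTop ℕ∞) ≠ 0 := by simp
    refine hasFDerivWithinAt_of_implicit hy ?_ ?_ hmem (fun i => hG i _ (hmem i y hy)) (hT y hy)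
      heq (h0 y hy) (implicitDeriv_apply _ _ (h0 y hy))
    · exact ((ha.contDiffAt (hO.mem_nhds (hXO hy))).differentiableAt
        hn).hasFDerivAt.hasFDerivWithinAt
    · exact ((hp.contDiffAt (hO.mem_nhds (hXO hy))).differentiableAt
        hn).hasFDerivAt.hasFDerivWithinAt
  have hstep : ∀ m : ℕ, m ≤ N + 1 → ContDiffOn ℝ m T X := by
    intro m
    induction m with
    | zero => exact fun _ => contDiffOn_zero.2 fun y hy => (hder y hy).continuousWithinAt
    | succ m ih =>
      intro hm
      have hm' : m ≤ N := by omega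
      have hTm := ih (by omega)
      have hmN : ((m : ℕ) : WithTop ℕ∞) ≤ (N : ℕ) := by exact_mod_cast hm'
      have hmN1 : ((m : ℕ) : WithTop ℕ∞) + 1 ≤ (N + 1 : ℕ) := by exact_mod_cast hm
      have hpm : ContDiffOn ℝ m p X := (hp.of_le (hmN.trans (by simp))).mono hXO
      have hPm : ∀ i, ContDiffOn ℝ m (fun y => G' i (p y + T y • w i)) X := fun i =>
        ((hG' i).of_le hmN).comp (hpm.add (hTm.smul contDiffOn_const)) (hmem i)
      have ha' : ContDiffOn ℝ m (fderiv ℝ a) X := (ha.fderiv_of_isOpen hO hmN1).mono hXO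
      have hp' : ContDiffOn ℝ m (fderiv ℝ p) X := (hp.fderiv_of_isOpen hO hmN1).mono hXO
      have hres : ContDiff ℝ m fun A : E →L[ℂ] ℂ => A.restrictScalars ℝ :=
        (ContinuousLinearMap.restrictScalarsL ℂ E ℂ ℝ ℝ).contDiff
      have hev : ∀ i, ContDiff ℝ m fun A : E →L[ℂ] ℂ => A (w i) := fun i =>
        ((ContinuousLinearMap.apply ℂ ℂ (w i)).restrictScalars ℝ).contDiff
      have hT'm : ContDiffOn ℝ m T' X := by
        refine ContDiffOn.smul (ContDiffOn.inv (contDiffOn_const.sub (ContDiffOn.sum fun i _ =>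
          (hev i).comp_contDiffOn (hPm i))) h0) (ha'.add (ContDiffOn.sum fun i _ =>
          (hres.comp_contDiffOn (hPm i)).clm_comp hp'))
      push_cast
      rw [contDiffOn_succ_iff_hasFDerivWithinAt (by simp)]
      intro y hy
      exact ⟨X, by rw [insert_eq_of_mem hy]; exact self_mem_nhdsWithin, by simp, T', hder, hT'm⟩
  exact hstep _ le_rfl

end ImplicitEquation

/-! ### Lipschitz extension of the remainder -/

section Remainder

variable {D : ℕ} {E : Type*} [NormedAddCommGroup E] [NormedSpace ℂ E]
  {γ : Rn D → E} {U : Set (Rn D)} {x₀ : Rn D} {v : E}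

theorem mem_closedConeRegion_of_mem_ball {r : ℝ} {x : Rn D} (hx : x ∈ Metric.ball x₀ r) :
    γ x ∈ closedConeRegion γ x₀ v r := by
  have hr : 0 < r := (norm_nonneg _).trans_lt (mem_ball_iff_norm.1 hx)
  exact ⟨x, hx, 0, ⟨le_rfl, hr⟩, v, Metric.mem_ball_self hr, by simp⟩

theorem HasSmoothBoundaryValue.exists_contDiffOn_edgeExtDeriv [FiniteDimensional ℂ E]
    (hU : IsOpen U) (hγ : ContDiffOn ℝ ∞ γ U) (hx₀ : x₀ ∈ U) {e : Fin D → Rn D}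
    {C₀ : E →L[ℂ] (Fin D → ℂ)} (hC₀ : frameMap C₀ (fun j => fderiv ℝ γ x₀ (e j)) = 1) (n : ℕ)
    {r : ℝ} (hr : 0 < r) {F : E → ℂ} {u : Rn D → ℂ} (h : HasSmoothBoundaryValue γ x₀ v r F u) :
    ∃ r' > 0, ContDiffOn ℝ n (edgeExtDeriv v C₀ (fun j => fderiv ℝ γ x₀ (e j)) F)
      (closedConeRegion γ x₀ v r') := by
  have h1 : ∀ j, ∃ r' > 0, ContDiffOn ℝ n
      (edgeExt v fun z => fderiv ℂ F z (fderiv ℝ γ x₀ (e j))) (closedConeRegion γ x₀ v r') := by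
    intro j
    obtain ⟨r₁, hr₁, -, u', h'⟩ := h.exists_fderiv hU hγ hx₀ hC₀ hr (fderiv ℝ γ x₀ (e j))
    exact h'.exists_contDiffOn hU hγ hx₀ hC₀ n hr₁
  obtain ⟨r₂, hr₂, hr₂'⟩ := exists_pos_forall_of_antitone
    (fun j r r' hr' hK => hK.mono (closedConeRegion_mono hr')) h1
  exact ⟨r₂, hr₂, ContDiffOn.sum fun j _ => (hr₂' j).smul contDiffOn_const⟩

/-- The first order Taylor remainder at `γ x₀` of a holomorphic function with smooth boundary value
is, near that point, the restriction of a globally defined function with small Lipschitz constant.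
The aperture `r'` of the cone region does not depend on the size of that constant. -/
theorem HasSmoothBoundaryValue.exists_remainder [FiniteDimensional ℂ E] (hU : IsOpen U)
    (hγ : ContDiffOn ℝ ∞ γ U) (hx₀ : x₀ ∈ U) {e : Fin D → Rn D} {C₀ : E →L[ℂ] (Fin D → ℂ)}
    (hC₀ : frameMap C₀ (fun j => fderiv ℝ γ x₀ (e j)) = 1) (n : ℕ) {r : ℝ} (hr : 0 < r)
    {F : E → ℂ} {u : Rn D → ℂ} (h : HasSmoothBoundaryValue γ x₀ v r F u) :
    ∃ A : E →L[ℂ] ℂ, fderiv ℝ u x₀ = (A.restrictScalars ℝ).comp (fderiv ℝ γ x₀) ∧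
      ∃ r' > 0, ∀ ε > 0, ∃ δ > 0, ∃ (G : E → ℂ) (G' : E → E →L[ℂ] ℂ),
        (∀ z z', ‖G z - G z'‖ ≤ ε * ‖z - z'‖) ∧
        (∀ z ∈ closedConeRegion γ x₀ v r' ∩ Metric.ball (γ x₀) δ,
          HasFDerivWithinAt G ((G' z).restrictScalars ℝ)
            (closedConeRegion γ x₀ v r' ∩ Metric.ball (γ x₀) δ) z) ∧
        ContDiffOn ℝ n G' (closedConeRegion γ x₀ v r' ∩ Metric.ball (γ x₀) δ) ∧
        (∀ z ∈ closedConeRegion γ x₀ v r' ∩ Metric.ball (γ x₀) δ, ‖G' z‖ ≤ ε) ∧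
        ∀ x ∈ Metric.ball x₀ r', γ x ∈ Metric.ball (γ x₀) δ →
          G (γ x) = u x - u x₀ - A (γ x - γ x₀) := by
  have hγx : ContDiffAt ℝ ∞ γ x₀ := hγ.contDiffAt (hU.mem_nhds hx₀)
  set D₀ := edgeExtDeriv v C₀ (fun j => fderiv ℝ γ x₀ (e j)) F with hD₀
  obtain ⟨r₁, hr₁, hr₁r, hder⟩ := h.exists_hasFDerivWithinAt hU hγ hx₀ hC₀ hr
  obtain ⟨r₂, hr₂, hsm⟩ := h.exists_contDiffOn_edgeExtDeriv hU hγ hx₀ hC₀ n hr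
  obtain ⟨r₃, hr₃, -, -, -, htend, heF, heu⟩ := h.exists_lipschitz hU hγ hx₀ hC₀ hr
  obtain ⟨m, hm, hm1, hm2, hm3⟩ : ∃ m > 0, m ≤ r₁ ∧ m ≤ r₂ ∧ m ≤ r₃ :=
    ⟨min r₁ (min r₂ r₃), by positivity, by simp⟩
  have hder' : ∀ z ∈ closedConeRegion γ x₀ v m, HasFDerivWithinAt (edgeExt v F)
      ((D₀ z).restrictScalars ℝ) (closedConeRegion γ x₀ v m) z := fun z hz =>
    (hder z (closedConeRegion_mono hm1 hz)).mono (closedConeRegion_mono hm1)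
  obtain ⟨r₄, hr₄, hr₄m, k, hk, hpath⟩ := exists_path_estimate (v := v) hγx.continuousAt hm
  have hmemγ : γ x₀ ∈ closedConeRegion γ x₀ v m :=
    mem_closedConeRegion_of_mem_ball (Metric.mem_ball_self hm)
  set A := D₀ (γ x₀) with hA
  refine ⟨A, ?_, r₄, hr₄, fun ε hε => ?_⟩
  · have h1 : MapsTo γ (Metric.ball x₀ m) (closedConeRegion γ x₀ v m) := fun x hx =>
      mem_closedConeRegion_of_mem_ball hx
    have h2 := ((hder' _ hmemγ).comp x₀ (hγx.differentiableAt
      (by simp)).hasFDerivAt.hasFDerivWithinAt h1).hasFDerivAt (Metric.ball_mem_nhds x₀ hm)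
    refine (h2.congr_of_eventuallyEq ?_).fderiv
    filter_upwards [Metric.ball_mem_nhds x₀ hm] with x hx
    exact (heu x (Metric.ball_subset_ball hm3 hx)).symm
  · obtain ⟨ε₁, hε₁, hε₁ε, hε₁L⟩ : ∃ ε₁ > 0, ε₁ ≤ ε ∧
        lipschitzExtensionConstant ℂ * (k * ε₁) ≤ ε := by
      have hL : (0 : ℝ) ≤ lipschitzExtensionConstant ℂ := NNReal.coe_nonneg _
      refine ⟨ε / (1 + lipschitzExtensionConstant ℂ * k), by positivity, ?_, ?_⟩
      · exact div_le_self hε.le (le_add_of_nonneg_right (by positivity))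
      · have h1 : (0 : ℝ) < 1 + lipschitzExtensionConstant ℂ * k := by positivity
        rw [mul_div_assoc', mul_div_assoc', div_le_iff₀ h1]
        nlinarith
    have hcont : ContinuousWithinAt D₀ (closedConeRegion γ x₀ v m) (γ x₀) :=
      hsm.continuousOn.mono (closedConeRegion_mono hm2) _ hmemγ
    obtain ⟨δ, hδ, hδε⟩ := Metric.continuousWithinAt_iff.1 hcont ε₁ hε₁
    have hfd : ∀ y ∈ coneRegion γ x₀ v m, fderiv ℂ F y = D₀ y := by
      intro y hy
      have h1 : HasFDerivAt (edgeExt v F) ((D₀ y).restrictScalars ℝ) y :=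
        (hder' y (coneRegion_subset_closedConeRegion hy)).hasFDerivAt
          (mem_of_superset (isOpen_coneRegion.mem_nhds hy) coneRegion_subset_closedConeRegion)
      have h2 : HasFDerivAt F (fderiv ℂ F y) y := ((h.holo y (coneRegion_mono
        (hm1.trans hr₁r) hy)).differentiableAt (isOpen_coneRegion.mem_nhds
          (coneRegion_mono (hm1.trans hr₁r) hy))).hasFDerivAt
      have h3 : HasFDerivAt (edgeExt v F) ((fderiv ℂ F y).restrictScalars ℝ) y := by
        refine (h2.restrictScalars ℝ).congr_of_eventuallyEq ?_
        filter_upwards [isOpen_coneRegion.mem_nhds hy] with w hw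
        exact heF w (coneRegion_mono hm3 hw)
      have h4 := h3.unique h1
      ext w
      exact congrArg (fun B : E →L[ℝ] ℂ => B w) h4
    set δ' := δ / (4 * (k + 1)) with hδ'
    have hδ'p : 0 < δ' := by positivity
    set R := closedConeRegion γ x₀ v r₄ ∩ Metric.ball (γ x₀) δ' with hR
    have hsub : R ⊆ closedConeRegion γ x₀ v m := fun z hz => closedConeRegion_mono hr₄m hz.1
    have hδk : δ' ≤ δ / 4 :=
      div_le_div_of_nonneg_left hδ.le (by norm_num) (by linarith)
    have hlip : ∀ z ∈ R, ∀ z' ∈ R,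
        ‖edgeExt v F z' - edgeExt v F z - A (z' - z)‖ ≤ k * ε₁ * ‖z' - z‖ := by
      intro z hz z' hz'
      have t1 := htend z (closedConeRegion_mono hm3 (hsub hz))
      have t2 := htend z' (closedConeRegion_mono hm3 (hsub hz'))
      have t3 := ((t2.sub t1).sub_const (A (z' - z))).norm
      refine le_of_tendsto t3 ?_
      have hb : ∀ y ∈ R, ‖y - γ x₀‖ < δ' := fun y hy => mem_ball_iff_norm.1 hy.2
      filter_upwards [Ioo_mem_nhdsGT (lt_min hr₄ hδ'p)] with s hs
      refine hpath F (h.holo.mono (coneRegion_mono (hm1.trans hr₁r))) z hz.1 z' hz'.1 s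
        ⟨hs.1, hs.2.trans_le (min_le_left _ _)⟩ A ε₁ fun y hy hyz => ?_
      rw [hfd y hy, ← dist_eq_norm]
      refine (hδε (coneRegion_subset_closedConeRegion hy) ?_).le
      rw [dist_eq_norm]
      have hs2 := hs.2.trans_le (min_le_right _ _)
      have h6 : ‖z' - z‖ ≤ 2 * δ' := by
        calc _ = ‖(z' - γ x₀) - (z - γ x₀)‖ := by congr 1; abel
          _ ≤ _ := norm_sub_le _ _
          _ ≤ _ := by linarith [hb z hz, hb z' hz']
      calc ‖y - γ x₀‖ = ‖(y - z) + (z - γ x₀)‖ := by congr 1; abel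
        _ ≤ ‖y - z‖ + ‖z - γ x₀‖ := norm_add_le _ _
        _ < k * (2 * δ' + δ') + δ' := by
            refine add_lt_add_of_le_of_lt (hyz.trans ?_) (hb z hz)
            gcongr
        _ = δ * ((3 * k + 1) / (4 * (k + 1))) := by rw [hδ']; ring
        _ ≤ δ := mul_le_of_le_one_right hδ.le ((div_le_one (by positivity)).2 (by linarith))
    set G₀ : E → ℂ := fun z => edgeExt v F z - u x₀ - A (z - γ x₀) with hG₀
    have hG₀lip : LipschitzOnWith (Real.toNNReal (k * ε₁)) G₀ R := by
      refine LipschitzOnWith.of_dist_le_mul fun z hz z' hz' => ?_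
      rw [dist_eq_norm, dist_eq_norm, Real.coe_toNNReal _ (by positivity)]
      have e1 : G₀ z - G₀ z' = edgeExt v F z - edgeExt v F z' - A (z - z') := by
        simp only [hG₀, map_sub]
        ring
      rw [e1]
      exact hlip z' hz' z hz
    obtain ⟨G, hG, hGG⟩ := hG₀lip.extend_finite_dimension
    refine ⟨δ', hδ'p, G, fun z => D₀ z - A, fun z z' => ?_, fun z hz => ?_, ?_, fun z hz => ?_,
      fun x hx hxδ => ?_⟩
    · rw [← dist_eq_norm, ← dist_eq_norm]
      refine (hG.dist_le_mul z z').trans ?_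
      refine mul_le_mul_of_nonneg_right ?_ dist_nonneg
      rw [NNReal.coe_mul, Real.coe_toNNReal _ (by positivity)]
      exact hε₁L
    · have h1 := ((hder' z (hsub hz)).mono hsub).sub_const (u x₀)
      have h2 : HasFDerivWithinAt (fun z => A (z - γ x₀)) (A.restrictScalars ℝ)
          R z := by
        have := (A.restrictScalars ℝ).hasFDerivWithinAt (s := R) (x := z)
        refine (this.sub_const (A (γ x₀))).congr_of_eventuallyEq
          (Eventually.of_forall fun w => ?_) ?_ <;> exact map_sub _ _ _
      exact ((h1.sub h2).congr_fderiv rfl).congr (fun w hw => (hGG hw).symm) (hGG hz).symm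
    · exact (hsm.mono (hsub.trans (closedConeRegion_mono hm2))).sub contDiffOn_const
    · rw [← dist_eq_norm]
      refine ((hδε (hsub hz) ?_).le).trans hε₁ε
      exact lt_of_lt_of_le hz.2 (by linarith)
    · rw [← hGG ⟨mem_closedConeRegion_of_mem_ball hx, hxδ⟩]
      change edgeExt v F (γ x) - _ - _ = _
      rw [heu x (Metric.ball_subset_ball (hr₄m.trans hm3) hx)]

end Remainder

/-! ### Solutions of the implicit equation near a cone region -/

section ConeSolutions

variable {ι : Type*} [Fintype ι] {V E : Type*} [NormedAddCommGroup V] [NormedSpace ℂ V]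
  [NormedAddCommGroup E] [NormedSpace ℂ E]

theorem isBigO_sub_of_norm_sub_le {V : Type*} [NormedAddCommGroup V] {X : Set V} {T : V → ℂ} {C : ℝ}
    (hT : ∀ q q', ‖T q - T q'‖ ≤ C * ‖q - q'‖) (y : V) :
    (fun x => T x - T y) =O[𝓝[X] y] fun x => x - y :=
  Asymptotics.IsBigO.of_bound C (Eventually.of_forall fun x => hT x y)

theorem HasFDerivWithinAt.hasFDerivAt_complex {R O : Set E} {G : E → ℂ} {B : E →L[ℂ] ℂ} {z : E}
    (h : HasFDerivWithinAt G (B.restrictScalars ℝ) R z) (hO : IsOpen O) (hz : z ∈ O)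
    (hOR : O ⊆ R) : HasFDerivAt G B z :=
  hasFDerivAt_of_restrictScalars ℝ (h.hasFDerivAt (mem_of_superset (hO.mem_nhds hz) hOR)) rfl

/-- In the interior of the region where the data are holomorphic, the solution of the implicit
equation is holomorphic. -/
theorem differentiableOn_of_implicit {O : Set V} (hO : IsOpen O) {a : V → ℂ} {a' : V →L[ℂ] ℂ}
    (ha : ∀ q, HasFDerivAt a a' q) (p : V →L[ℂ] E) {T : V → ℂ} {R : ι → Set E} {G : ι → E → ℂ}
    {G' : ι → E → E →L[ℂ] ℂ} {w : ι → E} (hmem : ∀ i, ∀ q ∈ O, p q + T q • w i ∈ R i)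
    (hG : ∀ i, ∀ z ∈ R i, HasFDerivWithinAt (G i) ((G' i z).restrictScalars ℝ) (R i) z) {K : ℝ}
    (hGK : ∀ i, ∀ z ∈ R i, ‖G' i z‖ ≤ K) (hKw : K * ∑ i, ‖w i‖ ≤ 1 / 2) {C : ℝ}
    (hT : ∀ q q', ‖T q - T q'‖ ≤ C * ‖q - q'‖)
    (heq : ∀ q, T q = a q + ∑ i, G i (p q + T q • w i)) : DifferentiableOn ℂ T O := by
  intro q hq
  have h0 := one_sub_sum_ne_zero (fun i => hGK i _ (hmem i q hq)) hKw
  set B : ι → E →L[ℂ] ℂ := fun i => G' i (p q + T q • w i) with hB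
  set T' : V →L[ℂ] ℂ := (1 - ∑ i, B i (w i))⁻¹ • (a' + ∑ i, (B i).comp p) with hT'
  have e1 : T'.restrictScalars ℝ =
      implicitDeriv (a'.restrictScalars ℝ) (p.restrictScalars ℝ) B w := by
    ext ξ
    simp only [hT', implicitDeriv, smul_apply, add_apply, sum_apply,
      ContinuousLinearMap.comp_apply, ContinuousLinearMap.coe_restrictScalars', smul_eq_mul]
  have h1 : HasFDerivWithinAt T (T'.restrictScalars ℝ) O q := by
    rw [e1]
    exact hasFDerivWithinAt_of_implicit hq ((ha q).restrictScalars ℝ).hasFDerivWithinAt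
      (p.hasFDerivAt.restrictScalars ℝ).hasFDerivWithinAt hmem (fun i => hG i _ (hmem i q hq))
      (isBigO_sub_of_norm_sub_le hT q) (fun x _ => heq x) h0 (implicitDeriv_apply _ _ h0)
  exact (h1.hasFDerivAt_complex hO hq le_rfl).differentiableAt.differentiableWithinAt

/-- Holomorphic functions on a neighbourhood are smooth CR functions. -/
theorem isSmoothCR_of_differentiableOn [FiniteDimensional ℂ V] {M W O : Set V} (hO : IsOpen O)
    (hWO : W ⊆ O) {F : V → ℂ} (hF : DifferentiableOn ℂ F O) : IsSmoothCR M W F := by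
  refine ⟨((contDiffOn_of_differentiableOn_complex hO hF).restrict_scalars ℝ).mono hWO,
    fun q hq => ⟨(fderiv ℂ F q).restrictScalars ℝ, ?_, fun X _ => (fderiv ℂ F q).map_smul _ _⟩⟩
  exact (((hF q (hWO hq)).differentiableAt
    (hO.mem_nhds (hWO hq))).hasFDerivAt.restrictScalars ℝ).hasFDerivWithinAt

/-- Near the edge, in the direction `v₁` normalized by `a v₁ = 1`, the solution `τ` is close
to the parameter `t`; translating by `τ` the projection of a point of the wedge, one obtains a
point near the ray of any prescribed direction. -/
theorem exists_aperture (a : V →L[ℂ] ℂ) (p : V →L[ℂ] E) (w : ι → E) {v₁ : V} (hv₁ : a v₁ = 1)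
    {r : ℝ} (hr : 0 < r) (m : ℝ) :
    ∃ K₀ > 0, ∀ K ∈ Ioc 0 K₀, K * ∑ i, ‖w i‖ ≤ 1 / 2 ∧
      ∀ (G : ι → E → ℂ) (τ : V → ℂ) (p₀ : V), (∀ i z z', ‖G i z - G i z'‖ ≤ K * ‖z - z'‖) →
        (∀ q, τ q = a (q - p₀) + ∑ i, G i (p q + τ q • w i)) →
        (∀ q q' s, s = a (q' - p₀) + ∑ i, G i (p q' + s • w i) →
          ‖τ q - s‖ ≤ 2 * (‖a (q - p₀) - a (q' - p₀)‖ + Fintype.card ι * K * ‖p q - p q'‖)) →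
        ∀ q₀ : V, 0 = a (q₀ - p₀) + ∑ i, G i (p q₀) → ∀ t > (0 : ℝ), ∀ y ∈ Metric.ball v₁ K,
          ∀ v' : E, ‖v' - p v₁‖ ≤ m → ∃ v'' ∈ Metric.ball v' r,
            p (q₀ + t • y) + τ (q₀ + t • y) • (v' - p v₁) = p q₀ + t • v'' := by
  set Wn := ∑ i, ‖w i‖ with hWn
  have hWn0 : 0 ≤ Wn := Finset.sum_nonneg fun i _ => norm_nonneg _
  set N : ℝ := (Fintype.card ι : ℝ) with hN
  have hN0 : 0 ≤ N := Nat.cast_nonneg _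
  set L := ‖a‖ + N * ‖p‖ * (‖v₁‖ + 1) + 2 * Wn * (‖a‖ + N * ‖p‖) * (‖v₁‖ + 1) with hL
  have hL0 : 0 ≤ L := by positivity
  set m' := max m 0 with hm'
  have hm'0 : 0 ≤ m' := le_max_right _ _
  obtain ⟨K₀, hK₀, hK1, hKW, hKr⟩ : ∃ K₀ > 0, K₀ ≤ 1 ∧ K₀ * Wn ≤ 1 / 2 ∧
      K₀ * (‖p‖ + L * m' + 1) ≤ r := by
    refine ⟨min 1 (min (1 / (2 * (Wn + 1))) (r / (‖p‖ + L * m' + 1))), by positivity,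
      min_le_left _ _, ?_, ?_⟩
    · calc _ ≤ 1 / (2 * (Wn + 1)) * (Wn + 1) := by
            gcongr
            · exact (min_le_right _ _).trans (min_le_left _ _)
            · linarith
        _ = 1 / 2 := by field_simp
    · rw [← le_div_iff₀ (by positivity)]
      exact (min_le_right _ _).trans (min_le_right _ _)
  refine ⟨K₀, hK₀, fun K hK => ⟨?_, ?_⟩⟩
  · exact (mul_le_mul_of_nonneg_right hK.2 hWn0).trans hKW
  intro G τ p₀ hG hτ hLip q₀ h0 t ht y hy v' hv'
  have hKp := hK.1
  have hK1' : K ≤ 1 := hK.2.trans hK1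
  rw [mem_ball_iff_norm] at hy
  have hyn : ‖y‖ ≤ ‖v₁‖ + 1 := by
    have := norm_add_le (y - v₁) v₁
    rw [sub_add_cancel] at this
    linarith
  set q := q₀ + t • y with hq
  have hpq : p q - p q₀ = t • p y := by
    rw [hq, map_add, add_sub_cancel_left]
    exact (p.restrictScalars ℝ).map_smul t y
  have haq : a (q - p₀) - a (q₀ - p₀) = (t : ℂ) * a y := by
    rw [← map_sub, sub_sub_sub_cancel_right, hq, add_sub_cancel_left]
    exact ((a.restrictScalars ℝ).map_smul t y).trans (Complex.real_smul ..)
  have hpn : ‖p q - p q₀‖ ≤ t * (‖p‖ * (‖v₁‖ + 1)) := by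
    rw [hpq, norm_smul, Real.norm_of_nonneg ht.le]
    gcongr
    exact (p.le_opNorm y).trans (by gcongr)
  have hτn : ‖τ q‖ ≤ t * (2 * (‖a‖ + N * ‖p‖) * (‖v₁‖ + 1)) := by
    have h1 := hLip q q₀ 0 (by simpa using h0)
    rw [sub_zero, haq, norm_mul, Complex.norm_real, Real.norm_of_nonneg ht.le] at h1
    calc _ ≤ _ := h1
      _ ≤ 2 * (t * (‖a‖ * (‖v₁‖ + 1)) + N * 1 * (t * (‖p‖ * (‖v₁‖ + 1)))) := by
          gcongr
          exact (a.le_opNorm y).trans (by gcongr)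
      _ = _ := by ring
  have hmain : ‖τ q - t‖ ≤ t * (K * L) := by
    have e1 : τ q - t = t * a (y - v₁) + ∑ i, (G i (p q + τ q • w i) - G i (p q₀)) := by
      rw [map_sub, hv₁, Finset.sum_sub_distrib]
      linear_combination hτ q - h0 + haq
    have e2 : ∀ i, ‖G i (p q + τ q • w i) - G i (p q₀)‖ ≤
        K * (t * (‖p‖ * (‖v₁‖ + 1))) +
          K * (t * (2 * (‖a‖ + N * ‖p‖) * (‖v₁‖ + 1))) * ‖w i‖ := by
      intro i
      refine (hG i _ _).trans ?_
      have : p q + τ q • w i - p q₀ = (p q - p q₀) + τ q • w i := by abel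
      rw [this, mul_assoc, ← mul_add]
      gcongr
      refine (norm_add_le _ _).trans (add_le_add hpn ?_)
      rw [norm_smul]
      gcongr
    rw [e1]
    calc _ ≤ ‖(t : ℂ) * a (y - v₁)‖ + ∑ i, ‖G i (p q + τ q • w i) - G i (p q₀)‖ :=
          (norm_add_le _ _).trans (by gcongr; exact norm_sum_le _ _)
      _ ≤ t * (‖a‖ * K) + ∑ i, (K * (t * (‖p‖ * (‖v₁‖ + 1))) +
          K * (t * (2 * (‖a‖ + N * ‖p‖) * (‖v₁‖ + 1))) * ‖w i‖) := by
          gcongr with i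
          · rw [norm_mul, Complex.norm_real, Real.norm_of_nonneg ht.le]
            gcongr
            exact (a.le_opNorm _).trans (by gcongr)
          · exact e2 i
      _ = t * (K * L) := by
          rw [Finset.sum_add_distrib, Finset.sum_const, ← Finset.mul_sum, Finset.card_univ,
            nsmul_eq_mul, hL]
          ring
  refine ⟨v' + p (y - v₁) + (((t : ℂ)⁻¹ * (τ q - t)) • (v' - p v₁)), ?_, ?_⟩
  · rw [mem_ball_iff_norm]
    have e3 : v' + p (y - v₁) + (((t : ℂ)⁻¹ * (τ q - t)) • (v' - p v₁)) - v' =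
        p (y - v₁) + (((t : ℂ)⁻¹ * (τ q - t)) • (v' - p v₁)) := by abel
    have e4 : ‖(t : ℂ)⁻¹ * (τ q - t)‖ ≤ K * L := by
      rw [norm_mul, norm_inv, Complex.norm_real, Real.norm_of_nonneg ht.le, inv_mul_le_iff₀ ht]
      exact hmain
    rw [e3]
    calc _ ≤ ‖p (y - v₁)‖ + ‖((t : ℂ)⁻¹ * (τ q - t)) • (v' - p v₁)‖ := norm_add_le _ _
      _ ≤ ‖p‖ * K + K * L * m' := by
          rw [norm_smul]
          gcongr
          · exact (p.le_opNorm _).trans (by gcongr)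
          · exact hv'.trans (le_max_left _ _)
      _ < K * (‖p‖ + L * m' + 1) := by linarith
      _ ≤ K₀ * (‖p‖ + L * m' + 1) := by gcongr; exact hK.2
      _ ≤ r := hKr
  · have ht' : (t : ℂ) ≠ 0 := by exact_mod_cast ht.ne'
    have e5 : p q = p q₀ + (t : ℂ) • p y := by
      rw [← sub_eq_iff_eq_add', hpq]
      exact (Complex.coe_smul t (p y)).symm
    rw [e5, ← Complex.coe_smul t, smul_add, smul_add, smul_smul, mul_inv_cancel_left₀ ht', map_sub]
    module

theorem exists_add_smul_eq_of_mem_ball {v v' a : E} {r t s : ℝ} (hv' : v' ∈ Metric.ball v r)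
    (ht : 0 ≤ t) (hs : 0 ≤ s) (hts : 0 < t + s) :
    ∃ w ∈ Metric.ball v r, a + t • v' + s • v = a + (t + s) • w := by
  refine ⟨(t / (t + s)) • v' + (s / (t + s)) • v, ?_, ?_⟩
  · exact (convex_ball v r) hv' (Metric.mem_ball_self ((norm_nonneg _).trans_lt
      (mem_ball_iff_norm.1 hv'))) (div_nonneg ht hts.le) (div_nonneg hs hts.le) (by field_simp)
  · rw [smul_add, smul_smul, smul_smul, mul_div_cancel₀ _ hts.ne', mul_div_cancel₀ _ hts.ne',
      add_assoc]

end ConeSolutions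

/-! ### Linear independence on nearby tangent spaces, and curves entering a wedge -/

section Transversality

variable {V : Type*} [NormedAddCommGroup V] [NormedSpace ℂ V] {M N : Set V}

/-- Linear independence of differentials along `M` is an open condition. -/
theorem IsLocalParam.exists_linearIndependent {d n : ℕ} {Ω : Opens (Rn d)} {μ : Rn d → V}
    {y₀ : Rn d} (hμ : IsLocalParam M Ω μ) (hy₀ : y₀ ∈ Ω) (Q : Fin n → V →L[ℝ] ℂ)
    (hQ : LinearIndependent ℂ
      fun l => (Q l : V →ₗ[ℝ] ℂ).domRestrict (tangentSpace M (μ y₀))) :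
    ∃ ε > 0, ∀ᶠ q in 𝓝 (μ y₀), q ∈ M → ∀ A : Fin n → V →L[ℝ] ℂ, (∀ l, ‖A l - Q l‖ ≤ ε) →
      LinearIndependent ℂ fun l => (A l : V →ₗ[ℝ] ℂ).domRestrict (tangentSpace M q) := by
  set Φ : (Rn d) × (Fin n → V →L[ℝ] ℂ) → Fin n → Rn d →L[ℝ] ℂ := fun z l =>
    (z.2 l).comp (fderiv ℝ μ z.1) with hΦ
  have hind : LinearIndependent ℂ (Φ (y₀, Q)) := by
    rw [Fintype.linearIndependent_iff] at hQ ⊢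
    intro c hc
    refine hQ c ?_
    ext ⟨x, hx⟩
    rw [hμ.tangentSpace_eq hy₀] at hx
    obtain ⟨ξ, rfl⟩ := hx
    have := congrArg (fun B : Rn d →L[ℝ] ℂ => B ξ) hc
    simpa [hΦ] using this
  have hcont : ContinuousAt Φ (y₀, Q) := by
    have h1 : ContinuousAt (fun z : (Rn d) × (Fin n → V →L[ℝ] ℂ) => fderiv ℝ μ z.1) (y₀, Q) :=
      ContinuousAt.comp (g := fderiv ℝ μ) (f := Prod.fst)
        ((hμ.smooth.continuousOn_fderiv_of_isOpen Ω.isOpen (by simp)).continuousAt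
          (Ω.isOpen.mem_nhds hy₀)) continuousAt_fst
    exact continuousAt_pi.2 fun l =>
      (((continuous_apply l).comp continuous_snd).continuousAt).clm_comp h1
  have hev := hcont.eventually hind.eventually
  rw [nhds_prod_eq] at hev
  obtain ⟨P₁, hP₁, P₂, hP₂, hP⟩ := eventually_prod_iff.1 hev
  obtain ⟨ε, hε, hb⟩ := Metric.eventually_nhds_iff_ball.1 hP₂
  refine ⟨ε / 2, half_pos hε, ?_⟩
  filter_upwards [hμ.eventually_exists hy₀ hP₁] with q hq hqM A hA
  obtain ⟨y, hy, hyP, rfl⟩ := hq hqM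
  have hAQ : A ∈ Metric.ball Q ε := by
    rw [mem_ball_iff_norm]
    exact ((pi_norm_le_iff_of_nonneg (half_pos hε).le).2 hA).trans_lt (half_lt_self hε)
  have h2 := hP hyP (hb A hAQ)
  rw [Fintype.linearIndependent_iff] at h2 ⊢
  intro c hc
  refine h2 c ?_
  ext ξ
  have hmem : fderiv ℝ μ y ξ ∈ tangentSpace M (μ y) := by
    rw [hμ.tangentSpace_eq hy]
    exact ⟨ξ, rfl⟩
  have := LinearMap.congr_fun hc ⟨_, hmem⟩
  simpa [hΦ] using this

/-- A smooth family of curves which enters a wedge transversally to the edge stays in the wedge for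
small times, locally uniformly in the parameter, and leaves the edge at a linear rate. -/
theorem Wedge.IsApproach.exists_mem_toSet {d : ℕ} {p : V} {W : Wedge M N p} {b : Rn d → V}
    {U : Set (Rn d)} {σ : Rn d → ℝ → V} (hσ : W.IsApproach b U σ) (hU : IsOpen U)
    (hb : ∀ x ∈ U, b x ∈ N) (hNM : N ⊆ M) (h0 : (0 : Rn W.c) ∉ W.Γ) {K : Set (Rn d)}
    (hK : IsCompact K) (hKU : K ⊆ U) :
    ∃ δ > 0, ∃ c > 0, ∀ x ∈ K, ∀ t ∈ Ioo 0 δ, σ x t ∈ W.toSet ∧ c * t ≤ ‖W.ρ (σ x t)‖ := by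
  obtain ⟨hσ0, ⟨ε, hε, hσs, hσM⟩, hdir⟩ := hσ
  have key : ∀ x₁ ∈ K, ∃ s ∈ 𝓝[K] x₁, ∃ δ > 0, ∃ c > 0, ∀ x ∈ s, ∀ t ∈ Ioo 0 δ,
      σ x t ∈ W.toSet ∧ c * t ≤ ‖W.ρ (σ x t)‖ := by
    intro x₁ hx₁
    obtain ⟨hnhd, -, hΓ⟩ := hdir x₁ (hKU hx₁)
    have hopen : IsOpen (U ×ˢ Ioo (-ε) ε) := hU.prod isOpen_Ioo
    have hmem : (x₁, (0 : ℝ)) ∈ U ×ˢ Ioo (-ε) ε := ⟨hKU hx₁, by simpa using hε⟩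
    have hσc : ContDiffAt ℝ ∞ (fun y : Rn d × ℝ => σ y.1 y.2) (x₁, 0) :=
      hσs.contDiffAt (hopen.mem_nhds hmem)
    have hbx : σ x₁ 0 = b x₁ := hσ0 x₁ (hKU hx₁)
    have hρc : ContDiffAt ℝ ∞ W.ρ (σ x₁ 0) := by
      rw [hbx]
      exact W.smooth_ρ.contDiffAt (W.isOpen_nhd.mem_nhds hnhd)
    set f : Rn d × ℝ → Rn W.c := fun y => W.ρ (σ y.1 y.2) with hf
    have hfc : ContDiffAt ℝ ∞ f (x₁, 0) := ContDiffAt.comp (x₁, (0 : ℝ)) hρc hσc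
    have hfs : HasStrictFDerivAt f (fderiv ℝ f (x₁, 0)) (x₁, 0) :=
      hfc.hasStrictFDerivAt (by simp)
    set ξ := fderiv ℝ f (x₁, 0) (0, 1) with hξ
    have hξΓ : ξ ∈ W.Γ := by
      have h1 : HasDerivAt (fun t : ℝ => (x₁, t)) ((0 : Rn d), (1 : ℝ)) 0 :=
        (hasDerivAt_const (0 : ℝ) x₁).prodMk (hasDerivAt_id (0 : ℝ))
      have h2 : HasDerivAt (fun t : ℝ => f (x₁, t)) ξ 0 :=
        HasFDerivAt.comp_hasDerivAt (f := fun t : ℝ => (x₁, t)) 0 hfs.hasFDerivAt h1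
      have h3 : HasDerivAt (σ x₁) (deriv (σ x₁) 0) 0 :=
        (HasFDerivAt.comp_hasDerivAt (f := fun t : ℝ => (x₁, t)) 0
          (hσc.differentiableAt (by simp)).hasFDerivAt h1).differentiableAt.hasDerivAt
      have h4 : HasDerivAt (fun t : ℝ => W.ρ (σ x₁ t))
          (fderiv ℝ W.ρ (σ x₁ 0) (deriv (σ x₁) 0)) 0 :=
        HasFDerivAt.comp_hasDerivAt (f := σ x₁) 0
          (hρc.differentiableAt (by simp)).hasFDerivAt h3
      rw [h2.unique h4, hbx]
      exact hΓ
    obtain ⟨η, hη, hηΓ⟩ := Metric.isOpen_iff.1 W.isOpen_Γ _ hξΓ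
    obtain ⟨ρ, hρ, hest⟩ := hfs.exists_norm_sub_sub_le (c := η / 4) (by positivity)
    have hev : ∀ᶠ y in 𝓝 (x₁, (0 : ℝ)), y ∈ U ×ˢ Ioo (-ε) ε ∧ σ y.1 y.2 ∈ W.nhd ∧
        y ∈ Metric.ball (x₁, (0 : ℝ)) ρ :=
      (hopen.eventually_mem hmem).and ((hσc.continuousAt.eventually (W.isOpen_nhd.eventually_mem (by
        change σ x₁ 0 ∈ _
        rwa [hbx]))).and (Metric.ball_mem_nhds _ hρ))
    rw [nhds_prod_eq] at hev
    obtain ⟨P₁, hP₁, P₂, hP₂, hP⟩ := eventually_prod_iff.1 hev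
    obtain ⟨δ, hδ, hδP⟩ := Metric.eventually_nhds_iff_ball.1 hP₂
    refine ⟨{x | P₁ x}, nhdsWithin_le_nhds hP₁, δ, hδ, η / 4, by positivity, fun x hx t ht => ?_⟩
    have ht0 := ht.1
    have hPt : P₂ t := hδP t (by
      rw [mem_ball_zero_iff, Real.norm_of_nonneg ht0.le]
      exact ht.2)
    obtain ⟨⟨hxU, htε⟩, hnx, hbl⟩ := hP hx hPt
    obtain ⟨-, hn0, hbl0⟩ := hP hx (hδP 0 (Metric.mem_ball_self hδ))
    have hf0 : f (x, 0) = 0 := by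
      change W.ρ (σ x 0) = 0
      rw [hσ0 x hxU]
      refine (W.mem_edge_iff _ ⟨hNM (hb x hxU), ?_⟩).1 (hb x hxU)
      rw [← hσ0 x hxU]
      exact hn0
    have h5 := hest _ hbl _ hbl0
    have e1 : ((x, t) : Rn d × ℝ) - (x, 0) = t • ((0 : Rn d), (1 : ℝ)) := by simp
    have e2 : ‖((0 : Rn d), (1 : ℝ))‖ = 1 := by simp [Prod.norm_def]
    rw [hf0, sub_zero, e1, map_smul, norm_smul, e2, Real.norm_of_nonneg ht0.le, mul_one] at h5
    have h6 : ‖t⁻¹ • f (x, t) - ξ‖ ≤ η / 4 := by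
      have e3 : t⁻¹ • f (x, t) - ξ = t⁻¹ • (f (x, t) - t • ξ) := by
        rw [smul_sub, inv_smul_smul₀ ht0.ne']
      rw [e3, norm_smul, norm_inv, Real.norm_of_nonneg ht0.le, inv_mul_le_iff₀ ht0, mul_comm t]
      exact h5
    refine ⟨⟨⟨hσM x hxU t ⟨ht0.le, htε.2⟩, hnx⟩, ?_⟩, ?_⟩
    · have h7 : t⁻¹ • f (x, t) ∈ W.Γ := hηΓ (by
        rw [mem_ball_iff_norm]
        linarith)
      have h8 := W.Γ.smul_mem ht0 h7
      rwa [smul_inv_smul₀ ht0.ne'] at h8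
    · have h7 : η ≤ ‖ξ‖ := by
        by_contra hlt
        refine h0 (hηΓ ?_)
        rw [mem_ball_iff_norm, zero_sub, norm_neg]
        exact not_le.1 hlt
      have h8 := norm_sub_norm_le ξ (t⁻¹ • f (x, t))
      rw [norm_sub_rev, norm_smul, norm_inv, Real.norm_of_nonneg ht0.le] at h8
      have h9 : η / 4 ≤ t⁻¹ * ‖f (x, t)‖ := by linarith
      rw [inv_mul_eq_div, le_div_iff₀ ht0] at h9
      exact h9
  refine hK.induction_on (p := fun s => ∃ δ > 0, ∃ c > 0, ∀ x ∈ s, ∀ t ∈ Ioo 0 δ,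
    σ x t ∈ W.toSet ∧ c * t ≤ ‖W.ρ (σ x t)‖) ⟨1, one_pos, 1, one_pos, by simp⟩ ?_ ?_ key
  · rintro s s' hss ⟨δ, hδ, c, hc, h⟩
    exact ⟨δ, hδ, c, hc, fun x hx => h x (hss hx)⟩
  · rintro s s' ⟨δ, hδ, c, hc, h⟩ ⟨δ', hδ', c', hc', h'⟩
    refine ⟨min δ δ', lt_min hδ hδ', min c c', lt_min hc hc', fun x hx t ht => ?_⟩
    have ht0 := ht.1
    rcases hx with hx | hx
    · obtain ⟨h1, h2⟩ := h x hx t ⟨ht0, ht.2.trans_le (min_le_left _ _)⟩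
      exact ⟨h1, (by gcongr; exact min_le_left _ _ : _ ≤ c * t).trans h2⟩
    · obtain ⟨h1, h2⟩ := h' x hx t ⟨ht0, ht.2.trans_le (min_le_right _ _)⟩
      exact ⟨h1, (by gcongr; exact min_le_right _ _ : _ ≤ c' * t).trans h2⟩

end Transversality

/-! ### Boundary values along curves entering a wedge -/

section BoundaryValues

variable {D : ℕ} {E : Type*} [NormedAddCommGroup E] [NormedSpace ℂ E]

/-- If the tangent space of `γ` spans `E` over `ℂ`, then the identity of `E` is of the form
`∑ C₀_j ∂_jγ`. -/
theorem exists_frameMap_eq_one [FiniteDimensional ℂ E] {B : Rn D →L[ℝ] E}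
    (hB : Submodule.span ℂ ((B : Rn D →ₗ[ℝ] E).range : Set E) = ⊤) :
    ∃ C₀ : E →L[ℂ] (Fin D → ℂ), frameMap C₀ (fun j => B (EuclideanSpace.single j 1)) = 1 := by
  set T : Fin D → E := fun j => B (EuclideanSpace.single j 1) with hT
  have hs : Function.Surjective (Fintype.linearCombination ℂ T) := by
    rw [← LinearMap.range_eq_top, eq_top_iff, ← hB, Submodule.span_le]
    rintro _ ⟨ξ, rfl⟩
    refine ⟨fun j => (ξ j : ℂ), ?_⟩
    have h1 : ξ = ∑ j, ξ j • EuclideanSpace.single j (1 : ℝ) := by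
      ext i
      simp [Finset.sum_apply, Pi.single_apply]
    rw [Fintype.linearCombination_apply]
    change _ = B ξ
    conv_rhs => rw [h1]
    rw [map_sum]
    refine Finset.sum_congr rfl fun j _ => ?_
    rw [map_smul, Complex.coe_smul]
  obtain ⟨C, hC⟩ := LinearMap.exists_rightInverse_of_surjective _ (LinearMap.range_eq_top.2 hs)
  refine ⟨LinearMap.toContinuousLinearMap C, ?_⟩
  ext1 a
  rw [frameMap_apply]
  have := LinearMap.congr_fun hC a
  rw [LinearMap.comp_apply, Fintype.linearCombination_apply] at this
  exact this

theorem norm_implicitDeriv_le {ι Y : Type*} [Fintype ι] [NormedAddCommGroup Y] [NormedSpace ℝ Y]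
    (a' : Y →L[ℝ] ℂ) (p' : Y →L[ℝ] E) {B : ι → E →L[ℂ] ℂ} {w : ι → E} {K : ℝ}
    (hB : ∀ i, ‖B i‖ ≤ K) (hKw : K * ∑ i, ‖w i‖ ≤ 1 / 2) :
    ‖implicitDeriv a' p' B w‖ ≤ 2 * (‖a'‖ + Fintype.card ι * K * ‖p'‖) := by
  rcases isEmpty_or_nonempty ι with hι | ⟨⟨i₀⟩⟩
  · have : implicitDeriv a' p' B w = a' := by simp [implicitDeriv]
    rw [this, Fintype.card_eq_zero]
    simp only [Nat.cast_zero, zero_mul, add_zero]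
    linarith [norm_nonneg a']
  have hK : 0 ≤ K := (norm_nonneg _).trans (hB i₀)
  have h0 := one_sub_sum_ne_zero hB hKw
  refine ContinuousLinearMap.opNorm_le_bound _ (by positivity) fun ξ => ?_
  set s := implicitDeriv a' p' B w ξ with hs
  have h1 := implicitDeriv_apply a' p' h0 ξ
  rw [← hs] at h1
  have h2 : ‖s‖ ≤ ‖a'‖ * ‖ξ‖ + ∑ i, (K * (‖p'‖ * ‖ξ‖) + K * ‖w i‖ * ‖s‖) := by
    calc ‖s‖ = ‖a' ξ + ∑ i, B i (p' ξ + s • w i)‖ := by rw [← h1]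
      _ ≤ ‖a' ξ‖ + ∑ i, ‖B i (p' ξ + s • w i)‖ :=
          (norm_add_le _ _).trans (by gcongr; exact norm_sum_le _ _)
      _ ≤ _ := by
          gcongr with i
          · exact a'.le_opNorm ξ
          · calc _ ≤ ‖B i‖ * ‖p' ξ + s • w i‖ := (B i).le_opNorm _
              _ ≤ K * (‖p'‖ * ‖ξ‖ + ‖s‖ * ‖w i‖) := by
                  gcongr
                  · exact hB i
                  · refine (norm_add_le _ _).trans (add_le_add (p'.le_opNorm ξ) ?_)
                    rw [norm_smul]
              _ = _ := by ring
  have h3 : ∑ i, (K * (‖p'‖ * ‖ξ‖) + K * ‖w i‖ * ‖s‖) =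
      Fintype.card ι * K * ‖p'‖ * ‖ξ‖ + (K * ∑ i, ‖w i‖) * ‖s‖ := by
    rw [Finset.sum_add_distrib, Finset.sum_const, ← Finset.sum_mul, ← Finset.mul_sum,
      Finset.card_univ, nsmul_eq_mul]
    ring
  have h4 : (K * ∑ i, ‖w i‖) * ‖s‖ ≤ 1 / 2 * ‖s‖ := by gcongr
  rw [h3] at h2
  linarith

/-- Derivative of a translated function within a set. -/
theorem exists_hasFDerivWithinAt_translate {Y : Type*} [NormedAddCommGroup Y] [NormedSpace ℝ Y]
    {X : Set Y} {q : Y} {p : Y → E} {p' : Y →L[ℝ] E} (hp : HasFDerivWithinAt p p' X q)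
    {τ : Y → ℂ} {τ' : Y →L[ℝ] ℂ} (hτ : HasFDerivWithinAt τ τ' X q) {R : Set E} {w : E}
    (hmem : ∀ x ∈ X, p x + τ x • w ∈ R) {G : E → ℂ} {B : E →L[ℂ] ℂ}
    (hG : HasFDerivWithinAt G (B.restrictScalars ℝ) R (p q + τ q • w)) :
    ∃ L : Y →L[ℝ] ℂ, HasFDerivWithinAt (fun x => G (p x + τ x • w)) L X q ∧
      ‖L‖ ≤ ‖B‖ * (‖p'‖ + ‖τ'‖ * ‖w‖) := by
  have h1 := hp.add (hτ.smul_const w)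
  refine ⟨_, HasFDerivWithinAt.comp q (f := fun x => p x + τ x • w) hG h1 hmem, ?_⟩
  refine ContinuousLinearMap.opNorm_le_bound _ (by positivity) fun ξ => ?_
  change ‖B (p' ξ + τ' ξ • w)‖ ≤ _
  calc _ ≤ ‖B‖ * (‖p' ξ‖ + ‖τ' ξ • w‖) :=
        (B.le_opNorm _).trans (by gcongr; exact norm_add_le _ _)
    _ ≤ ‖B‖ * (‖p'‖ * ‖ξ‖ + ‖τ'‖ * ‖ξ‖ * ‖w‖) := by
        rw [norm_smul]
        gcongr
        · exact p'.le_opNorm ξ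
        · exact τ'.le_opNorm ξ
    _ = _ := by ring

variable {V : Type*} [NormedAddCommGroup V] [NormedSpace ℂ V] {M N : Set V} {p₀ : V}
  {Ω : Opens (Rn D)} {γ : Rn D → E} {x₀ : Rn D}

/-- Boundary values of `F ∘ P` along curves `σ` entering a wedge, where `P` maps the wedge to a cone
region and is smooth up to the edge along `σ`. -/
theorem Wedge.IsApproach.tendsto_integral [CompleteSpace E] {W : Wedge M N p₀} {b : Rn D → V}
    {U : Set (Rn D)} {σ : Rn D → ℝ → V} (hσ : W.IsApproach b U σ) (hU : IsOpen U)
    (hb : ∀ x ∈ U, b x ∈ N) (hNM : N ⊆ M) (h0 : (0 : Rn W.c) ∉ W.Γ)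
    {e : Fin D → Rn D} {C₀ : E →L[ℂ] (Fin D → ℂ)}
    (hC₀ : ∀ x ∈ U, ‖frameMap C₀ (fun j => fderiv ℝ γ x (e j)) - 1‖ < 1)
    {v : E} {r : ℝ} (hUr : U ⊆ Metric.ball x₀ r) {F : E → ℂ}
    (hF : DifferentiableOn ℂ F (coneRegion γ x₀ v r)) {l : ℕ} {C : ℝ}
    (hFC : SlowGrowth γ x₀ v r l C F) {P : V → E} (hPb : ∀ x ∈ U, P (b x) = γ x)
    (hreg : ∀ O X : Set (Rn D × ℝ), IsOpen O → X ⊆ O → ∀ s : Rn D × ℝ → V, ContDiffOn ℝ ∞ s O →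
      MapsTo s X (W.toSet ∪ (N ∩ W.nhd)) → ContDiffOn ℝ (l + 2 : ℕ) (fun y => P (s y)) X)
    {C₁ : ℝ} (hcone : ∀ q ∈ W.toSet, ∃ x ∈ Metric.ball x₀ r, ∃ t ∈ Ioo 0 (r / 2),
      ‖W.ρ q‖ ≤ C₁ * t ∧ ∃ v' ∈ Metric.ball v r, P q = γ x + t • v')
    (φ : 𝓓(Ω, ℝ)) (hφU : tsupport φ ⊆ U) {T : ℂ}
    (hT : Tendsto (fun t : ℝ => ∫ x, F (γ x + t • v) * (φ x : ℂ)) (𝓝[>] 0) (𝓝 T)) :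
    Tendsto (fun t : ℝ => ∫ x, F (P (σ x t)) * (φ x : ℂ)) (𝓝[>] 0) (𝓝 T) := by
  have hφc : IsCompact (tsupport φ) := φ.hasCompactSupport'
  obtain ⟨U₁, hU₁, hφU₁, hU₁U, hU₁c⟩ := exists_open_between_and_isCompact_closure hφc hU hφU
  obtain ⟨U₂, hU₂, hφU₂, hU₂U₁, hU₂c⟩ := exists_open_between_and_isCompact_closure hφc hU₁ hφU₁
  have hU₁U' : U₁ ⊆ U := subset_closure.trans hU₁U
  obtain ⟨δ₁, hδ₁, c, hc, hW⟩ := hσ.exists_mem_toSet hU hb hNM h0 hU₁c hU₁U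
  obtain ⟨hσ0, ⟨ε, hε, hσs, hσM⟩, hdir⟩ := hσ
  -- if the cone region is empty, so is the domain of integration
  by_cases hr : 0 < r
  swap
  · have hUe : U = ∅ := by
      rw [Metric.ball_eq_empty.2 (not_lt.1 hr)] at hUr
      exact subset_empty_iff.1 hUr
    have hφ0 : ∀ x, φ x = 0 := fun x => image_eq_zero_of_notMem_tsupport fun hx => by
      have := hφU hx
      rw [hUe] at this
      exact this
    simp only [hφ0, Complex.ofReal_zero, mul_zero, integral_zero] at hT ⊢
    exact hT
  obtain ⟨δ, hδ, hδδ₁, hδε, hδr⟩ : ∃ δ > 0, δ ≤ δ₁ ∧ δ ≤ ε ∧ δ ≤ r / 2 :=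
    ⟨min δ₁ (min ε (r / 2)), by positivity, by simp⟩
  set ψ : Rn D × ℝ → E := fun y => P (σ y.1 y.2) with hψ
  have hψ0 : ∀ x ∈ U₁, ψ (x, 0) = γ x := fun x hx => by
    change P (σ x 0) = γ x
    rw [hσ0 x (hU₁U' hx), hPb x (hU₁U' hx)]
  have hψs : ContDiffOn ℝ (l + 2 : ℕ) ψ (U₁ ×ˢ Ico 0 δ) := by
    refine hreg (U ×ˢ Ioo (-ε) ε) _ (hU.prod isOpen_Ioo) ?_ _ hσs ?_
    · rintro ⟨x, t⟩ ⟨hx, ht⟩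
      exact ⟨hU₁U' hx, (neg_lt_zero.2 hε).trans_le ht.1, ht.2.trans_le hδε⟩
    · rintro ⟨x, t⟩ ⟨hx, ht⟩
      rcases ht.1.eq_or_lt with h | h
      · right
        change σ x t ∈ _
        have ht0 : t = 0 := h.symm
        rw [ht0, hσ0 x (hU₁U' hx)]
        exact ⟨hb x (hU₁U' hx), (hdir x (hU₁U' hx)).1⟩
      · exact Or.inl (hW x (subset_closure hx) t ⟨h, ht.2.trans_le hδδ₁⟩).1
  -- points of the wedge, translated along `v`
  have hpt : ∀ x ∈ U₁, ∀ t ∈ Ioo 0 δ, ∀ s ∈ Ico 0 δ, ∃ x' ∈ Metric.ball x₀ r, ∃ t' ∈ Ioo 0 r,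
      c / C₁ * t ≤ t' ∧ 0 < C₁ ∧ ∃ v' ∈ Metric.ball v r, ψ (x, t) + s • v = γ x' + t' • v' := by
    intro x hx t ht s hs
    obtain ⟨h1, h2⟩ := hW x (subset_closure hx) t ⟨ht.1, ht.2.trans_le hδδ₁⟩
    obtain ⟨x', hx', t', ht', hρ, v', hv', hP⟩ := hcone _ h1
    have ht0 := ht.1
    have ht0' := ht'.1
    have hC₁ : 0 < C₁ := by
      have : 0 < C₁ * t' := (mul_pos hc ht0).trans_le (h2.trans hρ)
      exact pos_of_mul_pos_left this ht0'.le
    obtain ⟨v'', hv'', he⟩ := exists_add_smul_eq_of_mem_ball (a := γ x') hv' ht0'.le hs.1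
      (add_pos_of_pos_of_nonneg ht0' hs.1)
    refine ⟨x', hx', t' + s, ⟨by linarith [hs.1], by linarith [ht'.2, hs.2]⟩, ?_, hC₁, v'', hv'', ?_⟩
    · have : c / C₁ * t ≤ t' := by
        rw [div_mul_eq_mul_div, div_le_iff₀' hC₁]
        exact h2.trans hρ
      linarith [hs.1]
    · rw [← he, ← hP]
  have hC : 0 ≤ C := hFC.nonneg hr
  -- small translates of the test function are supported in a fixed compact set
  obtain ⟨η, hη, hηU⟩ := hφc.exists_thickening_subset_open hU₂ hφU₂
  have hφs : ContDiff ℝ ∞ fun x => ((φ (-x) : ℝ) : ℂ) :=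
    (Complex.ofRealCLM.contDiff (n := ∞)).comp (φ.contDiff'.comp contDiff_neg)
  obtain ⟨B, δ₂, hδ₂, hB⟩ := norm_integral_sub_boundaryValue_le (L := l) (U := U₁)
    (K := closure U₂) hU₁ hU₂c hU₂U₁ hδ hψs hψ0 (fun x hx => hC₀ x (hU₁U' hx))
    (isOpen_coneRegion (γ := γ) (x₀ := x₀) (v := v) (r := r)) hF
    (by
      intro x hx t ht s hs hts
      rcases ht.1.eq_or_lt with h | h
      · rw [← h, hψ0 x (hU₂U₁ hx)]
        rw [← h, zero_add] at hts
        exact ⟨x, hUr (hU₁U' (hU₂U₁ hx)), s, ⟨hts, by linarith [hs.2]⟩, v,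
          Metric.mem_ball_self hr, rfl⟩
      · obtain ⟨x', hx', t', ht', -, -, v', hv', he⟩ := hpt x (hU₂U₁ hx) t ⟨h, ht.2⟩ s hs
        exact ⟨x', hx', t', ht', v', hv', he⟩)
    (C := C / (c / C₁) ^ l)
    (by
      intro x hx t ht s hs
      obtain ⟨x', hx', t', ht', htt, hC₁, v', hv', he⟩ := hpt x (hU₂U₁ hx) t ht s hs
      have ht0 := ht.1
      rw [he, div_div, ← mul_pow]
      exact (hFC x' hx' t' ht' v' hv').trans (by gcongr))
    (contDiff_infty.1 hφs (l + 1)) (Y₀ := Metric.ball 0 η) (Y₁ := {0}) Metric.isOpen_ball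
    isCompact_singleton (by simpa using hη)
    (by
      intro y hy x hx
      have : -(y - x) ∉ tsupport φ := fun h => hx (subset_closure (hηU (by
        rw [Metric.mem_thickening_iff]
        refine ⟨_, h, ?_⟩
        rw [dist_eq_norm, neg_sub, sub_sub_cancel]
        exact mem_ball_zero_iff.1 hy)))
      rw [image_eq_zero_of_notMem_tsupport this, Complex.ofReal_zero])
    (l := fun _ => T)
    (by
      rintro y rfl
      simpa using hT)
  have hlim : Tendsto (fun t : ℝ => B * √t) (𝓝[>] 0) (𝓝 0) := by
    have : Tendsto (fun t : ℝ => B * √t) (𝓝 0) (𝓝 (B * √0)) :=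
      (continuous_const.mul Real.continuous_sqrt).tendsto 0
    rw [Real.sqrt_zero, mul_zero] at this
    exact this.mono_left nhdsWithin_le_nhds
  rw [tendsto_iff_norm_sub_tendsto_zero]
  refine squeeze_zero' (Eventually.of_forall fun t => norm_nonneg _) ?_ hlim
  filter_upwards [Ioc_mem_nhdsGT hδ₂.1] with t ht
  simpa using hB t ht 0 rfl

end BoundaryValues

/-! ### The defining functions of the graph -/

section GraphFunctions

variable {D n : ℕ} {E : Type*} [NormedAddCommGroup E] [NormedSpace ℂ E]

/-- The functional `(z, w) ↦ w_l - A_l z`, which vanishes on the graph of `A`. -/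
noncomputable def graphDefect (A : Fin n → E →L[ℂ] ℂ) (l : Fin n) : E × Cn n →L[ℂ] ℂ :=
  (EuclideanSpace.proj l).comp (ContinuousLinearMap.snd ℂ E (Cn n)) -
    (A l).comp (ContinuousLinearMap.fst ℂ E (Cn n))

theorem graphDefect_apply (A : Fin n → E →L[ℂ] ℂ) (l : Fin n) (q : E × Cn n) :
    graphDefect A l q = q.2 l - A l q.1 := rfl

theorem linearIndependent_graphDefect (A : Fin n → E →L[ℂ] ℂ) {T : Submodule ℝ (E × Cn n)}
    (hT : Submodule.span ℂ (T : Set (E × Cn n)) = ⊤) :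
    LinearIndependent ℂ fun l =>
      (((graphDefect A l).restrictScalars ℝ : E × Cn n →L[ℝ] ℂ) :
        E × Cn n →ₗ[ℝ] ℂ).domRestrict T := by
  rw [Fintype.linearIndependent_iff]
  intro c hc i
  have h1 : (⊤ : Submodule ℂ (E × Cn n)) ≤
      LinearMap.ker ((∑ l, c l • graphDefect A l : E × Cn n →L[ℂ] ℂ) : E × Cn n →ₗ[ℂ] ℂ) := by
    rw [← hT, Submodule.span_le]
    intro x hx
    have := LinearMap.congr_fun hc ⟨x, hx⟩
    simpa using this
  have h2 : (∑ l, c l • graphDefect A l : E × Cn n →L[ℂ] ℂ)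
      ((0 : E), EuclideanSpace.single i (1 : ℂ)) = 0 := h1 Submodule.mem_top
  simpa [graphDefect_apply, Pi.single_apply] using h2

theorem mem_span_of_graphDefect_eq_zero {A : Fin n → E →L[ℂ] ℂ} {B : Rn D →L[ℝ] E × Cn n}
    (hB : ∀ l ξ, graphDefect A l (B ξ) = 0) {e : Fin D → Rn D} {C₀ : E →L[ℂ] (Fin D → ℂ)}
    (hC₀ : frameMap C₀ (fun j => (B (e j)).1) = 1) {v : E × Cn n}
    (hv : ∀ l, graphDefect A l v = 0) :
    v ∈ Submodule.span ℂ ((B : Rn D →ₗ[ℝ] E × Cn n).range : Set (E × Cn n)) := by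
  have h1 : v = ∑ j, C₀ v.1 j • B (e j) := by
    rw [← sub_eq_zero]
    set u := v - ∑ j, C₀ v.1 j • B (e j) with hu
    have hu1 : u.1 = 0 := by
      have h := congrArg (fun L : E →L[ℂ] E => L v.1) hC₀
      simp only [frameMap_apply, one_apply_eq_self] at h
      rw [hu, Prod.fst_sub, Prod.fst_sum]
      simp only [Prod.smul_fst]
      rw [h, sub_self]
    have huQ : ∀ l, graphDefect A l u = 0 := fun l => by
      rw [hu, map_sub, hv, map_sum]
      simp [hB]
    refine Prod.ext hu1 ?_
    ext l
    have := huQ l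
    rw [graphDefect_apply, hu1, map_zero, sub_zero] at this
    exact this
  rw [h1]
  exact Submodule.sum_mem _ fun j _ => Submodule.smul_mem _ _ (Submodule.subset_span ⟨_, rfl⟩)

/-- Smoothness, up to the edge, of the solution of the implicit equation along a smooth map. -/
theorem contDiffOn_comp_solution {ι V Y : Type*} [Fintype ι] [NormedAddCommGroup V]
    [NormedSpace ℂ V] [NormedAddCommGroup Y] [NormedSpace ℝ Y] (N : ℕ) {O X : Set Y}
    (hO : IsOpen O) (hXO : X ⊆ O) {s : Y → V} (hs : ContDiffOn ℝ ∞ s O) (a : V →L[ℂ] ℂ)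
    (p : V →L[ℂ] E) (p₀ : V) {τ : V → ℂ} {R : ι → Set E} {G : ι → E → ℂ} {G' : ι → E → E →L[ℂ] ℂ}
    {w : ι → E} (hmem : ∀ i, ∀ x ∈ X, p (s x) + τ (s x) • w i ∈ R i)
    (hG : ∀ i, ∀ z ∈ R i, HasFDerivWithinAt (G i) ((G' i z).restrictScalars ℝ) (R i) z)
    (hG' : ∀ i, ContDiffOn ℝ N (G' i) (R i)) {K : ℝ} (hGK : ∀ i, ∀ z ∈ R i, ‖G' i z‖ ≤ K)
    (hKw : K * ∑ i, ‖w i‖ ≤ 1 / 2) {C : ℝ} (hτC : ∀ q q', ‖τ q - τ q'‖ ≤ C * ‖q - q'‖)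
    (heq : ∀ q, τ q = a (q - p₀) + ∑ i, G i (p q + τ q • w i)) :
    ContDiffOn ℝ (N + 1 : ℕ) (fun y => τ (s y)) X := by
  have hsN : ContDiffOn ℝ (N + 1 : ℕ) s O := contDiffOn_infty.1 hs _
  refine contDiffOn_of_implicit N hO hXO (a := fun y => a (s y - p₀)) (p := fun y => p (s y))
    ?_ ?_ hmem hG hG' hGK hKw (fun y hy => ?_) fun x _ => heq (s x)
  · exact (a.restrictScalars ℝ).contDiff.comp_contDiffOn (hsN.sub contDiffOn_const)
  · exact (p.restrictScalars ℝ).contDiff.comp_contDiffOn hsN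
  · have h1 : (fun x => s x - s y) =O[𝓝[X] y] fun x => x - y :=
      ((hs.contDiffAt (hO.mem_nhds (hXO hy))).differentiableAt
        (by simp)).hasFDerivAt.hasFDerivWithinAt.isBigO_sub
    exact (Asymptotics.IsBigO.of_bound C (Eventually.of_forall fun x => hτC _ _)).trans h1

end GraphFunctions

set_option maxHeartbeats 4000000 in
theorem corollary1p5 (k m n : ℕ) (hn : 0 < n)
    (S : Set (Cn (k + m))) (hS : IsGenericSubmanifold k S)
    (h : Cn (k + m) → Cn n) (hh : IsSmoothCR S S h)
    (M : Set (Cn (k + m) × Cn n)) (hM : IsGenericSubmanifold k M)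
    (hNM : graphOver S h ⊆ M)
    (Ω : TopologicalSpace.Opens (Rn (2 * k + m))) (γ : Rn (2 * k + m) → Cn (k + m))
    (hγ : IsLocalParam S Ω γ)
    (x₀ : Rn (2 * k + m)) (hx₀ : x₀ ∈ Ω)
    (hdec : ∀ l : Fin n, FunctionDecomposableAt S Ω γ x₀ (fun q => h q l))
    (v : Cn (k + m) × Cn n)
    (hv : v ∈ tangentSpace M (γ x₀, h (γ x₀)))
    (hv' : v ∉ Submodule.span ℂ
      (tangentSpace (graphOver S h) (γ x₀, h (γ x₀)) : Set (Cn (k + m) × Cn n)))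
    (f : 𝓓'(Ω, ℂ)) (hf : IsCRDistribution γ f) (hfdec : DistributionDecomposableAt S γ x₀ f) :
    ∃ W : Wedge M (graphOver S h) (γ x₀, h (γ x₀)),
      W.DirectedAt (γ x₀, h (γ x₀)) v ∧
      (∃ F : Cn (k + m) × Cn n → ℂ, IsSmoothCR M W.toSet F ∧
        W.HasBoundaryValue (fun x => (γ x, h (γ x))) x₀ F f) ∧
      ∃ g : Fin n → Cn (k + m) × Cn n → ℂ,
        (∀ l, IsSmoothCR M W.toSet (g l)) ∧ W.VanishToFirstOrder g := by
  set p : Cn (k + m) × Cn n →L[ℂ] Cn (k + m) := ContinuousLinearMap.fst ℂ _ _ with hp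
  set b : Rn (2 * k + m) → Cn (k + m) × Cn n := fun x => (γ x, h (γ x)) with hbdef
  set p₀ : Cn (k + m) × Cn n := (γ x₀, h (γ x₀)) with hp₀
  have hb : IsLocalParam (graphOver S h) Ω b := hγ.graph hh.1
  have hp₀M : p₀ ∈ M := hNM (hb.mem hx₀)
  obtain ⟨dM, hdM⟩ := hM.isSmooth
  obtain ⟨Ω', μ, hμ, y₀, hy₀, hμb⟩ := hdM p₀ hp₀M
  set Bb := fderiv ℝ b x₀ with hBb
  have hbd : HasFDerivAt b Bb x₀ := (hb.hasStrictFDerivAt hx₀).hasFDerivAt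
  have hTN : tangentSpace (graphOver S h) p₀ =
      (Bb : Rn (2 * k + m) →ₗ[ℝ] Cn (k + m) × Cn n).range := hb.tangentSpace_eq hx₀
  have hBγ : fderiv ℝ γ x₀ = (ContinuousLinearMap.fst ℝ _ _).comp Bb := hbd.fst.fderiv
  obtain ⟨C₀, hC₀⟩ := exists_frameMap_eq_one (B := fderiv ℝ γ x₀) (by
    rw [← hγ.tangentSpace_eq hx₀]
    exact hS.span_eq_top _ (hγ.mem hx₀))
  -- decompositions of the components of `h` and of `f`
  choose Kh vs Fs Us r hr hrΩ hbvs hsum using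
    fun l => (hdec l).exists_hasSmoothBoundaryValue hγ hx₀
  obtain ⟨Kf, Tf, hext, Of, hOf, hxOf, hfsum⟩ := hfdec
  choose vf Ff rf hrf hrfΩ hFf hGf hbvf using fun j => (hext j).exists_coneRegion hγ hx₀
  choose lf Cf hCf using hGf
  -- the curves in the boundary value of a function growing like `t ^ (-l)` must be of class `C^(l+2)`,
  -- and the solution of the implicit equation is of class `C^(N+1)`
  set N := ∑ j, lf j + 1 with hN
  choose A hA r₁ hr₁ hrem using fun i : (Σ l, Fin (Kh l)) =>
    (hbvs i.1 i.2).exists_remainder Ω.isOpen hγ.smooth hx₀ hC₀ N (hr i.1)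
  set Al : Fin n → Cn (k + m) →L[ℂ] ℂ := fun l => ∑ j, A ⟨l, j⟩ with hAl
  set Q := graphDefect Al with hQ
  -- the functionals `Q l` vanish on the tangent space of the graph
  have hQB : ∀ l ξ, Q l (Bb ξ) = 0 := by
    intro l ξ
    have h1 : HasFDerivAt (fun x => (b x).2 l)
        ((((EuclideanSpace.proj l : Cn n →L[ℂ] ℂ).comp
          (ContinuousLinearMap.snd ℂ (Cn (k + m)) (Cn n))).restrictScalars ℝ).comp Bb) x₀ :=
      (ContinuousLinearMap.hasFDerivAt (((EuclideanSpace.proj l : Cn n →L[ℂ] ℂ).comp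
        (ContinuousLinearMap.snd ℂ (Cn (k + m)) (Cn n))).restrictScalars ℝ)).comp x₀ hbd
    have h2 : HasFDerivAt (fun x => ∑ j, Us l j x) (∑ j, fderiv ℝ (Us l j) x₀) x₀ :=
      HasFDerivAt.fun_sum fun j _ => (((hbvs l j).smooth.contDiffAt
        (Metric.ball_mem_nhds x₀ (hr l))).differentiableAt (by simp)).hasFDerivAt
    have h3 : HasFDerivAt (fun x => (b x).2 l) (∑ j, fderiv ℝ (Us l j) x₀) x₀ := by
      refine h2.congr_of_eventuallyEq ?_
      filter_upwards [Metric.ball_mem_nhds x₀ (hr l)] with x hx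
      exact hsum l x hx
    have h4 := congrArg (fun L : Rn (2 * k + m) →L[ℝ] ℂ => L ξ) (h1.unique h3)
    have h5 : ∀ j, fderiv ℝ (Us l j) x₀ ξ = A ⟨l, j⟩ (Bb ξ).1 := by
      intro j
      rw [hA ⟨l, j⟩, hBγ]
      rfl
    have h6 : (Bb ξ).2 l = ∑ j, fderiv ℝ (Us l j) x₀ ξ := by
      simpa using h4
    rw [hQ, graphDefect_apply, h6, hAl]
    simp [h5]
  have hQv : ∃ l, Q l v ≠ 0 := by
    by_contra! hcon
    refine hv' ?_
    rw [hTN]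
    refine mem_span_of_graphDefect_eq_zero hQB (e := fun j => EuclideanSpace.single j 1)
      (C₀ := C₀) ?_ hcon
    rw [← hC₀, hBγ]
    rfl
  obtain ⟨l₀, hl₀⟩ := hQv
  -- `a` vanishes along the graph and measures the distance from it in the direction `v`
  set α := (Q l₀ v)⁻¹ with hα
  set a : Cn (k + m) × Cn n →L[ℂ] ℂ := α • Q l₀ with ha
  have haB : ∀ ξ, a (Bb ξ) = 0 := fun ξ => by
    rw [ha, smul_apply, hQB, smul_zero]
  have hav : a v = 1 := by
    rw [ha, smul_apply, smul_eq_mul, hα, inv_mul_cancel₀ hl₀]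
  -- `v₁` differs from `v` by a vector tangent to the graph
  obtain ⟨v₁, hvv₁, hwedge⟩ := exists_thin_wedge hNM hb hx₀ hμ hy₀ hμb hv
    fun hmem => hv' (Submodule.subset_span hmem)
  have hav₁ : a v₁ = 1 := by
    have h1 : v - v₁ ∈ tangentSpace (graphOver S h) p₀ := hvv₁
    rw [hTN] at h1
    obtain ⟨ξ, hξ⟩ := h1
    have h2 : a (v - v₁) = 0 := hξ ▸ haB ξ
    rw [map_sub, hav, sub_eq_zero] at h2
    exact h2.symm
  set w : (Σ l, Fin (Kh l)) → Cn (k + m) := fun i => vs i.1 i.2 - p v₁ with hw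
  -- a common aperture of the cone regions
  obtain ⟨r₂, hr₂, hr₂r⟩ := exists_pos_forall_of_antitone (P := fun i s => s ≤ r₁ i)
    (fun j a b hab hb => hab.trans hb) fun j => ⟨r₁ j, hr₁ j, le_rfl⟩
  obtain ⟨r₃, hr₃, hr₃r⟩ := exists_pos_forall_of_antitone (P := fun j s => s ≤ rf j)
    (fun j a b hab hb => hab.trans hb) fun j => ⟨rf j, hrf j, le_rfl⟩
  obtain ⟨r₄, hr₄, hr₄r⟩ := exists_pos_forall_of_antitone (P := fun l s => s ≤ r l)
    (fun j a b hab hb => hab.trans hb) fun l => ⟨r l, hr l, le_rfl⟩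
  obtain ⟨r₀, hr₀, hr₀r₂, hr₀r₃, hr₀r₄⟩ : ∃ r₀ > 0, r₀ ≤ r₂ ∧ r₀ ≤ r₃ ∧ r₀ ≤ r₄ :=
    ⟨min r₂ (min r₃ r₄), by positivity, by simp⟩
  set mdir := ∑ i, ‖w i‖ + ∑ j, ‖vf j - p v₁‖ with hmdir
  have hdir₁ : ∀ i, ‖w i‖ ≤ mdir := fun i =>
    (Finset.single_le_sum (f := fun i => ‖w i‖) (fun i _ => norm_nonneg _)
      (Finset.mem_univ i)).trans (le_add_of_nonneg_right
        (Finset.sum_nonneg fun j _ => norm_nonneg _))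
  have hdir₂ : ∀ j, ‖vf j - p v₁‖ ≤ mdir := fun j =>
    (Finset.single_le_sum (f := fun j => ‖vf j - p v₁‖) (fun i _ => norm_nonneg _)
      (Finset.mem_univ j)).trans (le_add_of_nonneg_left
        (Finset.sum_nonneg fun j _ => norm_nonneg _))
  obtain ⟨K₀, hK₀, haper⟩ := exists_aperture a p w hav₁ hr₀ mdir
  obtain ⟨ε₀, hε₀, hLI⟩ := hμ.exists_linearIndependent hy₀
    (fun l => (Q l).restrictScalars ℝ) (linearIndependent_graphDefect Al (hμb.symm ▸
      hM.span_eq_top p₀ hp₀M))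
  rw [hμb] at hLI
  -- the Lipschitz constant `K` of the remainders is so small that the implicit equation is
  -- contracting and that the differentials of the `g l` remain independent
  set ci : ℝ := (Fintype.card (Σ l, Fin (Kh l)) : ℝ) with hci
  have hci0 : 0 ≤ ci := Nat.cast_nonneg _
  set Cτ := 2 * (‖a‖ + ci * ‖p‖) with hCτ
  set Cg := ci * (‖p‖ + Cτ * mdir) with hCg
  have hmdir0 : 0 ≤ mdir := by positivity
  have hCg0 : 0 ≤ Cg := by positivity
  obtain ⟨K, hK, hKK₀, hK1, hKε⟩ : ∃ K > 0, K ≤ K₀ ∧ K ≤ 1 ∧ K * Cg ≤ ε₀ := by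
    refine ⟨min K₀ (min 1 (ε₀ / (Cg + 1))), by positivity, by simp, by simp, ?_⟩
    calc _ ≤ ε₀ / (Cg + 1) * (Cg + 1) := by
          gcongr
          · exact (min_le_right _ _).trans (min_le_right _ _)
          · linarith
      _ = ε₀ := by field_simp
  obtain ⟨hKw, haper⟩ := haper K ⟨hK, hKK₀⟩
  set ε := K / (1 + ‖α‖) with hε
  have hεp : 0 < ε := by positivity
  have hεK : ε ≤ K := div_le_self hK.le (le_add_of_nonneg_right (norm_nonneg _))
  have hεα : ‖α‖ * ε ≤ K := by
    rw [hε, mul_div_assoc', div_le_iff₀ (by positivity)]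
    nlinarith [norm_nonneg α]
  choose δ hδ G G' hGL hGd hGs hGb hGe using fun i => hrem i ε hεp
  set R : (Σ l, Fin (Kh l)) → Set (Cn (k + m)) := fun i =>
    closedConeRegion γ x₀ (vs i.1 i.2) (r₁ i) ∩ Metric.ball (γ x₀) (δ i) with hR
  -- the data of the implicit equation: only the terms of `g l₀` enter, since along the graph
  -- `a (b x - p₀) = α * ∑ j, G ⟨l₀, j⟩ (γ x)`
  set c : (Σ l, Fin (Kh l)) → ℂ := fun i => if i.1 = l₀ then -α else 0 with hc
  have hcα : ∀ i, ‖c i‖ ≤ ‖α‖ := by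
    intro i
    simp only [hc]
    split_ifs
    · rw [norm_neg]
    · rw [norm_zero]
      exact norm_nonneg _
  have hHL : ∀ i z z', ‖c i * G i z - c i * G i z'‖ ≤ K * ‖z - z'‖ := by
    intro i z z'
    rw [← mul_sub, norm_mul]
    calc _ ≤ ‖α‖ * (ε * ‖z - z'‖) := by
          gcongr
          · exact hcα i
          · exact hGL i z z'
      _ = ‖α‖ * ε * ‖z - z'‖ := by ring
      _ ≤ _ := by gcongr
  have hHd : ∀ i, ∀ z ∈ R i, HasFDerivWithinAt (fun z => c i * G i z)
      ((c i • G' i z).restrictScalars ℝ) (R i) z := fun i z hz => by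
    refine ((hGd i z hz).const_mul (c i)).congr_fderiv ?_
    ext ξ
    rfl
  have hHs : ∀ i, ContDiffOn ℝ N (fun z => c i • G' i z) (R i) := fun i =>
    (hGs i).const_smul (c i)
  have hHb : ∀ i, ∀ z ∈ R i, ‖c i • G' i z‖ ≤ K := fun i z hz => by
    rw [norm_smul]
    calc _ ≤ ‖α‖ * ε := by
          gcongr
          · exact hcα i
          · exact hGb i z hz
      _ ≤ K := hεα
  obtain ⟨τ, hτ, hτL⟩ := exists_solution_of_lipschitz (G := fun i z => c i * G i z) hK.le hHL hKw
    (fun q => a (q - p₀)) p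
  have hτC : ∀ q q', ‖τ q - τ q'‖ ≤ Cτ * ‖q - q'‖ := by
    intro q q'
    refine (hτL q q' (τ q') (hτ q')).trans ?_
    have e1 : a (q - p₀) - a (q' - p₀) = a (q - q') := by
      rw [← map_sub, sub_sub_sub_cancel_right]
    rw [e1, ← map_sub]
    calc _ ≤ 2 * (‖a‖ * ‖q - q'‖ + ci * 1 * (‖p‖ * ‖q - q'‖)) := by
          gcongr
          · exact a.le_opNorm _
          · exact p.le_opNorm _
      _ = _ := by rw [hCτ]; ring
  have hτc : Continuous τ :=
    (LipschitzWith.of_dist_le_mul (K := Real.toNNReal Cτ) fun q q' => by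
      rw [dist_eq_norm, dist_eq_norm, Real.coe_toNNReal _ (by positivity)]
      exact hτC q q').continuous
  -- the equation along the edge
  have hedge : ∀ᶠ x in 𝓝 x₀, ∀ l, ∑ j, G ⟨l, j⟩ (γ x) = Q l (b x - p₀) := by
    have h1 : ∀ᶠ x in 𝓝 x₀, ∀ i, γ x ∈ Metric.ball (γ x₀) (δ i) := eventually_all.2 fun i =>
      (hγ.contDiffAt hx₀).continuousAt.eventually (Metric.ball_mem_nhds _ (hδ i))
    filter_upwards [h1, Metric.ball_mem_nhds x₀ hr₀] with x hx hxr l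
    have h2 : ∀ j, G ⟨l, j⟩ (γ x) = Us l j x - Us l j x₀ - A ⟨l, j⟩ (γ x - γ x₀) := fun j =>
      hGe ⟨l, j⟩ x (Metric.ball_subset_ball (hr₀r₂.trans (hr₂r _)) hxr) (hx _)
    have h3 := hsum l x (Metric.ball_subset_ball (hr₀r₄.trans (hr₄r l)) hxr)
    have h4 := hsum l x₀ (Metric.mem_ball_self (hr l))
    rw [hQ, graphDefect_apply]
    change _ = h (γ x) l - h (γ x₀) l - (∑ j, A ⟨l, j⟩) (γ x - γ x₀)
    rw [h3, h4, sum_apply]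
    simp only [h2, Finset.sum_sub_distrib]
  obtain ⟨κ₁, hκ₁, hedge⟩ := Metric.eventually_nhds_iff_ball.1 hedge
  have hedge₀ : ∀ x ∈ Metric.ball x₀ κ₁, 0 = a (b x - p₀) + ∑ i, c i * G i (p (b x)) := by
    intro x hx
    have h1 : ∑ i, c i * G i (p (b x)) = -α * Q l₀ (b x - p₀) := by
      rw [Fintype.sum_sigma, Finset.sum_eq_single l₀]
      · simp only [hc, if_true]
        rw [← Finset.mul_sum]
        congr 1
        exact hedge x hx l₀
      · intro l _ hl
        simp [hc, hl]
      · simp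
    rw [h1, ha, smul_apply, smul_eq_mul]
    ring
  have hτ0 : ∀ x ∈ Metric.ball x₀ κ₁, τ (b x) = 0 := by
    intro x hx
    have h1 := hτL (b x) (b x) 0 (by simpa using hedge₀ x hx)
    simpa using h1
  have hτp₀ : τ p₀ = 0 := hτ0 x₀ (Metric.mem_ball_self hκ₁)
  -- a wedge thin enough for all the arguments `p q + τ q • w i` to lie in the cone regions
  obtain ⟨κ, hκ, hκK, hκκ₁, hκr⟩ : ∃ κ > 0, κ ≤ K ∧ κ ≤ κ₁ ∧ κ ≤ r₀ / 2 :=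
    ⟨min K (min κ₁ (r₀ / 2)), by positivity, by simp⟩
  have hO : ∀ᶠ q in 𝓝 p₀, ∀ i, p q + τ q • w i ∈ Metric.ball (γ x₀) (δ i) := by
    refine eventually_all.2 fun i => ?_
    have h1 : ContinuousAt (fun q => p q + τ q • w i) p₀ := by fun_prop
    refine h1.eventually (Metric.isOpen_ball.eventually_mem ?_)
    change p p₀ + τ p₀ • w i ∈ Metric.ball (γ x₀) (δ i)
    rw [hτp₀, zero_smul, add_zero]
    exact Metric.mem_ball_self (hδ i)
  obtain ⟨W, hWO, hWv, hW0, hWN, C₁, hWc⟩ := hwedge κ hκ _ (hO.and hLI)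
  have hcone : ∀ q ∈ W.toSet, ∃ x ∈ Metric.ball x₀ κ, ∃ t ∈ Ioo 0 κ, ‖W.ρ q‖ ≤ C₁ * t ∧
      ∀ v', ‖v' - p v₁‖ ≤ mdir → ∃ v'' ∈ Metric.ball v' r₀,
        p q + τ q • (v' - p v₁) = γ x + t • v'' := by
    intro q hq
    obtain ⟨x, hx, t, ht, hρ, y, hy, rfl⟩ := hWc q hq
    exact ⟨x, hx, t, ht, hρ, fun v' hvm => haper (fun i z => c i * G i z) τ p₀ hHL hτ hτL (b x)
      (hedge₀ x (Metric.ball_subset_ball hκκ₁ hx)) t ht.1 y (Metric.ball_subset_ball hκK hy) v' hvm⟩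
  have hN0 : ∀ q ∈ graphOver S h ∩ W.nhd, ∃ x ∈ Metric.ball x₀ κ, q = b x ∧ τ q = 0 := by
    intro q hq
    obtain ⟨x, hx, rfl⟩ := hWN q hq
    exact ⟨x, hx, rfl, hτ0 x (Metric.ball_subset_ball hκκ₁ hx)⟩
  have hball : ∀ q ∈ W.nhd, ∀ i, p q + τ q • w i ∈ Metric.ball (γ x₀) (δ i) := fun q hq =>
    (hWO hq).1
  have hconeO : ∀ i, ∀ q ∈ W.toSet, p q + τ q • w i ∈ coneRegion γ x₀ (vs i.1 i.2) (r₁ i) := by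
    intro i q hq
    obtain ⟨x, hx, t, ht, -, hdirs⟩ := hcone q hq
    obtain ⟨v'', hv'', he⟩ := hdirs (vs i.1 i.2) (hdir₁ i)
    have h1 : κ ≤ r₁ i := by linarith [hr₂r i]
    exact ⟨x, Metric.ball_subset_ball h1 hx, t, ⟨ht.1, ht.2.trans_le h1⟩, v'',
      Metric.ball_subset_ball (hr₀r₂.trans (hr₂r i)) hv'', he⟩
  set X := W.toSet ∪ (graphOver S h ∩ W.nhd) with hX
  have hmemX : ∀ i, ∀ q ∈ X, p q + τ q • w i ∈ R i := by
    rintro i q (hq | hq)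
    · exact ⟨coneRegion_subset_closedConeRegion (hconeO i q hq), hball q hq.1.2 i⟩
    · refine ⟨?_, hball q hq.2 i⟩
      obtain ⟨x, hx, rfl, h0⟩ := hN0 q hq
      rw [h0, zero_smul, add_zero]
      exact mem_closedConeRegion_of_mem_ball (Metric.ball_subset_ball (by linarith [hr₂r i]) hx)
  -- the open set on which all functions are holomorphic
  set P : Cn (k + m) → Cn (k + m) × Cn n → Cn (k + m) := fun v' q => p q + τ q • (v' - p v₁)
    with hP
  have hPc : ∀ v', Continuous (P v') := fun v' => by fun_prop
  set O₁ : Set (Cn (k + m) × Cn n) :=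
    (⋂ i, P (vs i.1 i.2) ⁻¹' (coneRegion γ x₀ (vs i.1 i.2) (r₁ i) ∩ Metric.ball (γ x₀) (δ i))) ∩
      ⋂ j, P (vf j) ⁻¹' coneRegion γ x₀ (vf j) (rf j) with hO₁
  have hO₁o : IsOpen O₁ := (isOpen_iInter_of_finite fun i =>
    (isOpen_coneRegion.inter Metric.isOpen_ball).preimage (hPc _)).inter
      (isOpen_iInter_of_finite fun j => isOpen_coneRegion.preimage (hPc _))
  have hconef : ∀ j, ∀ q ∈ W.toSet, ∃ x ∈ Metric.ball x₀ (rf j), ∃ t ∈ Ioo 0 (rf j / 2),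
      ‖W.ρ q‖ ≤ C₁ * t ∧ ∃ v' ∈ Metric.ball (vf j) (rf j), P (vf j) q = γ x + t • v' := by
    intro j q hq
    obtain ⟨x, hx, t, ht, hρ, hdirs⟩ := hcone q hq
    obtain ⟨v'', hv'', he⟩ := hdirs (vf j) (hdir₂ j)
    have h1 : r₀ ≤ rf j := hr₀r₃.trans (hr₃r j)
    exact ⟨x, Metric.ball_subset_ball (by linarith) hx, t, ⟨ht.1, by linarith [ht.2]⟩, hρ, v'',
      Metric.ball_subset_ball h1 hv'', he⟩
  have hWO₁ : W.toSet ⊆ O₁ := by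
    intro q hq
    refine ⟨mem_iInter.2 fun i => ⟨hconeO i q hq, hball q hq.1.2 i⟩, mem_iInter.2 fun j => ?_⟩
    obtain ⟨x, hx, t, ht, -, v', hv', he⟩ := hconef j q hq
    exact ⟨x, hx, t, ⟨ht.1, by linarith [ht.2, hrf j]⟩, v', hv', he⟩
  have hO₁R : ∀ i, ∀ q ∈ O₁, P (vs i.1 i.2) q ∈
      coneRegion γ x₀ (vs i.1 i.2) (r₁ i) ∩ Metric.ball (γ x₀) (δ i) := fun i q hq =>
    mem_iInter.1 hq.1 i
  have hinc : ∀ i, coneRegion γ x₀ (vs i.1 i.2) (r₁ i) ∩ Metric.ball (γ x₀) (δ i) ⊆ R i :=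
    fun i => inter_subset_inter_left _ coneRegion_subset_closedConeRegion
  have had : ∀ q, HasFDerivAt (fun q => a (q - p₀)) a q := fun q =>
    HasFDerivAt.comp q (f := fun q => q - p₀) a.hasFDerivAt ((hasFDerivAt_id q).sub_const p₀)
  have hτO : DifferentiableOn ℂ τ O₁ :=
    differentiableOn_of_implicit hO₁o had p (fun i q hq => hinc i (hO₁R i q hq)) hHd hHb hKw hτC hτ
  have hPO : ∀ v', DifferentiableOn ℂ (P v') O₁ := fun v' =>
    p.differentiable.differentiableOn.add (hτO.smul_const _)
  refine ⟨W, hWv, ⟨fun q => ∑ j, Ff j (P (vf j) q), ?_, ?_⟩,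
    fun l q => Q l (q - p₀) - ∑ j, G ⟨l, j⟩ (P (vs l j) q), ?_, ?_⟩
  · -- the extension of the distribution is holomorphic
    refine isSmoothCR_of_differentiableOn hO₁o hWO₁ (DifferentiableOn.fun_sum fun j _ => ?_)
    exact (hFf j).comp (hPO _) fun q hq => mem_iInter.1 hq.2 j
  · -- its boundary value
    obtain ⟨rO, hrO, hrOΩ, hrOf⟩ :=
      exists_ball_norm_frameMap_sub_one_lt Ω.isOpen hγ.smooth hx₀ hC₀
    refine ⟨Metric.ball x₀ (min rO r₀) ∩ Of, Metric.isOpen_ball.inter hOf,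
      ⟨Metric.mem_ball_self (lt_min hrO hr₀), hxOf⟩, fun U hU hUO σ hσ φ hφ => ?_⟩
    have hUr : U ⊆ Metric.ball x₀ rO := fun x hx =>
      Metric.ball_subset_ball (min_le_left _ _) (hUO hx).1
    have hUr₀ : ∀ j, U ⊆ Metric.ball x₀ (rf j) := fun j x hx =>
      Metric.ball_subset_ball ((min_le_right _ _).trans (hr₀r₃.trans (hr₃r j))) (hUO hx).1
    have hbN : ∀ x ∈ U, b x ∈ graphOver S h := fun x hx => hb.mem (hrOΩ (hUr hx))
    have hτb : ∀ x ∈ U, τ (b x) = 0 := by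
      intro x hx
      obtain ⟨-, -, -, h0⟩ := hN0 (b x) ⟨hbN x hx, (hσ.2.2 x hx).1⟩
      exact h0
    have hlim : ∀ j, Tendsto (fun t : ℝ => ∫ x, Ff j (P (vf j) (σ x t)) * (φ x : ℂ)) (𝓝[>] 0)
        (𝓝 (Tf j φ)) := by
      intro j
      have hlj : lf j + 2 ≤ N + 1 := by
        have := Finset.single_le_sum (f := lf) (fun i _ => Nat.zero_le _) (Finset.mem_univ j)
        omega
      refine hσ.tendsto_integral hU hbN hNM hW0 (fun x hx => hrOf x (hUr hx)) (hUr₀ j) (hFf j)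
        (hCf j) (P := P (vf j)) (fun x hx => ?_) (fun O Y hO hYO s hs hY => ?_) (hconef j) φ hφ
        (hbvf j φ (hφ.trans (hUr₀ j)))
      · simp only [hP]
        rw [hτb x hx, zero_smul, add_zero]
        rfl
      · have h1 := contDiffOn_comp_solution N hO hYO hs a p p₀
          (fun i y hy => hmemX i _ (hY hy)) hHd hHs hHb hKw hτC hτ
        have h2 : ContDiffOn ℝ (N + 1 : ℕ) (fun y => p (s y)) Y :=
          ((p.restrictScalars ℝ).contDiff.comp_contDiffOn (contDiffOn_infty.1 hs _)).mono hYO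
        exact (h2.add (h1.smul contDiffOn_const)).of_le (by exact_mod_cast hlj)
    have hfφ : f φ = ∑ j, Tf j φ := hfsum φ fun x hx => (hUO (hφ hx)).2
    rw [hfφ]
    refine (tendsto_finsetSum _ fun j _ => hlim j).congr' ?_
    have hφc : IsCompact (tsupport φ) := φ.hasCompactSupport'
    obtain ⟨δ₁, hδ₁, c₁, -, hmem⟩ := hσ.exists_mem_toSet hU hbN hNM hW0 hφc hφ
    obtain ⟨-, ⟨ε₁, hε₁, hσs, -⟩, -⟩ := hσ
    filter_upwards [Ioo_mem_nhdsGT (lt_min hδ₁ hε₁)] with t ht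
    rw [← integral_finsetSum]
    · refine integral_congr_ae (Eventually.of_forall fun x => ?_)
      exact (Finset.sum_mul _ _ _).symm
    · intro j _
      have h1 : ContinuousOn (fun x => σ x t) (tsupport φ) :=
        hσs.continuousOn.comp (f := fun x => (x, t)) (by fun_prop) fun x hx =>
          ⟨hφ hx, by linarith [ht.1], ht.2.trans_le (min_le_right _ _)⟩
      have h2 : ContinuousOn (fun x => Ff j (P (vf j) (σ x t))) (tsupport φ) := by
        refine (hFf j).continuousOn.comp ((hPc (vf j)).comp_continuousOn h1) fun x hx => ?_
        exact mem_iInter.1 (hWO₁ (hmem x hx t ⟨ht.1, ht.2.trans_le (min_le_left _ _)⟩).1).2 j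
      have h3 : Continuous fun x => ((φ x : ℝ) : ℂ) :=
        Complex.continuous_ofReal.comp φ.contDiff'.continuous
      refine ((h2.mul h3.continuousOn).integrableOn_compact
        hφc).integrable_of_forall_notMem_eq_zero fun x hx => ?_
      change _ * ((φ x : ℝ) : ℂ) = 0
      rw [image_eq_zero_of_notMem_tsupport hx, Complex.ofReal_zero, mul_zero]
  · -- the defining functions are holomorphic
    intro l
    refine isSmoothCR_of_differentiableOn hO₁o hWO₁ (DifferentiableOn.sub ?_
      (DifferentiableOn.fun_sum fun j _ => ?_))
    · exact (Q l).differentiable.differentiableOn.comp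
        (differentiableOn_id.sub_const p₀) fun q _ => mem_univ _
    · have h1 : DifferentiableOn ℂ (G ⟨l, j⟩)
          (coneRegion γ x₀ (vs l j) (r₁ ⟨l, j⟩) ∩ Metric.ball (γ x₀) (δ ⟨l, j⟩)) := fun z hz =>
        ((hGd ⟨l, j⟩ z (hinc ⟨l, j⟩ hz)).hasFDerivAt_complex
          (isOpen_coneRegion.inter Metric.isOpen_ball) hz
          (hinc ⟨l, j⟩)).differentiableAt.differentiableWithinAt
      exact h1.comp (hPO _) fun q hq => hO₁R ⟨l, j⟩ q hq
  · -- their behaviour at the edge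
    have hτX : ContDiffOn ℝ 1 τ X := by
      have := contDiffOn_comp_solution N isOpen_univ (subset_univ X) contDiffOn_id a p p₀
        hmemX hHd hHs hHb hKw hτC hτ
      exact this.of_le (by simp)
    refine ⟨fun l => ?_, fun l q hq => ?_, fun q hq => ?_⟩
    · refine ContDiffOn.sub ?_ (ContDiffOn.sum fun j _ => ?_)
      · exact ((Q l).restrictScalars ℝ).contDiff.comp_contDiffOn
          (contDiffOn_id.sub contDiffOn_const)
      · have h1 : ContDiffOn ℝ 1 (G ⟨l, j⟩) (R ⟨l, j⟩) := by
          rw [← zero_add (1 : WithTop ℕ∞), contDiffOn_succ_iff_hasFDerivWithinAt (by simp)]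
          intro z hz
          refine ⟨R ⟨l, j⟩, by rw [insert_eq_of_mem hz]; exact self_mem_nhdsWithin, by simp, _,
            hGd ⟨l, j⟩, ?_⟩
          have hG0 := (hGs ⟨l, j⟩).of_le (m := 0) (by exact_mod_cast Nat.zero_le N)
          exact (ContinuousLinearMap.restrictScalarsL ℂ (Cn (k + m)) ℂ ℝ ℝ).contDiff.comp_contDiffOn
            hG0
        refine h1.comp (ContDiffOn.add (p.restrictScalars ℝ).contDiff.contDiffOn
          (hτX.smul contDiffOn_const)) fun q hq => hmemX ⟨l, j⟩ q hq
    · obtain ⟨x, hx, rfl, h0⟩ := hN0 q hq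
      have h1 : ∀ j, P (vs l j) (b x) = γ x := fun j => by
        simp only [hP]
        rw [h0, zero_smul, add_zero]
        rfl
      simp only [h1]
      rw [hedge x (Metric.ball_subset_ball hκκ₁ hx) l, sub_self]
    · have hqM : q ∈ M ∩ W.nhd := by
        rcases hq with hq | hq
        · exact hq.1
        · exact ⟨hNM hq.1, hq.2⟩
      have hB : ∀ i, ‖c i • G' i (p q + τ q • w i)‖ ≤ K := fun i => hHb i _ (hmemX i q hq)
      have h0 := one_sub_sum_ne_zero hB hKw
      set τ' := implicitDeriv (a.restrictScalars ℝ) (p.restrictScalars ℝ)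
        (fun i => c i • G' i (p q + τ q • w i)) w with hτ'
      have hτd : HasFDerivWithinAt τ τ' X q :=
        hasFDerivWithinAt_of_implicit hq ((had q).restrictScalars ℝ).hasFDerivWithinAt
          (p.hasFDerivAt.restrictScalars ℝ).hasFDerivWithinAt hmemX
          (fun i => hHd i _ (hmemX i q hq)) (isBigO_sub_of_norm_sub_le hτC q) (fun x _ => hτ x) h0
          (implicitDeriv_apply _ _ h0)
      have hτn : ‖τ'‖ ≤ Cτ := by
        refine (norm_implicitDeriv_le _ _ hB hKw).trans ?_
        rw [hCτ, ContinuousLinearMap.norm_restrictScalars, ContinuousLinearMap.norm_restrictScalars]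
        gcongr
        exact mul_le_of_le_one_right hci0 hK1
      choose L hL hLn using fun i => exists_hasFDerivWithinAt_translate
        (p.hasFDerivAt.restrictScalars ℝ).hasFDerivWithinAt hτd (hmemX i)
        (hGd i _ (hmemX i q hq))
      refine ⟨fun l => (Q l).restrictScalars ℝ - ∑ j, L ⟨l, j⟩, fun l => ?_, ?_⟩
      · have h1 : HasFDerivWithinAt (fun q => Q l (q - p₀)) ((Q l).restrictScalars ℝ) X q :=
          ((HasFDerivAt.comp q (f := fun q => q - p₀) (Q l).hasFDerivAt
            ((hasFDerivAt_id q).sub_const p₀)).restrictScalars ℝ).hasFDerivWithinAt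
        exact h1.sub (HasFDerivWithinAt.fun_sum fun j _ => hL ⟨l, j⟩)
      · refine (hWO hqM.2).2 hqM.1 _ fun l => ?_
        rw [sub_sub_cancel_left, norm_neg]
        have h1 : ∀ i, ‖L i‖ ≤ K * (‖p‖ + Cτ * mdir) := fun i => by
          refine (hLn i).trans ?_
          rw [ContinuousLinearMap.norm_restrictScalars]
          gcongr
          · exact (hGb i _ (hmemX i q hq)).trans hεK
          · exact hdir₁ i
        calc _ ≤ ∑ j, ‖L ⟨l, j⟩‖ := norm_sum_le _ _
          _ ≤ ∑ l, ∑ j, ‖L ⟨l, j⟩‖ := Finset.single_le_sum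
              (f := fun l => ∑ j, ‖L ⟨l, j⟩‖)
              (fun l _ => Finset.sum_nonneg fun j _ => norm_nonneg _) (Finset.mem_univ l)
          _ = ∑ i, ‖L i‖ := (Fintype.sum_sigma (fun i : (Σ l, Fin (Kh l)) => ‖L i‖)).symm
          _ ≤ ∑ _i : (Σ l, Fin (Kh l)), K * (‖p‖ + Cτ * mdir) := Finset.sum_le_sum fun i _ => h1 i
          _ = K * Cg := by
              rw [Finset.sum_const, Finset.card_univ, nsmul_eq_mul, hCg]
              ring
          _ ≤ ε₀ := hKε
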